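/- Consider one of three cases. (uH): $F/F_0$ is an unramified quadratic extension of $p$-adic fields, with nontrivial automorphism $\sigma$. (S): $F=F_0$ is a $p$-adic field with $p$ odd. (A): $F=F_0$ is a $p$-adic field. Let $\varpi$ be a uniformizer of $F_0$, let $q_0,q$ be the cardinalities of the residue fields of $F_0,F$, and put $\gamma=2$ in case (A) and $\gamma=1$ otherwise. Let $\mathrm{Sign}=\{\pm1\}\cong\mathcal O_F^\times/(\mathcal O_F^\times)^2$ in case (S) and $\mathrm{Sign}=\{1\}$ otherwise, with natural map $\mathrm{sign}\colon\mathcal O_F^\times\to\mathrm{Sign}$, and let $\epsilon=\mathrm{sign}(-1)$. Let $R\ne0$ be a commutative ring in which $\#\mathrm{Sign}$ is invertible, and let $r,\alpha\ge1$ be integers. **Spherical functions.** Let $X\subseteq\mathrm{GL}_{\gamma r}(F)$ be the space of nondegenerate Hermitian (uH), symmetric (S), or alternating (A) matrices, on which $K=\mathrm{GL}_{\gamma r}(\mathcal O_F)$ acts by change of basis, and let $\mathcal S(X/K,R)$ be the $R$-module of locally constant, compactly supported functions $X/K\to R$. Let $\mathrm{Typ}^0_r$ be the set of pairs $(e^0\colon\mathbb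 Z\to\mathbb Z_{\ge0},\ \chi^0\colon\mathbb Z\to\mathrm{Sign})$ with $\sum_ie^0(i)=r$ and $\chi^0(i)=1$ whenever $e^0(i)=0$. The map $\mathrm{typ}\colon X/K\to\mathrm{Typ}^0_r$ sends $x$ to $(e^0,\chi^0)$ if the lattice $\mathcal O_F^{\gamma r}$ with Gram matrix $x$ is an orthogonal sum over $i\in\mathbb Z$ of $\varpi^i$ times unimodular lattices of rank $\gamma e^0(i)$ whose determinant has sign $\chi^0(i)$. This is a bijection, and it identifies $\mathcal S(X/K,R)$ with the free module $R[\mathrm{Typ}^0_r]$. Duals of operators are taken with respect to the pairing $\{f,v\}=\sum_{o\in X/K}f(o)\,v(\mathrm{typ}(o))$. **Straightening.** Let $\mathrm{Typ}_r=(\mathbb Z\times\mathrm{Sign})^r$, and let $R[\mathrm{Typ}]=\bigoplus_{n\ge0}R[\mathrm{Typ}_n]$ be the $R$-algebra whose product is concatenation. Write $\delta(e,\chi)$ for its standard basis elements, where $e\in\mathbb Z^n$ and $\chi\in\mathrm{Sign}^n$, and put $\delta_s(e)=\sum_\chi s(\chi)\delta(e,\chi)$ for a character $s\colon\mathrm{Sign}^n\to\{\pm1\}$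 with components $s_1,\dots,s_n$. In degree two, write $(a,b)$ for $\delta((a,b),(1,1))$ in cases (uH) and (A), and in case (S) write $(a_{s_1},b_{s_2})$ for $\delta_s((a,b))$, where $s=(s_1,s_2)$ with $s_i\in\{\pm1\}\cong\widehat{\mathrm{Sign}}$. Let $\mathrm{Rel}$ be the two-sided ideal generated by the following elements, and let $\mathrm{Rel}_r$ be its degree $r$ part. * In cases (uH) and (A), with $t=-q_0$ and $t=q^2$ respectively: $(a,a+1)-(a+1,a)$ for $a\in\mathbb Z$, and $(a,b)-(a+1,b-1)-t^{\,b-a-1}\big((b,a)-(b-1,a+1)\big)$ for $a<b$. * In case (S): - $(a_{s_1},b_{s_2})-(a{+}1_{s_2},b{-}1_{s_1})-q^{(b-a-1)/2}\big((b_{s_2},a_{s_1})-(b{-}1_{s_1},a{+}1_{s_2})\big)$ for $b-a\ge1$ odd; - $(a_s,b_{-s})+q^{(b-a)/2}(b_s,a_{-s})$ for $b-a\ge0$ even; - $H_s(a+1,b-1)+q^{(b-a-2)/2}H_s(b-1,a+1)$ for $b-a\ge2$ even, where $H_s(a,b)=-(a_s,b_s)+(a{-}1_s,b{+}1_s)-\epsilon\big((a_{-s},b_{-s})-(a{+}1_{-s},b{-}1_{-s})\big)$.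 There is a unique isomorphism $\mathrm{str}\colon R[\mathrm{Typ}_r]/\mathrm{Rel}_r\cong R[\mathrm{Typ}^0_r]$ with $\mathrm{str}(\delta(e,\chi))=(e^0,\chi^0)$ whenever $e_1\ge\dots\ge e_r$, where $e^0(i)=\#\{k:e_k=i\}$ and $\chi^0(i)=\prod_{k:\,e_k=i}\chi_k$. For $e_1\ge\dots\ge e_r$, regard $\delta_s(e)$ as an element of $\mathcal S(X/K,R)$ through $\mathrm{str}$ and $\mathrm{typ}$. For $\varepsilon\in\mathbb Z^r$ let $t(\varepsilon)$ be the translation $\delta(e,\chi)\mapsto\delta(e+\varepsilon,\chi)$ of $R[\mathrm{Typ}_r]$. **Theorem.** Let $S_0,\dots,S_r$ be commuting $R$-linear operators on $\mathcal S(X/K,R)$ whose duals $S_k^*$ on $R[\mathrm{Typ}^0_r]$ are induced through $\mathrm{str}$ by $$\sum_{k=0}^rS_k^*x^k=\sum_{\varepsilon\in\{0,1\}^r}a(\varepsilon)\,x^{\lambda_1(\varepsilon)}\,t(\alpha\varepsilon),\qquad\lambda_1(\varepsilon)=\#\{i:\varepsilon_i=1\},$$ for some coefficients $a(\varepsilon)\in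 R$ such that $a(0,\dots,0,\underbrace{1,\dots,1}_k)=1$ for all $0\le k\le r$. Then $S_r$ is invertible, $S_1,\dots,S_r$ are algebraically independent over $R$, and $\mathcal S(X/K,R)$ is a free module over the algebra $R[S_1,\dots,S_r,S_r^{-1}]$ of operators, with basis the elements $\delta_s(e)$, one for each pair of a character $s\colon\mathrm{Sign}^r\to\{\pm1\}$ and $e\in\mathbb Z^r$ such that $$e_i-e_{i+1}-(1\text{ if }s_i\ne s_{i+1})\in[0,\alpha-1]\ \ (1\le i<r),\qquad 0\le e_r<\alpha .$$ -/

import Mathlib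

open scoped ValuativeRel

noncomputable section

namespace SphForm

/-- The three families of forms: Hermitian for an unramified quadratic extension, symmetric, and
alternating. -/
inductive FormType : Type
  | unramHermitian
  | symmetric
  | alternating

namespace FormType

/-- The forms of rank parameter `r` are forms on `F ^ (γ r)`. -/
def gamma : FormType → ℕ
  | unramHermitian => 1
  | symmetric => 1
  | alternating => 2

/-- `Sign` as a subgroup of `{±1}`: everything in the symmetric case, trivial otherwise. -/
def signGroup : FormType → Subgroup ℤˣ
  | unramHermitian => ⊥
  | symmetric => ⊤
  | alternating => ⊥

/-- The group `Sign`. -/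
abbrev Sign (c : FormType) : Type := ↥(c.signGroup)

instance (c : FormType) : Fintype c.Sign := Fintype.ofFinite _

end FormType

/-! ### Fields, forms and the space `X / K` -/

section Forms

variable (c : FormType) {F₀ F : Type*}
  [Field F₀] [ValuativeRel F₀] [TopologicalSpace F₀] [IsNonarchimedeanLocalField F₀]
  [Field F] [ValuativeRel F] [TopologicalSpace F] [IsNonarchimedeanLocalField F]
  [Algebra F₀ F] [ValuativeExtension F₀ F]

/-- The standing hypotheses on `F / F₀` in each of the three cases:
`F / F₀` is quadratic and unramified (the two fields have the same value group) with nontrivial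
automorphism `σ`; or `F = F₀` and `2` is a unit of the ring of integers; or `F = F₀`. -/
def FieldHyp (σ : F ≃ₐ[F₀] F) : Prop :=
  match c with
  | .unramHermitian =>
      Module.finrank F₀ F = 2 ∧
      (∀ x : F, ∃ y : F₀, ValuativeRel.valuation F (algebraMap F₀ F y) =
        ValuativeRel.valuation F x) ∧
      σ ≠ 1
  | .symmetric => Module.finrank F₀ F = 1 ∧ IsUnit (2 : 𝒪[F])
  | .alternating => Module.finrank F₀ F = 1

/-- The map `sign : 𝒪ˣ → Sign`: the quadratic residue symbol in the symmetric case, trivial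
otherwise. -/
def sign (u : (𝒪[F])ˣ) : c.Sign :=
  open Classical in
  if h : (-1 : ℤˣ) ∈ c.signGroup ∧ ¬ IsSquare u then ⟨-1, h.1⟩ else 1

/-- Conjugate transpose in the Hermitian case, transpose in the other two. -/
def adj (σ : F ≃ₐ[F₀] F) {m n : Type*} (A : Matrix m n F) : Matrix n m F :=
  match c with
  | .unramHermitian => (A.map σ).transpose
  | .symmetric => A.transpose
  | .alternating => A.transpose

/-- `A` is Hermitian, symmetric, or alternating. -/
def IsForm (σ : F ≃ₐ[F₀] F) {n : Type*} (A : Matrix n n F) : Prop :=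
  match c with
  | .unramHermitian => adj .unramHermitian σ A = A
  | .symmetric => adj .symmetric σ A = A
  | .alternating => adj .alternating σ A = -A

/-- The space `X` of nondegenerate Hermitian (`r × r`), symmetric (`r × r`) or alternating
(`2r × 2r`) matrices, with the topology induced from the space of all matrices. -/
abbrev FormSpace (σ : F ≃ₐ[F₀] F) (r : ℕ) : Type _ :=
  {x : Matrix (Fin (c.gamma * r)) (Fin (c.gamma * r)) F // IsUnit x.det ∧ IsForm c σ x}

/-- An integral matrix, seen over the field. -/
def toField {m n : Type*} (k : Matrix m n 𝒪[F]) : Matrix m n F := k.map (fun a => (a : F))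

/-- The quotient `X / K` for `K = GL(𝒪)` acting by change of basis, with the quotient topology. -/
abbrev FormClass (σ : F ≃ₐ[F₀] F) (r : ℕ) : Type _ :=
  Quot (fun x y : FormSpace c σ r =>
    ∃ k : Matrix.GeneralLinearGroup (Fin (c.gamma * r)) 𝒪[F],
      y.1 = adj c σ (toField k.val) * x.1 * toField k.val)

/-- `𝒮(X/K, R)`: locally constant, compactly supported functions `X / K → R`. -/
def sphericalFunctions (σ : F ≃ₐ[F₀] F) (r : ℕ) (R : Type*) [CommRing R] :
    Submodule R (FormClass c σ r → R) where
  carrier := {f | IsLocallyConstant f ∧ HasCompactSupport f}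
  add_mem' hf hg := ⟨hf.1.add hg.1, hf.2.add hg.2⟩
  zero_mem' := ⟨IsLocallyConstant.const 0, HasCompactSupport.zero⟩
  smul_mem' a _ hf := ⟨hf.1.comp (a * ·), hf.2.mul_left (f := fun _ => a)⟩

end Forms

/-! ### Types of lattices -/

/-- `Typ⁰_r`: pairs `(e⁰, χ⁰)` with `e⁰ : ℤ → ℕ` finitely supported of total mass `r`, and
`χ⁰ : ℤ → Sign` with `χ⁰ i = 1` whenever `e⁰ i = 0`. -/
structure Typ0 (c : FormType) (r : ℕ) where
  e : ℤ →₀ ℕ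
  χ : ℤ → c.Sign
  χ_eq_one : ∀ i, e i = 0 → χ i = 1
  sum_e : (e.sum fun _ m => m) = r

/-- `Typ_r = (ℤ × Sign) ^ r`. -/
abbrev Typ (c : FormType) (r : ℕ) : Type := Fin r → ℤ × c.Sign

/-- The element of `Typ⁰_r` with `e⁰ i = #{k | e_k = i}` and `χ⁰ i = ∏_{k : e_k = i} χ_k`. -/
def toTyp0 {c : FormType} {r : ℕ} (w : Typ c r) : Typ0 c r where
  e := ∑ k, Finsupp.single (w k).1 1
  χ i := ∏ k with (w k).1 = i, (w k).2
  χ_eq_one i hi := by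
    refine Finset.prod_eq_one fun k hk => ?_
    rw [Finset.mem_filter] at hk
    simp only [Finsupp.finsetSum_apply, Finset.sum_eq_zero_iff] at hi
    have := hi k (Finset.mem_univ k)
    simp [hk.2] at this
  sum_e := by
    rw [← Finsupp.sum_finsetSum_index (fun _ => rfl) (fun _ _ _ => rfl)]
    simp

instance (c : FormType) (r : ℕ) : Nonempty (Typ0 c r) := ⟨toTyp0 fun _ => (0, 1)⟩

section Lattice

variable {c : FormType} {F₀ F : Type*}
  [Field F₀] [ValuativeRel F₀] [TopologicalSpace F₀] [IsNonarchimedeanLocalField F₀]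
  [Field F] [ValuativeRel F] [TopologicalSpace F] [IsNonarchimedeanLocalField F]
  [Algebra F₀ F] [ValuativeExtension F₀ F]

/-- The standard lattice `𝒪 ^ (γ r)`, with the form of Gram matrix `x`, has a decomposition of
type `τ`. In the basis given by the columns of some `g ∈ GL(𝒪)`, where the basis vector with index
`a` is placed in degree `d a`, the form is the orthogonal sum over `i : ℤ` of `ϖ ^ i` times a form
on the part of degree `i` that is unimodular, of rank `γ * τ.e i`, and whose determinant has sign
`τ.χ i`. -/
def HasTyp (σ : F ≃ₐ[F₀] F) (ϖ : 𝒪[F₀]) {r : ℕ} (x : FormSpace c σ r) (τ : Typ0 c r) : Prop :=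
  ∃ (g : Matrix.GeneralLinearGroup (Fin (c.gamma * r)) 𝒪[F]) (d : Fin (c.gamma * r) → ℤ)
    (y : Matrix (Fin (c.gamma * r)) (Fin (c.gamma * r)) 𝒪[F]) (u : ℤ → (𝒪[F])ˣ),
    (∀ a b, (adj c σ (toField g.val) * x.1 * toField g.val) a b =
      if d a = d b then (algebraMap F₀ F (ϖ : F₀)) ^ d a * (y a b : F) else 0) ∧
    ∀ i : ℤ,
      (u i : 𝒪[F]) = (y.submatrix (Subtype.val : {a // d a = i} → _) Subtype.val).det ∧
      c.gamma * τ.e i = Fintype.card {a // d a = i} ∧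
      τ.χ i = sign c (u i)

/-- The map `typ : X / K → Typ⁰_r`. -/
def typ (σ : F ≃ₐ[F₀] F) (ϖ : 𝒪[F₀]) {r : ℕ} (o : FormClass c σ r) : Typ0 c r :=
  Classical.epsilon fun τ => ∃ x : FormSpace c σ r, Quot.mk _ x = o ∧ HasTyp σ ϖ x τ

/-- The pairing `{f, v} = ∑_{o ∈ X / K} f(o) v(typ o)` of functions on `X / K` with `R[Typ⁰_r]`. -/
def pairing (σ : F ≃ₐ[F₀] F) (ϖ : 𝒪[F₀]) {r : ℕ} {R : Type*} [CommRing R]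
    (f : FormClass c σ r → R) (v : Typ0 c r →₀ R) : R :=
  ∑ᶠ o : FormClass c σ r, f o * v (typ σ ϖ o)

/-- `T : R[Typ⁰_r] → R[Typ⁰_r]` is the dual of the operator `S` on `𝒮(X/K, R)`. -/
def IsDual (σ : F ≃ₐ[F₀] F) (ϖ : 𝒪[F₀]) {r : ℕ} {R : Type*} [CommRing R]
    (S : Module.End R (sphericalFunctions c σ r R)) (T : Module.End R (Typ0 c r →₀ R)) : Prop :=
  ∀ (f : sphericalFunctions c σ r R) (v : Typ0 c r →₀ R),
    pairing σ ϖ (S f : FormClass c σ r → R) v = pairing σ ϖ (f : FormClass c σ r → R) (T v)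

open Classical in
/-- For `e_1 ≥ ⋯ ≥ e_r`, the element `δ_s(e) = ∑_χ s(χ) δ(e, χ)`, as a function on `X / K`
(an element of `Typ⁰_r` being identified with the indicator function of its class). -/
def deltaFun (σ : F ≃ₐ[F₀] F) (ϖ : 𝒪[F₀]) {r : ℕ} (R : Type*) [CommRing R]
    (e : Fin r → ℤ) (s : (Fin r → c.Sign) →* ℤˣ) (o : FormClass c σ r) : R :=
  ∑ χ : Fin r → c.Sign,
    (((s χ : ℤˣ) : ℤ) : R) * if typ σ ϖ o = toTyp0 (fun k => (e k, χ k)) then 1 else 0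

end Lattice

/-! ### Straightening relations -/

section Straightening

variable (c : FormType) (R : Type*) [CommRing R]

/-- The graded ring `R[Typ]` with concatenation as product. -/
abbrev TypAlg : Type _ := MonoidAlgebra R (FreeMonoid (ℤ × c.Sign))

variable {c}

/-- The word `(a, χ₁) (b, χ₂)`. -/
def word2 (a : ℤ) (χ₁ : c.Sign) (b : ℤ) (χ₂ : c.Sign) : TypAlg c R :=
  MonoidAlgebra.of R _ (FreeMonoid.of (a, χ₁) * FreeMonoid.of (b, χ₂))

/-- The character of `Sign` with label `s`: trivial for `s = 1`, the inclusion into `{±1}` for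
`s = -1`. -/
def signChar (s : ℤˣ) (χ : c.Sign) : ℤˣ := if s = 1 then 1 else χ

variable (c)

/-- The element of `R[Typ]` with exponents `a, b` and characters `s₁, s₂`:
`∑_{χ₁, χ₂} s₁(χ₁) s₂(χ₂) (a, χ₁) (b, χ₂)`. -/
def sigma2 (a : ℤ) (s₁ : ℤˣ) (b : ℤ) (s₂ : ℤˣ) : TypAlg c R :=
  ∑ χ₁ : c.Sign, ∑ χ₂ : c.Sign,
    (((signChar s₁ χ₁ * signChar s₂ χ₂ : ℤˣ) : ℤ) : R) • word2 R a χ₁ b χ₂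

/-- Generators of `Rel` in the Hermitian case (`t = -q₀`) and the alternating case (`t = q ^ 2`). -/
def relTrivialSign (t : R) : Set (TypAlg c R) :=
  {x | ∃ a : ℤ, x = word2 R a 1 (a + 1) 1 - word2 R (a + 1) 1 a 1} ∪
  {x | ∃ a b : ℤ, a < b ∧
    x = word2 R a 1 b 1 - word2 R (a + 1) 1 (b - 1) 1 -
      t ^ (b - a - 1).toNat • (word2 R b 1 a 1 - word2 R (b - 1) 1 (a + 1) 1)}

/-- The element `RelHalf` of the symmetric case; `η` is the value of `sign (-1)` in `R`. -/
def relHalf (η : R) (a b : ℤ) (s : ℤˣ) : TypAlg c R :=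
  -sigma2 c R a s b s + sigma2 c R (a - 1) s (b + 1) s -
    η • (sigma2 c R a (-s) b (-s) - sigma2 c R (a + 1) (-s) (b - 1) (-s))

/-- Generators of `Rel` in the symmetric case; `η` is the value of `sign (-1)` in `R`. -/
def relSymmetric (q η : R) : Set (TypAlg c R) :=
  {x | ∃ (a b : ℤ) (n : ℕ) (s₁ s₂ : ℤˣ), b - a = 2 * n + 1 ∧
    x = sigma2 c R a s₁ b s₂ - sigma2 c R (a + 1) s₂ (b - 1) s₁ -
      q ^ n • (sigma2 c R b s₂ a s₁ - sigma2 c R (b - 1) s₁ (a + 1) s₂)} ∪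
  {x | ∃ (a b : ℤ) (n : ℕ) (s : ℤˣ), b - a = 2 * n ∧
    x = sigma2 c R a s b (-s) + q ^ n • sigma2 c R b s a (-s)} ∪
  {x | ∃ (a b : ℤ) (n : ℕ) (s : ℤˣ), b - a = 2 * n + 2 ∧
    x = relHalf c R η (a + 1) (b - 1) s + q ^ n • relHalf c R η (b - 1) (a + 1) s}

/-- The degree two generators of `Rel`, for the fields `F₀` and `F`. -/
def relGenerators (F₀ F : Type*) [Field F₀] [ValuativeRel F₀] [Field F] [ValuativeRel F] :
    Set (TypAlg c R) :=
  match c with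
  | .unramHermitian => relTrivialSign .unramHermitian R (-(Nat.card 𝓀[F₀] : R))
  | .symmetric => relSymmetric .symmetric R (Nat.card 𝓀[F] : R)
      (((sign .symmetric (-1 : (𝒪[F])ˣ) : ℤˣ) : ℤ) : R)
  | .alternating => relTrivialSign .alternating R ((Nat.card 𝓀[F] : R) ^ 2)

variable {c}

/-- The inclusion `R[Typ_r] ⊆ R[Typ]` of the degree `r` part. -/
def inclTyp (r : ℕ) : (Typ c r →₀ R) →ₗ[R] TypAlg c R :=
  Finsupp.linearCombination R fun w =>
    MonoidAlgebra.of R (FreeMonoid (ℤ × c.Sign)) (FreeMonoid.ofList (List.ofFn w))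

variable {R}

/-- Membership in `Rel_r`, the degree `r` part of the two-sided ideal `Rel`. -/
def InRel (F₀ F : Type*) [Field F₀] [ValuativeRel F₀] [Field F] [ValuativeRel F] {r : ℕ}
    (v : Typ c r →₀ R) : Prop :=
  inclTyp R r v ∈ TwoSidedIdeal.span (relGenerators c R F₀ F)

/-- `str v = w`, where `str : R[Typ_r] / Rel_r → R[Typ⁰_r]` is the straightening map: modulo
`Rel_r`, `v` is a combination of elements `δ(e, χ)` with `e_1 ≥ ⋯ ≥ e_r`, and `w` is the
corresponding combination of elements of `Typ⁰_r`. -/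
def IsStr (F₀ F : Type*) [Field F₀] [ValuativeRel F₀] [Field F] [ValuativeRel F] {r : ℕ}
    (v : Typ c r →₀ R) (w : Typ0 c r →₀ R) : Prop :=
  ∃ u : Typ c r →₀ R, (∀ p ∈ u.support, Antitone fun k => (p k).1) ∧
    InRel F₀ F (v - u) ∧ Finsupp.mapDomain toTyp0 u = w

variable (c R)

/-- The translation `t(ε) : δ(e, χ) ↦ δ(e + ε, χ)` of `R[Typ_r]`. -/
def translation {r : ℕ} (ε : Fin r → ℤ) : Module.End R (Typ c r →₀ R) :=
  Finsupp.lmapDomain R R fun w k => ((w k).1 + ε k, (w k).2)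

variable {R}

/-- The coefficient of `x ^ k` in `∑_{ε ∈ {0,1}^r} a(ε) x^{λ₁(ε)} t(α ε)`, where `λ₁(ε)` is the
number of entries equal to `1`. -/
def shiftSum {r : ℕ} (a : (Fin r → Fin 2) → R) (α k : ℕ) : Module.End R (Typ c r →₀ R) :=
  ∑ ε : Fin r → Fin 2 with (Finset.univ.filter fun i => ε i = 1).card = k,
    a ε • translation c R fun i => (α : ℤ) * ((ε i : ℕ) : ℤ)

/-- The sequence `(0, …, 0, 1, …, 1)` with `k` ones. -/
def lastOnes (r k : ℕ) (i : Fin r) : Fin 2 := if r ≤ i + k then 1 else 0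

end Straightening

/-- The index set of the basis: `e ∈ ℤ ^ r` and a character `s` of `Sign ^ r` with
`e_i - e_{i+1} - (1 if s_i ≠ s_{i+1}) ∈ [0, α - 1]` for `i < r`, and `0 ≤ e_r < α`. -/
def BasisIndex (c : FormType) (r α : ℕ) : Type :=
  open Classical in
  {p : (Fin r → ℤ) × ((Fin r → c.Sign) →* ℤˣ) //
    (∀ i j : Fin r, (i : ℕ) + 1 = j →
      p.1 i - p.1 j - (if p.2.comp (MonoidHom.mulSingle (fun _ => c.Sign) i) ≠
          p.2.comp (MonoidHom.mulSingle (fun _ => c.Sign) j) then 1 else 0) ∈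
        Set.Icc (0 : ℤ) (α - 1)) ∧
    ∀ i : Fin r, (i : ℕ) + 1 = r → 0 ≤ p.1 i ∧ p.1 i < α}

end SphForm

end

open scoped ValuativeRel

noncomputable section

namespace SphForm

/-! ### Yang–Baxter exchange operators, and why their antisymmetrizer annihilates Rel. -/

/-! ### Exchange operators -/

section Exchange

variable {B Z : Type*} [Field B]

/-! The theorem is a triangularity statement. Forms over a complete discrete valuation ring are
classified by their Jordan type, and the classes are open (`typ_bijective_and_discreteTopology`), so
spherical functions are the finitely supported functions on types. By duality, the value of S_k f at
the type of a weakly decreasing word w is a sum over the ε with k ones: a(ε) times the pairing of f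
with the straightening of w translated by αε.

Straightening a word produces only exponents that dominate the given ones. Among all ε with k ones,
(0,…,0,1,…,1) gives the dominance-smallest translate, and its coefficient is 1. Hence if f is
supported on exponents dominated by e, then S_k f is supported on exponents dominated by e −
α(0,…,0,1,…,1), and the values at the top exponent are carried over unchanged
(`hasShift_of_shiftSum`). For k = r there is only one ε and no straightening is needed, so S_r is a
bijective translation.

A monomial in the S_k applied to δ_s(e) therefore has leading term a unit times δ_s(e − d). The
exponents of S_1, …, S_{r−1} raise the gaps of e independently by nonnegative multiples of α, and
the integral exponent of S_r then moves the last entry by any multiple of α. Division with remainder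
by α shows that each pair (e, s) with e weakly decreasing and s constant along equal exponents
arises exactly once from a monomial and an index in the box (`leadIndex_injective`,
`exists_leadIndex_eq`). As #Sign is invertible, orthogonality of characters separates the functions
with a given leading exponent. So the monomials applied to the δ_s(e) of the box form an R-basis
(`linearIndependent_of_triangular`, `span_eq_top_of_triangular`), which gives freeness and algebraic
independence together.

The serious input is a straightening map that is well defined and triangular (`exists_str`). That
words reduce to canonical ones is a rewriting argument. That canonical words are independent modulo
Rel is shown over ℤ[1/#Sign][t] with t an indeterminate, and then specialized, because R and the
value of t are arbitrary. Put t = h⁻¹, or t = h⁻² in the symmetric case, and work over ℚ((h)). A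
word becomes a product of one-variable functions, the letter at site k being evaluated at its
variable rescaled by h^(−k); labels record parities of exponents and characters of signs. On such
functions act exchange operators satisfying the Coxeter relations of the symmetric group
(`exchange_mul_self`, `exchange_commute`, `exchange_braid`). With this rescaling the generators of
Rel become functions fixed by an exchange, so the antisymmetrizer kills Rel
(`antisymmetrizer_eq_zero_of_mem_rels`). At h = 0 the exchanges become permutations of exponents, up
to a shift resembling ρ, and the antisymmetrizer is unitriangular on strictly decreasing exponents.
A nontrivial relation between canonical words, scaled so that its coefficients are integral in h and
one of them is 1, contradicts this at h = 0 (`eq_zero_of_mem_rels`).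

The classification treats the three cases at once through `FormModel`. Existence scales a form until
it has a unit entry and splits off a model block, using Hensel's lemma and the surjectivity of the
norm on units. Uniqueness compares two Jordan decompositions that agree only modulo a high power of
the uniformizer, which also makes the type locally constant. -/

/-- The coefficient of the label-preserving part of the exchange matrix. -/
def wu (h a b : B) : B := (1 - h ^ 2) * a * b / (a ^ 2 - h ^ 2 * b ^ 2)

/-- The coefficient of the label-changing part of the exchange matrix. -/
def wv (h a b : B) : B := h * (b ^ 2 - a ^ 2) / (a ^ 2 - h ^ 2 * b ^ 2)

/-- Labels of a site: a parity and a character of `Sign`. -/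
abbrev Label : Type := ℤˣ × ℤˣ

/-- The exchange operator on functions of two sites. -/
def exchange2 (c : FormType) (h ε : B) (ι : Z → B) (g : Z → Z → Label → Label → B)
    (a b : Z) (p q : Label) : B :=
  match c with
  | .symmetric =>
    if p.1 = q.1 then
      if p.2 = q.2 then
        wu h (ι a) (ι b) ^ 2 * g b a p q +
        wu h (ι a) (ι b) * wv h (ι a) (ι b) *
          (g b a (-p.1, p.2) (-q.1, q.2) + ε * g b a (-p.1, -p.2) (-q.1, -q.2)) +
        ε * wv h (ι a) (ι b) ^ 2 * g b a (p.1, -p.2) (q.1, -q.2)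
      else g b a p q
    else wu h (ι a) (ι b) * g b a p q + wv h (ι a) (ι b) * g b a q p
  | _ => (wu h (ι a) (ι b) + wv h (ι a) (ι b)) * g b a p q

/-- Replace the entries with indices `i` and `i + 1`. -/
def upd2 {A : Type*} (z : ℕ → A) (i : ℕ) (a b : A) : ℕ → A := fun k =>
  if k = i then a else if k = i + 1 then b else z k

/-- Replace the entries with indices `i`, `i + 1` and `i + 2`. -/
def upd3 {A : Type*} (z : ℕ → A) (i : ℕ) (a b d : A) : ℕ → A := fun k =>
  if k = i then a else if k = i + 1 then b else if k = i + 2 then d else z k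

/-- The exchange operator on functions of infinitely many sites. -/
def exchange (c : FormType) (h ε : B) (ι : Z → B) (i : ℕ) :
    Module.End B ((ℕ → Z) → (ℕ → Label) → B) where
  toFun f z s := exchange2 c h ε ι (fun a b p q => f (upd2 z i a b) (upd2 s i p q))
    (z i) (z (i + 1)) (s i) (s (i + 1))
  map_add' f g := by
    funext z s
    cases c <;> simp only [exchange2, Pi.add_apply] <;> (try split_ifs) <;> ring
  map_smul' m f := by
    funext z s
    cases c <;> simp only [exchange2, Pi.smul_apply, smul_eq_mul, RingHom.id_apply] <;>
      (try split_ifs) <;> ring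

theorem exchange_apply (c : FormType) (h ε : B) (ι : Z → B) (i : ℕ)
    (f : (ℕ → Z) → (ℕ → Label) → B) (z : ℕ → Z) (s : ℕ → Label) :
    exchange c h ε ι i f z s = exchange2 c h ε ι (fun a b p q => f (upd2 z i a b) (upd2 s i p q))
      (z i) (z (i + 1)) (s i) (s (i + 1)) := rfl

theorem upd2_self {A : Type*} (z : ℕ → A) (i : ℕ) : upd2 z i (z i) (z (i + 1)) = z := by
  funext k; simp only [upd2]; split_ifs <;> simp_all

theorem upd3_self {A : Type*} (z : ℕ → A) (i : ℕ) :
    upd3 z i (z i) (z (i + 1)) (z (i + 2)) = z := by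
  funext k; simp only [upd3]; split_ifs <;> simp_all

theorem upd2_upd2 {A : Type*} (z : ℕ → A) (i : ℕ) (a b a' b' : A) :
    upd2 (upd2 z i a b) i a' b' = upd2 z i a' b' := by
  funext k; simp only [upd2]; split_ifs <;> rfl

theorem upd2_upd3_left {A : Type*} (z : ℕ → A) (i : ℕ) (a b d a' b' : A) :
    upd2 (upd3 z i a b d) i a' b' = upd3 z i a' b' d := by
  funext k; simp only [upd2, upd3]; split_ifs <;> rfl

theorem upd2_upd3_right {A : Type*} (z : ℕ → A) (i : ℕ) (a b d a' b' : A) :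
    upd2 (upd3 z i a b d) (i + 1) a' b' = upd3 z i a a' b' := by
  funext k; simp only [upd2, upd3]; split_ifs <;> first | rfl | omega

theorem upd2_comm {A : Type*} (z : ℕ → A) {i j : ℕ} (hij : i + 2 ≤ j) (a b a' b' : A) :
    upd2 (upd2 z j a b) i a' b' = upd2 (upd2 z i a' b') j a b := by
  funext k; simp only [upd2]; split_ifs <;> first | rfl | omega

theorem upd2_of_ne {A : Type*} (z : ℕ → A) {i k : ℕ} (h : k ≠ i) (h' : k ≠ i + 1) (a b : A) :
    upd2 z i a b k = z k := by
  simp [upd2, h, h']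

theorem exchange_upd2 (c : FormType) (h ε : B) (ι : Z → B) (i : ℕ)
    (f : (ℕ → Z) → (ℕ → Label) → B) (z : ℕ → Z) (s : ℕ → Label) (a b : Z) (p q : Label) :
    exchange c h ε ι i f (upd2 z i a b) (upd2 s i p q) =
      exchange2 c h ε ι (fun a b p q => f (upd2 z i a b) (upd2 s i p q)) a b p q := by
  rw [exchange_apply]
  simp only [upd2_upd2]
  congr 1 <;> simp [upd2]

theorem exchange_upd3_left (c : FormType) (h ε : B) (ι : Z → B) (i : ℕ)
    (f : (ℕ → Z) → (ℕ → Label) → B) (z : ℕ → Z) (s : ℕ → Label) (a b d : Z) (p q t : Label) :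
    exchange c h ε ι i f (upd3 z i a b d) (upd3 s i p q t) =
      exchange2 c h ε ι (fun a b p q => f (upd3 z i a b d) (upd3 s i p q t)) a b p q := by
  rw [exchange_apply]
  simp only [upd2_upd3_left]
  congr 1 <;> simp [upd3]

theorem exchange_upd3_right (c : FormType) (h ε : B) (ι : Z → B) (i : ℕ)
    (f : (ℕ → Z) → (ℕ → Label) → B) (z : ℕ → Z) (s : ℕ → Label) (a b d : Z) (p q t : Label) :
    exchange c h ε ι (i + 1) f (upd3 z i a b d) (upd3 s i p q t) =
      exchange2 c h ε ι (fun b d q t => f (upd3 z i a b d) (upd3 s i p q t)) b d q t := by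
  rw [exchange_apply]
  simp only [upd2_upd3_right]
  congr 1 <;> simp [upd3] <;> omega

theorem unit_ne_neg (x : ℤˣ) : (x = -x) = False := by revert x; decide

theorem unit_eq_or_eq_neg (x y : ℤˣ) : y = x ∨ y = -x := by revert x y; decide

theorem neg_unit_ne (x : ℤˣ) : (-x = x) = False := by revert x; decide

/-- Unitarity. By `r1` and `r2`, the operator u + vP at (a, b) is inverse to the one at (b, a) for
every involution P. On equal labels the exchange is (u + vP)(u + εvPQ), where P flips both parities
and Q both characters; on opposite parities it is u + vP with P the swap of labels. -/
theorem exchange2_exchange2 (c : FormType) (h ε : B) (hε : ε = 1 ∨ ε = -1) (ι : Z → B)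
    (hne : ∀ a b, (ι a) ^ 2 - h ^ 2 * (ι b) ^ 2 ≠ 0)
    (g : Z → Z → Label → Label → B) (a b : Z) (p q : Label) :
    exchange2 c h ε ι (exchange2 c h ε ι g) a b p q = g a b p q := by
  have h1 := hne a b
  have h2 := hne b a
  have r1 : wu h (ι a) (ι b) * wu h (ι b) (ι a) + wv h (ι a) (ι b) * wv h (ι b) (ι a) = 1 := by
    simp only [wu, wv]; field_simp; ring
  have r2 : wu h (ι a) (ι b) * wv h (ι b) (ι a) + wv h (ι a) (ι b) * wu h (ι b) (ι a) = 0 := by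
    simp only [wu, wv]; field_simp; ring
  obtain ⟨p1, p2⟩ := p
  obtain ⟨q1, q2⟩ := q
  have d1 : q1 = p1 ∨ q1 = -p1 := unit_eq_or_eq_neg _ _
  have d2 : q2 = p2 ∨ q2 = -p2 := unit_eq_or_eq_neg _ _
  cases c
  · simp only [exchange2]; grind
  · obtain rfl | rfl := d1 <;> obtain rfl | rfl := d2 <;>
      simp only [exchange2, neg_neg, unit_ne_neg, neg_unit_ne, if_true, if_false] <;>
      obtain rfl | rfl := hε <;> grind
  · simp only [exchange2]; grind

theorem exchange_mul_self (c : FormType) (h ε : B) (hε : ε = 1 ∨ ε = -1) (ι : Z → B)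
    (hne : ∀ a b, (ι a) ^ 2 - h ^ 2 * (ι b) ^ 2 ≠ 0) (i : ℕ) :
    exchange c h ε ι i * exchange c h ε ι i = 1 := by
  ext f z s
  rw [Module.End.mul_apply, Module.End.one_apply, exchange_apply]
  simp only [exchange_upd2]
  have := exchange2_exchange2 c h ε hε ι hne
    (fun a b p q => f (upd2 z i a b) (upd2 s i p q)) (z i) (z (i + 1)) (s i) (s (i + 1))
  rw [upd2_self, upd2_self] at this
  exact this

theorem exchange_commute (c : FormType) (h ε : B) (ι : Z → B) (i j : ℕ) (hij : i + 2 ≤ j) :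
    exchange c h ε ι i * exchange c h ε ι j = exchange c h ε ι j * exchange c h ε ι i := by
  have n1 : j ≠ i := by omega
  have n2 : j ≠ i + 1 := by omega
  have n3 : j + 1 ≠ i := by omega
  have n4 : j + 1 ≠ i + 1 := by omega
  have n5 : i + 1 ≠ j := by omega
  have n6 : i ≠ j + 1 := by omega
  ext f z s
  simp only [Module.End.mul_apply, exchange_apply, upd2_comm _ hij, upd2_of_ne _ n1 n2,
    upd2_of_ne _ n3 n4, upd2_of_ne _ n1.symm n6, upd2_of_ne _ n5 n4.symm]
  cases c
  · simp only [exchange2]; ring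
  · simp only [exchange2]; split_ifs <;> ring
  · simp only [exchange2]; ring

-- The Yang–Baxter equation. In the scalar cases both sides multiply f(d, b, a) by the same three
-- factors. In the symmetric case, once all labels are written relative to the first one, it is a
-- polynomial identity in the six values of u and v; it follows from the three relations `r1`, `r2`,
-- `r3` between them and from ε² = 1.
set_option maxHeartbeats 4000000 in
theorem exchange2_braid (c : FormType) (h ε : B) (hε : ε = 1 ∨ ε = -1) (ι : Z → B)
    (hne : ∀ a b, (ι a) ^ 2 - h ^ 2 * (ι b) ^ 2 ≠ 0)
    (f : Z → Z → Z → Label → Label → Label → B) (a b d : Z) (p q t : Label) :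
    let e12 := fun (f : Z → Z → Z → Label → Label → Label → B) a b d p q t =>
      exchange2 c h ε ι (fun a b p q => f a b d p q t) a b p q
    let e23 := fun (f : Z → Z → Z → Label → Label → Label → B) a b d p q t =>
      exchange2 c h ε ι (fun b d q t => f a b d p q t) b d q t
    e12 (e23 (e12 f)) a b d p q t = e23 (e12 (e23 f)) a b d p q t := by
  intro e12 e23
  obtain ⟨p, s⟩ := p
  obtain ⟨p', s'⟩ := q
  obtain ⟨p'', s''⟩ := t
  have h1 := hne a b
  have h2 := hne b d
  have h3 := hne a d
  have r1 : wu h (ι a) (ι b) * wv h (ι a) (ι d) - wu h (ι a) (ι b) * wv h (ι b) (ι d) -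
      wu h (ι a) (ι d) * wu h (ι b) (ι d) * wv h (ι a) (ι b) = 0 := by
    simp only [wu, wv]; field_simp; ring
  have r2 : wu h (ι a) (ι b) * wu h (ι a) (ι d) * wv h (ι b) (ι d) +
      wu h (ι b) (ι d) * wv h (ι a) (ι b) - wu h (ι b) (ι d) * wv h (ι a) (ι d) = 0 := by
    simp only [wu, wv]; field_simp; ring
  have r3 : wu h (ι a) (ι b) * wu h (ι b) (ι d) - wu h (ι a) (ι d) +
      wu h (ι a) (ι d) * wv h (ι a) (ι b) * wv h (ι b) (ι d) = 0 := by
    simp only [wu, wv]; field_simp; ring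
  have hp : p' = p ∨ p' = -p := unit_eq_or_eq_neg _ _
  have hs : s' = s ∨ s' = -s := unit_eq_or_eq_neg _ _
  have hp' : p'' = p ∨ p'' = -p := unit_eq_or_eq_neg _ _
  have hs' : s'' = s ∨ s'' = -s := unit_eq_or_eq_neg _ _
  cases c
  · simp only [e12, e23, exchange2]; ring
  · obtain rfl | rfl := hp <;> obtain rfl | rfl := hs <;> obtain rfl | rfl := hp' <;>
      obtain rfl | rfl := hs'
    all_goals
      try simp only [e12, e23, exchange2, neg_neg, unit_ne_neg, neg_unit_ne, if_true, if_false]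
    all_goals
      generalize wu h (ι a) (ι b) = u1 at *
      generalize wu h (ι a) (ι d) = u2 at *
      generalize wu h (ι b) (ι d) = u3 at *
      generalize wv h (ι a) (ι b) = v1 at *
      generalize wv h (ι a) (ι d) = v2 at *
      generalize wv h (ι b) (ι d) = v3 at *
      generalize f d b a = g at *
      clear hne e12 e23 f h1 h2 h3
    all_goals obtain rfl | rfl := hε
    all_goals grind
  · simp only [e12, e23, exchange2]; ring

theorem exchange_braid (c : FormType) (h ε : B) (hε : ε = 1 ∨ ε = -1) (ι : Z → B)
    (hne : ∀ a b, (ι a) ^ 2 - h ^ 2 * (ι b) ^ 2 ≠ 0) (i : ℕ) :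
    exchange c h ε ι i * exchange c h ε ι (i + 1) * exchange c h ε ι i =
      exchange c h ε ι (i + 1) * exchange c h ε ι i * exchange c h ε ι (i + 1) := by
  ext f z s
  rw [← upd3_self z i, ← upd3_self s i]
  simp only [Module.End.mul_apply, exchange_upd3_left, exchange_upd3_right]
  exact exchange2_braid c h ε hε ι hne (fun a b d p q t => f (upd3 z i a b d) (upd3 s i p q t)) _ _ _ _ _ _

end Exchange

/-! ### Antisymmetrizers -/

section Antisymmetrizer

variable {A : Type*} [Ring A]

/-- `1 - s_{k-1} + s_{k-1} s_{k-2} - ⋯`, the signed sum over minimal coset representatives. -/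
def cosetSum (s : ℕ → A) : ℕ → A
  | 0 => 1
  | k + 1 => 1 - s k * cosetSum s k

/-- The antisymmetrizer in the first `k + 1` sites. -/
def antisymmetrizer (s : ℕ → A) : ℕ → A
  | 0 => 1
  | k + 1 => antisymmetrizer s k * cosetSum s (k + 1)

theorem cosetSum_commute (s : ℕ → A) (hc : ∀ i j, i + 2 ≤ j → s i * s j = s j * s i) (k j : ℕ)
    (hj : k + 1 ≤ j) : cosetSum s k * s j = s j * cosetSum s k := by
  induction k with
  | zero => simp [cosetSum]
  | succ k ih =>
    rw [cosetSum, sub_mul, mul_sub, mul_assoc, ih (by omega), ← mul_assoc, hc k j (by omega)]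
    noncomm_ring

/-- The inductive step for absorption by the antisymmetrizer: anything that changes sign under the
earlier generators, multiplied by the signed sum of coset representatives, changes sign under one
more generator. -/
theorem mul_cosetSum_mul_eq_zero (s : ℕ → A) (hs : ∀ i, s i * s i = 1)
    (hc : ∀ i j, i + 2 ≤ j → s i * s j = s j * s i)
    (hb : ∀ i, s i * s (i + 1) * s i = s (i + 1) * s i * s (i + 1)) (k : ℕ) :
    ∀ b : A, (∀ j, j + 1 < k → b * (1 + s j) = 0) → ∀ i, i < k →
      b * cosetSum s k * (1 + s i) = 0 := by
  induction k with
  | zero => intro b _ i hi; omega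
  | succ k ih =>
    intro b hbk i hi
    rcases Nat.lt_or_ge i k with hik | hik
    · rw [cosetSum, mul_sub, sub_mul, mul_one, hbk i (by omega), ← mul_assoc, zero_sub, neg_eq_zero]
      -- The last generator commutes with all those that b must absorb at the shorter length, so b *
      -- s k satisfies the same hypothesis.
      refine ih (b * s k) (fun j hj => ?_) i hik
      rw [mul_assoc, mul_add, mul_one, ← hc j k (by omega)]
      have := hbk j (by omega)
      calc b * (s k + s j * s k) = b * (1 + s j) * s k := by noncomm_ring
        _ = 0 := by rw [this, zero_mul]
    · obtain rfl : i = k := by omega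
      cases i with
      | zero =>
        have := hs 0
        rw [cosetSum, cosetSum, mul_assoc]
        have e : (1 - s 0 * 1) * (1 + s 0) = 1 - s 0 * s 0 := by noncomm_ring
        rw [e, this, sub_self, mul_zero]
      | succ k =>
        have h1 := cosetSum_commute s hc k (k + 1) le_rfl
        have h2 := hbk k (by omega)
        have h3 := hs (k + 1)
        have h4 := hb k
        -- The braid relation carries the last generator to the far left, exposing a factor 1 + s k
        -- that b kills.
        have key : cosetSum s (k + 1 + 1) * (1 + s (k + 1)) =
            (1 + s k) * (s (k + 1) * s k * cosetSum s k) := by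
          rw [cosetSum, cosetSum]
          have e1 : (1 - s (k + 1) * (1 - s k * cosetSum s k)) * (1 + s (k + 1)) =
            1 - s (k + 1) * s (k + 1) + s (k + 1) * s k * cosetSum s k +
              s (k + 1) * s k * (cosetSum s k * s (k + 1)) := by noncomm_ring
          rw [e1, h1, h3]
          have e2 : s (k + 1) * s k * (s (k + 1) * cosetSum s k) =
            s (k + 1) * s k * s (k + 1) * cosetSum s k := by noncomm_ring
          rw [e2, ← h4]
          noncomm_ring
        rw [mul_assoc, key, ← mul_assoc, h2, zero_mul]

theorem antisymmetrizer_mul_eq_zero (s : ℕ → A) (hs : ∀ i, s i * s i = 1)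
    (hc : ∀ i j, i + 2 ≤ j → s i * s j = s j * s i)
    (hb : ∀ i, s i * s (i + 1) * s i = s (i + 1) * s i * s (i + 1)) (k : ℕ) (i : ℕ) (hi : i < k) :
    antisymmetrizer s k * (1 + s i) = 0 := by
  induction k generalizing i with
  | zero => omega
  | succ k ih =>
    rw [antisymmetrizer]
    exact mul_cosetSum_mul_eq_zero s hs hc hb (k + 1) _ (fun j hj => ih j (by omega)) i hi

end Antisymmetrizer


/-! ### Words as functions of sites -/

theorem upd2_left {X : Type*} (z : ℕ → X) (i : ℕ) (a b : X) : upd2 z i a b i = a := by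
  simp [upd2]

theorem upd2_right {X : Type*} (z : ℕ → X) (i : ℕ) (a b : X) : upd2 z i a b (i + 1) = b := by
  simp [upd2]

section Words

variable {c : FormType}

/-- The linear map on `R[Typ]` with prescribed values on words. -/
def wordLin {A M : Type*} [CommRing A] [AddCommGroup M] [Module A M]
    (f : List (ℤ × c.Sign) → M) : TypAlg c A →ₗ[A] M :=
  (Finsupp.linearCombination A fun w : FreeMonoid (ℤ × c.Sign) => f w.toList) ∘ₗ
    (MonoidAlgebra.coeffLinearEquiv A).toLinearMap

theorem wordLin_of {A M : Type*} [CommRing A] [AddCommGroup M] [Module A M]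
    (f : List (ℤ × c.Sign) → M) (w : FreeMonoid (ℤ × c.Sign)) :
    wordLin f (MonoidAlgebra.of A _ w) = f w.toList := by
  have : (MonoidAlgebra.coeffLinearEquiv A) (MonoidAlgebra.of A _ w) = Finsupp.single w 1 := rfl
  rw [wordLin, LinearMap.comp_apply, LinearEquiv.coe_coe, this, Finsupp.linearCombination_single,
    one_smul]

theorem span_of_words (A : Type*) [CommRing A] :
    Submodule.span A (Set.range (MonoidAlgebra.of A (FreeMonoid (ℤ × c.Sign)))) = ⊤ := by
  rw [eq_top_iff]
  rintro x -
  induction x using MonoidAlgebra.induction_linear with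
  | zero => exact zero_mem _
  | add x y hx hy => exact add_mem hx hy
  | single w a =>
    have : MonoidAlgebra.single w a = a • MonoidAlgebra.of A (FreeMonoid (ℤ × c.Sign)) w := by
      simp
    rw [this]
    exact Submodule.smul_mem _ _ (Submodule.subset_span ⟨w, rfl⟩)

/-- A linear map that kills all products of words with generators kills the ideal. -/
theorem map_eq_zero_of_mem_span {A M : Type*} [CommRing A] [AddCommGroup M] [Module A M]
    (s : Set (TypAlg c A)) (Φ : TypAlg c A →ₗ[A] M)
    (h : ∀ x ∈ s, ∀ w₁ w₂ : FreeMonoid (ℤ × c.Sign),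
      Φ (MonoidAlgebra.of A _ w₁ * x * MonoidAlgebra.of A _ w₂) = 0)
    {x : TypAlg c A} (hx : x ∈ TwoSidedIdeal.span s) : Φ x = 0 := by
  suffices H : ∀ y z : TypAlg c A, Φ (y * x * z) = 0 by simpa using H 1 1
  have ext_left : ∀ x : TypAlg c A, (∀ w₁ w₂ : FreeMonoid (ℤ × c.Sign),
      Φ (MonoidAlgebra.of A _ w₁ * x * MonoidAlgebra.of A _ w₂) = 0) →
      ∀ y z : TypAlg c A, Φ (y * x * z) = 0 := by
    intro x hx y z
    have hy : y ∈ Submodule.span A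
        (Set.range (MonoidAlgebra.of A (FreeMonoid (ℤ × c.Sign)))) := by
      rw [span_of_words]; trivial
    have hz : z ∈ Submodule.span A
        (Set.range (MonoidAlgebra.of A (FreeMonoid (ℤ × c.Sign)))) := by
      rw [span_of_words]; trivial
    induction hy using Submodule.span_induction with
    | zero => simp
    | add y y' _ _ h h' => rw [add_mul, add_mul, map_add, h, h', add_zero]
    | smul a y _ h => rw [smul_mul_assoc, smul_mul_assoc, map_smul, h, smul_zero]
    | mem y hy =>
      obtain ⟨w₁, rfl⟩ := hy
      induction hz using Submodule.span_induction with
      | zero => simp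
      | add y y' _ _ h h' => rw [mul_add, map_add, h, h', add_zero]
      | smul a y _ h => rw [mul_smul_comm, map_smul, h, smul_zero]
      | mem z hz =>
        obtain ⟨w₂, rfl⟩ := hz
        exact hx w₁ w₂
  induction hx using TwoSidedIdeal.span_induction with
  | mem x hx => exact ext_left x (h x hx)
  | zero => simp
  | add x y _ _ h h' => intro y' z; rw [mul_add, add_mul, map_add, h, h', add_zero]
  | neg x _ h => intro y z; rw [mul_neg, neg_mul, map_neg, h, neg_zero]
  | left_absorb a x _ h => intro y z; rw [← mul_assoc]; exact h _ _
  | right_absorb b x _ h => intro y z; rw [← mul_assoc, mul_assoc _ b z]; exact h _ _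

end Words

section Letters

variable {B Z : Type*} [Field B]

/-- The function attached to the letter `x` at the site `k`. -/
def letter (c : FormType) (h : B) (ι : Z → B) (k : ℕ) (x : ℤ × c.Sign) (z : Z) (p : Label) : B :=
  ((h ^ k)⁻¹ * ι z) ^ x.1 * (((signChar p.2 x.2 : ℤˣ) : ℤ) : B) *
    (match c with
      | .symmetric => if p.1 = (-1) ^ x.1 then 1 else 0
      | _ => 1)

/-- The function attached to a word starting at the site `k`. -/
def wordFun (c : FormType) (h : B) (ι : Z → B) : ℕ → List (ℤ × c.Sign) →
    (ℕ → Z) → (ℕ → Label) → B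
  | _, [] => 1
  | k, x :: l => fun z s => letter c h ι k x (z k) (s k) * wordFun c h ι (k + 1) l z s

theorem wordFun_append (c : FormType) (h : B) (ι : Z → B) (k : ℕ) (l l' : List (ℤ × c.Sign))
    (z : ℕ → Z) (s : ℕ → Label) :
    wordFun c h ι k (l ++ l') z s = wordFun c h ι k l z s * wordFun c h ι (k + l.length) l' z s := by
  induction l generalizing k with
  | nil => simp [wordFun]
  | cons x l ih =>
    simp only [List.cons_append, wordFun, List.length_cons, ih]
    rw [mul_assoc, show k + (l.length + 1) = k + 1 + l.length by ring]

theorem wordFun_congr (c : FormType) (h : B) (ι : Z → B) (k : ℕ) (l : List (ℤ × c.Sign))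
    (z z' : ℕ → Z) (s s' : ℕ → Label) (hz : ∀ j, k ≤ j → j < k + l.length → z j = z' j)
    (hs : ∀ j, k ≤ j → j < k + l.length → s j = s' j) :
    wordFun c h ι k l z s = wordFun c h ι k l z' s' := by
  induction l generalizing k with
  | nil => rfl
  | cons x l ih =>
    simp only [List.length_cons] at hz hs
    simp only [wordFun]
    rw [ih (k + 1) (fun j h1 h2 => hz j (by omega) (by omega))
      (fun j h1 h2 => hs j (by omega) (by omega)), hz k le_rfl (by omega), hs k le_rfl (by omega)]

theorem wordFun_ofFn (c : FormType) (h : B) (ι : Z → B) (k r : ℕ) (w : Fin r → ℤ × c.Sign)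
    (z : ℕ → Z) (s : ℕ → Label) :
    wordFun c h ι k (List.ofFn w) z s =
      ∏ j : Fin r, letter c h ι (k + j) (w j) (z (k + j)) (s (k + j)) := by
  induction r generalizing k with
  | zero => simp [wordFun]
  | succ r ih =>
    rw [List.ofFn_succ, Fin.prod_univ_succ]
    simp only [wordFun]
    rw [ih]
    simp only [Fin.val_zero, add_zero, Fin.val_succ]
    congr 1
    refine Finset.prod_congr rfl fun j _ => ?_
    rw [show k + 1 + (j : ℕ) = k + (j + 1) by ring]

end Letters

/-! ### Relations over an arbitrary base -/

/-- The generators of `Rel` over a ring `A`, with parameter `t` and sign `η`. -/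
def rels (c : FormType) (A : Type*) [CommRing A] (t η : A) : Set (TypAlg c A) :=
  match c with
  | .unramHermitian => relTrivialSign .unramHermitian A t
  | .symmetric => relSymmetric .symmetric A t η
  | .alternating => relTrivialSign .alternating A t

section Theta

variable {B Z : Type*} [Field B]

theorem exchange2_sandwich (c : FormType) (h ε : B) (ι : Z → B) (C : B)
    (G : Z → Z → Label → Label → B) (D : B) (a b : Z) (p q : Label) :
    exchange2 c h ε ι (fun a b p q => C * G a b p q * D) a b p q =
      C * exchange2 c h ε ι G a b p q * D := by
  cases c <;> simp only [exchange2] <;> (try split_ifs) <;> ring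

/-- The function of two sites attached to an element of degree two. -/
def pairFun {c : FormType} {A : Type*} [CommRing A] [Algebra A B] (h : B) (ι : Z → B) (i : ℕ) :
    TypAlg c A →ₗ[A] (Z → Z → Label → Label → B) :=
  wordLin fun l a b p q => wordFun c h ι i l (fun k => if k = i then a else b)
    (fun k => if k = i then p else q)

theorem pairFun_word2 {c : FormType} {A : Type*} [CommRing A] [Algebra A B] (h : B) (ι : Z → B)
    (i : ℕ) (m n : ℤ) (χ₁ χ₂ : c.Sign) (a b : Z) (p q : Label) :
    pairFun (A := A) h ι i (word2 A m χ₁ n χ₂) a b p q =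
      letter c h ι i (m, χ₁) a p * letter c h ι (i + 1) (n, χ₂) b q := by
  rw [pairFun, word2, wordLin_of]
  change wordFun c h ι i [(m, χ₁), (n, χ₂)] _ _ = _
  simp [wordFun]

/-- The letters of a word occupy disjoint sites, so a degree two element placed between two words
contributes a factor that depends only on two adjacent sites. -/
theorem theta_sandwich {c : FormType} {A : Type*} [CommRing A] [Algebra A B] (h : B) (ι : Z → B)
    (w₁ w₂ : FreeMonoid (ℤ × c.Sign)) (x : TypAlg c A)
    (hx : x ∈ Submodule.span A {y | ∃ a χ₁ b χ₂, y = word2 A a χ₁ b χ₂}) (k : ℕ)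
    (z : ℕ → Z) (s : ℕ → Label) :
    wordLin (fun l => if l.length = k then wordFun c h ι 0 l else 0)
      (MonoidAlgebra.of A _ w₁ * x * MonoidAlgebra.of A _ w₂) z s =
    if w₁.toList.length + 2 + w₂.toList.length = k then
      wordFun c h ι 0 w₁.toList z s *
      pairFun h ι w₁.toList.length x (z w₁.toList.length) (z (w₁.toList.length + 1))
        (s w₁.toList.length) (s (w₁.toList.length + 1)) *
      wordFun c h ι (w₁.toList.length + 2) w₂.toList z s
    else 0 := by
  induction hx using Submodule.span_induction with
  | zero => simp
  | add x y _ _ hx hy =>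
    simp only [mul_add, add_mul, map_add, Pi.add_apply, hx, hy]
    split_ifs <;> ring
  | smul a x _ hx =>
    simp only [mul_smul_comm, smul_mul_assoc, map_smul, Pi.smul_apply, hx]
    split_ifs <;> simp
  | mem x hx =>
    obtain ⟨a, χ₁, b, χ₂, rfl⟩ := hx
    rw [pairFun_word2, word2, ← map_mul, ← map_mul, wordLin_of]
    have hl : (w₁ * (FreeMonoid.of (a, χ₁) * FreeMonoid.of (b, χ₂)) * w₂).toList =
      w₁.toList ++ ([(a, χ₁), (b, χ₂)] ++ w₂.toList) := by
      simp [FreeMonoid.toList_mul]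
    have hlen : (w₁ * (FreeMonoid.of (a, χ₁) * FreeMonoid.of (b, χ₂)) * w₂).toList.length =
        w₁.toList.length + 2 + w₂.toList.length := by
      rw [hl]; simp; ring
    rw [hlen]
    split_ifs with hk
    · rw [hl, wordFun_append, wordFun_append]
      simp [wordFun]
      ring
    · rfl

/-- The outer factors do not involve the two exchanged sites, so they behave as scalars and
invariance reduces to degree two. -/
theorem exchange_theta_sandwich {c : FormType} {A : Type*} [CommRing A] [Algebra A B] (h ε : B)
    (ι : Z → B) (w₁ w₂ : FreeMonoid (ℤ × c.Sign)) (x : TypAlg c A)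
    (hx : x ∈ Submodule.span A {y | ∃ a χ₁ b χ₂, y = word2 A a χ₁ b χ₂}) (k : ℕ)
    (hfix : ∀ a b p q, exchange2 c h ε ι (pairFun h ι w₁.toList.length x) a b p q =
      pairFun h ι w₁.toList.length x a b p q) :
    exchange c h ε ι w₁.toList.length
      (wordLin (fun l => if l.length = k then wordFun c h ι 0 l else 0)
        (MonoidAlgebra.of A _ w₁ * x * MonoidAlgebra.of A _ w₂)) =
    wordLin (fun l => if l.length = k then wordFun c h ι 0 l else 0)
      (MonoidAlgebra.of A _ w₁ * x * MonoidAlgebra.of A _ w₂) := by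
  funext z s
  rw [exchange_apply]
  simp only [theta_sandwich h ι w₁ w₂ x hx k]
  split_ifs with hk
  · have e1 : ∀ a b p q, wordFun c h ι 0 w₁.toList (upd2 z w₁.toList.length a b)
        (upd2 s w₁.toList.length p q) = wordFun c h ι 0 w₁.toList z s := by
      intro a b p q
      apply wordFun_congr <;> intro j _ hj <;> rw [upd2_of_ne] <;> omega
    have e2 : ∀ a b p q, wordFun c h ι (w₁.toList.length + 2) w₂.toList
        (upd2 z w₁.toList.length a b) (upd2 s w₁.toList.length p q) =
        wordFun c h ι (w₁.toList.length + 2) w₂.toList z s := by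
      intro a b p q
      apply wordFun_congr <;> intro j hj _ <;> rw [upd2_of_ne] <;> omega
    simp only [e1, e2, upd2_left, upd2_right]
    rw [exchange2_sandwich, hfix]
  · cases c <;> simp [exchange2]

/-- The product with words of a degree two element that is fixed by exchange is killed by the
antisymmetrizer. -/
theorem antisymmetrizer_theta_eq_zero [CharZero B] {c : FormType} {A : Type*} [CommRing A]
    [Algebra A B] (h ε : B) (hε : ε = 1 ∨ ε = -1) (ι : Z → B)
    (hne : ∀ a b, (ι a) ^ 2 - h ^ 2 * (ι b) ^ 2 ≠ 0)
    (w₁ w₂ : FreeMonoid (ℤ × c.Sign)) (x : TypAlg c A)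
    (hx : x ∈ Submodule.span A {y | ∃ a χ₁ b χ₂, y = word2 A a χ₁ b χ₂}) (k : ℕ)
    (hfix : ∀ a b p q, exchange2 c h ε ι (pairFun h ι w₁.toList.length x) a b p q =
      pairFun h ι w₁.toList.length x a b p q) :
    antisymmetrizer (exchange c h ε ι) (k - 1)
      (wordLin (fun l => if l.length = k then wordFun c h ι 0 l else 0)
        (MonoidAlgebra.of A _ w₁ * x * MonoidAlgebra.of A _ w₂)) = 0 := by
  by_cases hk : w₁.toList.length + 2 + w₂.toList.length = k
  · have h1 := antisymmetrizer_mul_eq_zero (exchange c h ε ι) (exchange_mul_self c h ε hε ι hne)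
      (exchange_commute c h ε ι) (exchange_braid c h ε hε ι hne) (k - 1) w₁.toList.length
      (by omega)
    have h2 := exchange_theta_sandwich h ε ι w₁ w₂ x hx k hfix
    have h3 := congrArg (fun T => T (wordLin (fun l => if l.length = k then wordFun c h ι 0 l else 0)
        (MonoidAlgebra.of A _ w₁ * x * MonoidAlgebra.of A _ w₂))) h1
    -- Since the function is fixed by the exchange, A(1 + s) = 0 says that twice its
    -- antisymmetrization vanishes.
    simp only [Module.End.mul_apply, LinearMap.add_apply, Module.End.one_apply, h2,
      LinearMap.zero_apply, ← two_smul B, map_smul] at h3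
    exact (smul_eq_zero.1 h3).resolve_left two_ne_zero
  · have : wordLin (fun l => if l.length = k then wordFun c h ι 0 l else 0)
        (MonoidAlgebra.of A _ w₁ * x * MonoidAlgebra.of A _ w₂) = 0 := by
      funext z s
      rw [theta_sandwich h ι w₁ w₂ x hx k, if_neg hk]
      rfl
    rw [this, map_zero]

end Theta


/-! ### The generators of `Rel` are fixed by exchange -/

theorem unit_eq_or_neg_eq (x y : ℤˣ) : x = y ∨ -x = y := by revert x y; decide

section Fixed

variable {B Z : Type*} [Field B]

/-- The numerator of u + v is (x + hy)(y − hx), and x + hy cancels against the denominator (x +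
hy)(x − hy). -/
theorem wu_add_wv (h x y : B) (h1 : x ^ 2 - h ^ 2 * y ^ 2 ≠ 0) :
    (x - h * y) * (wu h x y + wv h x y) = y - h * x := by
  rw [wu, wv]
  field_simp
  ring

/-- In the scalar cases this criterion covers the functions (ι b − h ι a) times a symmetric
function. -/
theorem exchange2_eq_self_of_ne_symmetric {c : FormType} (hc : c ≠ .symmetric) (h ε : B) (ι : Z → B)
    (hne : ∀ a b, (ι a) ^ 2 - h ^ 2 * (ι b) ^ 2 ≠ 0) (G : Z → Z → Label → Label → B)
    (hG : ∀ a b p q, (ι a - h * ι b) * G a b p q = (ι b - h * ι a) * G b a p q)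
    (a b : Z) (p q : Label) : exchange2 c h ε ι G a b p q = G a b p q := by
  have h1 : ι a - h * ι b ≠ 0 := fun h0 => hne a b (by linear_combination (ι a + h * ι b) * h0)
  have h2 := wu_add_wv h (ι a) (ι b) (hne a b)
  have : exchange2 c h ε ι G a b p q = (wu h (ι a) (ι b) + wv h (ι a) (ι b)) * G b a p q := by
    cases c <;> first | rfl | exact absurd rfl hc
  rw [this]
  apply mul_left_cancel₀ h1
  rw [hG, ← mul_assoc, h2]

/-- The model vector for generators of odd difference: on labels of opposite parity the exchange is
a 2 × 2 matrix combined with the swap of variables, and (ι b, −h ι a) is fixed by it. -/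
theorem exchange2_odd (h ε : B) (ι : Z → B) (hne : ∀ a b, (ι a) ^ 2 - h ^ 2 * (ι b) ^ 2 ≠ 0)
    (S : Z → Z → B) (hS : ∀ a b, S a b = S b a) (π s₁ s₂ : ℤˣ) (a b : Z) (p q : Label) :
    exchange2 .symmetric h ε ι (fun a b p q =>
      S a b * ((if p = (π, s₁) ∧ q = (-π, s₂) then ι b else 0) -
        (if p = (-π, s₂) ∧ q = (π, s₁) then h * ι a else 0))) a b p q =
      S a b * ((if p = (π, s₁) ∧ q = (-π, s₂) then ι b else 0) -
        (if p = (-π, s₂) ∧ q = (π, s₁) then h * ι a else 0)) := by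
  have h1 := hne a b
  obtain ⟨p1, p2⟩ := p
  obtain ⟨q1, q2⟩ := q
  rw [hS a b]
  rcases unit_eq_or_neg_eq π p1 with rfl | rfl <;> rcases unit_eq_or_neg_eq π q1 with rfl | rfl <;>
    rcases unit_eq_or_neg_eq s₁ s₂ with rfl | rfl <;>
    rcases unit_eq_or_neg_eq s₁ p2 with rfl | rfl <;>
    rcases unit_eq_or_neg_eq s₁ q2 with rfl | rfl <;>
    simp [exchange2, unit_ne_neg, neg_unit_ne] <;>
    (simp only [wu, wv]; field_simp; ring)

/-- On labels with the same parity and different characters the exchange only swaps the variables,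
so symmetry suffices. -/
theorem exchange2_even_ne (h ε : B) (ι : Z → B)
    (S : Z → Z → B) (hS : ∀ a b, S a b = S b a) (π s : ℤˣ) (a b : Z) (p q : Label) :
    exchange2 .symmetric h ε ι (fun a b p q =>
      S a b * (if p = (π, s) ∧ q = (π, -s) then 1 else 0)) a b p q =
      S a b * (if p = (π, s) ∧ q = (π, -s) then 1 else 0) := by
  obtain ⟨p1, p2⟩ := p
  obtain ⟨q1, q2⟩ := q
  rw [hS a b]
  rcases unit_eq_or_neg_eq π p1 with rfl | rfl <;> rcases unit_eq_or_neg_eq π q1 with rfl | rfl <;>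
    rcases unit_eq_or_neg_eq s p2 with rfl | rfl <;>
    rcases unit_eq_or_neg_eq s q2 with rfl | rfl <;>
    simp [exchange2, unit_ne_neg, neg_unit_ne]

/-- On equal labels the exchange mixes four label pairs. The four coefficients here are those of a
sum of two `relHalf` terms after a symmetric factor is removed. -/
theorem exchange2_even_eq (h ε : B) (hh : h ≠ 0) (hε : ε = 1 ∨ ε = -1) (ι : Z → B)
    (hι : ∀ a, ι a ≠ 0)
    (hne : ∀ a b, (ι a) ^ 2 - h ^ 2 * (ι b) ^ 2 ≠ 0)
    (S : Z → Z → B) (hS : ∀ a b, S a b = S b a) (π s : ℤˣ) (a b : Z) (p q : Label) :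
    exchange2 .symmetric h ε ι (fun a b p q =>
      S a b * (-(if p = (π, s) ∧ q = (π, s) then 1 else 0) +
        (if p = (-π, s) ∧ q = (-π, s) then ι b / (h * ι a) else 0) -
        (if p = (π, -s) ∧ q = (π, -s) then ε else 0) +
        (if p = (-π, -s) ∧ q = (-π, -s) then ε * (h * ι a / ι b) else 0))) a b p q =
      S a b * (-(if p = (π, s) ∧ q = (π, s) then 1 else 0) +
        (if p = (-π, s) ∧ q = (-π, s) then ι b / (h * ι a) else 0) -
        (if p = (π, -s) ∧ q = (π, -s) then ε else 0) +
        (if p = (-π, -s) ∧ q = (-π, -s) then ε * (h * ι a / ι b) else 0)) := by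
  have h1 := hne a b
  have h2 := hι a
  have h3 := hι b
  have h4 : ε * ε = 1 := by rcases hε with rfl | rfl <;> ring
  obtain ⟨p1, p2⟩ := p
  obtain ⟨q1, q2⟩ := q
  rw [hS a b]
  rcases unit_eq_or_neg_eq π p1 with rfl | rfl <;> rcases unit_eq_or_neg_eq π q1 with rfl | rfl <;>
    rcases unit_eq_or_neg_eq s p2 with rfl | rfl <;>
    rcases unit_eq_or_neg_eq s q2 with rfl | rfl <;>
    simp [exchange2, unit_ne_neg, neg_unit_ne] <;>
    (simp only [wu, wv]; rcases hε with rfl | rfl <;> field_simp <;> ring)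

theorem pairFun_word2_of_ne_symmetric {c : FormType} (hc : c ≠ .symmetric) {A : Type*} [CommRing A]
    [Algebra A B] (h : B) (ι : Z → B) (i : ℕ) (m n : ℤ) (a b : Z) (p q : Label) :
    pairFun (A := A) (c := c) h ι i (word2 A m 1 n 1) a b p q =
      ((h ^ i)⁻¹ * ι a) ^ m * ((h ^ (i + 1))⁻¹ * ι b) ^ n := by
  rw [pairFun_word2]
  cases c with
  | symmetric => exact absurd rfl hc
  | unramHermitian => simp [letter, signChar]
  | alternating => simp [letter, signChar]

theorem sum_signChar (s t : ℤˣ) :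
    ∑ χ : FormType.symmetric.Sign,
      (((signChar s χ : ℤˣ) : ℤ) : B) * (((signChar t χ : ℤˣ) : ℤ) : B) =
      if s = t then 2 else 0 := by
  have : ∀ f : FormType.symmetric.Sign → B, ∑ χ, f χ = f 1 + f ⟨-1, trivial⟩ := by
    intro f
    have : (Finset.univ : Finset FormType.symmetric.Sign) = {1, ⟨-1, trivial⟩} := by
      ext ⟨x, hx⟩
      rcases Int.units_eq_one_or x with rfl | rfl
      · simp [Subtype.ext_iff]
      · simp [Subtype.ext_iff]
    rw [this, Finset.sum_pair]
    rw [Ne, Subtype.ext_iff]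
    decide
  rw [this]
  rcases Int.units_eq_one_or s with rfl | rfl <;> rcases Int.units_eq_one_or t with rfl | rfl <;>
    simp [signChar] <;> norm_num

/-- Orthogonality of characters concentrates `sigma2` on a single pair of labels; each of the two
sites contributes a factor 2. -/
theorem pairFun_sigma2 {A : Type*} [CommRing A] [Algebra A B] (h : B) (ι : Z → B) (i : ℕ)
    (m n : ℤ) (s₁ s₂ : ℤˣ) (a b : Z) (p q : Label) :
    pairFun h ι i (sigma2 .symmetric A m s₁ n s₂) a b p q =
      4 * (((h ^ i)⁻¹ * ι a) ^ m * ((h ^ (i + 1))⁻¹ * ι b) ^ n) *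
        (if p = ((-1) ^ m, s₁) ∧ q = ((-1) ^ n, s₂) then 1 else 0) := by
  have e1 : pairFun h ι i (sigma2 .symmetric A m s₁ n s₂) a b p q =
      (∑ χ : FormType.symmetric.Sign, (((signChar s₁ χ : ℤˣ) : ℤ) : B) *
        letter .symmetric h ι i (m, χ) a p) *
      (∑ χ : FormType.symmetric.Sign, (((signChar s₂ χ : ℤˣ) : ℤ) : B) *
        letter .symmetric h ι (i + 1) (n, χ) b q) := by
    rw [Finset.sum_mul_sum, sigma2]
    simp only [map_sum, Finset.sum_apply, map_smul, Pi.smul_apply, pairFun_word2]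
    refine Finset.sum_congr rfl fun χ₁ _ => Finset.sum_congr rfl fun χ₂ _ => ?_
    rw [Algebra.smul_def, map_intCast]
    push_cast
    ring
  have e2 : ∀ (i : ℕ) (m : ℤ) (s : ℤˣ) (a : Z) (p : Label),
      (∑ χ : FormType.symmetric.Sign, (((signChar s χ : ℤˣ) : ℤ) : B) *
        letter .symmetric h ι i (m, χ) a p) =
      2 * ((h ^ i)⁻¹ * ι a) ^ m * if p = ((-1) ^ m, s) then 1 else 0 := by
    intro i m s a p
    have : ∀ χ : FormType.symmetric.Sign, (((signChar s χ : ℤˣ) : ℤ) : B) *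
        letter .symmetric h ι i (m, χ) a p =
        (((signChar s χ : ℤˣ) : ℤ) : B) * (((signChar p.2 χ : ℤˣ) : ℤ) : B) *
        (((h ^ i)⁻¹ * ι a) ^ m * (if p.1 = (-1) ^ m then 1 else 0)) := by
      intro χ
      simp only [letter]
      ring
    simp only [this]
    rw [← Finset.sum_mul, sum_signChar]
    obtain ⟨p1, p2⟩ := p
    simp only [Prod.mk.injEq, eq_comm (a := s)]
    by_cases h1 : p2 = s <;> by_cases h2 : p1 = (-1) ^ m <;> simp [h1, h2] <;> ring
  rw [e1, e2, e2]
  by_cases h1 : p = ((-1) ^ m, s₁) <;> by_cases h2 : q = ((-1) ^ n, s₂) <;> simp [h1, h2] <;> ring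

theorem pairFun_smul_apply {c : FormType} {A : Type*} [CommRing A] [Algebra A B] (h : B) (ι : Z → B)
    (i : ℕ) (t : A) (x : TypAlg c A) (a b : Z) (p q : Label) :
    pairFun h ι i (t • x) a b p q = algebraMap A B t * pairFun h ι i x a b p q := by
  rw [map_smul, ← Algebra.smul_def]
  rfl

theorem sigma2_mem_span {c : FormType} (A : Type*) [CommRing A] (a b : ℤ) (s₁ s₂ : ℤˣ) :
    sigma2 c A a s₁ b s₂ ∈ Submodule.span A {y | ∃ a χ₁ b χ₂, y = word2 A a χ₁ b χ₂} :=
  Submodule.sum_mem _ fun _ _ => Submodule.sum_mem _ fun _ _ =>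
    Submodule.smul_mem _ _ (Submodule.subset_span ⟨_, _, _, _, rfl⟩)

theorem rels_subset_span (c : FormType) (A : Type*) [CommRing A] (t η : A) :
    ∀ x ∈ rels c A t η,
      x ∈ Submodule.span A {y | ∃ a χ₁ b χ₂, y = word2 (c := c) A a χ₁ b χ₂} := by
  intro x hx
  have hw : ∀ a χ₁ b χ₂, word2 (c := c) A a χ₁ b χ₂ ∈
      Submodule.span A {y | ∃ a χ₁ b χ₂, y = word2 (c := c) A a χ₁ b χ₂} :=
    fun a χ₁ b χ₂ => Submodule.subset_span ⟨_, _, _, _, rfl⟩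
  have ht : ∀ t : A, ∀ x ∈ relTrivialSign c A t,
      x ∈ Submodule.span A {y | ∃ a χ₁ b χ₂, y = word2 (c := c) A a χ₁ b χ₂} := by
    rintro t x (⟨a, rfl⟩ | ⟨a, b, -, rfl⟩)
    · exact sub_mem (hw _ _ _ _) (hw _ _ _ _)
    · exact sub_mem (sub_mem (hw _ _ _ _) (hw _ _ _ _))
        (Submodule.smul_mem _ _ (sub_mem (hw _ _ _ _) (hw _ _ _ _)))
  cases c with
  | unramHermitian => exact ht t x hx
  | alternating => exact ht t x hx
  | symmetric =>
    have hs := fun a b s₁ s₂ => sigma2_mem_span (c := .symmetric) A a b s₁ s₂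
    have hH : ∀ a b s, relHalf .symmetric A η a b s ∈
        Submodule.span A {y | ∃ a χ₁ b χ₂, y = word2 A a χ₁ b χ₂} := fun a b s =>
      sub_mem (add_mem (neg_mem (hs _ _ _ _)) (hs _ _ _ _))
        (Submodule.smul_mem _ _ (sub_mem (hs _ _ _ _) (hs _ _ _ _)))
    rcases hx with (⟨a, b, n, s₁, s₂, -, rfl⟩ | ⟨a, b, n, s, -, rfl⟩) | ⟨a, b, n, s, -, rfl⟩
    · exact sub_mem (sub_mem (hs _ _ _ _) (hs _ _ _ _))
        (Submodule.smul_mem _ _ (sub_mem (hs _ _ _ _) (hs _ _ _ _)))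
    · exact add_mem (hs _ _ _ _) (Submodule.smul_mem _ _ (hs _ _ _ _))
    · exact add_mem (hH _ _ _) (Submodule.smul_mem _ _ (hH _ _ _))

/-- Evaluating neighbouring sites at variables that differ by the scale h⁻¹ turns (a, b) − (a+1,
b−1) into a monomial times ι b − h ι a. The choice t = h⁻¹ makes the two monomials of a generator
add up to a symmetric cofactor. -/
theorem exchange2_rels_of_ne_symmetric {c : FormType} (hc : c ≠ .symmetric) {A : Type*} [CommRing A]
    [Algebra A B] (h ε : B) (hh : h ≠ 0) (t : A) (ht : algebraMap A B t = h⁻¹) (ι : Z → B)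
    (hι : ∀ a, ι a ≠ 0) (hne : ∀ a b, (ι a) ^ 2 - h ^ 2 * (ι b) ^ 2 ≠ 0)
    (x : TypAlg c A) (hx : x ∈ relTrivialSign c A t) (i : ℕ) (a b : Z) (p q : Label) :
    exchange2 c h ε ι (pairFun h ι i x) a b p q = pairFun h ι i x a b p q := by
  apply exchange2_eq_self_of_ne_symmetric hc h ε ι hne
  intro a b p q
  have hH : (h ^ i)⁻¹ ≠ 0 := inv_ne_zero (pow_ne_zero _ hh)
  have ha := hι a
  have hb := hι b
  rcases hx with ⟨m, rfl⟩ | ⟨m, n, hmn, rfl⟩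
  · simp only [map_sub, Pi.sub_apply, pairFun_word2_of_ne_symmetric hc, pow_succ, mul_inv, mul_zpow,
      zpow_add₀ hH, zpow_add₀ ha, zpow_add₀ hb, zpow_add₀ (inv_ne_zero hh), zpow_one]
    field_simp
  · obtain ⟨N, rfl⟩ : ∃ N : ℕ, n = m + 1 + N := ⟨(n - m - 1).toNat, by omega⟩
    have e1 : (m + 1 + N - m - 1 : ℤ).toNat = N := by omega
    have e2 : (m + 1 + N - 1 : ℤ) = m + N := by ring
    rw [e1, e2]
    simp only [map_sub, pairFun_smul_apply, Pi.sub_apply, pairFun_word2_of_ne_symmetric hc,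
      map_pow, ht, pow_succ, mul_inv, mul_zpow, inv_zpow, inv_pow, zpow_add₀ hh,
      zpow_add₀ hH, zpow_add₀ ha, zpow_add₀ hb, zpow_one, zpow_natCast]
    generalize (h ^ i)⁻¹ = H at *
    field_simp
    ring

theorem ite_zero_eq_mul (P : Prop) [Decidable P] (x : B) :
    (if P then x else 0) = x * if P then 1 else 0 := by split_ifs <;> simp

/-- Each of the three families becomes a symmetric function times one of the model vectors above.
Here t = h⁻², since the exponent of t is half a difference of exponents; the parities of the
exponents supply the labels. -/
theorem exchange2_relSymmetric {A : Type*} [CommRing A]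
    [Algebra A B] (h ε : B) (hh : h ≠ 0) (hε : ε = 1 ∨ ε = -1) (t η : A)
    (ht : algebraMap A B t = (h ^ 2)⁻¹) (hη : algebraMap A B η = ε) (ι : Z → B)
    (hι : ∀ a, ι a ≠ 0) (hne : ∀ a b, (ι a) ^ 2 - h ^ 2 * (ι b) ^ 2 ≠ 0)
    (x : TypAlg .symmetric A) (hx : x ∈ relSymmetric .symmetric A t η) (i : ℕ) (a b : Z)
    (p q : Label) :
    exchange2 .symmetric h ε ι (pairFun h ι i x) a b p q = pairFun h ι i x a b p q := by
  have hH : h ^ i ≠ 0 := pow_ne_zero _ hh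
  have e4 : ∀ n, (h ^ 2)⁻¹ ^ n = (h ^ (2 * n))⁻¹ := fun n => by rw [inv_pow, pow_mul]
  have e5 : h ^ (i + 1) = h ^ i * h := pow_succ _ _
  have par : ∀ (m : ℤ) (n : ℕ), (-1 : ℤˣ) ^ (m + 2 * n) = (-1) ^ m := by
    intro m n
    rw [zpow_add, zpow_mul]
    simp
  have par1 : ∀ m : ℤ, (-1 : ℤˣ) ^ (m + 1) = -(-1) ^ m := fun m => by rw [zpow_add_one]; simp
  have par2 : ∀ m : ℤ, (-1 : ℤˣ) ^ (m - 1) = -(-1) ^ m := fun m => by rw [zpow_sub_one]; simp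
  rcases hx with (⟨m, k, n, s₁, s₂, hk, rfl⟩ | ⟨m, k, n, s, hk, rfl⟩) | ⟨m, k, n, s, hk, rfl⟩
  · have key : pairFun h ι i (sigma2 .symmetric A m s₁ k s₂ -
        sigma2 .symmetric A (m + 1) s₂ (k - 1) s₁ - t ^ n • (sigma2 .symmetric A k s₂ m s₁ -
          sigma2 .symmetric A (k - 1) s₁ (m + 1) s₂)) = fun a b p q =>
        (4 * ((h ^ i)⁻¹ * (h ^ (i + 1))⁻¹ * (ι a * ι b)) ^ m * (h ^ (i + 1))⁻¹ ^ (2 * n + 1) *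
          ((ι a) ^ (2 * n) + (ι b) ^ (2 * n))) *
        ((if p = ((-1) ^ m, s₁) ∧ q = (-(-1) ^ m, s₂) then ι b else 0) -
        (if p = (-(-1) ^ m, s₂) ∧ q = ((-1) ^ m, s₁) then h * ι a else 0)) := by
      funext a b p q
      have ha := hι a
      have hb := hι b
      obtain rfl : k = m + 2 * n + 1 := by omega
      have e2 : (m + 2 * n + 1 - 1 : ℤ) = m + 2 * n := by ring
      have e3 : (2 * n : ℤ) = ((2 * n : ℕ) : ℤ) := by push_cast; ring
      rw [e2]
      simp only [map_sub, pairFun_smul_apply, Pi.sub_apply, pairFun_sigma2, par1, par]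
      rw [ite_zero_eq_mul _ (ι b), ite_zero_eq_mul _ (h * ι a)]
      simp only [e3, map_pow, ht, e4, e5, mul_pow, mul_inv, mul_zpow, inv_zpow, inv_pow,
        zpow_add₀ hh, zpow_add₀ hH, zpow_add₀ ha, zpow_add₀ hb, zpow_one, zpow_natCast]
      generalize h ^ i = H at *
      field_simp
      ring
    rw [key]
    exact exchange2_odd h ε ι hne _ (fun a b => by ring) _ _ _ a b p q
  · have key : pairFun h ι i (sigma2 .symmetric A m s k (-s) +
        t ^ n • sigma2 .symmetric A k s m (-s)) = fun a b p q =>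
        (4 * ((h ^ i)⁻¹ * (h ^ (i + 1))⁻¹ * (ι a * ι b)) ^ m * (h ^ (i + 1))⁻¹ ^ (2 * n) *
          ((ι a) ^ (2 * n) + (ι b) ^ (2 * n))) *
        (if p = ((-1) ^ m, s) ∧ q = ((-1) ^ m, -s) then 1 else 0) := by
      funext a b p q
      have ha := hι a
      have hb := hι b
      obtain rfl : k = m + 2 * n := by omega
      have e3 : (2 * n : ℤ) = ((2 * n : ℕ) : ℤ) := by push_cast; ring
      simp only [map_add, pairFun_smul_apply, Pi.add_apply, pairFun_sigma2, par]
      simp only [e3, map_pow, ht, e4, e5, mul_pow, mul_inv, mul_zpow, inv_zpow, inv_pow,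
        zpow_add₀ hh, zpow_add₀ hH, zpow_add₀ ha, zpow_add₀ hb, zpow_one, zpow_natCast]
      generalize h ^ i = H at *
      field_simp
      ring
    rw [key]
    exact exchange2_even_ne h ε ι _ (fun a b => by ring) _ _ a b p q
  -- After this shift the two `relHalf` terms sit at the exponents m and m + 2n.
  · obtain ⟨m, rfl⟩ : ∃ m', m = m' - 1 := ⟨m + 1, by ring⟩
    have key : pairFun h ι i (relHalf .symmetric A η (m - 1 + 1) (k - 1) s +
        t ^ n • relHalf .symmetric A η (k - 1) (m - 1 + 1) s) = fun a b p q =>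
        (4 * ((h ^ i)⁻¹ * (h ^ (i + 1))⁻¹ * (ι a * ι b)) ^ m * (h ^ (i + 1))⁻¹ ^ (2 * n) *
          ((ι a) ^ (2 * n) + (ι b) ^ (2 * n))) *
        (-(if p = ((-1) ^ m, s) ∧ q = ((-1) ^ m, s) then 1 else 0) +
        (if p = (-(-1) ^ m, s) ∧ q = (-(-1) ^ m, s) then ι b / (h * ι a) else 0) -
        (if p = ((-1) ^ m, -s) ∧ q = ((-1) ^ m, -s) then ε else 0) +
        (if p = (-(-1) ^ m, -s) ∧ q = (-(-1) ^ m, -s) then ε * (h * ι a / ι b) else 0)) := by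
      funext a b p q
      have ha := hι a
      have hb := hι b
      obtain rfl : k = m + 2 * n + 1 := by omega
      have e1 : (m - 1 + 1 : ℤ) = m := by ring
      have e2 : (m + 2 * n + 1 - 1 : ℤ) = m + 2 * n := by ring
      have e3 : (2 * n : ℤ) = ((2 * n : ℕ) : ℤ) := by push_cast; ring
      rw [e1, e2]
      simp only [relHalf, map_sub, map_add, map_neg, pairFun_smul_apply, Pi.sub_apply, Pi.add_apply,
        Pi.neg_apply, pairFun_sigma2, par1, par2, par]
      rw [ite_zero_eq_mul _ (ι b / _), ite_zero_eq_mul _ ε, ite_zero_eq_mul _ (ε * _)]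
      simp only [e3, hη, map_pow, ht, e4, e5, mul_pow, mul_inv, mul_zpow, inv_zpow, inv_pow,
        zpow_add₀ hh, zpow_add₀ hH, zpow_add₀ ha, zpow_add₀ hb, zpow_one, zpow_natCast,
        zpow_sub₀ hh, zpow_sub₀ hH, zpow_sub₀ ha, zpow_sub₀ hb]
      generalize h ^ i = H at *
      field_simp
      ring
    rw [key]
    exact exchange2_even_eq h ε hh hε ι hι hne _ (fun a b => by ring) _ _ a b p q

/-- The value of the parameter `t` of `rels` is `Q⁻¹` or `Q⁻²`. -/
def relExp (c : FormType) : ℕ :=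
  match c with
  | .symmetric => 2
  | _ => 1

theorem exchange2_rels (c : FormType) {A : Type*} [CommRing A]
    [Algebra A B] (h ε : B) (hh : h ≠ 0) (hε : ε = 1 ∨ ε = -1) (t η : A)
    (ht : algebraMap A B t = (h ^ relExp c)⁻¹) (hη : algebraMap A B η = ε) (ι : Z → B)
    (hι : ∀ a, ι a ≠ 0) (hne : ∀ a b, (ι a) ^ 2 - h ^ 2 * (ι b) ^ 2 ≠ 0)
    (x : TypAlg c A) (hx : x ∈ rels c A t η) (i : ℕ) (a b : Z) (p q : Label) :
    exchange2 c h ε ι (pairFun h ι i x) a b p q = pairFun h ι i x a b p q := by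
  cases c with
  | symmetric => exact exchange2_relSymmetric h ε hh hε t η ht hη ι hι hne x hx i a b p q
  | unramHermitian =>
    exact exchange2_rels_of_ne_symmetric (by simp) h ε hh t (by simpa [relExp] using ht) ι hι hne x
      hx i a b p q
  | alternating =>
    exact exchange2_rels_of_ne_symmetric (by simp) h ε hh t (by simpa [relExp] using ht) ι hι hne x
      hx i a b p q

/-- The antisymmetrizer kills the function attached to an element of `Rel`. -/
theorem antisymmetrizer_eq_zero_of_mem_rels [CharZero B] (c : FormType) {A : Type*} [CommRing A]
    [Algebra A B] (h ε : B) (hh : h ≠ 0) (hε : ε = 1 ∨ ε = -1) (t η : A)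
    (ht : algebraMap A B t = (h ^ relExp c)⁻¹) (hη : algebraMap A B η = ε) (ι : Z → B)
    (hι : ∀ a, ι a ≠ 0) (hne : ∀ a b, (ι a) ^ 2 - h ^ 2 * (ι b) ^ 2 ≠ 0) (k : ℕ)
    {x : TypAlg c A} (hx : x ∈ TwoSidedIdeal.span (rels c A t η)) :
    antisymmetrizer (exchange c h ε ι) (k - 1)
      (wordLin (A := A) (fun l => if l.length = k then wordFun c h ι 0 l else 0) x) = 0 := by
  refine map_eq_zero_of_mem_span (rels c A t η)
    (((antisymmetrizer (exchange c h ε ι) (k - 1)).restrictScalars A) ∘ₗ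
      (wordLin (A := A) (fun l => if l.length = k then wordFun c h ι 0 l else 0))) ?_ hx
  intro x hx w₁ w₂
  exact antisymmetrizer_theta_eq_zero h ε hε ι hne w₁ w₂ x (rels_subset_span c A t η x hx) k
    (exchange2_rels c h ε hh hε t η ht hη ι hι hne x hx _)

end Fixed


/-! ### Degeneration at h = 0, and independence of canonical words modulo Rel. -/

/-! ### Antisymmetrizers -/

section Abstract

variable {k V : Type*} [CommRing k] [AddCommGroup V] [Module k V]

theorem map_cosetSum {V' : Type*} [AddCommGroup V'] [Module k V'] (s : ℕ → Module.End k V)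
    (s' : ℕ → Module.End k V') (φ : V →ₗ[k] V') (hφ : ∀ i v, φ (s i v) = s' i (φ v)) (n : ℕ)
    (v : V) : φ (cosetSum s n v) = cosetSum s' n (φ v) := by
  induction n generalizing v with
  | zero => rfl
  | succ n ih => simp [cosetSum, hφ, ih]

theorem map_antisymmetrizer {V' : Type*} [AddCommGroup V'] [Module k V'] (s : ℕ → Module.End k V)
    (s' : ℕ → Module.End k V') (φ : V →ₗ[k] V') (hφ : ∀ i v, φ (s i v) = s' i (φ v)) (n : ℕ)
    (v : V) : φ (antisymmetrizer s n v) = antisymmetrizer s' n (φ v) := by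
  induction n generalizing v with
  | zero => rfl
  | succ n ih => simp [antisymmetrizer, ih, map_cosetSum s s' φ hφ]

/-- A version of functoriality for a relation in place of a map, because reduction at h = 0 is
defined only on integral Laurent series. -/
theorem rel_antisymmetrizer {k' V' : Type*} [CommRing k'] [AddCommGroup V'] [Module k' V']
    (s : ℕ → Module.End k V) (s' : ℕ → Module.End k' V') (P : V → V' → Prop)
    (hP : ∀ v w v' w', P v v' → P w w' → P (v - w) (v' - w'))
    (hs : ∀ i v v', P v v' → P (s i v) (s' i v')) (n : ℕ) (v : V) (v' : V') (hv : P v v') :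
    P (antisymmetrizer s n v) (antisymmetrizer s' n v') := by
  have hcoset : ∀ n v v', P v v' → P (cosetSum s n v) (cosetSum s' n v') := by
    intro n
    induction n with
    | zero => intro v v' h; exact h
    | succ n ih =>
      intro v v' h
      exact hP _ _ _ _ h (hs _ _ _ (ih _ _ h))
  induction n generalizing v v' with
  | zero => exact hv
  | succ n ih => exact ih _ _ (hcoset _ _ _ hv)

/-- The weight of the first `n` terms of a sequence. -/
def seqWeight (n : ℕ) (f : ℕ → ℤ) : ℤ := ∑ j ∈ Finset.range n, (j : ℤ) * f j

theorem seqWeight_swap (n i : ℕ) (hi : i + 1 < n) (f : ℕ → ℤ) :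
    seqWeight n (f ∘ Equiv.swap i (i + 1)) = seqWeight n f + (f i - f (i + 1)) := by
  have h1 : ∀ j : ℕ, (j : ℤ) * (f ∘ Equiv.swap i (i + 1)) j = j * f j +
      ((if j = i then (i : ℤ) * (f (i + 1) - f i) else 0) +
       (if j = i + 1 then ((i : ℤ) + 1) * (f i - f (i + 1)) else 0)) := by
    intro j
    by_cases h : j = i
    · subst h; simp; ring
    · by_cases h' : j = i + 1
      · subst h'; simp; ring
      · rw [Function.comp_apply, Equiv.swap_apply_of_ne_of_ne h h']; simp [h, h']
  simp only [seqWeight, h1]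
  rw [Finset.sum_add_distrib, Finset.sum_add_distrib, Finset.sum_ite_eq', Finset.sum_ite_eq',
    if_pos (Finset.mem_range.2 (by omega)), if_pos (Finset.mem_range.2 hi)]
  ring

/-- Each nontrivial term of the coset sum moves one entry to position n, past smaller ones, so the
weight grows. The remaining conditions on g are what the next step needs: the entries before
position n still decrease strictly, and those after it are untouched. -/
theorem cosetSum_sub_mem (s : ℕ → Module.End k V) (N : (ℕ → ℤ) → V) (m : ℕ)
    (hs : ∀ i, i + 1 < m → ∀ f, s i (N f) = N (f ∘ Equiv.swap i (i + 1))) (n : ℕ) (hn : n < m)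
    (f : ℕ → ℤ) (hf : ∀ i j, i < j → j ≤ n → f j < f i) :
    cosetSum s n (N f) - N f ∈ Submodule.span k (N '' {g | (∀ i j, i < j → j < n → g j < g i) ∧
      (∀ i, i ≤ n → f n ≤ g i) ∧ (∀ i, n < i → g i = f i) ∧ seqWeight m f < seqWeight m g}) := by
  induction n with
  | zero => simp [cosetSum]
  | succ n ih =>
    have e : cosetSum s (n + 1) (N f) - N f = -(s n (N f)) - s n (cosetSum s n (N f) - N f) := by
      rw [map_sub]
      simp only [cosetSum, LinearMap.sub_apply, Module.End.one_apply, Module.End.mul_apply]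
      abel
    rw [e]
    have hlt := hf n (n + 1) (by omega) le_rfl
    -- The next entry f (n + 1) is smaller than everything before it, so this transposition again
    -- acts on a descending pair.
    have step : ∀ g : ℕ → ℤ, (∀ i j, i < j → j < n → g j < g i) → (∀ i, i ≤ n → f n ≤ g i) →
        (∀ i, n < i → g i = f i) → seqWeight m f ≤ seqWeight m g →
        s n (N g) ∈ Submodule.span k (N '' {g | (∀ i j, i < j → j < n + 1 → g j < g i) ∧
          (∀ i, i ≤ n + 1 → f (n + 1) ≤ g i) ∧ (∀ i, n + 1 < i → g i = f i) ∧
          seqWeight m f < seqWeight m g}) := by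
      intro g h1 h2 h3 h4
      rw [hs n hn]
      refine Submodule.subset_span ⟨_, ⟨?_, ?_, ?_, ?_⟩, rfl⟩
      · intro i j hij hj
        have hi : (g ∘ Equiv.swap n (n + 1)) i = g i := by
          rw [Function.comp_apply, Equiv.swap_apply_of_ne_of_ne] <;> omega
        rw [hi]
        rcases Nat.lt_succ_iff_lt_or_eq.1 hj with hj | rfl
        · rw [Function.comp_apply, Equiv.swap_apply_of_ne_of_ne (by omega) (by omega)]
          exact h1 i j hij hj
        · rw [Function.comp_apply, Equiv.swap_apply_left, h3 _ (by omega)]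
          exact hlt.trans_le (h2 i hij.le)
      · intro i hi
        by_cases hi1 : i = n
        · subst hi1
          rw [Function.comp_apply, Equiv.swap_apply_left, h3 _ (by omega)]
        · by_cases hi2 : i = n + 1
          · subst hi2
            rw [Function.comp_apply, Equiv.swap_apply_right]
            exact hlt.le.trans (h2 n le_rfl)
          · rw [Function.comp_apply, Equiv.swap_apply_of_ne_of_ne hi1 hi2]
            exact hlt.le.trans (h2 i (by omega))
      · intro i hi
        rw [Function.comp_apply, Equiv.swap_apply_of_ne_of_ne (by omega) (by omega)]
        exact h3 i (by omega)
      · rw [seqWeight_swap m n hn]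
        have := h2 n le_rfl
        have := h3 (n + 1) (by omega)
        omega
    refine sub_mem (neg_mem (step f (fun i j hij hj => hf i j hij (by omega)) ?_ (fun _ _ => rfl)
      le_rfl)) ?_
    · intro i hi
      rcases hi.lt_or_eq with h | rfl
      · exact (hf i n h (by omega)).le
      · exact le_rfl
    · have := ih (by omega) (fun i j hij hj => hf i j hij (by omega))
      generalize cosetSum s n (N f) - N f = x at this
      induction this using Submodule.span_induction with
      | zero => simp
      | add x y _ _ hx hy => rw [map_add]; exact add_mem hx hy
      | smul a x _ hx => rw [map_smul]; exact Submodule.smul_mem _ _ hx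
      | mem x hx =>
        obtain ⟨g, ⟨h1, h2, h3, h4⟩, rfl⟩ := hx
        exact step g h1 h2 h3 h4.le

/-- Unitriangularity: a strictly decreasing sequence has the smallest `seqWeight` among its
rearrangements, and every nontrivial one has a larger weight. -/
theorem antisymmetrizer_sub_mem (s : ℕ → Module.End k V) (N : (ℕ → ℤ) → V) (m : ℕ)
    (hs : ∀ i, i + 1 < m → ∀ f, s i (N f) = N (f ∘ Equiv.swap i (i + 1))) (n : ℕ) (hn : n < m)
    (f : ℕ → ℤ) (hf : ∀ i j, i < j → j ≤ n → f j < f i) :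
    antisymmetrizer s n (N f) - N f ∈
      Submodule.span k (N '' {g | seqWeight m f < seqWeight m g}) := by
  induction n generalizing f with
  | zero => simp [antisymmetrizer]
  | succ n ih =>
    have e : antisymmetrizer s (n + 1) (N f) - N f = (antisymmetrizer s n (N f) - N f) +
        antisymmetrizer s n (cosetSum s (n + 1) (N f) - N f) := by
      rw [map_sub]
      simp [antisymmetrizer]
    rw [e]
    refine add_mem (ih (by omega) f fun i j hij hj => hf i j hij (by omega)) ?_
    have := cosetSum_sub_mem s N m hs (n + 1) hn f hf
    generalize cosetSum s (n + 1) (N f) - N f = x at this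
    induction this using Submodule.span_induction with
    | zero => simp
    | add x y _ _ hx hy => rw [map_add]; exact add_mem hx hy
    | smul a x _ hx => rw [map_smul]; exact Submodule.smul_mem _ _ hx
    | mem x hx =>
      obtain ⟨g, ⟨h1, -, -, h4⟩, rfl⟩ := hx
      have h5 := ih (by omega) g fun i j hij hj => h1 i j hij (by omega)
      rw [← sub_add_cancel (antisymmetrizer s n (N g)) (N g)]
      refine add_mem (Submodule.span_mono (Set.image_mono ?_) h5) (Submodule.subset_span ⟨g, h4, rfl⟩)
      intro g' hg'
      exact h4.trans hg'

end Abstract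

/-! ### The degenerate exchange operators -/

section Degenerate

/-- The shift of exponents under the degenerate exchange operator. -/
def labelShift (c : FormType) (p q : Label) : ℤ :=
  match c with
  | .symmetric => if p.1 = q.1 then (if p.2 = q.2 then 2 else 0) else 1
  | _ => 1

theorem labelShift_nonneg (c : FormType) (p q : Label) : 0 ≤ labelShift c p q := by
  cases c <;> simp only [labelShift] <;> (try split_ifs) <;> norm_num

/-- At h = 0 one has v = 0 and u = b/a. Labels are then preserved, and `labelShift` counts the
factors u that remain. -/
theorem exchange2_zero (c : FormType) (ε : ℚ) (G : ℚˣ → ℚˣ → Label → Label → ℚ) (a b : ℚˣ)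
    (p q : Label) : exchange2 c 0 ε (fun x : ℚˣ => (x : ℚ)) G a b p q =
      ((b : ℚ) / a) ^ labelShift c p q * G b a p q := by
  have h1 : wu (0 : ℚ) a b = b / a := by
    rw [wu]
    have := a.ne_zero
    field_simp
    ring
  have h2 : wv (0 : ℚ) a b = 0 := by simp [wv]
  cases c <;> simp only [exchange2, labelShift, h1, h2]
  · simp
  · split_ifs
    · norm_cast; simp
    · simp
    · simp
  · simp

/-- The correction of exponents that turns the degenerate exchange into a permutation. -/
def rhoShift (c : FormType) (s₀ : ℕ → Label) (j : ℕ) : ℤ :=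
  ∑ i ∈ Finset.range j, labelShift c (s₀ i) (s₀ (i + 1))

open Classical in
/-- A monomial, as a function that is supported on the label `s₀`. -/
def monoFun (c : FormType) (r : ℕ) (s₀ : ℕ → Label) (f : ℕ → ℤ) (z : ℕ → ℚˣ) (s : ℕ → Label) : ℚ :=
  if s = s₀ then ∏ j ∈ Finset.range r, (z j : ℚ) ^ (f j + rhoShift c s₀ j) else 0

/-- `rhoShift` grows by exactly `labelShift` from site i to i + 1, which absorbs the factor
(b/a)^`labelShift`, as ρ does in the dot action of a Weyl group. -/
theorem exchange_monoFun (c : FormType) (ε : ℚ) (r : ℕ) (s₀ : ℕ → Label) (i : ℕ) (hi : i + 1 < r)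
    (f : ℕ → ℤ) :
    exchange c 0 ε (fun x : ℚˣ => (x : ℚ)) i (monoFun c r s₀ f) =
      monoFun c r s₀ (f ∘ Equiv.swap i (i + 1)) := by
  funext z s
  rw [exchange_apply, exchange2_zero]
  have hs := upd2_self s i
  simp only [monoFun]
  by_cases h : s = s₀
  · subst h
    rw [if_pos hs, if_pos rfl]
    have hi1 : i ∈ Finset.range r := Finset.mem_range.2 (by omega)
    have hi2 : i + 1 ∈ (Finset.range r).erase i :=
      Finset.mem_erase.2 ⟨by omega, Finset.mem_range.2 hi⟩
    rw [← Finset.mul_prod_erase _ _ hi1, ← Finset.mul_prod_erase _ _ hi2,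
      ← Finset.mul_prod_erase _ _ hi1, ← Finset.mul_prod_erase _ _ hi2]
    have hrest : ∏ x ∈ ((Finset.range r).erase i).erase (i + 1),
        ((upd2 z i (z (i + 1)) (z i) x : ℚˣ) : ℚ) ^ (f x + rhoShift c s x) =
        ∏ x ∈ ((Finset.range r).erase i).erase (i + 1),
        (z x : ℚ) ^ ((f ∘ Equiv.swap i (i + 1)) x + rhoShift c s x) := by
      refine Finset.prod_congr rfl fun x hx => ?_
      simp only [Finset.mem_erase] at hx
      rw [upd2_of_ne _ hx.2.1 hx.1, Function.comp_apply,
        Equiv.swap_apply_of_ne_of_ne hx.2.1 hx.1]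
    rw [hrest, upd2_left, upd2_right]
    have hρ : rhoShift c s (i + 1) = rhoShift c s i + labelShift c (s i) (s (i + 1)) :=
      Finset.sum_range_succ _ _
    simp only [Function.comp_apply, Equiv.swap_apply_left, Equiv.swap_apply_right, hρ]
    have ha := (z i).ne_zero
    have hb := (z (i + 1)).ne_zero
    rw [div_zpow]
    simp only [zpow_add₀ ha, zpow_add₀ hb]
    field_simp
  · rw [if_neg (by rwa [hs]), if_neg h, mul_zero]

/-- Restricted to the label s₀ and to the first r variables, monomials with different exponents are
different characters of (ℚˣ)^r, so Dedekind's independence of characters applies. -/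
theorem monoFun_notMem_span (c : FormType) (r : ℕ) (s₀ : ℕ → Label) (f : ℕ → ℤ) :
    monoFun c r s₀ f ∉ Submodule.span ℚ (monoFun c r s₀ '' {g | ∃ j < r, g j ≠ f j}) := by
  let φ : ((ℕ → ℚˣ) → (ℕ → Label) → ℚ) →ₗ[ℚ] ((Fin r → ℚˣ) → ℚ) :=
    { toFun := fun F z => F (fun j => if h : j < r then z ⟨j, h⟩ else 1) s₀
      map_add' := fun _ _ => rfl
      map_smul' := fun _ _ => rfl }
  let M : (Fin r → ℤ) → ((Fin r → ℚˣ) →* ℚ) := fun e =>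
    { toFun := fun z => ∏ j : Fin r, ((z j : ℚˣ) : ℚ) ^ e j
      map_one' := by simp
      map_mul' := fun z z' => by simp [mul_zpow, Finset.prod_mul_distrib] }
  have hφ : ∀ g, φ (monoFun c r s₀ g) = M (fun j => g j + rhoShift c s₀ j) := by
    intro g
    funext z
    change monoFun c r s₀ g _ s₀ = ∏ j : Fin r, ((z j : ℚˣ) : ℚ) ^ (g j + rhoShift c s₀ j)
    rw [monoFun, if_pos rfl, Finset.prod_range]
    simp
  have hM : Function.Injective M := by
    intro e e' h
    funext j
    have := DFunLike.congr_fun h (Pi.mulSingle j (Units.mk0 2 two_ne_zero))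
    change ∏ i : Fin r, _ = ∏ i : Fin r, _ at this
    rw [Finset.prod_eq_single j, Finset.prod_eq_single j] at this
    · simp only [Pi.mulSingle_eq_same, Units.val_mk0] at this
      exact zpow_right_injective₀ (by norm_num) (by norm_num) this
    · intro b _ hb; simp [Pi.mulSingle_eq_of_ne hb]
    · simp
    · intro b _ hb; simp [Pi.mulSingle_eq_of_ne hb]
    · simp
  have hli : LinearIndependent ℚ (fun e : Fin r → ℤ => (M e : (Fin r → ℚˣ) → ℚ)) :=
    (linearIndependent_monoidHom (Fin r → ℚˣ) ℚ).comp M hM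
  intro hmem
  have h1 := Submodule.mem_map_of_mem (f := φ) hmem
  rw [Submodule.map_span, hφ] at h1
  refine hli.notMem_span_image (s := {e | e ≠ fun j : Fin r => f j + rhoShift c s₀ j})
    (x := fun j : Fin r => f j + rhoShift c s₀ j) (by simp) (Submodule.span_mono ?_ h1)
  rintro _ ⟨_, ⟨g, ⟨j, hj, hg⟩, rfl⟩, rfl⟩
  rw [hφ]
  refine ⟨_, ?_, rfl⟩
  intro h
  have := congrFun h ⟨j, hj⟩
  simp only [add_left_inj] at this
  exact hg this

/-- A combination of monomials with weakly decreasing exponents that is killed by the degenerate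
antisymmetrizer has no strictly decreasing terms. -/
theorem coeff_eq_zero_of_antisymmetrizer (c : FormType) (ε : ℚ) (hε : ε = 1 ∨ ε = -1) (r : ℕ)
    (s₀ : ℕ → Label) {I : Type*} (T : Finset I) (x : I → ℚ) (f : I → ℕ → ℤ)
    (hinj : ∀ i ∈ T, ∀ j ∈ T, (∀ n < r, f i n = f j n) → i = j)
    (hanti : ∀ i ∈ T, ∀ n, n + 1 < r → f i (n + 1) ≤ f i n)
    (h0 : antisymmetrizer (exchange c 0 ε (fun x : ℚˣ => (x : ℚ))) (r - 1)
      (∑ i ∈ T, x i • monoFun c r s₀ (f i)) = 0)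
    (i : I) (hi : i ∈ T) (hstrict : ∀ n, n + 1 < r → f i (n + 1) < f i n) : x i = 0 := by
  classical
  by_contra hxi
  have hne : ∀ a b : ℚˣ, (a : ℚ) ^ 2 - 0 ^ 2 * (b : ℚ) ^ 2 ≠ 0 := by
    intro a b
    simp
  set E := exchange c 0 ε (fun x : ℚˣ => (x : ℚ)) with hE
  set T' := T.filter fun i => x i ≠ 0 ∧ ∀ n, n + 1 < r → f i (n + 1) < f i n with hT'
  have hiT' : i ∈ T' := Finset.mem_filter.2 ⟨hi, hxi, hstrict⟩
  -- At minimal weight nothing can cancel the monomial: every correction term has a strictly larger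
  -- weight.
  obtain ⟨i₀, hi₀, hmin⟩ := T'.exists_min_image (fun i => seqWeight r (f i)) ⟨i, hiT'⟩
  have hi₀' := (Finset.mem_filter.1 hi₀)
  -- A weakly but not strictly decreasing sequence has two equal neighbours; its monomial is fixed
  -- by that exchange and dies.
  have hzero : ∀ j ∈ T, j ∉ T' → antisymmetrizer E (r - 1) (x j • monoFun c r s₀ (f j)) = 0 := by
    intro j hj hjT'
    by_cases hx : x j = 0
    · rw [hx, zero_smul, map_zero]
    obtain ⟨n, hn, hfn⟩ : ∃ n, n + 1 < r ∧ f j (n + 1) = f j n := by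
      by_contra! hcon
      exact hjT' (Finset.mem_filter.2 ⟨hj, hx, fun n hn => (hanti j hj n hn).lt_of_ne (hcon n hn)⟩)
    have h1 := antisymmetrizer_mul_eq_zero E (exchange_mul_self c 0 ε hε _ hne)
      (exchange_commute c 0 ε _) (exchange_braid c 0 ε hε _ hne) (r - 1) n (by omega)
    have h2 : E n (monoFun c r s₀ (f j)) = monoFun c r s₀ (f j) := by
      rw [hE, exchange_monoFun c ε r s₀ n hn]
      congr 1
      funext m
      rw [Function.comp_apply]
      by_cases h : m = n
      · subst h; rw [Equiv.swap_apply_left, hfn]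
      · by_cases h' : m = n + 1
        · subst h'; rw [Equiv.swap_apply_right, hfn]
        · rw [Equiv.swap_apply_of_ne_of_ne h h']
    have h3 := congrArg (fun T => T (monoFun c r s₀ (f j))) h1
    simp only [Module.End.mul_apply, LinearMap.add_apply, Module.End.one_apply, h2,
      LinearMap.zero_apply, ← two_smul ℚ, map_smul] at h3
    rw [map_smul, (smul_eq_zero.1 h3).resolve_left two_ne_zero, smul_zero]
  rw [map_sum, ← Finset.sum_subset (s₁ := T') (Finset.filter_subset _ T) hzero] at h0
  -- For r = 0 the index r − 1 truncates to 0, which is not below r, so the triangularity lemma does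
  -- not apply; there is then only one monomial.
  by_cases hr : r = 0
  · subst hr
    have hT1 : T' = {i₀} := by
      refine Finset.eq_singleton_iff_unique_mem.2 ⟨hi₀, fun j hj => ?_⟩
      exact hinj j (Finset.mem_filter.1 hj).1 i₀ hi₀'.1 (by simp)
    rw [hT1, Finset.sum_singleton] at h0
    have := congrFun (congrFun h0 1) s₀
    simp [antisymmetrizer, monoFun] at this
    exact hi₀'.2.1 this
  have hspan : ∀ j ∈ T', antisymmetrizer E (r - 1) (monoFun c r s₀ (f j)) - monoFun c r s₀ (f j) ∈
      Submodule.span ℚ (monoFun c r s₀ '' {g | ∃ n < r, g n ≠ f i₀ n}) := by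
    intro j hj
    have hst := (Finset.mem_filter.1 hj).2.2
    have hst' : ∀ a b, a < b → b ≤ r - 1 → f j b < f j a := by
      intro a b hab
      induction b, hab using Nat.le_induction with
      | base => intro hb; exact hst a (by omega)
      | succ b hab ih => intro hb; exact (hst b (by omega)).trans (ih (by omega))
    refine Submodule.span_mono (Set.image_mono ?_) (antisymmetrizer_sub_mem E (monoFun c r s₀) r
      (fun i hi f => exchange_monoFun c ε r s₀ i hi f) (r - 1) (by omega) (f j) hst')
    intro g hg
    by_contra hcon
    have hgf : ∀ n < r, g n = f i₀ n := by
      intro n hn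
      by_contra h
      exact hcon ⟨n, hn, h⟩
    have : seqWeight r g = seqWeight r (f i₀) :=
      Finset.sum_congr rfl fun n hn => by rw [hgf n (Finset.mem_range.1 hn)]
    have h1 : seqWeight r (f i₀) ≤ seqWeight r (f j) := hmin j hj
    have h2 : seqWeight r (f j) < seqWeight r g := hg
    omega
  refine monoFun_notMem_span c r s₀ (f i₀) ?_
  have hsum : x i₀ • monoFun c r s₀ (f i₀) = -(∑ j ∈ T', x j •
      (antisymmetrizer E (r - 1) (monoFun c r s₀ (f j)) - monoFun c r s₀ (f j))) -
      ∑ j ∈ T'.erase i₀, x j • monoFun c r s₀ (f j) := by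
    simp only [smul_sub, Finset.sum_sub_distrib]
    simp only [map_smul] at h0
    rw [h0, ← Finset.add_sum_erase _ _ hi₀]
    abel
  have hmem : x i₀ • monoFun c r s₀ (f i₀) ∈
      Submodule.span ℚ (monoFun c r s₀ '' {g | ∃ n < r, g n ≠ f i₀ n}) := by
    rw [hsum]
    refine sub_mem (neg_mem (Submodule.sum_mem _ fun j hj => Submodule.smul_mem _ _ (hspan j hj)))
      (Submodule.sum_mem _ fun j hj => Submodule.smul_mem _ _ (Submodule.subset_span ⟨_, ?_, rfl⟩))
    by_contra hcon
    have hj' := Finset.mem_erase.1 hj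
    refine hj'.1 (hinj j (Finset.mem_filter.1 hj'.2).1 i₀ hi₀'.1 ?_)
    intro n hn
    by_contra h
    exact hcon ⟨n, hn, h⟩
  exact (Submodule.smul_mem_iff _ hi₀'.2.1).1 hmem

end Degenerate


/-! ### Reduction of Laurent series -/

section Reduction

/-- The Laurent series `x` is a power series with constant coefficient `r`. -/
def Reduces (x : LaurentSeries ℚ) (r : ℚ) : Prop :=
  ∃ F : PowerSeries ℚ, HahnSeries.ofPowerSeries ℤ ℚ F = x ∧ PowerSeries.constantCoeff F = r

theorem Reduces.add {x y : LaurentSeries ℚ} {r s : ℚ} (hx : Reduces x r) (hy : Reduces y s) :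
    Reduces (x + y) (r + s) := by
  obtain ⟨F, rfl, rfl⟩ := hx
  obtain ⟨G, rfl, rfl⟩ := hy
  exact ⟨F + G, map_add _ _ _, map_add _ _ _⟩

theorem Reduces.sub {x y : LaurentSeries ℚ} {r s : ℚ} (hx : Reduces x r) (hy : Reduces y s) :
    Reduces (x - y) (r - s) := by
  obtain ⟨F, rfl, rfl⟩ := hx
  obtain ⟨G, rfl, rfl⟩ := hy
  exact ⟨F - G, map_sub _ _ _, map_sub _ _ _⟩

theorem Reduces.mul {x y : LaurentSeries ℚ} {r s : ℚ} (hx : Reduces x r) (hy : Reduces y s) :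
    Reduces (x * y) (r * s) := by
  obtain ⟨F, rfl, rfl⟩ := hx
  obtain ⟨G, rfl, rfl⟩ := hy
  exact ⟨F * G, map_mul _ _ _, map_mul _ _ _⟩

theorem reduces_const (r : ℚ) : Reduces (HahnSeries.C r) r :=
  ⟨PowerSeries.C r, HahnSeries.ofPowerSeries_C _, by simp⟩

theorem reduces_one : Reduces 1 1 := ⟨1, map_one _, map_one _⟩

theorem reduces_zero : Reduces 0 0 := ⟨0, map_zero _, map_zero _⟩

theorem Reduces.pow {x : LaurentSeries ℚ} {r : ℚ} (hx : Reduces x r) (n : ℕ) :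
    Reduces (x ^ n) (r ^ n) := by
  obtain ⟨F, rfl, rfl⟩ := hx
  exact ⟨F ^ n, map_pow _ _ _, map_pow _ _ _⟩

theorem Reduces.sum {I : Type*} (T : Finset I) {x : I → LaurentSeries ℚ} {r : I → ℚ}
    (h : ∀ i ∈ T, Reduces (x i) (r i)) : Reduces (∑ i ∈ T, x i) (∑ i ∈ T, r i) := by
  classical
  induction T using Finset.induction_on with
  | empty => simpa using reduces_zero
  | insert i T hi ih =>
    rw [Finset.sum_insert hi, Finset.sum_insert hi]
    exact (h i (Finset.mem_insert_self _ _)).add (ih fun j hj => h j (Finset.mem_insert_of_mem hj))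

theorem Reduces.unique {x : LaurentSeries ℚ} {r s : ℚ} (hx : Reduces x r) (hy : Reduces x s) :
    r = s := by
  obtain ⟨F, rfl, rfl⟩ := hx
  obtain ⟨G, h, rfl⟩ := hy
  rw [HahnSeries.ofPowerSeries_injective h]

theorem Reduces.ne_zero {x : LaurentSeries ℚ} {r : ℚ} (hx : Reduces x r) (hr : r ≠ 0) : x ≠ 0 := by
  rintro rfl
  exact hr (hx.unique reduces_zero)

theorem Reduces.inv {x : LaurentSeries ℚ} {r : ℚ} (hx : Reduces x r) (hr : r ≠ 0) :
    Reduces x⁻¹ r⁻¹ := by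
  have h0 := hx.ne_zero hr
  obtain ⟨F, rfl, rfl⟩ := hx
  refine ⟨F⁻¹, ?_, by simp⟩
  refine eq_inv_of_mul_eq_one_left ?_
  rw [← map_mul, PowerSeries.inv_mul_cancel _ hr, map_one]

theorem Reduces.div {x y : LaurentSeries ℚ} {r s : ℚ} (hx : Reduces x r) (hy : Reduces y s)
    (hs : s ≠ 0) : Reduces (x / y) (r / s) := by
  rw [div_eq_mul_inv, div_eq_mul_inv]
  exact hx.mul (hy.inv hs)

/-- The parameter of Laurent series. -/
def lX : LaurentSeries ℚ := HahnSeries.single 1 1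

theorem reduces_lX : Reduces lX 0 := ⟨PowerSeries.X, HahnSeries.ofPowerSeries_X, by simp⟩

theorem lX_ne_zero : lX ≠ 0 := HahnSeries.single_ne_zero one_ne_zero

/-- Nonzero rational numbers as Laurent series. -/
def lconst (a : ℚˣ) : LaurentSeries ℚ := HahnSeries.C (a : ℚ)

theorem lconst_ne_zero (a : ℚˣ) : lconst a ≠ 0 := (reduces_const _).ne_zero a.ne_zero

theorem reduces_denominator (a b : ℚˣ) :
    Reduces (lconst a ^ 2 - lX ^ 2 * lconst b ^ 2) ((a : ℚ) ^ 2 - 0 ^ 2 * (b : ℚ) ^ 2) :=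
  ((reduces_const _).pow 2).sub ((reduces_lX.pow 2).mul ((reduces_const _).pow 2))

theorem lconst_sub_ne_zero (a b : ℚˣ) : lconst a ^ 2 - lX ^ 2 * lconst b ^ 2 ≠ 0 :=
  (reduces_denominator a b).ne_zero (by simp)

theorem reduces_wu (a b : ℚˣ) : Reduces (wu lX (lconst a) (lconst b)) (wu (0 : ℚ) a b) :=
  (((reduces_one.sub (reduces_lX.pow 2)).mul (reduces_const _)).mul (reduces_const _)).div
    (reduces_denominator a b) (by simp)

theorem reduces_wv (a b : ℚˣ) : Reduces (wv lX (lconst a) (lconst b)) (wv (0 : ℚ) a b) :=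
  (reduces_lX.mul (((reduces_const _).pow 2).sub ((reduces_const _).pow 2))).div
    (reduces_denominator a b) (by simp)

theorem reduces_exchange2 (c : FormType) (e : ℤˣ)
    (g : ℚˣ → ℚˣ → Label → Label → LaurentSeries ℚ) (g₀ : ℚˣ → ℚˣ → Label → Label → ℚ)
    (hg : ∀ a b p q, Reduces (g a b p q) (g₀ a b p q)) (a b : ℚˣ) (p q : Label) :
    Reduces (exchange2 c lX ((e : ℤ) : LaurentSeries ℚ) lconst g a b p q)
      (exchange2 c (0 : ℚ) ((e : ℤ) : ℚ) (fun x : ℚˣ => (x : ℚ)) g₀ a b p q) := by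
  have he : Reduces ((e : ℤ) : LaurentSeries ℚ) ((e : ℤ) : ℚ) := by
    have := reduces_const ((e : ℤ) : ℚ)
    rwa [map_intCast] at this
  have hu := reduces_wu a b
  have hv := reduces_wv a b
  cases c <;> simp only [exchange2]
  · exact (hu.add hv).mul (hg _ _ _ _)
  · split_ifs
    · exact (((hu.pow 2).mul (hg _ _ _ _)).add ((hu.mul hv).mul ((hg _ _ _ _).add
        (he.mul (hg _ _ _ _))))).add ((he.mul (hv.pow 2)).mul (hg _ _ _ _))
    · exact hg _ _ _ _
    · exact (hu.mul (hg _ _ _ _)).add (hv.mul (hg _ _ _ _))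
  · exact (hu.add hv).mul (hg _ _ _ _)

theorem reduces_antisymmetrizer (c : FormType) (e : ℤˣ) (n : ℕ)
    (g : (ℕ → ℚˣ) → (ℕ → Label) → LaurentSeries ℚ) (g₀ : (ℕ → ℚˣ) → (ℕ → Label) → ℚ)
    (hg : ∀ z s, Reduces (g z s) (g₀ z s)) (z : ℕ → ℚˣ) (s : ℕ → Label) :
    Reduces (antisymmetrizer (exchange c lX ((e : ℤ) : LaurentSeries ℚ) lconst) n g z s)
      (antisymmetrizer (exchange c (0 : ℚ) ((e : ℤ) : ℚ) (fun x : ℚˣ => (x : ℚ))) n g₀ z s) := by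
  refine rel_antisymmetrizer (k := LaurentSeries ℚ) (k' := ℚ) _ _ (fun g g₀ => ∀ z s, Reduces (g z s) (g₀ z s)) ?_ ?_ n g g₀ hg z s
  · intro v w v' w' h h' z s
    exact (h z s).sub (h' z s)
  · intro i v v' h z s
    rw [exchange_apply, exchange_apply]
    exact reduces_exchange2 c e _ _ (fun _ _ _ _ => h _ _) _ _ _ _

theorem exists_reduces_of_val_le {x : LaurentSeries ℚ}
    (hx : Valued.v x ≤ (1 : WithZero (Multiplicative ℤ))) : ∃ r, Reduces x r := by
  obtain ⟨F, hF⟩ := (LaurentSeries.val_le_one_iff_eq_coe ℚ x).1 hx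
  exact ⟨_, F, hF, rfl⟩

end Reduction

/-! ### Signs -/

section Signs

variable {c : FormType}

theorem signChar_one (s : ℤˣ) : signChar s (1 : c.Sign) = 1 := by
  rw [signChar]; split_ifs <;> simp

/-- The sum runs over labels, not characters. When `Sign` is trivial both labels give the same
character and the value is still 2. -/
theorem sum_signChar_mul {k : Type*} [CommRing k] (χ χ' : c.Sign) :
    ∑ t : ℤˣ, (((signChar t χ : ℤˣ) : ℤ) : k) * (((signChar t χ' : ℤˣ) : ℤ) : k) =
      if χ = χ' then 2 else 0 := by
  have h1 : (Finset.univ : Finset ℤˣ) = {1, -1} := rfl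
  obtain ⟨x, hx⟩ := χ
  obtain ⟨y, hy⟩ := χ'
  rw [h1, Finset.sum_pair (by decide)]
  rcases Int.units_eq_one_or x with rfl | rfl <;> rcases Int.units_eq_one_or y with rfl | rfl <;>
    simp [signChar] <;> norm_num

theorem sum_prod_signChar {k : Type*} [CommRing k] {r : ℕ} (χ χ' : Fin r → c.Sign) :
    ∑ s : Fin r → ℤˣ, (∏ j, (((signChar (s j) (χ j) : ℤˣ) : ℤ) : k)) *
      (∏ j, (((signChar (s j) (χ' j) : ℤˣ) : ℤ) : k)) = if χ = χ' then 2 ^ r else 0 := by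
  simp only [← Finset.prod_mul_distrib]
  rw [← Fintype.prod_sum (fun j t => (((signChar t (χ j) : ℤˣ) : ℤ) : k) *
    (((signChar t (χ' j) : ℤˣ) : ℤ) : k))]
  simp only [sum_signChar_mul]
  split_ifs with h
  · subst h; simp
  · obtain ⟨j, hj⟩ := Function.ne_iff.1 h
    exact Finset.prod_eq_zero (Finset.mem_univ j) (if_neg hj)

end Signs


/-! ### Independence of canonical words modulo `Rel` -/

instance : CharZero (LaurentSeries ℚ) :=
  charZero_of_injective_algebraMap (algebraMap ℚ (LaurentSeries ℚ)).injective

section Independence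

variable {c : FormType} {r : ℕ}

/-- The exponents of a word. -/
def expo (w : Typ c r) (j : Fin r) : ℤ := (w j).1

/-- A word with weakly decreasing exponents in which only the last letter with a given exponent may
have a nontrivial sign. -/
def IsCanonical (w : Typ c r) : Prop :=
  Antitone (expo w) ∧ ∀ i j, i < j → expo w i = expo w j → (w i).2 = 1

/-- The factor of a letter that tests the parity of the exponent. -/
def parityInd (c : FormType) (B : Type*) [Field B] (m : ℤ) (p : ℤˣ) : B :=
  match c with
  | .symmetric => if p = (-1) ^ m then 1 else 0
  | _ => 1

open Classical in
/-- The coefficient of `δ_s(e)` in `u`, up to normalization. -/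
def fourierCoeff {A B : Type*} [CommRing A] [Field B] [Algebra A B] (u : Typ c r →₀ A)
    (e : Fin r → ℤ) (s : Fin r → ℤˣ) : B :=
  ∑ w ∈ u.support with expo w = e,
    algebraMap A B (u w) * ∏ j, (((signChar (s j) (w j).2 : ℤˣ) : ℤ) : B)

/-- Fourier inversion: pairing all the transforms with the signs of w₀ recovers 2^r times the
coefficient at w₀. -/
theorem exists_fourierCoeff_ne_zero {A B : Type*} [CommRing A] [Field B] [CharZero B] [Algebra A B]
    (hinj : Function.Injective (algebraMap A B)) (u : Typ c r →₀ A) (w₀ : Typ c r)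
    (hw₀ : u w₀ ≠ 0) : ∃ s, fourierCoeff (B := B) u (expo w₀) s ≠ 0 := by
  classical
  by_contra! h
  have h1 : ∑ s : Fin r → ℤˣ, fourierCoeff (B := B) u (expo w₀) s *
      ∏ j, (((signChar (s j) (w₀ j).2 : ℤˣ) : ℤ) : B) = 0 :=
    Finset.sum_eq_zero fun s _ => by rw [h, zero_mul]
  simp only [fourierCoeff, Finset.sum_mul] at h1
  rw [Finset.sum_comm] at h1
  simp only [mul_assoc, ← Finset.mul_sum, sum_prod_signChar] at h1
  rw [Finset.sum_eq_single w₀] at h1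
  · rw [if_pos rfl] at h1
    rcases mul_eq_zero.1 h1 with h2 | h2
    · exact hw₀ (hinj (by rw [h2, map_zero]))
    · exact pow_ne_zero r two_ne_zero h2
  · intro w hw hne
    rw [if_neg, mul_zero]
    intro h2
    apply hne
    funext j
    exact Prod.ext (congrFun (Finset.mem_filter.1 hw).2 j) (congrFun h2 j)
  · intro hw
    rw [Finset.mem_filter] at hw
    exact (hw ⟨Finsupp.mem_support_iff.2 hw₀, rfl⟩).elim

theorem letter_eq {B Z : Type*} [Field B] (h : B) (ι : Z → B) (k : ℕ) (x : ℤ × c.Sign) (z : Z)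
    (p : Label) : letter c h ι k x z p = (h ^ k)⁻¹ ^ x.1 * (((signChar p.2 x.2 : ℤˣ) : ℤ) : B) *
      (ι z ^ x.1 * parityInd c B x.1 p.1) := by
  cases c <;> simp only [letter, parityInd, mul_zpow] <;> ring

theorem prod_letter {B Z : Type*} [Field B] (h : B) (ι : Z → B) (w : Typ c r) (z : ℕ → Z)
    (s : ℕ → Label) : ∏ j : Fin r, letter c h ι j (w j) (z j) (s j) =
      (∏ j : Fin r, (h ^ (j : ℕ))⁻¹ ^ expo w j) *
      (∏ j : Fin r, (((signChar (s j).2 (w j).2 : ℤˣ) : ℤ) : B)) *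
      ((∏ j : Fin r, ι (z j) ^ expo w j) * ∏ j : Fin r, parityInd c B (expo w j) (s j).1) := by
  simp only [← Finset.prod_mul_distrib]
  refine Finset.prod_congr rfl fun j _ => ?_
  rw [letter_eq]
  simp only [expo]

open Classical in
theorem theta_inclTyp {A B Z : Type*} [CommRing A] [Field B] [Algebra A B] (h : B) (ι : Z → B)
    (u : Typ c r →₀ A) (z : ℕ → Z) (s : ℕ → Label) :
    wordLin (A := A) (fun l => if l.length = r then wordFun c h ι 0 l else 0) (inclTyp A r u) z s =
      ∑ e ∈ u.support.image expo, (∏ j : Fin r, (h ^ (j : ℕ))⁻¹ ^ e j) *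
        fourierCoeff u e (fun j => (s j).2) *
        ((∏ j : Fin r, ι (z j) ^ e j) * ∏ j : Fin r, parityInd c B (e j) (s j).1) := by
  rw [inclTyp, Finsupp.linearCombination_apply, Finsupp.sum, map_sum, Finset.sum_apply,
    Finset.sum_apply]
  simp only [map_smul, wordLin_of, Pi.smul_apply]
  rw [← Finset.sum_fiberwise_of_maps_to
    (fun w (hw : w ∈ u.support) => Finset.mem_image_of_mem expo hw)]
  refine Finset.sum_congr rfl fun e _ => ?_
  rw [fourierCoeff, Finset.mul_sum, Finset.sum_mul]
  refine Finset.sum_congr rfl fun w hw => ?_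
  obtain ⟨-, rfl⟩ := Finset.mem_filter.1 hw
  change u w • (if (List.ofFn w).length = r then wordFun c h ι 0 (List.ofFn w) else 0) z s = _
  rw [if_pos (List.length_ofFn), wordFun_ofFn]
  simp only [zero_add]
  rw [prod_letter, Algebra.smul_def]
  ring

/-- Signs can be made constant along equal exponents without changing the Fourier coefficient of a
combination of canonical words. -/
theorem exists_admissible_signs {A B : Type*} [CommRing A] [Field B] [Algebra A B]
    (u : Typ c r →₀ A) (hu : ∀ w ∈ u.support, IsCanonical w) (e : Fin r → ℤ) (s : Fin r → ℤˣ) :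
    ∃ s' : Fin r → ℤˣ, (∀ i j, e i = e j → s' i = s' j) ∧
      fourierCoeff (B := B) u e s' = fourierCoeff u e s := by
  classical
  -- In a canonical word every letter but the last of a run has trivial sign, so only the label at
  -- the last index of the run matters.
  let last : Fin r → Fin r := fun i => (Finset.univ.filter fun j => e j = e i).max' ⟨i, by simp⟩
  have hlast : ∀ i, e (last i) = e i := fun i =>
    (Finset.mem_filter.1 (Finset.max'_mem (Finset.univ.filter fun j => e j = e i) ⟨i, by simp⟩)).2
  have hle : ∀ i, i ≤ last i := fun i => Finset.le_max' _ _ (by simp)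
  refine ⟨fun i => s (last i), fun i j hij => ?_, ?_⟩
  · have : last i = last j := by simp only [last, hij]
    simp only [this]
  · refine Finset.sum_congr rfl fun w hw => ?_
    obtain ⟨hw', rfl⟩ := Finset.mem_filter.1 hw
    congr 1
    refine Finset.prod_congr rfl fun j _ => ?_
    rcases (hle j).lt_or_eq with h | h
    · rw [(hu w hw').2 j (last j) h (hlast j).symm, signChar_one, signChar_one]
    · simp only [← h]

/-- The shift vanishes only in the symmetric case, for equal parities and different characters; this
is why signs must first be made constant along equal exponents. -/
theorem labelShift_pos (c : FormType) (p q : Label) (h : c = .symmetric → p.1 = q.1 → p.2 = q.2) :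
    0 < labelShift c p q := by
  cases c <;> simp only [labelShift]
  · norm_num
  · split_ifs with h1 h2
    · norm_num
    · exact absurd (h rfl h1) h2
    · norm_num
  · norm_num

/-- Canonical words are linearly independent modulo `Rel`. -/
theorem eq_zero_of_mem_rels {A : Type*} [CommRing A] [Algebra A (LaurentSeries ℚ)]
    (hinj : Function.Injective (algebraMap A (LaurentSeries ℚ))) (ε : ℤˣ) (t : A)
    (ht : algebraMap A (LaurentSeries ℚ) t = (lX ^ relExp c)⁻¹) (u : Typ c r →₀ A)
    (hu : ∀ w ∈ u.support, IsCanonical w)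
    (hrel : inclTyp A r u ∈ TwoSidedIdeal.span (rels c A t ((ε : ℤ) : A))) : u = 0 := by
  classical
  by_contra hne
  obtain ⟨w₀, hw₀⟩ := Finsupp.ne_iff.1 hne
  obtain ⟨s₁, hs₁⟩ := exists_fourierCoeff_ne_zero hinj u w₀ hw₀
  set T := u.support.image (expo : Typ c r → Fin r → ℤ) with hT
  set C : (Fin r → ℤ) → (Fin r → ℤˣ) → LaurentSeries ℚ := fun e s =>
    (∏ j : Fin r, (lX ^ (j : ℕ))⁻¹ ^ e j) * fourierCoeff u e s with hC
  have hC1 : C (expo w₀) s₁ ≠ 0 := mul_ne_zero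
    (Finset.prod_ne_zero_iff.2 fun j _ => zpow_ne_zero _ (inv_ne_zero (pow_ne_zero _ lX_ne_zero)))
    hs₁
  have hw₀T : expo w₀ ∈ T := Finset.mem_image_of_mem _ (Finsupp.mem_support_iff.2 hw₀)
  -- Choose the h-adically largest coefficient. After division by it all coefficients are integral,
  -- and this one is 1, so the reduction at h = 0 is not identically zero.
  obtain ⟨⟨e₁, s₂⟩, hes, hmax⟩ := (T ×ˢ (Finset.univ : Finset (Fin r → ℤˣ))).exists_max_image
    (fun x => (Valued.v (C x.1 x.2) : WithZero (Multiplicative ℤ)))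
    ⟨(expo w₀, s₁), Finset.mem_product.2 ⟨hw₀T, Finset.mem_univ _⟩⟩
  have he₁ : e₁ ∈ T := (Finset.mem_product.1 hes).1
  obtain ⟨s', hadm, hs'⟩ := exists_admissible_signs (B := LaurentSeries ℚ) u hu e₁ s₂
  have hCs' : C e₁ s' = C e₁ s₂ := by simp only [hC, hs']
  have hle : ∀ e ∈ T, ∀ s, (Valued.v (C e s) : WithZero (Multiplicative ℤ)) ≤
      Valued.v (C e₁ s') := by
    intro e he s
    rw [hCs']
    exact hmax (e, s) (Finset.mem_product.2 ⟨he, Finset.mem_univ _⟩)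
  have hC0 : C e₁ s' ≠ 0 := by
    intro h0
    have := hle _ hw₀T s₁
    rw [h0, map_zero, le_zero_iff, map_eq_zero] at this
    exact hC1 this
  have hy : ∀ e s, ∃ ρ, e ∈ T → Reduces (C e s / C e₁ s') ρ := by
    intro e s
    by_cases he : e ∈ T
    · obtain ⟨ρ, hρ⟩ := exists_reduces_of_val_le (x := C e s / C e₁ s') (by
        rw [map_div₀]
        exact div_le_one_of_le₀ (hle e he s) zero_le)
      exact ⟨ρ, fun _ => hρ⟩
    · exact ⟨0, fun h => absurd h he⟩
  choose ρ hρ using hy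
  have hρ1 : ρ e₁ s' = 1 := by
    have := hρ e₁ s' he₁
    rw [div_self hC0] at this
    exact this.unique reduces_one
  -- the reduction of the function attached to `u`
  have hkill := antisymmetrizer_eq_zero_of_mem_rels c lX ((ε : ℤ) : LaurentSeries ℚ) lX_ne_zero
    (by rcases Int.units_eq_one_or ε with rfl | rfl <;> simp) t ((ε : ℤ) : A) ht (by simp) lconst
    lconst_ne_zero lconst_sub_ne_zero r hrel
  set Θ := wordLin (A := A) (fun l => if l.length = r then wordFun c lX lconst 0 l else 0)
    (inclTyp A r u) with hΘ
  set F₀ : (ℕ → ℚˣ) → (ℕ → Label) → ℚ := fun z s => ∑ e ∈ T, ρ e (fun j => (s j).2) *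
    ((∏ j : Fin r, (z j : ℚ) ^ e j) * ∏ j : Fin r, parityInd c ℚ (e j) (s j).1) with hF₀
  have hpar : ∀ m p, Reduces (parityInd c (LaurentSeries ℚ) m p) (parityInd c ℚ m p) := by
    intro m p
    cases c <;> simp only [parityInd]
    · exact reduces_one
    · split_ifs
      · exact reduces_one
      · exact reduces_zero
    · exact reduces_one
  have hprod : ∀ (x : Fin r → LaurentSeries ℚ) (y : Fin r → ℚ), (∀ j, Reduces (x j) (y j)) →
      Reduces (∏ j, x j) (∏ j, y j) := by
    intro x y hxy
    have : ∀ S : Finset (Fin r), Reduces (∏ j ∈ S, x j) (∏ j ∈ S, y j) := by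
      intro S
      induction S using Finset.induction_on with
      | empty => simpa using reduces_one
      | insert i S hi ih =>
        rw [Finset.prod_insert hi, Finset.prod_insert hi]
        exact (hxy i).mul ih
    exact this _
  have hzpow : ∀ (a : ℚˣ) (m : ℤ), Reduces (lconst a ^ m) ((a : ℚ) ^ m) := by
    intro a m
    have := reduces_const ((a : ℚ) ^ m)
    rwa [map_zpow₀] at this
  have hred : ∀ z s, Reduces (((C e₁ s')⁻¹ • Θ) z s) (F₀ z s) := by
    intro z s
    rw [Pi.smul_apply, Pi.smul_apply, hΘ, theta_inclTyp, Finset.smul_sum]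
    refine Reduces.sum _ fun e he => ?_
    have h1 := (hρ e (fun j => (s j).2) he).mul
      ((hprod _ _ fun j => hzpow (z j) (e j)).mul (hprod _ _ fun j => hpar (e j) (s j).1))
    refine Eq.mp (congrArg (fun x => Reduces x _) ?_) h1
    rw [smul_eq_mul, hC]
    ring
  have hkill₀ : antisymmetrizer (exchange c (0 : ℚ) ((ε : ℤ) : ℚ) (fun x : ℚˣ => (x : ℚ))) (r - 1)
      F₀ = 0 := by
    funext z s
    have h1 := reduces_antisymmetrizer c ε (r - 1) _ _ hred z s
    rw [map_smul, hkill, smul_zero] at h1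
    exact h1.unique reduces_zero
  -- projection to one label
  let s₀ : ℕ → Label := fun j => if h : j < r then ((-1) ^ e₁ ⟨j, h⟩, s' ⟨j, h⟩) else 1
  have hs₀ : ∀ j : Fin r, s₀ j = ((-1) ^ e₁ j, s' j) := fun j => by simp [s₀]
  let φ : ((ℕ → ℚˣ) → (ℕ → Label) → ℚ) →ₗ[ℚ] ((ℕ → ℚˣ) → (ℕ → Label) → ℚ) :=
    { toFun := fun F z s => if s = s₀ then F z s else 0
      map_add' := fun F G => by funext z s; simp only [Pi.add_apply]; split_ifs <;> simp
      map_smul' := fun a F => by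
        funext z s; simp only [Pi.smul_apply, RingHom.id_apply]; split_ifs <;> simp }
  -- The degenerate exchange preserves labels, so it commutes with restriction to a single label.
  have hφ : ∀ i v, φ (exchange c (0 : ℚ) ((ε : ℤ) : ℚ) (fun x : ℚˣ => (x : ℚ)) i v) =
      exchange c (0 : ℚ) ((ε : ℤ) : ℚ) (fun x : ℚˣ => (x : ℚ)) i (φ v) := by
    intro i v
    funext z s
    change (if s = s₀ then exchange c (0 : ℚ) _ _ i v z s else 0) = _
    simp only [exchange_apply, exchange2_zero]
    change _ = _ * (if upd2 s i (s i) (s (i + 1)) = s₀ then v (upd2 z i (z (i + 1)) (z i))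
      (upd2 s i (s i) (s (i + 1))) else 0)
    rw [upd2_self]
    split_ifs <;> simp
  have h3 := map_antisymmetrizer _ _ φ hφ (r - 1) F₀
  rw [hkill₀, map_zero] at h3
  -- On the label s₀ only the exponents with the same parities as e₁ survive; outside the symmetric
  -- case this is no condition.
  set T' := T.filter fun e => ∀ j, parityInd c ℚ (e j) ((-1) ^ e₁ j) = 1 with hT'
  set f : (Fin r → ℤ) → ℕ → ℤ := fun e n => (if h : n < r then e ⟨n, h⟩ else 0) - rhoShift c s₀ n
    with hf
  have hφF : φ F₀ = ∑ e ∈ T', ρ e s' • monoFun c r s₀ (f e) := by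
    funext z s
    change (if s = s₀ then F₀ z s else 0) = _
    rw [Finset.sum_apply, Finset.sum_apply]
    simp only [Pi.smul_apply, monoFun, smul_eq_mul]
    by_cases hs : s = s₀
    · subst hs
      simp only [if_true]
      have hsub : T' ⊆ T := Finset.filter_subset _ _
      rw [hF₀]
      simp only [hs₀]
      rw [← Finset.sum_subset hsub]
      · refine Finset.sum_congr rfl fun e he => ?_
        rw [Finset.prod_eq_one fun j _ => (Finset.mem_filter.1 he).2 j, mul_one, Finset.prod_range]
        simp [hf]
      · intro e he he'
        have : ∃ j, parityInd c ℚ (e j) ((-1) ^ e₁ j) ≠ 1 := by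
          by_contra! hcon
          exact he' (Finset.mem_filter.2 ⟨he, hcon⟩)
        obtain ⟨j, hj⟩ := this
        have hj0 : parityInd c ℚ (e j) ((-1) ^ e₁ j) = 0 := by
          revert hj
          cases c <;> simp [parityInd]
        rw [Finset.prod_eq_zero (f := fun j => parityInd c ℚ (e j) ((-1) ^ e₁ j))
          (Finset.mem_univ j) hj0, mul_zero, mul_zero]
    · simp [hs]
  rw [hφF] at h3
  have hTanti : ∀ e ∈ T, Antitone e := by
    intro e he
    obtain ⟨w, hw, rfl⟩ := Finset.mem_image.1 he
    exact (hu w hw).1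
  have hstep : ∀ e n (hn : n + 1 < r), f e n - f e (n + 1) = e ⟨n, by omega⟩ - e ⟨n + 1, hn⟩ +
      labelShift c (s₀ n) (s₀ (n + 1)) := by
    intro e n hn
    have hrho : rhoShift c s₀ (n + 1) = rhoShift c s₀ n + labelShift c (s₀ n) (s₀ (n + 1)) :=
      Finset.sum_range_succ _ _
    simp only [hf, hrho, dif_pos hn, dif_pos (show n < r by omega)]
    ring
  have hfin := coeff_eq_zero_of_antisymmetrizer c ((ε : ℤ) : ℚ)
    (by rcases Int.units_eq_one_or ε with rfl | rfl <;> simp) r s₀ T' (fun e => ρ e s') f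
    (by
      intro e _ e' _ hee
      funext j
      have := hee j j.2
      simpa [hf] using this)
    (by
      intro e he n hn
      have h1 := hstep e n hn
      have h2 := labelShift_nonneg c (s₀ n) (s₀ (n + 1))
      have h4 : e ⟨n + 1, hn⟩ ≤ e ⟨n, by omega⟩ :=
        hTanti e (Finset.mem_filter.1 he).1 (by simp [Fin.le_def])
      omega)
    h3.symm e₁
    (Finset.mem_filter.2 ⟨he₁, fun j => by cases c <;> simp [parityInd]⟩)
    (by
      intro n hn
      have h1 := hstep e₁ n hn
      have h2 := labelShift_nonneg c (s₀ n) (s₀ (n + 1))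
      have h4 : e₁ ⟨n + 1, hn⟩ ≤ e₁ ⟨n, by omega⟩ := hTanti e₁ he₁ (by simp [Fin.le_def])
      -- The shifted exponents of e₁ decrease strictly: at a tie the signs s' agree and the label
      -- shift is positive, elsewhere e₁ itself drops.
      by_cases h5 : e₁ ⟨n + 1, hn⟩ = e₁ ⟨n, by omega⟩
      · have h6 : 0 < labelShift c (s₀ n) (s₀ (n + 1)) := by
          apply labelShift_pos
          intro _ _
          have e1 := hs₀ ⟨n, by omega⟩
          have e2 := hs₀ ⟨n + 1, hn⟩
          simp only at e1 e2
          rw [e1, e2]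
          exact hadm _ _ h5.symm
        omega
      · omega)
  rw [hρ1] at hfin
  exact one_ne_zero hfin

end Independence


/-! ### Straightening: the rewriting argument, the universal ring and base change. -/

/-! ### Existence of straightenings -/

section Straighten

variable {c : FormType} {A : Type*} [CommRing A]

/-- The ideal `Rel` as a submodule. -/
def relSub (c : FormType) {A : Type*} [CommRing A] (t η : A) : Submodule A (TypAlg c A) where
  carrier := TwoSidedIdeal.span (rels c A t η)
  add_mem' hx hy := add_mem (S := TwoSidedIdeal (TypAlg c A)) hx hy
  zero_mem' := zero_mem (TwoSidedIdeal.span (rels c A t η))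
  smul_mem' a x hx := by
    rw [Algebra.smul_def]
    exact TwoSidedIdeal.mul_mem_left (TwoSidedIdeal.span (rels c A t η)) _ _ hx

theorem subset_relSub {t η : A} {x : TypAlg c A} (hx : x ∈ rels c A t η) : x ∈ relSub c t η :=
  TwoSidedIdeal.subset_span hx

theorem mem_of_two_smul_mem {M : Type*} [AddCommGroup M] [Module A M] (h2 : IsUnit (2 : A))
    (N : Submodule A M) {x : M} (hx : (2 : A) • x ∈ N) : x ∈ N := by
  obtain ⟨u, hu⟩ := h2
  have := N.smul_mem (↑u⁻¹ : A) hx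
  rwa [smul_smul, ← hu, Units.inv_mul, one_smul] at this

theorem sub_mem_sup {M : Type*} [AddCommGroup M] [Module A M] {N P : Submodule A M} {x y : M}
    (h : x - y ∈ N) (hy : y ∈ P) : x ∈ N ⊔ P := by
  rw [← sub_add_cancel x y]
  exact Submodule.add_mem_sup h hy

theorem word2_mem_of_relTrivialSign (t : A) (a b : ℤ) (hab : a < b)
    (N : Submodule A (TypAlg c A)) (hN : ∀ x ∈ relTrivialSign c A t, x ∈ N) :
    word2 A a (1 : c.Sign) b 1 ∈ N ⊔
      Submodule.span A {y | ∃ a' b' : ℤ, ∃ χ₁ χ₂ : c.Sign, a < a' ∧ a' ≤ b ∧ a' + b' = a + b ∧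
        y = word2 A a' χ₁ b' χ₂} := by
  have hw : ∀ a' b' : ℤ, a < a' → a' ≤ b → a' + b' = a + b → word2 A a' (1 : c.Sign) b' 1 ∈
      Submodule.span A {y | ∃ a' b' : ℤ, ∃ χ₁ χ₂ : c.Sign, a < a' ∧ a' ≤ b ∧ a' + b' = a + b ∧
        y = word2 A a' χ₁ b' χ₂} :=
    fun a' b' h1 h2 h3 => Submodule.subset_span ⟨_, _, _, _, h1, h2, h3, rfl⟩
  by_cases h : b = a + 1
  · subst h
    exact sub_mem_sup (hN _ (Or.inl ⟨a, rfl⟩)) (hw _ _ (by omega) (by omega) (by omega))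
  · refine sub_mem_sup (y := word2 A (a + 1) 1 (b - 1) 1 +
      t ^ (b - a - 1).toNat • (word2 A b 1 a 1 - word2 A (b - 1) 1 (a + 1) 1)) ?_ ?_
    · rw [← sub_sub]
      exact hN _ (Or.inr ⟨a, b, hab, rfl⟩)
    · exact add_mem (hw _ _ (by omega) (by omega) (by omega)) (Submodule.smul_mem _ _
        (sub_mem (hw _ _ (by omega) (by omega) (by omega))
          (hw _ _ (by omega) (by omega) (by omega))))

/-- Each generator is solved for its term with first exponent a. All other terms have a larger first
exponent, apart from the coincidences at n = 0. -/
theorem sigma2_mem_symmetric (h2 : IsUnit (2 : A)) (t η : A) (a b : ℤ) (hab : a < b)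
    (N : Submodule A (TypAlg .symmetric A)) (hN : ∀ x ∈ relSymmetric .symmetric A t η, x ∈ N)
    (s₁ s₂ : ℤˣ) :
    sigma2 .symmetric A a s₁ b s₂ ∈ N ⊔
      Submodule.span A {y | ∃ a' b' : ℤ, ∃ χ₁ χ₂ : FormType.symmetric.Sign,
        a < a' ∧ a' ≤ b ∧ a' + b' = a + b ∧ y = word2 A a' χ₁ b' χ₂} := by
  set P := Submodule.span A {y | ∃ a' b' : ℤ, ∃ χ₁ χ₂ : FormType.symmetric.Sign,
        a < a' ∧ a' ≤ b ∧ a' + b' = a + b ∧ y = word2 A a' χ₁ b' χ₂} with hP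
  have hw : ∀ a' b' : ℤ, a < a' → a' ≤ b → a' + b' = a + b → ∀ s₁ s₂,
      sigma2 .symmetric A a' s₁ b' s₂ ∈ P :=
    fun a' b' h1 h2 h3 s₁ s₂ => Submodule.sum_mem _ fun χ₁ _ => Submodule.sum_mem _ fun χ₂ _ =>
      Submodule.smul_mem _ _ (Submodule.subset_span ⟨_, _, _, _, h1, h2, h3, rfl⟩)
  rcases Int.even_or_odd' (b - a) with ⟨n, hn | hn⟩
  · obtain ⟨n, rfl⟩ : ∃ m : ℕ, n = m + 1 := ⟨(n - 1).toNat, by omega⟩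
    rcases unit_eq_or_neg_eq s₁ s₂ with rfl | rfl
    · have h3 := hN _ (Or.inr ⟨a, b, n, s₁, by omega, rfl⟩)
      simp only [relHalf] at h3
      rw [show a + 1 - 1 = a by ring, show b - 1 + 1 = b by ring, show a + 1 + 1 = a + 2 by ring,
        show b - 1 - 1 = b - 2 by ring] at h3
      -- For n = 0 the two `relHalf` terms coincide, so the leading term occurs twice and 2 has to
      -- be inverted.
      by_cases hn0 : n = 0
      · subst hn0
        obtain rfl : b = a + 2 := by omega
        rw [show a + 2 - 2 = a by ring, show a + 2 - 1 = a + 1 by ring] at h3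
        apply mem_of_two_smul_mem h2
        refine sub_mem_sup (y := (2 : A) • (sigma2 .symmetric A (a + 1) s₁ (a + 1) s₁) +
          η • ((2 : A) • (sigma2 .symmetric A (a + 1) (-s₁) (a + 1) (-s₁)) -
            (2 : A) • sigma2 .symmetric A (a + 2) (-s₁) a (-s₁))) ?_ ?_
        · convert h3 using 1
          simp only [two_smul, pow_zero, one_smul, smul_sub, smul_add]
          abel
        · exact add_mem (Submodule.smul_mem _ _ (hw _ _ (by omega) (by omega) (by omega) _ _))
            (Submodule.smul_mem _ _ (sub_mem
              (Submodule.smul_mem _ _ (hw _ _ (by omega) (by omega) (by omega) _ _))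
              (Submodule.smul_mem _ _ (hw _ _ (by omega) (by omega) (by omega) _ _))))
      · refine sub_mem_sup (y := sigma2 .symmetric A (a + 1) s₁ (b - 1) s₁ +
          η • (sigma2 .symmetric A (a + 1) (-s₁) (b - 1) (-s₁) -
            sigma2 .symmetric A (a + 2) (-s₁) (b - 2) (-s₁)) -
          t ^ n • (-sigma2 .symmetric A (b - 1) s₁ (a + 1) s₁ +
            sigma2 .symmetric A (b - 2) s₁ (a + 2) s₁ -
            η • (sigma2 .symmetric A (b - 1) (-s₁) (a + 1) (-s₁) -
              sigma2 .symmetric A b (-s₁) a (-s₁)))) ?_ ?_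
        · convert h3 using 1
          abel
        · exact sub_mem (add_mem (hw _ _ (by omega) (by omega) (by omega) _ _)
            (Submodule.smul_mem _ _ (sub_mem (hw _ _ (by omega) (by omega) (by omega) _ _)
              (hw _ _ (by omega) (by omega) (by omega) _ _))))
            (Submodule.smul_mem _ _ (sub_mem (add_mem
              (neg_mem (hw _ _ (by omega) (by omega) (by omega) _ _))
              (hw _ _ (by omega) (by omega) (by omega) _ _))
              (Submodule.smul_mem _ _ (sub_mem (hw _ _ (by omega) (by omega) (by omega) _ _)
                (hw _ _ (by omega) (by omega) (by omega) _ _)))))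
    · have h3 := hN _ (Or.inl (Or.inr ⟨a, b, n + 1, s₁, by push_cast; omega, rfl⟩))
      refine sub_mem_sup (y := -(t ^ (n + 1) • sigma2 .symmetric A b s₁ a (-s₁))) ?_ ?_
      · rwa [sub_neg_eq_add]
      · exact neg_mem (Submodule.smul_mem _ _ (hw _ _ (by omega) (by omega) (by omega) _ _))
  · obtain ⟨n, rfl⟩ : ∃ m : ℕ, n = m := ⟨n.toNat, by omega⟩
    have h3 := hN _ (Or.inl (Or.inl ⟨a, b, n, s₁, s₂, hn, rfl⟩))
    -- For b = a + 1 the two halves of the generator repeat each other, and again 2 has to be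
    -- inverted.
    by_cases hn0 : n = 0
    · subst hn0
      obtain rfl : b = a + 1 := by omega
      apply mem_of_two_smul_mem h2
      refine sub_mem_sup (y := (2 : A) • (sigma2 .symmetric A (a + 1) s₂ a s₁)) ?_ ?_
      · convert h3 using 1
        rw [show a + 1 - 1 = a by ring]
        simp only [two_smul, pow_zero, one_smul]
        abel
      · exact Submodule.smul_mem _ _ (hw _ _ (by omega) (by omega) (by omega) _ _)
    · refine sub_mem_sup (y := sigma2 .symmetric A (a + 1) s₂ (b - 1) s₁ +
        t ^ n • (sigma2 .symmetric A b s₂ a s₁ - sigma2 .symmetric A (b - 1) s₁ (a + 1) s₂)) ?_ ?_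
      · rwa [← sub_sub]
      · exact add_mem (hw _ _ (by omega) (by omega) (by omega) _ _) (Submodule.smul_mem _ _
          (sub_mem (hw _ _ (by omega) (by omega) (by omega) _ _)
            (hw _ _ (by omega) (by omega) (by omega) _ _)))

/-- Words are combinations of the elements `sigma2`. -/
theorem four_smul_word2 (a b : ℤ) (χ₁ χ₂ : c.Sign) :
    (4 : A) • word2 A a χ₁ b χ₂ = ∑ s₁ : ℤˣ, ∑ s₂ : ℤˣ,
      ((((signChar s₁ χ₁ : ℤˣ) : ℤ) : A) * (((signChar s₂ χ₂ : ℤˣ) : ℤ) : A)) •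
        sigma2 c A a s₁ b s₂ := by
  have h1 : ∀ s₁ s₂ : ℤˣ, ((((signChar s₁ χ₁ : ℤˣ) : ℤ) : A) *
      (((signChar s₂ χ₂ : ℤˣ) : ℤ) : A)) • sigma2 c A a s₁ b s₂ =
      ∑ χ₁' : c.Sign, ∑ χ₂' : c.Sign,
      (((((signChar s₁ χ₁ : ℤˣ) : ℤ) : A) * (((signChar s₁ χ₁' : ℤˣ) : ℤ) : A)) *
      ((((signChar s₂ χ₂ : ℤˣ) : ℤ) : A) * (((signChar s₂ χ₂' : ℤˣ) : ℤ) : A))) •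
        word2 A a χ₁' b χ₂' := by
    intro s₁ s₂
    simp only [sigma2, Finset.smul_sum, smul_smul]
    refine Finset.sum_congr rfl fun χ₁' _ => Finset.sum_congr rfl fun χ₂' _ => ?_
    congr 1
    push_cast
    ring
  simp only [h1]
  have h2 : ∀ F : ℤˣ → ℤˣ → c.Sign → c.Sign → TypAlg c A,
      ∑ s₁ : ℤˣ, ∑ s₂ : ℤˣ, ∑ χ₁', ∑ χ₂', F s₁ s₂ χ₁' χ₂' =
      ∑ χ₁', ∑ χ₂', ∑ s₁ : ℤˣ, ∑ s₂ : ℤˣ, F s₁ s₂ χ₁' χ₂' := by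
    intro F
    simp only [Finset.sum_comm (s := (Finset.univ : Finset ℤˣ)) (t := (Finset.univ : Finset c.Sign))]
  rw [h2]
  simp only [← Finset.sum_smul, ← Finset.mul_sum, ← Finset.sum_mul, sum_signChar_mul]
  rw [Finset.sum_eq_single χ₁, Finset.sum_eq_single χ₂]
  · rw [if_pos rfl, if_pos rfl]
    norm_num
  · intro b _ hb
    rw [if_neg hb.symm, mul_zero, zero_smul]
  · simp
  · intro b _ hb
    refine Finset.sum_eq_zero fun b' _ => ?_
    rw [if_neg hb.symm, zero_mul, zero_smul]
  · simp

theorem subsingleton_sign (hc : c ≠ .symmetric) : Subsingleton c.Sign := by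
  cases c with
  | symmetric => exact absurd rfl hc
  | unramHermitian => exact inferInstanceAs (Subsingleton (⊥ : Subgroup ℤˣ))
  | alternating => exact inferInstanceAs (Subsingleton (⊥ : Subgroup ℤˣ))

theorem isUnit_two_of_symmetric (hc : c = .symmetric) (hA : IsUnit (Nat.card c.Sign : A)) :
    IsUnit (2 : A) := by
  subst hc
  have : Nat.card FormType.symmetric.Sign = 2 := by
    change Nat.card (⊤ : Subgroup ℤˣ) = 2
    rw [Subgroup.card_top]
    simp
  rw [this] at hA
  exact_mod_cast hA

/-- One step of straightening in degree two. -/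
theorem word2_mem (hA : IsUnit (Nat.card c.Sign : A)) (t η : A) (a b : ℤ) (hab : a < b)
    (χ₁ χ₂ : c.Sign) : word2 A a χ₁ b χ₂ ∈ relSub c t η ⊔
      Submodule.span A {y | ∃ a' b' : ℤ, ∃ χ₁ χ₂ : c.Sign, a < a' ∧ a' ≤ b ∧ a' + b' = a + b ∧
        y = word2 A a' χ₁ b' χ₂} := by
  have htriv : ∀ hc : c ≠ .symmetric, (∀ x ∈ relTrivialSign c A t, x ∈ relSub c t η) →
      word2 A a χ₁ b χ₂ ∈ relSub c t η ⊔
      Submodule.span A {y | ∃ a' b' : ℤ, ∃ χ₁ χ₂ : c.Sign, a < a' ∧ a' ≤ b ∧ a' + b' = a + b ∧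
        y = word2 A a' χ₁ b' χ₂} := by
    intro hc hN
    have := subsingleton_sign hc
    rw [Subsingleton.elim χ₁ 1, Subsingleton.elim χ₂ 1]
    exact word2_mem_of_relTrivialSign t a b hab _ hN
  cases c with
  | unramHermitian => exact htriv (by simp) fun x hx => subset_relSub hx
  | alternating => exact htriv (by simp) fun x hx => subset_relSub hx
  | symmetric =>
    have h2 := isUnit_two_of_symmetric rfl hA
    apply mem_of_two_smul_mem h2
    apply mem_of_two_smul_mem h2
    rw [smul_smul, show (2 : A) * 2 = 4 by norm_num, four_smul_word2]
    exact Submodule.sum_mem _ fun s₁ _ => Submodule.sum_mem _ fun s₂ _ => Submodule.smul_mem _ _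
      (sigma2_mem_symmetric h2 t η a b hab _ (fun x hx => subset_relSub hx) s₁ s₂)

/-- Signs on equal exponents can be moved to the right. -/
theorem word2_sub_word2_mem (hA : IsUnit (Nat.card c.Sign : A)) (t η : A) (a : ℤ)
    (χ₁ χ₂ : c.Sign) : word2 A a χ₁ a χ₂ - word2 A a 1 a (χ₁ * χ₂) ∈ relSub c t η := by
  by_cases hc : c = .symmetric
  · subst hc
    have h2 := isUnit_two_of_symmetric rfl hA
    -- The even generator with equal exponents is twice this element.
    have hne : ∀ s : ℤˣ, sigma2 .symmetric A a s a (-s) ∈ relSub .symmetric t η := by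
      intro s
      apply mem_of_two_smul_mem h2
      have h3 : sigma2 .symmetric A a s a (-s) + t ^ 0 • sigma2 .symmetric A a s a (-s) ∈
        relSub .symmetric t η := subset_relSub (Or.inl (Or.inr ⟨a, a, 0, s, by simp, rfl⟩))
      rwa [pow_zero, one_smul, ← two_smul A] at h3
    apply mem_of_two_smul_mem h2
    apply mem_of_two_smul_mem h2
    rw [smul_smul, show (2 : A) * 2 = 4 by norm_num, smul_sub, four_smul_word2, four_smul_word2,
      ← Finset.sum_sub_distrib]
    refine Submodule.sum_mem _ fun s₁ _ => ?_
    rw [← Finset.sum_sub_distrib]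
    refine Submodule.sum_mem _ fun s₂ _ => ?_
    rw [← sub_smul]
    rcases unit_eq_or_neg_eq s₁ s₂ with rfl | rfl
    -- For equal characters the coefficient depends on the signs only through their product, so the
    -- two words contribute the same.
    · have : (((signChar s₁ χ₁ : ℤˣ) : ℤ) : A) * (((signChar s₁ χ₂ : ℤˣ) : ℤ) : A) -
        (((signChar s₁ (1 : FormType.symmetric.Sign) : ℤˣ) : ℤ) : A) *
          (((signChar s₁ (χ₁ * χ₂) : ℤˣ) : ℤ) : A) = 0 := by
        simp only [signChar]
        split_ifs <;> simp
      rw [this, zero_smul]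
      exact zero_mem _
    · exact Submodule.smul_mem _ _ (hne s₁)
  · have := subsingleton_sign hc
    rw [Subsingleton.elim χ₁ 1, Subsingleton.elim χ₂ 1, one_mul, sub_self]
    exact zero_mem _

end Straighten


/-! ### Straightening of words -/

/-- Dominance order: the partial sums of `e` are at most those of `e'`, with equal totals. -/
def Dominates {r : ℕ} (e' e : Fin r → ℤ) : Prop :=
  (∀ k : ℕ, ∑ j ∈ Finset.univ.filter (fun j : Fin r => (j : ℕ) < k), e j ≤
      ∑ j ∈ Finset.univ.filter (fun j : Fin r => (j : ℕ) < k), e' j) ∧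
    ∑ j, e j = ∑ j, e' j

theorem Dominates.refl {r : ℕ} (e : Fin r → ℤ) : Dominates e e := ⟨fun _ => le_rfl, rfl⟩

theorem Dominates.trans {r : ℕ} {e e' e'' : Fin r → ℤ} (h : Dominates e e') (h' : Dominates e' e'') :
    Dominates e e'' :=
  ⟨fun k => (h'.1 k).trans (h.1 k), h'.2.trans h.2⟩

theorem mem_sup_of_le {A M : Type*} [CommRing A] [AddCommGroup M] [Module A M]
    {N P N' P' : Submodule A M} {x : M} (hx : x ∈ N ⊔ P) (h : N ≤ N') (h' : P ≤ P') :
    x ∈ N' ⊔ P' := (sup_le_sup h h' : N ⊔ P ≤ N' ⊔ P') hx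

section Words

variable {c : FormType} {r : ℕ}

/-- Replace two letters. -/
def setPair (w : Typ c r) (i i' : Fin r) (x y : ℤ × c.Sign) : Typ c r :=
  Function.update (Function.update w i x) i' y

theorem setPair_left (w : Typ c r) {i i' : Fin r} (h : (i : ℕ) + 1 = i') (x y : ℤ × c.Sign) :
    setPair w i i' x y i = x := by
  have : i ≠ i' := fun e => by rw [e] at h; omega
  simp [setPair, this]

theorem setPair_right (w : Typ c r) (i i' : Fin r) (x y : ℤ × c.Sign) :
    setPair w i i' x y i' = y := by
  simp [setPair]

theorem setPair_of_ne (w : Typ c r) {i i' j : Fin r} (h : j ≠ i) (h' : j ≠ i') (x y : ℤ × c.Sign) :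
    setPair w i i' x y j = w j := by
  simp [setPair, h, h']

theorem setPair_self (w : Typ c r) (i i' : Fin r) : setPair w i i' (w i) (w i') = w := by
  simp [setPair]

theorem ofFn_setPair (w : Typ c r) {i i' : Fin r} (h : (i : ℕ) + 1 = i') (x y : ℤ × c.Sign) :
    List.ofFn (setPair w i i' x y) =
      (List.ofFn w).take i ++ ([x, y] ++ (List.ofFn w).drop (i + 2)) := by
  apply List.ext_getElem
  · simp
    omega
  · intro n h1 h2
    simp only [List.length_ofFn] at h1
    rw [List.getElem_ofFn]
    by_cases hn : n < i
    · rw [List.getElem_append_left (by simp; omega)]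
      rw [setPair_of_ne] <;> simp [Fin.ext_iff] <;> omega
    · rw [List.getElem_append_right (by simp; omega)]
      simp only [List.length_take, List.length_ofFn]
      by_cases hn1 : n = i
      · have : n - min (i : ℕ) r = 0 := by omega
        simp only [this]
        subst hn1
        exact setPair_left w h x y
      · by_cases hn2 : n = i'
        · have : n - min (i : ℕ) r = 1 := by omega
          simp only [this]
          subst hn2
          exact setPair_right w i i' x y
        · rw [List.getElem_append_right (by simp; omega)]
          rw [setPair_of_ne _ (by simp [Fin.ext_iff]; omega) (by simp [Fin.ext_iff]; omega)]
          simp only [List.getElem_drop, List.getElem_ofFn, List.length_cons, List.length_nil]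
          congr 1
          ext
          simp
          omega

theorem sum_expo_setPair (w : Typ c r) {i i' : Fin r} (h : (i : ℕ) + 1 = i') (x y : ℤ × c.Sign)
    (s : Finset (Fin r)) (g : Fin r → ℤ) :
    ∑ j ∈ s, g j * expo (setPair w i i' x y) j = ∑ j ∈ s, g j * expo w j +
      ((if i ∈ s then g i * (x.1 - (w i).1) else 0) +
        if i' ∈ s then g i' * (y.1 - (w i').1) else 0) := by
  classical
  have hne : i' ≠ i := fun e => by rw [e] at h; omega
  have h1 : ∀ j, g j * expo (setPair w i i' x y) j = g j * expo w j +
      ((if j = i then g i * (x.1 - (w i).1) else 0) +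
        if j = i' then g i' * (y.1 - (w i').1) else 0) := by
    intro j
    by_cases hj : j = i
    · subst hj
      rw [expo, setPair_left w h, if_pos rfl, if_neg (Ne.symm hne), expo]
      ring
    · by_cases hj' : j = i'
      · subst hj'
        rw [expo, setPair_right, if_neg hj, if_pos rfl, expo]
        ring
      · rw [expo, setPair_of_ne w hj hj', if_neg hj, if_neg hj', expo]
        ring
  simp only [h1]
  rw [Finset.sum_add_distrib, Finset.sum_add_distrib, Finset.sum_ite_eq', Finset.sum_ite_eq']

theorem dominates_setPair (w : Typ c r) {i i' : Fin r} (h : (i : ℕ) + 1 = i') (x y : ℤ × c.Sign)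
    (h1 : (w i).1 ≤ x.1) (h2 : x.1 + y.1 = (w i).1 + (w i').1) :
    Dominates (expo (setPair w i i' x y)) (expo w) := by
  have h3 := fun s => sum_expo_setPair w h x y s 1
  simp only [Pi.one_apply, one_mul] at h3
  constructor
  · intro k
    rw [h3]
    simp only [Finset.mem_filter, Finset.mem_univ, true_and]
    split_ifs <;> omega
  · rw [h3]
    simp only [Finset.mem_univ, if_true]
    omega

/-- A word, as an element of `R[Typ]`. -/
def wordOf (A : Type*) [CommRing A] (w : Typ c r) : TypAlg c A :=
  MonoidAlgebra.of A (FreeMonoid (ℤ × c.Sign)) (FreeMonoid.ofList (List.ofFn w))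

theorem inclTyp_single {A : Type*} [CommRing A] (w : Typ c r) (a : A) :
    inclTyp A r (Finsupp.single w a) = a • wordOf A w := by
  rw [inclTyp, Finsupp.linearCombination_single]
  rfl

theorem wordOf_setPair (A : Type*) [CommRing A] (w : Typ c r) {i i' : Fin r}
    (h : (i : ℕ) + 1 = i') (x y : ℤ × c.Sign) :
    wordOf A (setPair w i i' x y) =
      MonoidAlgebra.of A _ (FreeMonoid.ofList ((List.ofFn w).take i)) *
        word2 A x.1 x.2 y.1 y.2 *
        MonoidAlgebra.of A _ (FreeMonoid.ofList ((List.ofFn w).drop (i + 2))) := by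
  rw [wordOf, ofFn_setPair w h, word2, ← map_mul, ← map_mul, mul_assoc]
  rfl

theorem sandwich_mem_relSub {A : Type*} [CommRing A] {t η : A} {x : TypAlg c A}
    (hx : x ∈ relSub c t η) (y z : TypAlg c A) : y * x * z ∈ relSub c t η :=
  TwoSidedIdeal.mul_mem_right (TwoSidedIdeal.span (rels c A t η)) _ _
    (TwoSidedIdeal.mul_mem_left (TwoSidedIdeal.span (rels c A t η)) _ _ hx)

theorem wordOf_setPair_mem {A : Type*} [CommRing A] (t η : A) (w : Typ c r) {i i' : Fin r}
    (h : (i : ℕ) + 1 = i') (x y : ℤ × c.Sign) (P : ℤ × c.Sign → ℤ × c.Sign → Prop)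
    (hxy : word2 A x.1 x.2 y.1 y.2 ∈ relSub c t η ⊔
      Submodule.span A {v | ∃ x' y', P x' y' ∧ v = word2 A x'.1 x'.2 y'.1 y'.2}) :
    wordOf A (setPair w i i' x y) ∈ relSub c t η ⊔
      Submodule.span A {v | ∃ x' y', P x' y' ∧ v = wordOf A (setPair w i i' x' y')} := by
  let L : TypAlg c A →ₗ[A] TypAlg c A :=
    LinearMap.mulRight A (MonoidAlgebra.of A _ (FreeMonoid.ofList ((List.ofFn w).drop (i + 2)))) ∘ₗ
      LinearMap.mulLeft A (MonoidAlgebra.of A _ (FreeMonoid.ofList ((List.ofFn w).take i)))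
  have hL : ∀ x' y', L (word2 A x'.1 x'.2 y'.1 y'.2) = wordOf A (setPair w i i' x' y') :=
    fun x' y' => (wordOf_setPair A w h x' y').symm
  have h1 := Submodule.mem_map_of_mem (f := L) hxy
  rw [hL, Submodule.map_sup, Submodule.map_span] at h1
  refine mem_sup_of_le h1 ?_ (Submodule.span_mono ?_)
  · rintro _ ⟨v, hv, rfl⟩
    exact sandwich_mem_relSub hv _ _
  · rintro _ ⟨_, ⟨x', y', hP, rfl⟩, rfl⟩
    exact ⟨x', y', hP, hL x' y'⟩

/-- Words are combinations of words with weakly decreasing exponents modulo `Rel`. -/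
theorem wordOf_mem_antitone {A : Type*} [CommRing A] (hA : IsUnit (Nat.card c.Sign : A)) (t η : A)
    (w : Typ c r) : wordOf A w ∈ relSub c t η ⊔
      Submodule.span A {v | ∃ w' : Typ c r, (Antitone (expo w') ∧ Dominates (expo w') (expo w)) ∧
        v = wordOf A w'} := by
  obtain ⟨M, hM⟩ : ∃ M : ℤ, ∀ j, expo w j ≤ M := by
    obtain ⟨M, hM⟩ := (Set.finite_range (expo w)).bddAbove
    exact ⟨M, fun j => hM ⟨j, rfl⟩⟩
  have hbound : ∀ w' : Typ c r, (∀ j, expo w' j ≤ M) →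
      ∑ j : Fin r, ((r : ℤ) - j) * expo w' j ≤ ∑ j : Fin r, ((r : ℤ) - j) * M := by
    intro w' hw'
    refine Finset.sum_le_sum fun j _ => mul_le_mul_of_nonneg_left (hw' j) ?_
    have := j.2
    omega
  -- This potential is nonnegative while all exponents are at most M, a bound that straightening
  -- preserves. It drops when an adjacent pair is replaced by one with the same sum and a larger
  -- first entry.
  obtain ⟨n, hn⟩ : ∃ n : ℕ, ∑ j : Fin r, ((r : ℤ) - j) * M -
      ∑ j : Fin r, ((r : ℤ) - j) * expo w j = n :=
    ⟨_, (Int.toNat_of_nonneg (sub_nonneg.2 (hbound w hM))).symm⟩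
  induction n using Nat.strong_induction_on generalizing w with
  | _ n ih =>
    by_cases hanti : Antitone (expo w)
    · exact Submodule.mem_sup_right (Submodule.subset_span ⟨w, ⟨hanti, Dominates.refl _⟩, rfl⟩)
    obtain ⟨i, i', hi, hlt⟩ : ∃ i i' : Fin r, (i : ℕ) + 1 = i' ∧ (w i).1 < (w i').1 := by
      by_contra! hcon
      apply hanti
      rcases r with _ | r
      · exact fun i => i.elim0
      · refine Fin.antitone_iff_succ_le.2 fun i => ?_
        exact hcon i.castSucc i.succ (by simp)
    have h1 := wordOf_setPair_mem t η w hi (w i) (w i')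
      (fun x y => (w i).1 < x.1 ∧ x.1 ≤ (w i').1 ∧ x.1 + y.1 = (w i).1 + (w i').1) (by
        refine mem_sup_of_le (word2_mem hA t η (w i).1 (w i').1 hlt (w i).2 (w i').2) le_rfl
          (Submodule.span_mono ?_)
        rintro _ ⟨a', b', χ₁, χ₂, h1, h2, h3, rfl⟩
        exact ⟨(a', χ₁), (b', χ₂), ⟨h1, h2, h3⟩, rfl⟩)
    rw [setPair_self] at h1
    rw [← sup_idem (relSub c t η), sup_assoc]
    refine Submodule.mem_sup.2 ?_
    obtain ⟨y, hy, z, hz, h1⟩ := Submodule.mem_sup.1 h1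
    refine ⟨y, hy, z, ?_, h1⟩
    refine (Submodule.span_le.2 ?_ : Submodule.span A _ ≤ _) hz
    rintro _ ⟨x, y, ⟨hx1, hx2, hxy⟩, rfl⟩
    have hM' : ∀ j, expo (setPair w i i' x y) j ≤ M := by
      intro j
      have h1 := hM i'
      rw [expo] at h1
      by_cases hj : j = i
      · subst hj
        rw [expo, setPair_left w hi]
        omega
      · by_cases hj' : j = i'
        · subst hj'
          rw [expo, setPair_right]
          omega
        · rw [expo, setPair_of_ne w hj hj']
          exact hM j
    have hpot := sum_expo_setPair w hi x y Finset.univ (fun j => (r : ℤ) - j)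
    simp only [Finset.mem_univ, if_true] at hpot
    have hii : ((i' : ℕ) : ℤ) = (i : ℕ) + 1 := by rw [← hi]; push_cast; ring
    have hpot' : ∑ j : Fin r, ((r : ℤ) - j) * expo (setPair w i i' x y) j =
        ∑ j : Fin r, ((r : ℤ) - j) * expo w j + (x.1 - (w i).1) := by
      rw [hpot, hii]
      linear_combination ((r : ℤ) - i - 1) * hxy
    have hb := hbound _ hM'
    have h2 := ih (∑ j : Fin r, ((r : ℤ) - j) * M -
      ∑ j : Fin r, ((r : ℤ) - j) * expo (setPair w i i' x y) j).toNat (by omega) _ hM'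
      (by omega)
    refine mem_sup_of_le h2 le_rfl (Submodule.span_mono ?_)
    rintro _ ⟨w', ⟨hw1, hw2⟩, rfl⟩
    exact ⟨w', ⟨hw1, hw2.trans (dominates_setPair w hi x y hx1.le hxy)⟩, rfl⟩

theorem toTyp0_setPair (w : Typ c r) {i i' : Fin r} (h : (i : ℕ) + 1 = i')
    (he : (w i).1 = (w i').1) (χ₁ χ₂ : c.Sign) (hχ : χ₁ * χ₂ = (w i).2 * (w i').2) :
    toTyp0 (setPair w i i' ((w i).1, χ₁) ((w i').1, χ₂)) = toTyp0 w := by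
  classical
  have hne : i ≠ i' := fun e => by rw [e] at h; omega
  have h1 : ∀ j, (setPair w i i' ((w i).1, χ₁) ((w i').1, χ₂) j).1 = (w j).1 := by
    intro j
    by_cases hj : j = i
    · subst hj; rw [setPair_left w h]
    · by_cases hj' : j = i'
      · subst hj'; rw [setPair_right]
      · rw [setPair_of_ne w hj hj']
  simp only [toTyp0, h1, Typ0.mk.injEq, true_and]
  funext m
  by_cases hm : (w i).1 = m
  · have hi1 : i ∈ Finset.univ.filter fun k => (w k).1 = m := by simp [hm]
    have hi2 : i' ∈ (Finset.univ.filter fun k => (w k).1 = m).erase i := by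
      simp [hne.symm, ← he, hm]
    rw [← Finset.mul_prod_erase _ _ hi1, ← Finset.mul_prod_erase _ _ hi2,
      ← Finset.mul_prod_erase _ (fun k => (w k).2) hi1,
      ← Finset.mul_prod_erase _ (fun k => (w k).2) hi2, ← mul_assoc, ← mul_assoc,
      setPair_left w h, setPair_right, hχ]
    congr 1
    refine Finset.prod_congr rfl fun j hj => ?_
    simp only [Finset.mem_erase] at hj
    rw [setPair_of_ne w hj.2.1 hj.1]
  · refine Finset.prod_congr rfl fun j hj => ?_
    have hjm := (Finset.mem_filter.1 hj).2
    rw [setPair_of_ne w]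
    · rintro rfl; exact hm hjm
    · rintro rfl; exact hm (he.trans hjm)

theorem expo_setPair (w : Typ c r) {i i' : Fin r} (h : (i : ℕ) + 1 = i') (χ₁ χ₂ : c.Sign) :
    expo (setPair w i i' ((w i).1, χ₁) ((w i').1, χ₂)) = expo w := by
  funext j
  by_cases hj : j = i
  · subst hj; rw [expo, setPair_left w h]; rfl
  · by_cases hj' : j = i'
    · subst hj'; rw [expo, setPair_right]; rfl
    · rw [expo, setPair_of_ne w hj hj']; rfl

theorem sign_mul_self (χ : c.Sign) : χ * χ = 1 := by
  obtain ⟨x, hx⟩ := χ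
  rcases Int.units_eq_one_or x with rfl | rfl <;> simp [Subtype.ext_iff]

theorem sign_eq_of_ne_one {χ χ' : c.Sign} (h : χ ≠ 1) (h' : χ' ≠ 1) : χ * χ' = 1 := by
  obtain ⟨x, hx⟩ := χ
  obtain ⟨y, hy⟩ := χ'
  simp only [ne_eq, Subtype.ext_iff, OneMemClass.coe_one] at h h'
  rcases Int.units_eq_one_or x with rfl | rfl <;> rcases Int.units_eq_one_or y with rfl | rfl <;>
    simp_all [Subtype.ext_iff]

/-- Signs can be concentrated modulo `Rel`. -/
theorem exists_canonical {A : Type*} [CommRing A] (hA : IsUnit (Nat.card c.Sign : A)) (t η : A)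
    (w : Typ c r) (hw : Antitone (expo w)) : ∃ w' : Typ c r, IsCanonical w' ∧ expo w' = expo w ∧
      toTyp0 w' = toTyp0 w ∧ wordOf A w - wordOf A w' ∈ relSub c t η := by
  classical
  -- Nontrivial signs weigh less further right, so moving one to the right, or cancelling it against
  -- its neighbour, lowers the measure.
  obtain ⟨n, hn⟩ : ∃ n : ℕ, ∑ j : Fin r, (if (w j).2 = 1 then 0 else r - (j : ℕ)) = n := ⟨_, rfl⟩
  induction n using Nat.strong_induction_on generalizing w with
  | _ n ih =>
    by_cases hcan : IsCanonical w
    · exact ⟨w, hcan, rfl, rfl, by rw [sub_self]; exact zero_mem _⟩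
    obtain ⟨i, j, hij, heij, hχ⟩ : ∃ i j, i < j ∧ expo w i = expo w j ∧ (w i).2 ≠ 1 := by
      by_contra! hcon
      exact hcan ⟨hw, hcon⟩
    have hlt : (i : ℕ) + 1 < r := by
      have := j.2
      have : (i : ℕ) < j := hij
      omega
    set i' : Fin r := ⟨i + 1, hlt⟩ with hi'
    have hii : (i : ℕ) + 1 = i' := rfl
    have hne : i ≠ i' := fun e => by have := congrArg Fin.val e; simp [hi'] at this
    have he : (w i).1 = (w i').1 := by
      refine le_antisymm ?_ (hw (by simp [Fin.le_def, hi']))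
      have h1 : expo w j ≤ expo w i' := hw (by
        have : (i : ℕ) < j := hij
        simp only [Fin.le_def, hi']; omega)
      rw [← heij] at h1
      exact h1
    set w₁ := setPair w i i' ((w i).1, 1) ((w i').1, (w i).2 * (w i').2) with hw₁
    have hexpo : expo w₁ = expo w := expo_setPair w hii _ _
    have hrel : wordOf A w - wordOf A w₁ ∈ relSub c t η := by
      rw [hw₁, wordOf_setPair A w hii]
      nth_rewrite 1 [← setPair_self w i i']
      rw [wordOf_setPair A w hii, ← sub_mul, ← mul_sub]
      have h1 := word2_sub_word2_mem hA t η (w i).1 (w i).2 (w i').2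
      simp only [← he]
      exact sandwich_mem_relSub h1 _ _
    have hmeas : ∑ j : Fin r, (if (w₁ j).2 = 1 then 0 else r - (j : ℕ)) < n := by
      rw [← hn]
      have hm1 : i' ∈ (Finset.univ : Finset (Fin r)).erase i := by simp [hne.symm]
      rw [← Finset.add_sum_erase _ _ (Finset.mem_univ i), ← Finset.add_sum_erase _ _ hm1,
        ← Finset.add_sum_erase _ (fun j => if (w j).2 = 1 then 0 else r - (j : ℕ))
          (Finset.mem_univ i),
        ← Finset.add_sum_erase _ (fun j => if (w j).2 = 1 then 0 else r - (j : ℕ)) hm1,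
        ← add_assoc, ← add_assoc]
      refine add_lt_add_of_lt_of_le ?_ (le_of_eq (Finset.sum_congr rfl fun j hj => ?_))
      · rw [hw₁, setPair_left w hii, setPair_right]
        simp only [if_true, if_neg hχ, zero_add]
        have : (i' : ℕ) = i + 1 := rfl
        by_cases h1 : (w i').2 = 1
        · rw [h1, mul_one, if_neg hχ, if_pos rfl]; omega
        · rw [sign_eq_of_ne_one hχ h1, if_pos rfl, if_neg h1]; omega
      · simp only [Finset.mem_erase] at hj
        rw [hw₁, setPair_of_ne w hj.2.1 hj.1]
    obtain ⟨w', h1, h2, h3, h4⟩ := ih _ hmeas w₁ (by rw [hexpo]; exact hw) rfl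
    refine ⟨w', h1, h2.trans hexpo, h3.trans ?_, ?_⟩
    · exact toTyp0_setPair w hii he 1 _ (one_mul _)
    · have := add_mem hrel h4
      rwa [sub_add_sub_cancel] at this

end Words


/-! ### The straightening map -/

section Str

variable {c : FormType} {r : ℕ} {A : Type*} [CommRing A]

theorem inclTyp_eq (v : Typ c r →₀ A) :
    inclTyp A r v = Finsupp.linearCombination A (wordOf (c := c) (r := r) A) v := rfl

theorem exists_straight (hA : IsUnit (Nat.card c.Sign : A)) (t η : A) (w : Typ c r) :
    ∃ u : Typ c r →₀ A, (∀ w' ∈ u.support, IsCanonical w' ∧ Dominates (expo w') (expo w)) ∧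
      wordOf A w - inclTyp A r u ∈ relSub c t η := by
  have h1 : wordOf A w ∈ relSub c t η ⊔ Submodule.span A
      (wordOf A '' {w' : Typ c r | IsCanonical w' ∧ Dominates (expo w') (expo w)}) := by
    refine (sup_le le_sup_left (Submodule.span_le.2 ?_) : relSub c t η ⊔ _ ≤ _)
      (wordOf_mem_antitone hA t η w)
    rintro _ ⟨w', ⟨hw1, hw2⟩, rfl⟩
    obtain ⟨w'', h1, h2, -, h3⟩ := exists_canonical hA t η w' hw1
    exact sub_mem_sup h3 (Submodule.subset_span ⟨w'', ⟨h1, by rwa [h2]⟩, rfl⟩)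
  obtain ⟨y, hy, z, hz, hyz⟩ := Submodule.mem_sup.1 h1
  obtain ⟨u, hu, rfl⟩ := (Finsupp.mem_span_image_iff_linearCombination _).1 hz
  refine ⟨u, fun w' hw' => (Finsupp.mem_supported _ _).1 hu hw', ?_⟩
  rw [inclTyp_eq, ← hyz, add_sub_cancel_right]
  exact hy

theorem exists_ofFn_eq {X : Type*} (l : List X) {r : ℕ} (h : l.length = r) :
    ∃ w : Fin r → X, List.ofFn w = l := by
  subst h
  exact ⟨l.get, List.ofFn_get l⟩

open Classical in
/-- The linear map on `R[Typ]` with prescribed values on words of length `r`, and zero on the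
others. -/
def straightLin {M : Type*} [AddCommGroup M] [Module A M] (U : Typ c r → M) : TypAlg c A →ₗ[A] M :=
  wordLin fun l => if h : l.length = r then U (exists_ofFn_eq l h).choose else 0

theorem straightLin_wordOf {M : Type*} [AddCommGroup M] [Module A M] (U : Typ c r → M)
    (w : Typ c r) : straightLin U (wordOf A w) = U w := by
  rw [straightLin, wordOf, wordLin_of]
  have hl : (List.ofFn w).length = r := List.length_ofFn
  change (if h : (List.ofFn w).length = r then U (exists_ofFn_eq (List.ofFn w) h).choose else 0) = _
  rw [dif_pos hl]
  congr 1
  exact List.ofFn_injective (exists_ofFn_eq (List.ofFn w) hl).choose_spec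

theorem straightLin_of_ne {M : Type*} [AddCommGroup M] [Module A M] (U : Typ c r → M)
    (w : FreeMonoid (ℤ × c.Sign)) (hw : w.toList.length ≠ r) :
    straightLin U (MonoidAlgebra.of A _ w) = 0 := by
  rw [straightLin, wordLin_of, dif_neg hw]

theorem straightLin_inclTyp {M : Type*} [AddCommGroup M] [Module A M] (U : Typ c r → M)
    (v : Typ c r →₀ A) :
    straightLin U (inclTyp A r v) = Finsupp.linearCombination A U v := by
  rw [inclTyp_eq, Finsupp.linearCombination_apply, Finsupp.linearCombination_apply, Finsupp.sum,
    map_sum]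
  refine Finset.sum_congr rfl fun w _ => ?_
  rw [map_smul, straightLin_wordOf]

theorem sandwich_mem_span (w₁ w₂ : FreeMonoid (ℤ × c.Sign)) (x : TypAlg c A)
    (hx : x ∈ Submodule.span A {y | ∃ a χ₁ b χ₂, y = word2 A a χ₁ b χ₂}) :
    MonoidAlgebra.of A _ w₁ * x * MonoidAlgebra.of A _ w₂ ∈ Submodule.span A
      (MonoidAlgebra.of A (FreeMonoid (ℤ × c.Sign)) ''
        {w | w.toList.length = w₁.toList.length + 2 + w₂.toList.length}) := by
  induction hx using Submodule.span_induction with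
  | zero => simp
  | add x y _ _ hx hy => rw [mul_add, add_mul]; exact add_mem hx hy
  | smul a x _ hx => rw [mul_smul_comm, smul_mul_assoc]; exact Submodule.smul_mem _ _ hx
  | mem x hx =>
    obtain ⟨a, χ₁, b, χ₂, rfl⟩ := hx
    refine Submodule.subset_span ⟨w₁ * (FreeMonoid.of (a, χ₁) * FreeMonoid.of (b, χ₂)) * w₂, ?_, ?_⟩
    · simp [FreeMonoid.toList_mul]
      omega
    · rw [word2, map_mul, map_mul (MonoidAlgebra.of A _) w₁]

/-- Canonical words are linearly independent modulo `Rel`. -/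
def Independent (c : FormType) (r : ℕ) {A : Type*} [CommRing A] (t η : A) : Prop :=
  ∀ u : Typ c r →₀ A, (∀ w ∈ u.support, IsCanonical w) → inclTyp A r u ∈ relSub c t η → u = 0

/-- The straightenings U are chosen word by word. The linear extension nevertheless kills Rel,
because it sends an element of Rel to a canonical combination lying in Rel, which independence
forces to be zero. -/
theorem straightLin_sandwich_eq_zero (t η : A) (hind : Independent c r t η)
    (U : Typ c r → (Typ c r →₀ A)) (hU : ∀ w, ∀ w' ∈ (U w).support, IsCanonical w')
    (hU' : ∀ w, wordOf A w - inclTyp A r (U w) ∈ relSub c t η) (x : TypAlg c A)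
    (hx : x ∈ rels c A t η) (w₁ w₂ : FreeMonoid (ℤ × c.Sign)) :
    straightLin U (MonoidAlgebra.of A _ w₁ * x * MonoidAlgebra.of A _ w₂) = 0 := by
  have h1 := sandwich_mem_span w₁ w₂ x (rels_subset_span c A t η x hx)
  by_cases hr : w₁.toList.length + 2 + w₂.toList.length = r
  · have h2 : MonoidAlgebra.of A _ w₁ * x * MonoidAlgebra.of A _ w₂ ∈
        LinearMap.range (inclTyp (c := c) A r) := by
      refine (Submodule.span_le.2 ?_ : Submodule.span A _ ≤ _) h1
      rintro _ ⟨w, hw, rfl⟩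
      obtain ⟨w', hw'⟩ := exists_ofFn_eq w.toList (hw.trans hr)
      refine ⟨Finsupp.single w' 1, ?_⟩
      rw [inclTyp_single, one_smul, wordOf, hw']
      rfl
    obtain ⟨v, hv⟩ := h2
    rw [← hv, straightLin_inclTyp]
    have hvmem : inclTyp A r v ∈ relSub c t η := by
      rw [hv]
      exact sandwich_mem_relSub (subset_relSub hx) _ _
    apply hind
    · intro w' hw'
      have : Finsupp.linearCombination A U v ∈ Finsupp.supported A A {w | IsCanonical w} := by
        rw [Finsupp.linearCombination_apply]
        refine Submodule.sum_mem _ fun w _ => Submodule.smul_mem _ _ ?_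
        exact (Finsupp.mem_supported _ _).2 fun w' hw' => hU w w' hw'
      exact (Finsupp.mem_supported _ _).1 this hw'
    · have h3 : inclTyp A r v - inclTyp A r (Finsupp.linearCombination A U v) ∈ relSub c t η := by
        rw [inclTyp_eq v, Finsupp.linearCombination_apply, Finsupp.linearCombination_apply,
          Finsupp.sum, Finsupp.sum, map_sum, ← Finset.sum_sub_distrib]
        refine Submodule.sum_mem _ fun w _ => ?_
        rw [map_smul, ← smul_sub]
        exact Submodule.smul_mem _ _ (hU' w)
      have := sub_mem hvmem h3
      rwa [sub_sub_cancel] at this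
  · refine LinearMap.mem_ker.1 ((Submodule.span_le.2 ?_ :
      Submodule.span A _ ≤ LinearMap.ker (straightLin (A := A) U)) h1)
    rintro _ ⟨w, hw, rfl⟩
    refine straightLin_of_ne U w ?_
    intro h
    exact hr (hw.symm.trans h)

section BaseChange

variable {R : Type*} [CommRing R] (φ : A →+* R)

theorem mapRingHom_smul (a : A) (x : TypAlg c A) :
    MonoidAlgebra.mapRingHom _ φ (a • x) = φ a • MonoidAlgebra.mapRingHom _ φ x := by
  rw [Algebra.smul_def, Algebra.smul_def, map_mul]
  congr 1
  exact RingHom.congr_fun (MonoidAlgebra.mapRingHom_comp_algebraMap φ) a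

theorem mapRingHom_of (w : FreeMonoid (ℤ × c.Sign)) :
    MonoidAlgebra.mapRingHom _ φ (MonoidAlgebra.of A _ w) = MonoidAlgebra.of R _ w := by
  rw [MonoidAlgebra.of_apply, MonoidAlgebra.mapRingHom_single, map_one]
  rfl

theorem mapRingHom_word2 (a : ℤ) (χ₁ : c.Sign) (b : ℤ) (χ₂ : c.Sign) :
    MonoidAlgebra.mapRingHom _ φ (word2 A a χ₁ b χ₂) = word2 R a χ₁ b χ₂ :=
  mapRingHom_of φ _

theorem mapRingHom_sigma2 (a : ℤ) (s₁ : ℤˣ) (b : ℤ) (s₂ : ℤˣ) :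
    MonoidAlgebra.mapRingHom _ φ (sigma2 c A a s₁ b s₂) = sigma2 c R a s₁ b s₂ := by
  simp only [sigma2, map_sum, mapRingHom_smul, mapRingHom_word2, map_intCast]

/-- Generators over R lift to generators over A. This is how well-definedness descends to R without
proving independence there. -/
theorem exists_rels_map_eq (t η : A) (x : TypAlg c R) (hx : x ∈ rels c R (φ t) (φ η)) :
    ∃ x₀ ∈ rels c A t η, MonoidAlgebra.mapRingHom _ φ x₀ = x := by
  have ht : ∀ x ∈ relTrivialSign c R (φ t), ∃ x₀ ∈ relTrivialSign c A t,
      MonoidAlgebra.mapRingHom _ φ x₀ = x := by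
    rintro x (⟨a, rfl⟩ | ⟨a, b, hab, rfl⟩)
    · exact ⟨_, Or.inl ⟨a, rfl⟩, by simp only [map_sub, mapRingHom_word2]⟩
    · exact ⟨_, Or.inr ⟨a, b, hab, rfl⟩,
        by simp only [map_sub, mapRingHom_smul, mapRingHom_word2, map_pow]⟩
  cases c with
  | unramHermitian => exact ht x hx
  | alternating => exact ht x hx
  | symmetric =>
    rcases hx with (⟨a, b, n, s₁, s₂, h, rfl⟩ | ⟨a, b, n, s, h, rfl⟩) | ⟨a, b, n, s, h, rfl⟩
    · exact ⟨_, Or.inl (Or.inl ⟨a, b, n, s₁, s₂, h, rfl⟩),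
        by simp only [map_sub, mapRingHom_smul, mapRingHom_sigma2, map_pow]⟩
    · exact ⟨_, Or.inl (Or.inr ⟨a, b, n, s, h, rfl⟩),
        by simp only [map_add, mapRingHom_smul, mapRingHom_sigma2, map_pow]⟩
    · exact ⟨_, Or.inr ⟨a, b, n, s, h, rfl⟩, by
        simp only [relHalf, map_add, map_sub, map_neg, mapRingHom_smul, mapRingHom_sigma2, map_pow]⟩

/-- Independence of canonical words over `A` gives a straightening map over every `A`-algebra. -/
theorem exists_str_of_independent (hA : IsUnit (Nat.card c.Sign : A)) (t η : A)
    (hind : Independent c r t η) :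
    ∃ str : (Typ c r →₀ R) →ₗ[R] (Typ0 c r →₀ R),
      (∀ v, inclTyp R r v ∈ relSub c (φ t) (φ η) → str v = 0) ∧
      (∀ w, Antitone (expo w) → str (Finsupp.single w 1) = Finsupp.single (toTyp0 w) 1) ∧
      (∀ w τ, str (Finsupp.single w 1) τ ≠ 0 →
        ∃ w', Antitone (expo w') ∧ Dominates (expo w') (expo w) ∧ toTyp0 w' = τ) := by
  classical
  choose U hU hU' using exists_straight (r := r) hA t η
  have hcan : ∀ w, ∀ w' ∈ (U w).support, IsCanonical w' := fun w w' hw' => (hU w w' hw').1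
  -- Words are straightened over A, and the coefficients are then pushed to R.
  let V : Typ c r → (Typ c r →₀ R) := fun w => (U w).mapRange φ (map_zero φ)
  have hVsupp : ∀ w, (V w).support ⊆ (U w).support := fun w => Finsupp.support_mapRange
  have hbase : ∀ y : TypAlg c A, straightLin V (MonoidAlgebra.mapRingHom _ φ y) =
      (straightLin U y).mapRange φ (map_zero φ) := by
    intro y
    have hy : y ∈ Submodule.span A (Set.range (MonoidAlgebra.of A (FreeMonoid (ℤ × c.Sign)))) := by
      rw [span_of_words]; trivial
    induction hy using Submodule.span_induction with
    | zero => simp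
    | add x y _ _ hx hy =>
      rw [map_add, map_add, map_add, hx, hy, Finsupp.mapRange_add (fun a b => map_add φ a b)]
    | smul a x _ hx =>
      rw [mapRingHom_smul, map_smul, map_smul, hx]
      ext w
      simp
    | mem x hx =>
      obtain ⟨w, rfl⟩ := hx
      rw [mapRingHom_of]
      by_cases h : w.toList.length = r
      · obtain ⟨w', hw'⟩ := exists_ofFn_eq w.toList h
        obtain rfl : FreeMonoid.ofList (List.ofFn w') = w := by rw [hw']; rfl
        exact (straightLin_wordOf V w').trans
          (congrArg (fun u => Finsupp.mapRange φ (map_zero φ) u) (straightLin_wordOf U w').symm)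
      · rw [straightLin_of_ne V w h, straightLin_of_ne U w h]
        simp
  have hsingle : ∀ w, Finsupp.linearCombination R V (Finsupp.single w 1) = V w := fun w => by
    rw [Finsupp.linearCombination_single, one_smul]
  refine ⟨Finsupp.lmapDomain R R toTyp0 ∘ₗ Finsupp.linearCombination R V, ?_, ?_, ?_⟩
  · intro v hv
    rw [LinearMap.comp_apply, ← straightLin_inclTyp, map_eq_zero_of_mem_span (rels c R (φ t) (φ η))
      (straightLin V) ?_ hv, map_zero]
    intro x hx w₁ w₂
    obtain ⟨x₀, hx₀, rfl⟩ := exists_rels_map_eq φ t η x hx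
    rw [← mapRingHom_of φ, ← mapRingHom_of φ, ← map_mul, ← map_mul, hbase,
      straightLin_sandwich_eq_zero t η hind U hcan hU' x₀ hx₀]
    simp
  · intro w hw
    obtain ⟨w', h1, -, h3, h4⟩ := exists_canonical hA t η w hw
    -- Both sides are canonical representatives of w, and independence makes these unique.
    have hUw : U w = Finsupp.single w' 1 := by
      rw [← sub_eq_zero]
      apply hind
      · intro w'' hw''
        rcases Finset.mem_union.1 (Finsupp.support_sub hw'') with h | h
        · exact hcan w w'' h
        · have := Finsupp.support_single_subset h
          rw [Finset.mem_singleton] at this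
          rwa [this]
      · rw [map_sub, inclTyp_single, one_smul]
        have := sub_mem h4 (hU' w)
        rwa [sub_sub_sub_cancel_left] at this
    rw [LinearMap.comp_apply, hsingle]
    simp only [V, hUw, Finsupp.mapRange_single, map_one, Finsupp.lmapDomain_apply,
      Finsupp.mapDomain_single, h3]
  · intro w τ hτ
    rw [LinearMap.comp_apply, hsingle, Finsupp.lmapDomain_apply] at hτ
    obtain ⟨w', hw', rfl⟩ := Finset.mem_image.1 (Finsupp.mapDomain_support
      (Finsupp.mem_support_iff.2 hτ))
    have := hU w w' (hVsupp w hw')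
    exact ⟨w', this.1.1, this.2, rfl⟩

end BaseChange

/-- Independence over the universal ring. -/
theorem independent_polynomial (c : FormType) (r : ℕ) (ε : ℤˣ) :
    Independent c r (A := Polynomial (Localization.Away (Nat.card c.Sign : ℤ))) Polynomial.X
      ((ε : ℤ) : _) := by
  have hcard : (Nat.card c.Sign : ℤ) ≠ 0 := by
    exact_mod_cast Nat.card_pos.ne'
  have hu : IsUnit (Int.castRingHom ℚ (Nat.card c.Sign : ℤ)) := by
    rw [isUnit_iff_ne_zero]
    simp
  let ψ : Localization.Away (Nat.card c.Sign : ℤ) →+* ℚ :=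
    IsLocalization.Away.lift (Nat.card c.Sign : ℤ) hu
  have hψ : Function.Injective ψ := by
    refine (IsLocalization.lift_injective_iff _).2 fun x y => ?_
    rw [(IsLocalization.injective (Localization.Away (Nat.card c.Sign : ℤ))
      (powers_le_nonZeroDivisors_of_noZeroDivisors hcard)).eq_iff]
    simp
  let Ψ : Polynomial (Localization.Away (Nat.card c.Sign : ℤ)) →+* LaurentSeries ℚ :=
    Polynomial.eval₂RingHom ((HahnSeries.C : ℚ →+* LaurentSeries ℚ).comp ψ) (lX ^ relExp c)⁻¹
  have hpow : ∀ n : ℕ, ((lX ^ relExp c)⁻¹ : LaurentSeries ℚ) ^ n =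
      HahnSeries.single (-(relExp c * n : ℕ) : ℤ) 1 := by
    intro n
    rw [inv_pow, ← pow_mul, inv_eq_iff_eq_inv, eq_comm]
    refine inv_eq_of_mul_eq_one_left ?_
    rw [lX, HahnSeries.single_pow, HahnSeries.single_mul_single]
    simp
  have hpos : (relExp c : ℤ) ≠ 0 := by cases c <;> simp [relExp]
  -- The m-th coefficient of a polynomial is the Laurent coefficient at −m times `relExp`; these
  -- positions are distinct because `relExp` is nonzero.
  have hΨ : Function.Injective Ψ := by
    rw [injective_iff_map_eq_zero]
    intro p hp
    ext m
    have h1 : (Ψ p).coeff (-(relExp c * m : ℕ) : ℤ) = ψ (p.coeff m) := by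
      change (Polynomial.eval₂ ((HahnSeries.C : ℚ →+* LaurentSeries ℚ).comp ψ)
        (lX ^ relExp c)⁻¹ p : LaurentSeries ℚ).coeff _ = _
      rw [Polynomial.eval₂_eq_sum, Polynomial.sum, HahnSeries.coeff_sum]
      rw [Finset.sum_eq_single m]
      · rw [hpow, RingHom.comp_apply, HahnSeries.C_apply, HahnSeries.single_mul_single, zero_add,
          mul_one, HahnSeries.coeff_single_same]
      · intro b _ hb
        rw [hpow, RingHom.comp_apply, HahnSeries.C_apply, HahnSeries.single_mul_single, zero_add,
          mul_one, HahnSeries.coeff_single_of_ne]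
        push_cast
        intro h
        have h2 : (relExp c : ℤ) * (m : ℤ) = relExp c * b := by linarith
        have h3 := mul_left_cancel₀ hpos h2
        exact hb (by exact_mod_cast h3.symm)
      · intro hm
        rw [Polynomial.notMem_support_iff.1 hm]
        simp
    rw [hp] at h1
    apply hψ
    rw [← h1]
    simp
  intro u hu hrel
  let : Algebra (Polynomial (Localization.Away (Nat.card c.Sign : ℤ))) (LaurentSeries ℚ) :=
    RingHom.toAlgebra Ψ
  refine eq_zero_of_mem_rels (A := Polynomial (Localization.Away (Nat.card c.Sign : ℤ))) hΨ ε
    Polynomial.X ?_ u hu hrel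
  change Ψ Polynomial.X = _
  simp [Ψ]

theorem exists_str_of_independent_polynomial {R L : Type*} [CommRing R] [CommRing L] (φ : L →+* R)
    (hL : IsUnit (Nat.card c.Sign : L)) (t : R) (ε : ℤˣ)
    (hind : Independent c r (A := Polynomial L) Polynomial.X ((ε : ℤ) : Polynomial L)) :
    ∃ str : (Typ c r →₀ R) →ₗ[R] (Typ0 c r →₀ R),
      (∀ v, inclTyp R r v ∈ relSub c t ((ε : ℤ) : R) → str v = 0) ∧
      (∀ w, Antitone (expo w) → str (Finsupp.single w 1) = Finsupp.single (toTyp0 w) 1) ∧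
      (∀ w τ, str (Finsupp.single w 1) τ ≠ 0 →
        ∃ w', Antitone (expo w') ∧ Dominates (expo w') (expo w) ∧ toTyp0 w' = τ) := by
  have hA : IsUnit (Nat.card c.Sign : Polynomial L) := by
    have := hL.map (Polynomial.C : L →+* Polynomial L)
    rwa [map_natCast] at this
  have h := exists_str_of_independent (r := r) (Polynomial.eval₂RingHom φ t) hA Polynomial.X
    ((ε : ℤ) : Polynomial L) hind
  have h1 : Polynomial.eval₂RingHom φ t Polynomial.X = t := Polynomial.eval₂_X _ _
  rwa [h1, map_intCast] at h

/-- The straightening map. -/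
theorem exists_str {R : Type*} [CommRing R] (hR : IsUnit (Nat.card c.Sign : R)) (t : R) (ε : ℤˣ) :
    ∃ str : (Typ c r →₀ R) →ₗ[R] (Typ0 c r →₀ R),
      (∀ v, inclTyp R r v ∈ relSub c t ((ε : ℤ) : R) → str v = 0) ∧
      (∀ w, Antitone (expo w) → str (Finsupp.single w 1) = Finsupp.single (toTyp0 w) 1) ∧
      (∀ w τ, str (Finsupp.single w 1) τ ≠ 0 →
        ∃ w', Antitone (expo w') ∧ Dominates (expo w') (expo w) ∧ toTyp0 w' = τ) := by
  have hu : IsUnit (Int.castRingHom R (Nat.card c.Sign : ℤ)) := by rwa [map_natCast]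
  have hL : IsUnit (Nat.card c.Sign : Localization.Away (Nat.card c.Sign : ℤ)) := by
    have h1 := IsLocalization.Away.algebraMap_isUnit
      (S := Localization.Away (Nat.card c.Sign : ℤ)) (Nat.card c.Sign : ℤ)
    rwa [map_natCast] at h1
  exact exists_str_of_independent_polynomial
    (IsLocalization.Away.lift (Nat.card c.Sign : ℤ) hu) hL t ε (independent_polynomial c r ε)

end Str


/-! ### Types, dominance, characters and triangular families. -/

/-! ### Exponents of types -/

section Exponents

variable {c : FormType} {r : ℕ}

theorem toMultiset_sum_single (e : Fin r → ℤ) :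
    Finsupp.toMultiset (∑ k, Finsupp.single (e k) 1) = (List.ofFn e : Multiset ℤ) := by
  rw [map_sum, ← Fin.univ_val_map]
  simp only [Finsupp.toMultiset_single, one_smul]
  rw [← Multiset.sum_map_singleton (Multiset.map e _), Multiset.map_map]
  rfl

theorem pairwise_ofFn_of_antitone {e : Fin r → ℤ} (he : Antitone e) :
    (List.ofFn e).Pairwise (· ≥ ·) :=
  List.pairwise_ofFn.2 fun _ _ h => he h.le

/-- The exponents of a weakly decreasing word are determined by its type. -/
theorem expo_eq_of_toTyp0_eq {w w' : Typ c r} (hw : Antitone (expo w)) (hw' : Antitone (expo w'))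
    (h : toTyp0 w = toTyp0 w') : expo w = expo w' := by
  have h1 : ∑ k, Finsupp.single (expo w k) 1 = ∑ k, Finsupp.single (expo w' k) 1 :=
    congrArg Typ0.e h
  have h2 := congrArg Finsupp.toMultiset h1
  rw [toMultiset_sum_single, toMultiset_sum_single, Multiset.coe_eq_coe] at h2
  exact List.ofFn_injective (List.Perm.eq_of_pairwise (fun a b _ _ h h' => le_antisymm h' h)
    (pairwise_ofFn_of_antitone hw) (pairwise_ofFn_of_antitone hw') h2)

theorem exists_antitone_exponents (f : ℤ →₀ ℕ) (hf : (f.sum fun _ m => m) = r) :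
    ∃ e : Fin r → ℤ, Antitone e ∧ ∑ k, Finsupp.single (e k) 1 = f := by
  have hlen : ((Finsupp.toMultiset f).sort (· ≥ ·)).length = r := by
    rw [Multiset.length_sort, Finsupp.card_toMultiset]
    exact hf
  obtain ⟨e, he⟩ := exists_ofFn_eq _ hlen
  refine ⟨e, ?_, ?_⟩
  · have h1 := Multiset.pairwise_sort (Finsupp.toMultiset f) (· ≥ ·)
    rw [← he, List.pairwise_ofFn] at h1
    intro i j hij
    rcases hij.lt_or_eq with h | rfl
    · exact h1 h
    · exact le_rfl
  · apply Multiset.toFinsupp.symm.injective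
    change Finsupp.toMultiset _ = Finsupp.toMultiset f
    rw [toMultiset_sum_single, he, Multiset.sort_eq]

theorem exists_antitone_toTyp0_eq (τ : Typ0 c r) :
    ∃ w : Typ c r, Antitone (expo w) ∧ toTyp0 w = τ := by
  classical
  obtain ⟨e, he, hef⟩ := exists_antitone_exponents τ.e τ.sum_e
  -- The whole sign of a block is placed on the first letter of its run.
  let χ : Fin r → c.Sign := fun k => if ∀ j < k, e j ≠ e k then τ.χ (e k) else 1
  refine ⟨fun k => (e k, χ k), he, ?_⟩
  have h2 : ∀ i, ∏ k with e k = i, χ k = τ.χ i := by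
    intro i
    by_cases hi : ∃ k, e k = i
    · have hne : (Finset.univ.filter fun k => e k = i).Nonempty := by
        obtain ⟨k, hk⟩ := hi
        exact ⟨k, by simp [hk]⟩
      set k₀ := (Finset.univ.filter fun k => e k = i).min' hne with hk₀
      have hk₀m : k₀ ∈ Finset.univ.filter fun k => e k = i := Finset.min'_mem _ _
      have hek : e k₀ = i := (Finset.mem_filter.1 hk₀m).2
      rw [Finset.prod_eq_single_of_mem k₀ hk₀m]
      · simp only [χ]
        rw [if_pos, hek]
        intro j hj hje
        exact absurd (Finset.min'_le _ j (by simp [hje, hek])) (not_le.2 hj)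
      · intro k hk hkk
        simp only [χ]
        rw [if_neg]
        intro hcon
        refine hcon k₀ (lt_of_le_of_ne (Finset.min'_le _ k hk) (Ne.symm hkk)) ?_
        rw [hek, (Finset.mem_filter.1 hk).2]
    · rw [Finset.filter_false_of_mem, Finset.prod_empty]
      · refine (τ.χ_eq_one i ?_).symm
        rw [← hef, Finsupp.finsetSum_apply]
        refine Finset.sum_eq_zero fun k _ => ?_
        rw [Finsupp.single_apply, if_neg fun h => hi ⟨k, h⟩]
      · intro k _ hk
        exact hi ⟨k, hk⟩
  obtain ⟨τe, τχ, h1, h2'⟩ := τ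
  simp only at hef h2
  simp only [toTyp0, Typ0.mk.injEq]
  exact ⟨hef, funext h2⟩

/-- Partial sums. -/
def psum (e : Fin r → ℤ) (k : ℕ) : ℤ := ∑ j ∈ Finset.univ.filter (fun j : Fin r => (j : ℕ) < k), e j

theorem psum_succ (e : Fin r → ℤ) (j : Fin r) : psum e (j + 1) = psum e j + e j := by
  have : Finset.univ.filter (fun i : Fin r => (i : ℕ) < j + 1) =
      insert j (Finset.univ.filter fun i : Fin r => (i : ℕ) < j) := by
    ext i
    simp only [Finset.mem_filter, Finset.mem_univ, true_and, Finset.mem_insert, Fin.ext_iff]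
    omega
  rw [psum, this, Finset.sum_insert (by simp), add_comm]
  rfl

theorem psum_of_le (e : Fin r → ℤ) {k : ℕ} (hk : r ≤ k) : psum e k = ∑ j, e j := by
  rw [psum, Finset.filter_true_of_mem]
  intro j _
  omega

theorem Dominates.antisymm {e e' : Fin r → ℤ} (h : Dominates e e') (h' : Dominates e' e) :
    e = e' := by
  have h1 : ∀ k, psum e k = psum e' k := fun k => le_antisymm (h'.1 k) (h.1 k)
  funext j
  have h2 := psum_succ e j
  have h3 := psum_succ e' j
  rw [h1, h1] at h2
  linarith

theorem Dominates.add_right {e e' : Fin r → ℤ} (h : Dominates e e') (d : Fin r → ℤ) :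
    Dominates (e + d) (e' + d) := by
  constructor
  · intro k
    simp only [Pi.add_apply, Finset.sum_add_distrib]
    exact add_le_add_left (h.1 k) _
  · simp only [Pi.add_apply, Finset.sum_add_distrib]
    rw [h.2]

/-- The sum of all partial sums. -/
def height (e : Fin r → ℤ) : ℤ := ∑ k ∈ Finset.range (r + 1), psum e k

/-- `height` linearizes the dominance order strictly, so inductions and extremal choices can use an
integer. -/
theorem Dominates.height_lt {e e' : Fin r → ℤ} (h : Dominates e e') (hne : e ≠ e') :
    height e' < height e := by
  refine Finset.sum_lt_sum (fun k _ => h.1 k) ?_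
  by_contra! hcon
  refine hne (h.antisymm ⟨fun k => ?_, h.2.symm⟩)
  change psum e k ≤ psum e' k
  by_cases hk : k < r + 1
  · exact hcon k (Finset.mem_range.2 hk)
  · rw [psum_of_le e (by omega), psum_of_le e' (by omega), h.2]

/-- A partial sum may have fewer than r terms, so the bound rM on it requires M ≤ 0. -/
theorem height_ge {e : Fin r → ℤ} {M : ℤ} (hM0 : M ≤ 0) (hM : ∀ j, M ≤ e j) :
    ((r : ℤ) + 1) * (r * M) ≤ height e := by
  have h1 : ∀ k, (r : ℤ) * M ≤ psum e k := by
    intro k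
    have h2 : ∑ j ∈ Finset.univ.filter (fun j : Fin r => (j : ℕ) < k), M ≤ psum e k :=
      Finset.sum_le_sum fun j _ => hM j
    rw [Finset.sum_const, nsmul_eq_mul] at h2
    have h3 : (Finset.univ.filter fun j : Fin r => (j : ℕ) < k).card ≤ r := by
      simpa using Finset.card_filter_le (Finset.univ : Finset (Fin r)) fun j => (j : ℕ) < k
    refine le_trans ?_ h2
    exact mul_le_mul_of_nonpos_right (by exact_mod_cast h3) hM0
  have h4 : ∑ _k ∈ Finset.range (r + 1), (r : ℤ) * M ≤ height e :=
    Finset.sum_le_sum fun k _ => h1 k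
  rw [Finset.sum_const, Finset.card_range, nsmul_eq_mul] at h4
  exact_mod_cast h4

/-- The last entry is the total minus a partial sum, so it can only grow when passing to dominated
exponents; for weakly decreasing exponents it is the smallest entry. -/
theorem Dominates.le_of_antitone {e e' : Fin r → ℤ} (h : Dominates e e') (he' : Antitone e')
    {M : ℤ} (hM : ∀ j, M ≤ e j) (j : Fin r) : M ≤ e' j := by
  have hr : 0 < r := j.pos
  set l : Fin r := ⟨r - 1, by omega⟩ with hl
  have h1 := psum_succ e l
  have h2 := psum_succ e' l
  have h3 : psum e' l ≤ psum e l := h.1 l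
  rw [psum_of_le e (by simp [hl]; omega), ← h.2] at h1
  rw [psum_of_le e' (by simp [hl]; omega)] at h2
  have h4 : e' l ≤ e' j := he' (by simp [Fin.le_def, hl]; omega)
  have h5 := hM l
  omega

end Exponents

/-! ### Characters -/

section Characters

theorem sum_hom_units {G : Type*} [Group G] [Fintype G] (s : G →* ℤˣ) [Decidable (s = 1)] :
    ∑ g, ((s g : ℤˣ) : ℤ) = if s = 1 then (Nat.card G : ℤ) else 0 := by
  split_ifs with h
  · subst h
    simp
  · obtain ⟨g₀, hg₀⟩ : ∃ g, s g ≠ 1 := by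
      by_contra! hcon
      exact h (MonoidHom.ext hcon)
    have h1 : s g₀ = -1 := (Int.units_eq_one_or _).resolve_left hg₀
    have h2 : ∑ g, ((s g : ℤˣ) : ℤ) = ∑ g, ((s (g₀ * g) : ℤˣ) : ℤ) :=
      (Fintype.sum_equiv (Equiv.mulLeft g₀) _ _ fun g => rfl).symm
    simp only [map_mul, h1, neg_mul, one_mul, Units.val_neg, Finset.sum_neg_distrib] at h2
    omega

variable {c : FormType} {r : ℕ}

/-- The products of signs over equal exponents. -/
def blockHom (c : FormType) (e : Fin r → ℤ) : (Fin r → c.Sign) →* (ℤ → c.Sign) where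
  toFun χ m := ∏ k with e k = m, χ k
  map_one' := by funext m; simp
  map_mul' χ χ' := by funext m; simp [Finset.prod_mul_distrib]

theorem toTyp0_eq_iff (e : Fin r → ℤ) (χ χ' : Fin r → c.Sign) :
    toTyp0 (fun k => (e k, χ k)) = toTyp0 (fun k => (e k, χ' k)) ↔
      blockHom c e χ = blockHom c e χ' := by
  simp only [toTyp0, Typ0.mk.injEq, true_and]
  rfl

instance : Fintype ((Fin r → c.Sign) →* ℤˣ) := Fintype.ofFinite _

theorem hom_mul_eq_one_iff {G : Type*} [Group G] (s s' : G →* ℤˣ) : s * s' = 1 ↔ s = s' := by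
  constructor
  · intro h
    ext g
    have h1 := DFunLike.congr_fun h g
    simp only [MonoidHom.mul_apply, MonoidHom.one_apply] at h1
    rw [eq_inv_of_mul_eq_one_left h1, Int.units_inv_eq_self]
  · rintro rfl
    ext g
    simp [← pow_two]

open Classical in
theorem sum_signs_mul (s s' : (Fin r → c.Sign) →* ℤˣ) :
    ∑ χ, ((s χ : ℤˣ) : ℤ) * ((s' χ : ℤˣ) : ℤ) =
      if s = s' then (Nat.card (Fin r → c.Sign) : ℤ) else 0 := by
  have h1 := sum_hom_units (s * s')
  simp only [hom_mul_eq_one_iff, MonoidHom.mul_apply, Units.val_mul] at h1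
  exact h1

open Classical in
theorem sum_chars_mul (χ χ' : Fin r → c.Sign) :
    ∑ s : (Fin r → c.Sign) →* ℤˣ, ((s χ : ℤˣ) : ℤ) * ((s χ' : ℤˣ) : ℤ) =
      if χ = χ' then (Nat.card ((Fin r → c.Sign) →* ℤˣ) : ℤ) else 0 := by
  have h1 := sum_hom_units ((MonoidHom.eval χ : ((Fin r → c.Sign) →* ℤˣ) →* ℤˣ) * MonoidHom.eval χ')
  have h2 : (MonoidHom.eval χ : ((Fin r → c.Sign) →* ℤˣ) →* ℤˣ) * MonoidHom.eval χ' = 1 ↔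
      χ = χ' := by
    rw [hom_mul_eq_one_iff]
    constructor
    · intro h
      funext j
      have h3 := DFunLike.congr_fun h (c.signGroup.subtype.comp (Pi.evalMonoidHom _ j))
      exact Subtype.ext h3
    · rintro rfl; rfl
  simp only [h2, MonoidHom.mul_apply, Units.val_mul, MonoidHom.eval_apply_apply] at h1
  exact h1

theorem isUnit_card_signs {R : Type*} [CommRing R] (hR : IsUnit (Nat.card c.Sign : R)) :
    IsUnit (Nat.card (Fin r → c.Sign) : R) := by
  rw [Nat.card_fun, Nat.cast_pow]
  exact hR.pow _

/-- The character group has exponent dividing two, so its order is a power of 2; outside the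
symmetric case it is trivial. -/
theorem isUnit_card_chars {R : Type*} [CommRing R] (hR : IsUnit (Nat.card c.Sign : R)) :
    IsUnit (Nat.card ((Fin r → c.Sign) →* ℤˣ) : R) := by
  by_cases hc : c = .symmetric
  · have h2 := isUnit_two_of_symmetric hc hR
    have hp : IsPGroup 2 ((Fin r → c.Sign) →* ℤˣ) := fun s => ⟨1, by
      ext g
      simp⟩
    haveI : Fact (Nat.Prime 2) := ⟨Nat.prime_two⟩
    obtain ⟨n, hn⟩ := IsPGroup.iff_card.1 hp
    rw [hn, Nat.cast_pow]
    exact h2.pow _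
  · have := subsingleton_sign hc
    have : Subsingleton ((Fin r → c.Sign) →* ℤˣ) := ⟨fun s s' => by
      refine MonoidHom.ext fun g => ?_
      rw [Subsingleton.elim g 1, map_one, map_one]⟩
    rw [Nat.card_of_subsingleton 1, Nat.cast_one]
    exact isUnit_one

/-- The character `s` is trivial on signs with trivial block products. -/
def Admissible (e : Fin r → ℤ) (s : (Fin r → c.Sign) →* ℤˣ) : Prop :=
  ∀ χ, blockHom c e χ = 1 → s χ = 1

theorem isUnit_card_ker {R : Type*} [CommRing R] (hR : IsUnit (Nat.card c.Sign : R))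
    (e : Fin r → ℤ) : IsUnit (Nat.card (blockHom c e).ker : R) :=
  isUnit_of_dvd_unit (Nat.cast_dvd_cast (Subgroup.card_subgroup_dvd_card _))
    (isUnit_card_signs hR)

-- The fibres of `blockHom` are cosets of its kernel, and a character sums to zero over the kernel
-- unless it is trivial there.
open Classical in
theorem sum_block (e : Fin r → ℤ) (s : (Fin r → c.Sign) →* ℤˣ) (χ : Fin r → c.Sign) :
    ∑ χ' with blockHom c e χ = blockHom c e χ', ((s χ' : ℤˣ) : ℤ) =
      ((s χ : ℤˣ) : ℤ) * if Admissible e s then (Nat.card (blockHom c e).ker : ℤ) else 0 := by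
  have h1 := sum_hom_units (s.comp (blockHom c e).ker.subtype)
  have h2 : s.comp (blockHom c e).ker.subtype = 1 ↔ Admissible e s := by
    constructor
    · intro h χ hχ
      exact DFunLike.congr_fun h ⟨χ, hχ⟩
    · intro h
      ext ⟨χ, hχ⟩
      exact congrArg Units.val (h χ hχ)
  simp only [h2] at h1
  rw [← h1, Finset.mul_sum]
  symm
  refine Finset.sum_bij (fun κ _ => χ * (κ : Fin r → c.Sign)) ?_ ?_ ?_ ?_
  · intro κ _
    have := κ.2
    rw [MonoidHom.mem_ker] at this
    simp [this]
  · intro κ _ κ' _ h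
    exact Subtype.ext (mul_left_cancel h)
  · intro χ' hχ'
    have h3 := (Finset.mem_filter.1 hχ').2
    refine ⟨⟨χ⁻¹ * χ', ?_⟩, Finset.mem_univ _, by simp⟩
    rw [MonoidHom.mem_ker, map_mul, map_inv, h3, inv_mul_cancel]
  · intro κ _
    simp

/-- The components of a character. -/
def charComp (s : (Fin r → c.Sign) →* ℤˣ) (i : Fin r) : c.Sign →* ℤˣ :=
  s.comp (MonoidHom.mulSingle (fun _ => c.Sign) i)

theorem char_eq_prod (s : (Fin r → c.Sign) →* ℤˣ) (χ : Fin r → c.Sign) :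
    s χ = ∏ i, charComp s i (χ i) := by
  conv_lhs => rw [← Finset.univ_prod_mulSingle χ]
  rw [map_prod]
  rfl

/-- The signs equal to x at two neighbours of the same exponent and trivial elsewhere have trivial
block products, as x² = 1. Conversely, when components are constant along blocks, s factors through
the block products. -/
theorem admissible_iff {e : Fin r → ℤ} (he : Antitone e) (s : (Fin r → c.Sign) →* ℤˣ) :
    Admissible e s ↔ ∀ i j : Fin r, (i : ℕ) + 1 = j → e i = e j → charComp s i = charComp s j := by
  classical
  constructor
  · intro h i j hij heij
    have hne : i ≠ j := fun e => by rw [e] at hij; omega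
    ext x
    have h1 := h (Pi.mulSingle i x * Pi.mulSingle j x) (by
      funext m
      change ∏ k with e k = m, (Pi.mulSingle i x * Pi.mulSingle j x : Fin r → c.Sign) k = 1
      simp only [Pi.mul_apply, Finset.prod_mul_distrib, Finset.prod_pi_mulSingle',
        Finset.mem_filter, Finset.mem_univ, true_and]
      rw [heij]
      split_ifs
      · exact sign_mul_self x
      · exact one_mul 1)
    rw [map_mul] at h1
    change charComp s i x * charComp s j x = 1 at h1
    rw [eq_inv_of_mul_eq_one_left h1, Int.units_inv_eq_self]
  · intro h χ hχ
    have hconst : ∀ i j : Fin r, i ≤ j → e i = e j → charComp s i = charComp s j := by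
      intro i ⟨j, hj⟩ hij heij
      induction j with
      | zero =>
        have : i = ⟨0, hj⟩ := Fin.ext (by simpa [Fin.le_def] using hij)
        rw [this]
      | succ j ih =>
        by_cases hi : (i : ℕ) = j + 1
        · have : i = ⟨j + 1, hj⟩ := Fin.ext hi
          rw [this]
        · have hij' : i ≤ ⟨j, by omega⟩ := by
            simp only [Fin.le_def] at hij ⊢
            omega
          have h1 : e ⟨j, by omega⟩ = e ⟨j + 1, hj⟩ := by
            refine le_antisymm ?_ (he (by simp [Fin.le_def]))
            rw [← heij]
            exact he hij'
          rw [ih (by omega) hij' (heij.trans h1.symm)]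
          exact h _ _ rfl h1
    have hconst' : ∀ i j : Fin r, e i = e j → charComp s i = charComp s j := by
      intro i j hij
      rcases le_total i j with h | h
      · exact hconst i j h hij
      · exact (hconst j i h hij.symm).symm
    rw [char_eq_prod, ← Finset.prod_fiberwise_of_maps_to
      (fun i (_ : i ∈ Finset.univ) => Finset.mem_image_of_mem e (Finset.mem_univ i))]
    refine Finset.prod_eq_one fun m hm => ?_
    obtain ⟨i₀, -, rfl⟩ := Finset.mem_image.1 hm
    have h1 : ∀ i ∈ Finset.univ.filter (fun i => e i = e i₀),
        charComp s i (χ i) = charComp s i₀ (χ i) := fun i hi => by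
      rw [hconst' i i₀ (Finset.mem_filter.1 hi).2]
    rw [Finset.prod_congr rfl h1, ← map_prod]
    have h2 := congrFun hχ (e i₀)
    change ∏ k with e k = e i₀, χ k = 1 at h2
    rw [h2, map_one]

end Characters


/-! ### Triangular families -/

section Triangular

variable {c : FormType} {r : ℕ} {R : Type*} [CommRing R]

variable (R) in
/-- The image of `δ_s(e)` in `R[Typ⁰_r]`. -/
def dvec (e : Fin r → ℤ) (s : (Fin r → c.Sign) →* ℤˣ) : Typ0 c r →₀ R :=
  ∑ χ, Finsupp.single (toTyp0 fun k => (e k, χ k)) (((s χ : ℤˣ) : ℤ) : R)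

/-- `f` is supported on types whose exponents are dominated by `e`. -/
def SuppLE (f : Typ0 c r →₀ R) (e : Fin r → ℤ) : Prop :=
  ∀ w : Typ c r, Antitone (expo w) → f (toTyp0 w) ≠ 0 → Dominates e (expo w)

open Classical in
theorem dvec_apply (e : Fin r → ℤ) (s : (Fin r → c.Sign) →* ℤˣ) (χ : Fin r → c.Sign) :
    dvec R e s (toTyp0 fun k => (e k, χ k)) = (((s χ : ℤˣ) : ℤ) : R) *
      if Admissible e s then (Nat.card (blockHom c e).ker : R) else 0 := by
  have h := congrArg (Int.cast : ℤ → R) (sum_block e s χ)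
  rw [Finset.sum_filter] at h
  push_cast at h
  rw [← h, dvec, Finsupp.finsetSum_apply]
  refine Finset.sum_congr rfl fun χ' _ => ?_
  rw [Finsupp.single_apply]
  simp only [toTyp0_eq_iff]
  by_cases h1 : blockHom c e χ' = blockHom c e χ
  · rw [if_pos h1, if_pos h1.symm]
  · rw [if_neg h1, if_neg (Ne.symm h1)]

theorem exists_of_dvec_ne_zero {e : Fin r → ℤ} {s : (Fin r → c.Sign) →* ℤˣ} {τ : Typ0 c r}
    (h : dvec R e s τ ≠ 0) : ∃ χ : Fin r → c.Sign, τ = toTyp0 fun k => (e k, χ k) := by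
  rw [dvec, Finsupp.finsetSum_apply] at h
  obtain ⟨χ, -, hχ⟩ := Finset.exists_ne_zero_of_sum_ne_zero h
  exact ⟨χ, (Finsupp.single_apply_ne_zero.1 hχ).1⟩

theorem suppLE_dvec {e : Fin r → ℤ} (he : Antitone e) (s : (Fin r → c.Sign) →* ℤˣ) :
    SuppLE (dvec R e s) e := by
  intro w hw h
  obtain ⟨χ, hχ⟩ := exists_of_dvec_ne_zero h
  rw [expo_eq_of_toTyp0_eq (w' := fun k => (e k, χ k)) hw he hχ]
  exact Dominates.refl _

theorem dvec_eq_zero {e : Fin r → ℤ} {s : (Fin r → c.Sign) →* ℤˣ} (h : ¬ Admissible e s) :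
    dvec R e s = 0 := by
  classical
  ext τ
  by_contra hne
  obtain ⟨χ, rfl⟩ := exists_of_dvec_ne_zero hne
  rw [dvec_apply, if_neg h, mul_zero] at hne
  exact hne rfl

/-- Fourier inversion over all characters of the signs: a single type is recovered from the δ_s(e)
up to an invertible integer. -/
theorem sum_smul_dvec (e : Fin r → ℤ) (χ : Fin r → c.Sign) :
    ∑ s, (((s χ : ℤˣ) : ℤ) : R) • dvec R e s =
      Finsupp.single (toTyp0 fun k => (e k, χ k))
        (Nat.card ((Fin r → c.Sign) →* ℤˣ) : R) := by
  classical
  simp only [dvec, Finset.smul_sum, Finsupp.smul_single, smul_eq_mul]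
  rw [Finset.sum_comm]
  have h : ∀ χ' : Fin r → c.Sign,
      ∑ s : (Fin r → c.Sign) →* ℤˣ, (((s χ : ℤˣ) : ℤ) : R) * (((s χ' : ℤˣ) : ℤ) : R) =
        if χ = χ' then (Nat.card ((Fin r → c.Sign) →* ℤˣ) : R) else 0 := fun χ' => by
    have h := congrArg (Int.cast : ℤ → R) (sum_chars_mul χ χ')
    push_cast at h
    exact h
  rw [Finset.sum_eq_single_of_mem χ (Finset.mem_univ _)]
  · rw [← Finsupp.single_finsetSum, h, if_pos rfl]
  · intro χ' _ hne
    rw [← Finsupp.single_finsetSum, h, if_neg hne.symm, Finsupp.single_zero]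

theorem typ_eta (w : Typ c r) : (fun k => (expo w k, (w k).2)) = w := rfl

variable {ι : Type*} {idx : ι → (Fin r → ℤ) × ((Fin r → c.Sign) →* ℤˣ)} {v : ι → Typ0 c r →₀ R}
  {κ : ι → R}

/-- Dominance isolates the top exponents of a relation, and orthogonality of characters separates
the members of the family that share them. -/
theorem linearIndependent_of_triangular (hR : IsUnit (Nat.card c.Sign : R))
    (hinj : Function.Injective idx) (hanti : ∀ i, Antitone (idx i).1)
    (hsupp : ∀ i, SuppLE (v i) (idx i).1) (hκ : ∀ i, IsUnit (κ i))
    (hv : ∀ i χ, v i (toTyp0 fun k => ((idx i).1 k, χ k)) =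
      ((((idx i).2 χ : ℤˣ) : ℤ) : R) * κ i) :
    LinearIndependent R v := by
  classical
  rw [linearIndependent_iff']
  intro T g hg
  by_contra! hcon
  have hne : (T.filter fun i => g i ≠ 0).Nonempty := by
    obtain ⟨i, hi, hgi⟩ := hcon
    exact ⟨i, Finset.mem_filter.2 ⟨hi, hgi⟩⟩
  -- At exponents of maximal height, only members with exactly these leading exponents can be
  -- nonzero.
  obtain ⟨i₀, hi₀, hmax⟩ := Finset.exists_max_image _ (fun i => height (idx i).1) hne
  obtain ⟨hi₀T, hgi₀⟩ := Finset.mem_filter.1 hi₀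
  have h1 : ∀ χ : Fin r → c.Sign, ∑ i ∈ T.filter (fun i => (idx i).1 = (idx i₀).1),
      g i * (((((idx i).2 χ : ℤˣ) : ℤ) : R) * κ i) = 0 := by
    intro χ
    have h2 := DFunLike.congr_fun hg (toTyp0 fun k => ((idx i₀).1 k, χ k))
    rw [Finsupp.finsetSum_apply] at h2
    rw [← Finsupp.zero_apply (M := R) (a := toTyp0 fun k => ((idx i₀).1 k, χ k)), ← h2,
      Finset.sum_filter]
    refine Finset.sum_congr rfl fun i hi => ?_
    rw [Finsupp.smul_apply, smul_eq_mul]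
    split_ifs with he
    · rw [← he, hv]
    · by_contra hcon2
      have hg0 : g i ≠ 0 := fun h => hcon2 (by rw [h, zero_mul])
      have hv0 : v i (toTyp0 fun k => ((idx i₀).1 k, χ k)) ≠ 0 := fun h =>
        hcon2 (by rw [h, mul_zero])
      have h3 : Dominates (idx i).1 (idx i₀).1 := hsupp i (fun k => ((idx i₀).1 k, χ k)) (hanti i₀) hv0
      exact absurd (hmax i (Finset.mem_filter.2 ⟨hi, hg0⟩)) (not_le.2 (h3.height_lt he))
  -- Pairing with the character of i₀ leaves only i₀, because the index is determined by its
  -- exponents and character.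
  have h2 : ∑ χ : Fin r → c.Sign, ((((idx i₀).2 χ : ℤˣ) : ℤ) : R) *
      ∑ i ∈ T.filter (fun i => (idx i).1 = (idx i₀).1),
        g i * (((((idx i).2 χ : ℤˣ) : ℤ) : R) * κ i) = 0 := by simp [h1]
  simp only [Finset.mul_sum] at h2
  rw [Finset.sum_comm] at h2
  have h3 : ∀ i ∈ T.filter (fun i => (idx i).1 = (idx i₀).1),
      ∑ χ : Fin r → c.Sign, ((((idx i₀).2 χ : ℤˣ) : ℤ) : R) *
        (g i * (((((idx i).2 χ : ℤˣ) : ℤ) : R) * κ i)) =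
      if i = i₀ then g i₀ * κ i₀ * (Nat.card (Fin r → c.Sign) : R) else 0 := by
    intro i hi
    have h4 := congrArg (Int.cast : ℤ → R) (sum_signs_mul (idx i₀).2 (idx i).2)
    push_cast at h4
    have h5 : ∑ χ : Fin r → c.Sign, ((((idx i₀).2 χ : ℤˣ) : ℤ) : R) *
        (g i * (((((idx i).2 χ : ℤˣ) : ℤ) : R) * κ i)) = g i * κ i *
        ∑ χ : Fin r → c.Sign, ((((idx i₀).2 χ : ℤˣ) : ℤ) : R) *
          ((((idx i).2 χ : ℤˣ) : ℤ) : R) := by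
      rw [Finset.mul_sum]
      exact Finset.sum_congr rfl fun χ _ => by ring
    rw [h5, h4]
    have h6 : (idx i₀).2 = (idx i).2 ↔ i = i₀ :=
      ⟨fun h => hinj (Prod.ext (Finset.mem_filter.1 hi).2 h.symm), fun h => by rw [h]⟩
    simp only [h6]
    split_ifs with h7
    · rw [h7]
    · rw [mul_zero]
  have h4 : i₀ ∈ T.filter (fun i => (idx i).1 = (idx i₀).1) := Finset.mem_filter.2 ⟨hi₀T, rfl⟩
  rw [Finset.sum_congr rfl h3, Finset.sum_ite_eq', if_pos h4, mul_assoc] at h2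
  exact hgi₀ (((hκ i₀).mul (isUnit_card_signs hR)).mul_left_eq_zero.1 h2)

theorem span_eq_top_of_triangular (hR : IsUnit (Nat.card c.Sign : R))
    (hsurj : ∀ e s, Antitone e → Admissible e s → ∃ i, idx i = (e, s))
    (hsupp : ∀ i, SuppLE (v i) (idx i).1) (hκ : ∀ i, IsUnit (κ i))
    (hv : ∀ i χ, v i (toTyp0 fun k => ((idx i).1 k, χ k)) =
      ((((idx i).2 χ : ℤˣ) : ℤ) : R) * κ i) :
    Submodule.span R (Set.range v) = ⊤ := by
  classical
  set N := Submodule.span R (Set.range v) with hN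
  -- Induction on the height above the floor determined by M. Dominated weakly decreasing exponents
  -- keep the lower bound M, so the descent stops.
  have key : ∀ M : ℤ, M ≤ 0 → ∀ n : ℕ, ∀ w : Typ c r, Antitone (expo w) → (∀ j, M ≤ expo w j) →
      height (expo w) - (r + 1) * (r * M) < n → Finsupp.single (toTyp0 w) 1 ∈ N := by
    intro M hM n
    induction n with
    | zero =>
      intro w _ hw hn
      have := height_ge hM hw
      push_cast at hn
      omega
    | succ n ih =>
      intro w hwa hwM hn
      have hlow : ∀ f : Typ0 c r →₀ R, SuppLE f (expo w) →
          (∀ χ : Fin r → c.Sign, f (toTyp0 fun k => (expo w k, χ k)) = 0) → f ∈ N := by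
        intro f hf hf0
        rw [← f.sum_single]
        refine Submodule.sum_mem _ fun τ hτ => ?_
        obtain ⟨w', hw', rfl⟩ := exists_antitone_toTyp0_eq τ
        have hd := hf w' hw' (Finsupp.mem_support_iff.1 hτ)
        have hne : expo w ≠ expo w' := by
          intro h
          have h1 := hf0 fun k => (w' k).2
          rw [h, typ_eta] at h1
          exact Finsupp.mem_support_iff.1 hτ h1
        have hlt := hd.height_lt hne
        rw [← mul_one (f (toTyp0 w')), ← smul_eq_mul, ← Finsupp.smul_single]
        refine N.smul_mem _ (ih w' hw' (fun j => hd.le_of_antitone hw' hwM j) ?_)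
        push_cast at hn
        omega
      have hdv : ∀ s, dvec R (expo w) s ∈ N := by
        intro s
        by_cases hs : Admissible (expo w) s
        · obtain ⟨i, hi⟩ := hsurj (expo w) s hwa hs
          obtain ⟨u, hu⟩ := hκ i
          have hvi : v i ∈ N := Submodule.subset_span ⟨i, rfl⟩
          -- The multiple is chosen to cancel the values at the exponents of w, so that only
          -- strictly dominated ones remain.
          have h1 : dvec R (expo w) s - ((Nat.card (blockHom c (expo w)).ker : R) *
              (↑u⁻¹ : R)) • v i ∈ N := by
            refine hlow _ ?_ ?_
            · intro w' hw' h
              by_contra hnd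
              refine h ?_
              have e1 : dvec R (expo w) s (toTyp0 w') = 0 := by
                by_contra h0
                exact hnd (suppLE_dvec hwa s w' hw' h0)
              have e2 : v i (toTyp0 w') = 0 := by
                by_contra h0
                have := hsupp i w' hw' h0
                rw [hi] at this
                exact hnd this
              rw [Finsupp.sub_apply, Finsupp.smul_apply, e1, e2, smul_zero, sub_zero]
            · intro χ
              have e2 := hv i χ
              rw [hi] at e2
              rw [Finsupp.sub_apply, Finsupp.smul_apply, e2, dvec_apply, if_pos hs, ← hu, smul_eq_mul]
              have := u.inv_mul
              linear_combination (-(Nat.card (blockHom c (expo w)).ker : R) *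
                (((s χ : ℤˣ) : ℤ) : R)) * this
          have := N.add_mem h1 (N.smul_mem ((Nat.card (blockHom c (expo w)).ker : R) *
              (↑u⁻¹ : R)) hvi)
          rwa [sub_add_cancel] at this
        · rw [dvec_eq_zero hs]
          exact N.zero_mem
      obtain ⟨u, hu⟩ := isUnit_card_chars (r := r) hR
      have h1 := sum_smul_dvec (R := R) (expo w) fun k => (w k).2
      rw [typ_eta] at h1
      have h2 : Finsupp.single (toTyp0 w) (1 : R) = (↑u⁻¹ : R) •
          ∑ s, (((s fun k => (w k).2 : ℤˣ) : ℤ) : R) • dvec R (expo w) s := by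
        rw [h1, Finsupp.smul_single, smul_eq_mul, ← hu, u.inv_mul]
      rw [h2]
      exact N.smul_mem _ (N.sum_mem fun s _ => N.smul_mem _ (hdv s))
  rw [eq_top_iff]
  intro f _
  rw [← f.sum_single]
  refine Submodule.sum_mem _ fun τ _ => ?_
  obtain ⟨w, hw, rfl⟩ := exists_antitone_toTyp0_eq τ
  rw [← mul_one (f (toTyp0 w)), ← smul_eq_mul, ← Finsupp.smul_single]
  refine N.smul_mem _ (key (-∑ j, |expo w j|) ?_
    ((height (expo w) - (r + 1) * (r * (-∑ j, |expo w j|))).toNat + 1) w hw ?_ ?_)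
  · have := Finset.sum_nonneg fun j (_ : j ∈ Finset.univ) => abs_nonneg (expo w j)
    omega
  · intro j
    have h1 := Finset.single_le_sum (fun j (_ : j ∈ Finset.univ) => abs_nonneg (expo w j))
      (Finset.mem_univ j)
    have h2 := neg_abs_le (expo w j)
    omega
  · push_cast
    exact lt_of_le_of_lt (Int.self_le_toNat _) (by omega)

end Triangular

/-! ### The operators S_k as triangular shifts, and the resulting basis. -/

/-! ### Operators shifting the exponents -/

section Shift

variable {c : FormType} {r : ℕ} {R : Type*} [CommRing R] {W : Type*} [AddCommGroup W] [Module R W]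
  (Λ : W ≃ₗ[R] (Typ0 c r →₀ R))

/-- Translation of the exponents of a word. -/
def shiftWord (w : Typ c r) (d : Fin r → ℤ) : Typ c r := fun k => ((w k).1 + d k, (w k).2)

/-- `O` lowers the exponents by `d`, up to terms that are strictly dominated. -/
structure HasShift (O : Module.End R W) (d : Fin r → ℤ) : Prop where
  mono : Monotone d
  supp : ∀ f e, SuppLE (Λ f) e → SuppLE (Λ (O f)) (e - d)
  lead : ∀ f e, SuppLE (Λ f) e → Antitone e → ∀ w, expo w + d = e →
    Λ (O f) (toTyp0 w) = Λ f (toTyp0 (shiftWord w d))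

variable {Λ}

theorem HasShift.one : HasShift Λ 1 0 where
  mono := monotone_const
  supp f e h := by simpa using h
  lead f e h _ w _ := by
    have : shiftWord w 0 = w := by funext k; simp [shiftWord]
    rw [this]
    rfl

theorem HasShift.mul {O O' : Module.End R W} {d d' : Fin r → ℤ} (h : HasShift Λ O d)
    (h' : HasShift Λ O' d') : HasShift Λ (O * O') (d + d') where
  mono := h.mono.add h'.mono
  supp f e hf := by
    have := h.supp _ _ (h'.supp f e hf)
    rwa [sub_sub, add_comm d'] at this
  lead f e hf he w hw := by
    have hanti : Antitone (e - d') := by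
      rw [sub_eq_add_neg]
      exact he.add h'.mono.neg
    have h1 : expo w + d = e - d' := by rw [← hw]; abel
    have h2 := h.lead (O' f) (e - d') (h'.supp f e hf) hanti w h1
    have h3 : expo (shiftWord w d) + d' = e := by
      rw [← hw, ← add_assoc]
      rfl
    have h4 := h'.lead f e hf he _ h3
    rw [Module.End.mul_apply, h2, h4]
    congr 2
    funext k
    simp [shiftWord, add_assoc]

theorem HasShift.pow {O : Module.End R W} {d : Fin r → ℤ} (h : HasShift Λ O d) (n : ℕ) :
    HasShift Λ (O ^ n) (n • d) := by
  induction n with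
  | zero => simpa using HasShift.one
  | succ n ih =>
    rw [pow_succ, succ_nsmul]
    exact ih.mul h

theorem HasShift.zpow {U : (Module.End R W)ˣ} {d : Fin r → ℤ} (h : HasShift Λ U d)
    (h' : HasShift Λ (↑U⁻¹ : Module.End R W) (-d)) (n : ℤ) :
    HasShift Λ (↑(U ^ n) : Module.End R W) (n • d) := by
  cases n with
  | ofNat n =>
    have := h.pow n
    rw [← Units.val_pow_eq_pow_val] at this
    simpa using this
  | negSucc n =>
    have := h'.pow (n + 1)
    rw [← Units.val_pow_eq_pow_val] at this
    rw [zpow_negSucc, negSucc_zsmul, ← inv_pow, ← smul_neg]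
    exact this

theorem HasShift.list_prod {n : ℕ} {O : Fin n → Module.End R W} {d : Fin n → Fin r → ℤ}
    (h : ∀ i, HasShift Λ (O i) (d i)) : HasShift Λ (List.ofFn O).prod (∑ i, d i) := by
  induction n with
  | zero => simpa using HasShift.one
  | succ n ih =>
    rw [List.ofFn_succ, List.prod_cons, Fin.sum_univ_succ]
    exact (h 0).mul (ih fun i => h i.succ)

end Shift


/-! ### Bases over algebras of operators -/

section Algebra

variable {R W J B : Type*} [CommRing R] [AddCommGroup W] [Module R W]

/-- If spanning elements of the algebra, applied to the vectors b, form an R-basis, then b is a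
basis over the algebra. -/
theorem exists_basis_subalgebra (A : Subalgebra R (Module.End R W)) (mon : J → Module.End R W)
    (hA : Subalgebra.toSubmodule A = Submodule.span R (Set.range mon)) (b : B → W)
    (hli : LinearIndependent R fun x : J × B => mon x.1 (b x.2))
    (hsp : Submodule.span R (Set.range fun x : J × B => mon x.1 (b x.2)) = ⊤) :
    ∃ b' : Module.Basis B A W, ∀ p, b' p = b p := by
  classical
  have hmem : ∀ j, mon j ∈ A := fun j => by
    rw [← Subalgebra.mem_toSubmodule, hA]
    exact Submodule.subset_span ⟨j, rfl⟩
  -- The expression is merely chosen; its uniqueness is not needed, since it is enough that the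
  -- chosen coefficients vanish.
  have hrep : ∀ x : A, ∃ l : J →₀ R, (l.sum fun j y => y • mon j) = (x : Module.End R W) := by
    intro x
    have h := x.2
    rw [← Subalgebra.mem_toSubmodule, hA, Finsupp.mem_span_range_iff_exists_finsupp] at h
    exact h
  choose l hl using hrep
  have hli' : LinearIndependent A b := by
    rw [linearIndependent_iff']
    intro s g hg p hp
    set T := s.biUnion fun p => (l (g p)).support with hT
    have h1 : ∀ p ∈ s, g p • b p = ∑ j ∈ T, l (g p) j • mon j (b p) := by
      intro p hp
      change (g p : Module.End R W) (b p) = _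
      rw [← hl (g p), Finsupp.sum_of_support_subset _ (s := T)
        (fun j hj => Finset.mem_biUnion.2 ⟨p, hp, hj⟩) _ (by simp)]
      simp [LinearMap.sum_apply]
    rw [Finset.sum_congr rfl h1, Finset.sum_comm,
      ← Finset.sum_product (s := T) (t := s) (f := fun x => l (g x.2) x.1 • mon x.1 (b x.2))] at hg
    have h2 := linearIndependent_iff'.1 hli (T ×ˢ s) (fun x => l (g x.2) x.1) hg
    have h3 : l (g p) = 0 := by
      ext j
      by_cases hj : j ∈ (l (g p)).support
      · exact h2 (j, p) (Finset.mem_product.2 ⟨Finset.mem_biUnion.2 ⟨p, hp, hj⟩, hp⟩)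
      · exact Finsupp.notMem_support_iff.1 hj
    have h4 := hl (g p)
    rw [h3, Finsupp.sum_zero_index] at h4
    exact Subtype.ext h4.symm
  refine ⟨Module.Basis.mk hli' ?_, fun p => Module.Basis.mk_apply _ _ p⟩
  intro x _
  have hx : x ∈ Submodule.span R (Set.range fun x : J × B => mon x.1 (b x.2)) := hsp ▸ trivial
  induction hx using Submodule.span_induction with
  | mem x h =>
    obtain ⟨⟨j, p⟩, rfl⟩ := h
    exact Submodule.smul_mem _ (⟨mon j, hmem j⟩ : A) (Submodule.subset_span ⟨p, rfl⟩)
  | zero => exact Submodule.zero_mem _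
  | add x y _ _ h h' => exact Submodule.add_mem _ (h trivial) (h' trivial)
  | smul a x _ h =>
    have := Submodule.smul_mem _ (algebraMap R A a) (h trivial)
    rwa [algebraMap_smul] at this

variable {M : Type*} [Monoid M]

theorem commute_list_ofFn {n : ℕ} {O : Fin n → M} {x : M} (h : ∀ i, Commute x (O i)) :
    Commute x (List.ofFn O).prod :=
  Commute.list_prod_right _ _ fun y hy => by
    obtain ⟨i, rfl⟩ := (List.mem_ofFn' _ _).1 hy
    exact h i

theorem ofFn_pow_mul {n : ℕ} {O : Fin n → M} (h : ∀ i j, Commute (O i) (O j)) (m m' : Fin n → ℕ) :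
    (List.ofFn fun i => O i ^ m i).prod * (List.ofFn fun i => O i ^ m' i).prod =
      (List.ofFn fun i => O i ^ (m i + m' i)).prod := by
  induction n with
  | zero => simp
  | succ n ih =>
    simp only [List.ofFn_succ, List.prod_cons]
    rw [← ih (fun i j => h i.succ j.succ) (fun i => m i.succ) fun i => m' i.succ, pow_add,
      mul_assoc, mul_assoc, ← mul_assoc _ (O 0 ^ m' 0),
      ← (commute_list_ofFn fun i => ((h 0 i.succ).pow_pow _ _)).eq, mul_assoc]

theorem ofFn_pow_single {n : ℕ} (O : Fin n → M) (i : Fin n) :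
    (List.ofFn fun j => O j ^ (Pi.single i 1 : Fin n → ℕ) j).prod = O i := by
  induction n with
  | zero => exact i.elim0
  | succ n ih =>
    simp only [List.ofFn_succ, List.prod_cons]
    refine Fin.cases ?_ (fun i => ?_) i
    · simp [List.prod_eq_one]
    · have h1 := ih (fun j => O j.succ) i
      have h2 : ∀ j : Fin n, (Pi.single i.succ 1 : Fin (n + 1) → ℕ) j.succ =
          (Pi.single i 1 : Fin n → ℕ) j := fun j => by
        simp [Pi.single_apply, Fin.succ_inj]
      simp only [h2]
      rw [h1, Pi.single_eq_of_ne (Fin.succ_ne_zero i).symm, pow_zero, one_mul]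

/-- Monomials in commuting operators, the last of which is invertible. -/
def monomialOp {n : ℕ} (O : Fin n → M) (U : Mˣ) (x : (Fin n → ℕ) × ℤ) : M :=
  (List.ofFn fun i => O i ^ x.1 i).prod * ↑(U ^ x.2)

theorem monomialOp_mul {n : ℕ} {O : Fin n → M} {U : Mˣ} (h : ∀ i j, Commute (O i) (O j))
    (hU : ∀ i, Commute (O i) U) (x y : (Fin n → ℕ) × ℤ) :
    monomialOp O U x * monomialOp O U y = monomialOp O U (x + y) := by
  have h1 : Commute (↑(U ^ x.2) : M) (List.ofFn fun i => O i ^ y.1 i).prod :=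
    commute_list_ofFn fun i => (((hU i).pow_left _).units_zpow_right _).symm
  simp only [monomialOp, Prod.fst_add, Prod.snd_add, Pi.add_apply]
  rw [← ofFn_pow_mul h, zpow_add, Units.val_mul, mul_assoc, mul_assoc, ← mul_assoc _ _ (↑(U ^ y.2) : M),
    h1.eq, mul_assoc]

/-- By commutativity the monomials are closed under multiplication, so they are exactly the monoid
generated by the operators and the inverse of the last one. -/
theorem adjoin_eq_span_monomialOp {n : ℕ} {O : Fin n → Module.End R W} {U : (Module.End R W)ˣ}
    (h : ∀ i j, Commute (O i) (O j)) (hU : ∀ i, Commute (O i) U) :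
    Subalgebra.toSubmodule (Algebra.adjoin R
      (Set.range O ∪ {(U : Module.End R W)} ∪ {(↑U⁻¹ : Module.End R W)})) =
      Submodule.span R (Set.range (monomialOp O U)) := by
  have hO : ∀ i, monomialOp O U (Pi.single i 1, 0) = O i := fun i => by
    simp [monomialOp, ofFn_pow_single]
  have hUm : ∀ k, monomialOp O U (0, k) = ↑(U ^ k) := fun k => by
    simp [monomialOp, List.prod_eq_one]
  rw [Algebra.adjoin_eq_span]
  apply le_antisymm
  · refine Submodule.span_mono ?_
    intro x hx
    induction hx using Submonoid.closure_induction with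
    | mem x hx =>
      rcases hx with (⟨i, rfl⟩ | hx) | hx
      · exact ⟨_, hO i⟩
      · exact ⟨(0, 1), by rw [hUm, zpow_one]; exact hx.symm⟩
      · exact ⟨(0, -1), by rw [hUm, zpow_neg_one]; exact hx.symm⟩
    | one => exact ⟨(0, 0), by rw [hUm, zpow_zero, Units.val_one]⟩
    | mul x y _ _ hx hy =>
      obtain ⟨a, rfl⟩ := hx
      obtain ⟨b, rfl⟩ := hy
      exact ⟨a + b, (monomialOp_mul h hU a b).symm⟩
  · refine Submodule.span_mono ?_
    rintro _ ⟨x, rfl⟩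
    set N := Submonoid.closure (Set.range O ∪ {(U : Module.End R W)} ∪ {(↑U⁻¹ : Module.End R W)})
    have hU1 : (U : Module.End R W) ∈ N := Submonoid.subset_closure (Or.inl (Or.inr rfl))
    have hU2 : (↑U⁻¹ : Module.End R W) ∈ N := Submonoid.subset_closure (Or.inr rfl)
    refine N.mul_mem (N.list_prod_mem ?_) ?_
    · intro y hy
      obtain ⟨i, rfl⟩ := (List.mem_ofFn' _ _).1 hy
      exact N.pow_mem (Submonoid.subset_closure (Or.inl (Or.inl ⟨i, rfl⟩))) _
    · cases x.2 with
      | ofNat k =>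
        change ((U ^ (k : ℤ) : (Module.End R W)ˣ) : Module.End R W) ∈ N
        rw [zpow_natCast, Units.val_pow_eq_pow_val]
        exact N.pow_mem hU1 _
      | negSucc k =>
        rw [zpow_negSucc, ← inv_pow, Units.val_pow_eq_pow_val]
        exact N.pow_mem hU2 _

end Algebra


/-! ### The basis of `δ_s(e)` -/

section BasisThm

variable {c : FormType} {R : Type*} [CommRing R] {W : Type*} [AddCommGroup W] [Module R W]
  {Λ : W ≃ₗ[R] (Typ0 c r →₀ R)} {n α : ℕ}

/-- The shift of exponents caused by a monomial in the operators `S_k`. -/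
def monomialShift (n α : ℕ) (x : (Fin n → ℕ) × ℤ) : Fin (n + 1) → ℤ :=
  ∑ k, x.1 k • (fun i => (α : ℤ) * ((lastOnes (n + 1) (k + 1) i : ℕ) : ℤ)) + x.2 • fun _ => (α : ℤ)

theorem monomialShift_apply (x : (Fin n → ℕ) × ℤ) (i : Fin (n + 1)) :
    monomialShift n α x i =
      α * ((∑ k : Fin n, if n ≤ i + k then (x.1 k : ℤ) else 0) + x.2) := by
  simp only [monomialShift, Pi.add_apply, Finset.sum_apply, Pi.smul_apply]
  simp only [nsmul_eq_mul, smul_eq_mul, mul_add, Finset.mul_sum]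
  rw [mul_comm x.2]
  congr 1
  refine Finset.sum_congr rfl fun k _ => ?_
  simp only [lastOnes]
  by_cases h : n ≤ i + k
  · rw [if_pos h, if_pos (by omega)]
    simp [mul_comm]
  · rw [if_neg h, if_neg (by omega)]
    simp

theorem monomialShift_last (x : (Fin n → ℕ) × ℤ) :
    monomialShift n α x (Fin.last n) = α * (∑ k : Fin n, (x.1 k : ℤ) + x.2) := by
  rw [monomialShift_apply]
  simp

/-- Between positions i and i + 1 only the operator whose string of ones begins at i + 1 makes a
difference; hence the reversal of the index. -/
theorem monomialShift_succ (x : (Fin n → ℕ) × ℤ) (i : Fin n) :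
    monomialShift n α x i.succ = monomialShift n α x i.castSucc + α * x.1 i.rev := by
  rw [monomialShift_apply, monomialShift_apply, ← mul_add, add_right_comm]
  congr 2
  have h : (x.1 i.rev : ℤ) = ∑ k : Fin n, if k = i.rev then (x.1 k : ℤ) else 0 := by simp
  rw [h, ← Finset.sum_add_distrib]
  refine Finset.sum_congr rfl fun k _ => ?_
  have hk : k = i.rev ↔ (k : ℕ) + i + 1 = n := by
    rw [Fin.ext_iff, Fin.val_rev]
    omega
  simp only [hk, Fin.val_succ, Fin.val_castSucc]
  split_ifs <;> omega

open Classical in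
/-- The gap at position `i`. -/
def gap (e : Fin (n + 1) → ℤ) (s : (Fin (n + 1) → c.Sign) →* ℤˣ) (i : Fin n) : ℤ :=
  e i.castSucc - e i.succ - if charComp s i.castSucc ≠ charComp s i.succ then 1 else 0

theorem basisIndex_iff (p : (Fin (n + 1) → ℤ) × ((Fin (n + 1) → c.Sign) →* ℤˣ)) :
    (open Classical in
    (∀ i j : Fin (n + 1), (i : ℕ) + 1 = j →
      p.1 i - p.1 j - (if p.2.comp (MonoidHom.mulSingle (fun _ => c.Sign) i) ≠
          p.2.comp (MonoidHom.mulSingle (fun _ => c.Sign) j) then 1 else 0) ∈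
        Set.Icc (0 : ℤ) (α - 1)) ∧
    ∀ i : Fin (n + 1), (i : ℕ) + 1 = n + 1 → 0 ≤ p.1 i ∧ p.1 i < α) ↔
    (∀ i, 0 ≤ gap p.1 p.2 i ∧ gap p.1 p.2 i < α) ∧ 0 ≤ p.1 (Fin.last n) ∧ p.1 (Fin.last n) < α := by
  constructor
  · rintro ⟨h1, h2⟩
    refine ⟨fun i => ?_, h2 _ rfl⟩
    have h3 := h1 i.castSucc i.succ rfl
    exact ⟨h3.1, Int.lt_of_le_sub_one h3.2⟩
  · rintro ⟨h1, h2⟩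
    constructor
    · intro i j hij
      obtain ⟨k, rfl⟩ : ∃ k : Fin n, i = k.castSucc := ⟨⟨i, by omega⟩, rfl⟩
      obtain rfl : j = k.succ := Fin.ext hij.symm
      exact ⟨(h1 k).1, Int.le_sub_one_of_lt (h1 k).2⟩
    · intro i hi
      obtain rfl : i = Fin.last n := Fin.ext (by simpa using hi)
      exact h2

/-- Subtracting 1 where the character changes makes nonnegativity of the gaps encode both
conditions: a change of character forces a strict drop of exponents. -/
theorem gap_nonneg_iff (e : Fin (n + 1) → ℤ) (s : (Fin (n + 1) → c.Sign) →* ℤˣ) :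
    (∀ i, 0 ≤ gap e s i) ↔ Antitone e ∧ Admissible e s := by
  have key : Antitone e ↔ ∀ i : Fin n, e i.succ ≤ e i.castSucc := Fin.antitone_iff_succ_le
  constructor
  · intro h
    have he : Antitone e := key.2 fun i => by
      have := h i
      rw [gap] at this
      split_ifs at this <;> omega
    refine ⟨he, (admissible_iff he s).2 fun i j hij heij => ?_⟩
    obtain ⟨k, rfl⟩ : ∃ k : Fin n, i = k.castSucc := ⟨⟨i, by omega⟩, rfl⟩
    obtain rfl : j = k.succ := Fin.ext hij.symm
    by_contra hne
    have := h k
    rw [gap, if_pos hne] at this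
    omega
  · rintro ⟨he, hs⟩ i
    have h1 := key.1 he i
    rw [gap]
    split_ifs with h
    · have : e i.castSucc ≠ e i.succ := fun heq => h ((admissible_iff he s).1 hs _ _ rfl heq)
      omega
    · omega

theorem gap_sub_shift (e : Fin (n + 1) → ℤ) (s : (Fin (n + 1) → c.Sign) →* ℤˣ)
    (x : (Fin n → ℕ) × ℤ) (i : Fin n) :
    gap (e - monomialShift n α x) s i = gap e s i + α * x.1 i.rev := by
  simp only [gap, Pi.sub_apply, monomialShift_succ]
  ring

/-- The exponents and the character of the leading term of a monomial applied to a basis vector. -/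
def leadIndex (n α : ℕ) (x : ((Fin n → ℕ) × ℤ) × BasisIndex c (n + 1) α) :
    (Fin (n + 1) → ℤ) × ((Fin (n + 1) → c.Sign) →* ℤˣ) :=
  (x.2.1.1 - monomialShift n α x.1, x.2.1.2)

/-- Uniqueness of division by α: the box contains the remainders of the gaps and of the last
exponent, and the monomial gives the quotients. -/
theorem leadIndex_injective : Function.Injective (leadIndex (c := c) n α) := by
  rintro ⟨⟨m, k⟩, p⟩ ⟨⟨m', k'⟩, p'⟩ h
  have h1 := congrArg Prod.fst h
  have h2 : p.1.2 = p'.1.2 := (Prod.ext_iff.1 h).2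
  simp only [leadIndex] at h1
  obtain ⟨hp, hp0, hpl⟩ := (basisIndex_iff p.1).1 p.2
  obtain ⟨hp', hp0', hpl'⟩ := (basisIndex_iff p'.1).1 p'.2
  have hm : m = m' := by
    funext i
    have h3 := gap_sub_shift (α := α) p.1.1 p.1.2 (m, k) i.rev
    have h4 := gap_sub_shift (α := α) p'.1.1 p'.1.2 (m', k') i.rev
    rw [h1, h2, h4] at h3
    simp only [Fin.rev_rev] at h3
    have h5 := hp i.rev
    have h6 := hp' i.rev
    rw [h2] at h5
    have h7 := congrArg (· / (α : ℤ)) h3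
    rw [Int.add_mul_ediv_left _ _ (by omega), Int.add_mul_ediv_left _ _ (by omega),
      Int.ediv_eq_zero_of_lt h5.1 h5.2, Int.ediv_eq_zero_of_lt h6.1 h6.2] at h7
    omega
  subst hm
  have hk : k = k' := by
    have h3 := congrFun h1 (Fin.last n)
    simp only [Pi.sub_apply, monomialShift_last] at h3
    have h7 := congrArg (· / (α : ℤ)) h3
    simp only [sub_eq_add_neg, ← mul_neg] at h7
    rw [Int.add_mul_ediv_left _ _ (by omega), Int.add_mul_ediv_left _ _ (by omega),
      Int.ediv_eq_zero_of_lt hp0 hpl, Int.ediv_eq_zero_of_lt hp0' hpl'] at h7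
    omega
  subst hk
  have he : p.1.1 = p'.1.1 := sub_left_injective h1
  have : p = p' := Subtype.ext (Prod.ext he h2)
  rw [this]

theorem exists_leadIndex_eq (hα : 1 ≤ α) {e : Fin (n + 1) → ℤ}
    {s : (Fin (n + 1) → c.Sign) →* ℤˣ} (he : Antitone e) (hs : Admissible e s) :
    ∃ x, leadIndex n α x = (e, s) := by
  have hg := (gap_nonneg_iff e s).2 ⟨he, hs⟩
  have hα' : (0 : ℤ) < α := by omega
  let m : Fin n → ℕ := fun i => (gap e s i.rev / α).toNat
  have hm : ∀ i, (m i.rev : ℤ) = gap e s i / α := fun i => by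
    simp only [m, Fin.rev_rev]
    exact Int.toNat_of_nonneg (Int.ediv_nonneg (hg i) hα'.le)
  -- Each of the other operators also lowers the last exponent by α, so the exponent of S_r has to
  -- compensate for their total degree.
  let k : ℤ := -(e (Fin.last n) / α) - ∑ i, (m i : ℤ)
  have hgap : ∀ i, gap (e + monomialShift n α (m, k)) s i = gap e s i % α := by
    intro i
    have h1 := gap_sub_shift (α := α) (e + monomialShift n α (m, k)) s (m, k) i
    rw [add_sub_cancel_right] at h1
    have h2 := Int.emod_add_mul_ediv (gap e s i) α
    rw [← hm] at h2
    simp only at h1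
    linarith
  have hlast : (e + monomialShift n α (m, k)) (Fin.last n) = e (Fin.last n) % α := by
    rw [Pi.add_apply, monomialShift_last]
    have h2 := Int.emod_add_mul_ediv (e (Fin.last n)) α
    simp only [k]
    linear_combination -h2
  refine ⟨((m, k), ⟨(e + monomialShift n α (m, k), s), (basisIndex_iff _).2 ⟨fun i => ?_, ?_⟩⟩), ?_⟩
  · simp only [hgap]
    exact ⟨Int.emod_nonneg _ hα'.ne', Int.emod_lt_of_pos _ hα'⟩
  · simp only [hlast]
    exact ⟨Int.emod_nonneg _ hα'.ne', Int.emod_lt_of_pos _ hα'⟩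
  · simp [leadIndex]

theorem hasShift_monomialOp {Λ : W ≃ₗ[R] (Typ0 c (n + 1) →₀ R)} {O : Fin n → Module.End R W}
    {U : (Module.End R W)ˣ}
    (hO : ∀ k : Fin n, HasShift Λ (O k) fun i => (α : ℤ) * ((lastOnes (n + 1) (k + 1) i : ℕ) : ℤ))
    (hU : HasShift Λ U fun _ => (α : ℤ))
    (hU' : HasShift Λ (↑U⁻¹ : Module.End R W) (-fun _ => (α : ℤ))) (x : (Fin n → ℕ) × ℤ) :
    HasShift Λ (monomialOp O U x) (monomialShift n α x) :=
  (HasShift.list_prod fun k => (hO k).pow (x.1 k)).mul (hU.zpow hU' x.2)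

theorem exists_basis_of_hasShift [Nontrivial R] {r : ℕ} (hr : 1 ≤ r) (hα : 1 ≤ α)
    (hR : IsUnit (Nat.card c.Sign : R))
    {Λ : W ≃ₗ[R] (Typ0 c r →₀ R)} {S : Fin (r + 1) → Module.End R W}
    (hcomm : ∀ i j, Commute (S i) (S j)) {U : (Module.End R W)ˣ}
    (hSU : (U : Module.End R W) = S (Fin.last r))
    (hS : ∀ k : Fin (r + 1), HasShift Λ (S k) fun i => (α : ℤ) * ((lastOnes r k i : ℕ) : ℤ))
    (hU' : HasShift Λ (↑U⁻¹ : Module.End R W) (-fun _ => (α : ℤ))) :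
    LinearIndependent R
      (fun m : Fin r → ℕ => (List.ofFn fun i : Fin r => S i.succ ^ m i).prod) ∧
    ∃ b : Module.Basis (BasisIndex c r α)
      (Algebra.adjoin R (Set.range (fun i : Fin r => S i.succ) ∪ {(↑U⁻¹ : Module.End R W)})) W,
      ∀ p : BasisIndex c r α, b p = Λ.symm (dvec R p.1.1 p.1.2) := by
  -- With n = r − 1, the operators S_1, …, S_n carry natural exponents and S_r, being invertible, an
  -- integral one.
  obtain ⟨n, rfl⟩ : ∃ n, r = n + 1 := ⟨r - 1, by omega⟩
  set O : Fin n → Module.End R W := fun i => S i.castSucc.succ with hOdef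
  have hO : ∀ k : Fin n, HasShift Λ (O k)
      fun i => (α : ℤ) * ((lastOnes (n + 1) (k + 1) i : ℕ) : ℤ) := fun k => hS k.castSucc.succ
  have hU : HasShift Λ (U : Module.End R W) fun _ => (α : ℤ) := by
    rw [hSU]
    have := hS (Fin.last (n + 1))
    simpa [lastOnes] using this
  have hOO : ∀ i j, Commute (O i) (O j) := fun i j => hcomm _ _
  have hOU : ∀ i, Commute (O i) (U : Module.End R W) := fun i => by rw [hSU]; exact hcomm _ _
  set b : BasisIndex c (n + 1) α → W := fun p => Λ.symm (dvec R p.1.1 p.1.2) with hb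
  set v : ((Fin n → ℕ) × ℤ) × BasisIndex c (n + 1) α → Typ0 c (n + 1) →₀ R :=
    fun x => Λ (monomialOp O U x.1 (b x.2)) with hv
  have hadm : ∀ p : BasisIndex c (n + 1) α, Antitone p.1.1 ∧ Admissible p.1.1 p.1.2 := fun p =>
    (gap_nonneg_iff _ _).1 fun i => (((basisIndex_iff p.1).1 p.2).1 i).1
  have hanti : ∀ x : ((Fin n → ℕ) × ℤ) × BasisIndex c (n + 1) α, Antitone (leadIndex n α x).1 := by
    intro x
    have := (hasShift_monomialOp hO hU hU' x.1).mono
    simp only [leadIndex, sub_eq_add_neg]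
    exact (hadm x.2).1.add this.neg
  have hsb : ∀ p : BasisIndex c (n + 1) α, SuppLE (Λ (b p)) p.1.1 := fun p => by
    rw [hb, LinearEquiv.apply_symm_apply]
    exact suppLE_dvec (hadm p).1 _
  have hsupp : ∀ x, SuppLE (v x) (leadIndex n α x).1 := fun x =>
    (hasShift_monomialOp hO hU hU' x.1).supp _ _ (hsb x.2)
  have hlead : ∀ x (χ : Fin (n + 1) → c.Sign), v x (toTyp0 fun k => ((leadIndex n α x).1 k, χ k)) =
      ((((leadIndex n α x).2 χ : ℤˣ) : ℤ) : R) * (Nat.card (blockHom c x.2.1.1).ker : R) := by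
    intro x χ
    have h1 := (hasShift_monomialOp hO hU hU' x.1).lead _ _ (hsb x.2) (hadm x.2).1
      (fun k => ((leadIndex n α x).1 k, χ k)) (sub_add_cancel _ _)
    have h2 : shiftWord (c := c) (fun k => ((leadIndex n α x).1 k, χ k)) (monomialShift n α x.1) =
        fun k => (x.2.1.1 k, χ k) := by
      funext k
      simp [shiftWord, leadIndex]
    classical
    rw [hv]
    simp only
    rw [h1, h2, hb, LinearEquiv.apply_symm_apply, dvec_apply, if_pos (hadm x.2).2]
    rfl
  have hκ : ∀ x : ((Fin n → ℕ) × ℤ) × BasisIndex c (n + 1) α,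
      IsUnit (Nat.card (blockHom c x.2.1.1).ker : R) := fun x => isUnit_card_ker hR _
  have hli : LinearIndependent R v :=
    linearIndependent_of_triangular hR leadIndex_injective hanti hsupp hκ hlead
  have hsp : Submodule.span R (Set.range v) = ⊤ :=
    span_eq_top_of_triangular hR (fun e s he hs => exists_leadIndex_eq hα he hs) hsupp hκ hlead
  have hli' : LinearIndependent R
      fun x : ((Fin n → ℕ) × ℤ) × BasisIndex c (n + 1) α => monomialOp O U x.1 (b x.2) :=
    LinearIndependent.of_comp Λ.toLinearMap hli
  have hsp' : Submodule.span R (Set.range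
      fun x : ((Fin n → ℕ) × ℤ) × BasisIndex c (n + 1) α => monomialOp O U x.1 (b x.2)) = ⊤ := by
    have h1 : v = Λ ∘ fun x => monomialOp O U x.1 (b x.2) := rfl
    rw [h1, Set.range_comp, ← LinearEquiv.coe_coe, ← Submodule.map_span] at hsp
    have h2 := congrArg (Submodule.comap Λ.toLinearMap) hsp
    rwa [Submodule.comap_map_eq_of_injective Λ.injective, Submodule.comap_top] at h2
  have hset : Set.range (fun i : Fin (n + 1) => S i.succ) =
      Set.range O ∪ {(U : Module.End R W)} := by
    ext y
    constructor
    · rintro ⟨i, rfl⟩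
      refine Fin.lastCases ?_ (fun i => ?_) i
      · exact Or.inr hSU.symm
      · exact Or.inl ⟨i, rfl⟩
    · rintro (⟨i, rfl⟩ | h)
      · exact ⟨i.castSucc, rfl⟩
      · exact ⟨Fin.last n, (h.trans hSU).symm⟩
  constructor
  -- It suffices to apply the monomials to one basis vector; zero exponents with the trivial
  -- character lie in the box because α ≥ 1.
  · have h1 : LinearIndependent R (monomialOp O U) := by
      have p₀ : BasisIndex c (n + 1) α := ⟨(0, 1), (basisIndex_iff _).2
        ⟨fun i => by simp [gap, charComp]; omega, by simp; omega⟩⟩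
      have h2 := hli'.comp (fun x : (Fin n → ℕ) × ℤ => (x, p₀)) fun x y h => congrArg Prod.fst h
      exact LinearIndependent.of_comp (LinearMap.applyₗ (b p₀)) h2
    have h2 := h1.comp (fun m : Fin (n + 1) → ℕ => ((fun i : Fin n => m i.castSucc),
      (m (Fin.last n) : ℤ))) (by
        intro m m' h
        funext i
        refine Fin.lastCases ?_ (fun i => ?_) i
        · exact Int.ofNat_injective (congrArg Prod.snd h)
        · exact congrFun (congrArg Prod.fst h) i)
    convert h2 using 1
    funext m
    rw [List.ofFn_succ']
    simp only [List.concat_eq_append, List.prod_append, List.prod_singleton, Function.comp_apply,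
      monomialOp, zpow_natCast, Units.val_pow_eq_pow_val, hSU]
    rfl
  · refine exists_basis_subalgebra _ (monomialOp O U) ?_ b hli' hsp'
    rw [hset]
    exact adjoin_eq_span_monomialOp hOO hOU

end BasisThm


/-! ### Shifting types -/

section ShiftTyp

variable {c : FormType} {r : ℕ}

/-- Translation of the exponents of a type. -/
def shiftTyp0 (d : ℤ) (τ : Typ0 c r) : Typ0 c r where
  e := Finsupp.equivMapDomain (Equiv.addRight d) τ.e
  χ i := τ.χ (i - d)
  χ_eq_one i h := τ.χ_eq_one _ (by simpa [Finsupp.equivMapDomain_apply, sub_eq_add_neg] using h)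
  sum_e := by
    rw [Finsupp.sum_equivMapDomain]
    exact τ.sum_e

@[ext]
theorem Typ0.ext_iff' {τ τ' : Typ0 c r} (h : τ.e = τ'.e) (h' : τ.χ = τ'.χ) : τ = τ' := by
  cases τ; cases τ'; simp_all

theorem shiftTyp0_shiftTyp0 (d d' : ℤ) (h : d + d' = 0) (τ : Typ0 c r) :
    shiftTyp0 d (shiftTyp0 d' τ) = τ := by
  obtain rfl : d' = -d := by omega
  ext1
  · ext i
    simp [shiftTyp0, Finsupp.equivMapDomain_apply]
  · funext i
    simp [shiftTyp0]

/-- Translation of the exponents, as a bijection of types. -/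
def shiftEquiv (d : ℤ) : Typ0 c r ≃ Typ0 c r where
  toFun := shiftTyp0 d
  invFun := shiftTyp0 (-d)
  left_inv := shiftTyp0_shiftTyp0 _ _ (by omega)
  right_inv := shiftTyp0_shiftTyp0 _ _ (by omega)

theorem toTyp0_shiftWord (w : Typ c r) (d : ℤ) :
    toTyp0 (shiftWord w fun _ => d) = shiftTyp0 d (toTyp0 w) := by
  ext1
  · simp only [toTyp0, shiftTyp0, shiftWord]
    rw [Finsupp.equivMapDomain_eq_mapDomain, Finsupp.mapDomain_finsetSum]
    simp
  · funext i
    change ∏ k with (w k).1 + d = i, (w k).2 = ∏ k with (w k).1 = i - d, (w k).2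
    simp only [eq_sub_iff_add_eq]

end ShiftTyp

/-! ### Translations and dominance -/

section TranslationDominance

variable {r : ℕ}

theorem sum_lastOnes {k : ℕ} (hk : k ≤ r) : ∑ i, (lastOnes r k i : ℕ) = k := by
  have h1 : ∀ i : Fin r, (lastOnes r k i : ℕ) = if r ≤ (i : ℕ) + k then 1 else 0 := fun i => by
    simp only [lastOnes]
    split_ifs <;> rfl
  simp only [h1]
  rw [Fin.sum_univ_eq_sum_range (fun i => if r ≤ i + k then 1 else 0) r, ← Finset.sum_filter,
    Finset.sum_const, smul_eq_mul, mul_one]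
  have h2 : (Finset.range r).filter (fun i => r ≤ i + k) = Finset.Ico (r - k) r := by
    ext i
    simp only [Finset.mem_filter, Finset.mem_range, Finset.mem_Ico]
    omega
  rw [h2, Nat.card_Ico]
  omega

theorem monotone_lastOnes (k α : ℕ) :
    Monotone fun i : Fin r => (α : ℤ) * ((lastOnes r k i : ℕ) : ℤ) := by
  intro i j hij
  have hij' : (i : ℕ) ≤ j := hij
  refine mul_le_mul_of_nonneg_left ?_ (by positivity)
  norm_cast
  simp only [lastOnes]
  split_ifs <;> omega

theorem sum_val_eq_card (ε : Fin r → Fin 2) :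
    ∑ i, (ε i : ℕ) = (Finset.univ.filter fun i => ε i = 1).card := by
  rw [Finset.card_filter]
  refine Finset.sum_congr rfl fun i _ => ?_
  generalize ε i = x
  fin_cases x <;> rfl

/-- Partial sums of `lastOnes` vanish until its ones begin; afterwards its tail consists of ones and
is the largest possible, while the totals agree. -/
theorem dominates_lastOnes {k : ℕ} {ε : Fin r → Fin 2} (hk : k ≤ r)
    (hε : (Finset.univ.filter fun i => ε i = 1).card = k) (α : ℕ) (e : Fin r → ℤ) :
    Dominates (e + fun i => (α : ℤ) * ((ε i : ℕ) : ℤ))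
      (e + fun i => (α : ℤ) * ((lastOnes r k i : ℕ) : ℤ)) := by
  have htot : ∑ i, (lastOnes r k i : ℕ) = ∑ i, (ε i : ℕ) := by
    rw [sum_lastOnes hk, sum_val_eq_card, hε]
  constructor
  · intro m
    simp only [Pi.add_apply, Finset.sum_add_distrib, ← Finset.mul_sum]
    refine add_le_add_right (mul_le_mul_of_nonneg_left ?_ (by positivity)) _
    norm_cast
    by_cases hm : m + k ≤ r
    · rw [Finset.sum_eq_zero]
      · exact Nat.zero_le _
      · intro i hi
        have := (Finset.mem_filter.1 hi).2
        rw [lastOnes, if_neg (by omega)]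
        rfl
    · have h1 := Finset.sum_filter_add_sum_filter_not Finset.univ (fun i : Fin r => (i : ℕ) < m)
        fun i => (lastOnes r k i : ℕ)
      have h2 := Finset.sum_filter_add_sum_filter_not Finset.univ (fun i : Fin r => (i : ℕ) < m)
        fun i => (ε i : ℕ)
      have h3 : ∑ i ∈ Finset.univ.filter (fun i : Fin r => ¬ (i : ℕ) < m), (ε i : ℕ) ≤
          ∑ i ∈ Finset.univ.filter (fun i : Fin r => ¬ (i : ℕ) < m), (lastOnes r k i : ℕ) := by
        refine Finset.sum_le_sum fun i hi => ?_
        have := (Finset.mem_filter.1 hi).2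
        rw [lastOnes, if_pos (by omega)]
        have := (ε i).isLt
        simp only [Fin.val_one]
        omega
      omega
  · simp only [Pi.add_apply, Finset.sum_add_distrib, ← Finset.mul_sum]
    norm_cast
    rw [htot]

end TranslationDominance

/-! ### The operators `S_k` shift exponents -/

section Operators

variable {c : FormType} {R : Type*} [CommRing R] {W : Type*} [AddCommGroup W] [Module R W] {r : ℕ}
  {Λ : W ≃ₗ[R] (Typ0 c r →₀ R)} {a : (Fin r → Fin 2) → R} {α : ℕ}
  {str : (Typ c r →₀ R) →ₗ[R] (Typ0 c r →₀ R)} {S : Module.End R W} {k : ℕ}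

theorem shiftSum_single (w : Typ c r) :
    shiftSum c a α k (Finsupp.single w 1) =
      ∑ ε : Fin r → Fin 2 with (Finset.univ.filter fun i => ε i = 1).card = k,
        a ε • Finsupp.single (shiftWord w fun i => (α : ℤ) * ((ε i : ℕ) : ℤ)) 1 := by
  rw [shiftSum, LinearMap.sum_apply]
  refine Finset.sum_congr rfl fun ε _ => ?_
  rw [LinearMap.smul_apply, translation, Finsupp.lmapDomain_apply, Finsupp.mapDomain_single]
  rfl

theorem sum_mul_single (f : Typ0 c r →₀ R) (τ₀ : Typ0 c r) :
    (f.sum fun τ y => y * Finsupp.single τ₀ (1 : R) τ) = f τ₀ := by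
  classical
  rw [Finsupp.sum, Finset.sum_eq_single τ₀]
  · rw [Finsupp.single_eq_same, mul_one]
  · intro τ _ hτ
    rw [Finsupp.single_eq_of_ne hτ, mul_zero]
  · intro h
    rw [Finsupp.notMem_support_iff.1 h, zero_mul]

variable (hk : k ≤ r) (hα : 1 ≤ α)
  (hstr : ∀ w, Antitone (expo w) → str (Finsupp.single w 1) = Finsupp.single (toTyp0 w) 1)
  (hdom : ∀ w τ, str (Finsupp.single w 1) τ ≠ 0 →
    ∃ w', Antitone (expo w') ∧ Dominates (expo w') (expo w) ∧ toTyp0 w' = τ)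
  (hS : ∀ f w, Antitone (expo w) → Λ (S f) (toTyp0 w) =
    (Λ f).sum fun τ y => y * str (shiftSum c a α k (Finsupp.single w 1)) τ)

include hS in
theorem apply_toTyp0_eq_sum (f : W) (w : Typ c r) (hw : Antitone (expo w)) :
    Λ (S f) (toTyp0 w) =
      ∑ ε : Fin r → Fin 2 with (Finset.univ.filter fun i => ε i = 1).card = k,
        a ε * (Λ f).sum fun τ y =>
          y * str (Finsupp.single (shiftWord w fun i => (α : ℤ) * ((ε i : ℕ) : ℤ)) 1) τ := by
  rw [hS f w hw, shiftSum_single]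
  simp only [map_sum, map_smul, Finsupp.finsetSum_apply, Finsupp.smul_apply, smul_eq_mul,
    Finsupp.sum, Finset.mul_sum]
  rw [Finset.sum_comm]
  exact Finset.sum_congr rfl fun ε _ => Finset.sum_congr rfl fun τ _ => by ring

include hdom in
theorem dominates_of_sum_ne_zero {f : Typ0 c r →₀ R} {e : Fin r → ℤ} (hf : SuppLE f e)
    (w : Typ c r) (h : (f.sum fun τ y => y * str (Finsupp.single w 1) τ) ≠ 0) :
    Dominates e (expo w) := by
  obtain ⟨τ, -, hτ⟩ := Finset.exists_ne_zero_of_sum_ne_zero h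
  beta_reduce at hτ
  have h1 : f τ ≠ 0 := fun h0 => hτ (by rw [h0, zero_mul])
  have h2 : str (Finsupp.single w 1) τ ≠ 0 := fun h0 => hτ (by rw [h0, mul_zero])
  obtain ⟨w', hw', hd, rfl⟩ := hdom w τ h2
  exact (hf w' hw' h1).trans hd

-- For the support: if S f is nonzero at w, then for some ε the support bound e dominates w + αε,
-- which dominates w + α·`lastOnes`. The leading value is the case where this chain closes up.
include hk hα hstr hdom hS in
theorem hasShift_of_shiftSum (ha : a (lastOnes r k) = 1) :
    HasShift Λ S fun i => (α : ℤ) * ((lastOnes r k i : ℕ) : ℤ) where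
  mono := monotone_lastOnes k α
  supp f e hf w hw hne := by
    rw [apply_toTyp0_eq_sum hS f w hw] at hne
    obtain ⟨ε, hε, h⟩ := Finset.exists_ne_zero_of_sum_ne_zero hne
    have h1 := dominates_of_sum_ne_zero hdom hf _ (right_ne_zero_of_mul h)
    have h2 := (h1.trans (dominates_lastOnes hk (Finset.mem_filter.1 hε).2 α _)).add_right
      (-fun i => (α : ℤ) * ((lastOnes r k i : ℕ) : ℤ))
    rwa [add_neg_cancel_right, ← sub_eq_add_neg] at h2
  lead f e hf he w hwe := by
    set d : Fin r → ℤ := fun i => (α : ℤ) * ((lastOnes r k i : ℕ) : ℤ) with hd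
    have hmono : Monotone d := monotone_lastOnes k α
    have hw : Antitone (expo w) := by
      rw [eq_sub_of_add_eq hwe, sub_eq_add_neg]
      exact he.add hmono.neg
    rw [apply_toTyp0_eq_sum hS f w hw, Finset.sum_eq_single_of_mem (lastOnes r k), ha, one_mul]
    · have h1 : Antitone (expo (shiftWord w d)) := by
        change Antitone (expo w + d)
        rwa [hwe]
      rw [hstr _ h1]
      exact sum_mul_single _ _
    · rw [Finset.mem_filter, ← sum_val_eq_card, sum_lastOnes hk]
      exact ⟨Finset.mem_univ _, rfl⟩
    -- A contribution from another ε would be squeezed in dominance between two equal exponents;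
    -- antisymmetry and α ≥ 1 then give ε = `lastOnes`.
    · intro ε hε hne
      by_contra h
      have h1 := dominates_of_sum_ne_zero hdom hf _ (right_ne_zero_of_mul h)
      have h2 := dominates_lastOnes hk (Finset.mem_filter.1 hε).2 α (expo w)
      rw [← hwe] at h1
      have h3 := h2.antisymm h1
      refine hne (funext fun i => ?_)
      have h4 := congrFun h3 i
      simp only [Pi.add_apply, add_right_inj, expo] at h4
      have h5 := mul_left_cancel₀ (by omega) h4
      exact Fin.ext (by exact_mod_cast h5)

-- Only the all-ones ε has r ones. Translation by a constant keeps a word weakly decreasing, so no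
-- straightening occurs and S_r is exactly a translation.
include hstr hS in
theorem apply_toTyp0_of_eq (hkr : k = r) (ha : a (lastOnes r k) = 1) (f : W) (τ : Typ0 c r) :
    Λ (S f) τ = Λ f (shiftTyp0 α τ) := by
  classical
  subst hkr
  obtain ⟨w, hw, rfl⟩ := exists_antitone_toTyp0_eq τ
  have hone : ∀ ε : Fin k → Fin 2, (Finset.univ.filter fun i => ε i = 1).card = k ↔
      ε = lastOnes k k := by
    intro ε
    constructor
    · intro h
      have h1 : Finset.univ.filter (fun i => ε i = 1) = Finset.univ :=
        Finset.eq_univ_of_card _ (by rw [h, Fintype.card_fin])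
      funext i
      have h2 := Finset.mem_univ i
      rw [← h1, Finset.mem_filter] at h2
      simp [h2.2, lastOnes]
    · rintro rfl
      rw [← sum_val_eq_card, sum_lastOnes le_rfl]
  have hsh : (shiftWord w fun i => (α : ℤ) * ((lastOnes k k i : ℕ) : ℤ)) =
      shiftWord w fun _ => (α : ℤ) := by
    simp [lastOnes]
  rw [apply_toTyp0_eq_sum hS f w hw]
  simp only [hone]
  rw [Finset.filter_eq' , if_pos (Finset.mem_univ _), Finset.sum_singleton, ha, one_mul, hsh,
    hstr _ (fun i j hij => add_le_add_left (hw hij) _), ← toTyp0_shiftWord]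
  exact sum_mul_single _ _

theorem exists_unit_of_shift (h : ∀ f τ, Λ (S f) τ = Λ f (shiftTyp0 α τ)) :
    ∃ U : (Module.End R W)ˣ, (U : Module.End R W) = S ∧
      HasShift Λ (↑U⁻¹ : Module.End R W) (-fun _ => (α : ℤ)) := by
  let E : (Typ0 c r →₀ R) ≃ₗ[R] (Typ0 c r →₀ R) := Finsupp.domLCongr (shiftEquiv (α : ℤ))
  have hE : ∀ f τ, E f τ = f (shiftTyp0 (-(α : ℤ)) τ) := fun f τ => rfl
  let T : Module.End R W := Λ.symm.toLinearMap ∘ₗ E.toLinearMap ∘ₗ Λ.toLinearMap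
  have hT : ∀ f τ, Λ (T f) τ = Λ f (shiftTyp0 (-(α : ℤ)) τ) := fun f τ => by
    simp only [T, LinearMap.comp_apply, LinearEquiv.coe_coe, LinearEquiv.apply_symm_apply]
    exact hE _ _
  refine ⟨⟨S, T, ?_, ?_⟩, rfl, ?_⟩
  · ext f
    refine Λ.injective (Finsupp.ext fun τ => ?_)
    rw [Module.End.mul_apply, h, hT, shiftTyp0_shiftTyp0 _ _ (by omega)]
    rfl
  · ext f
    refine Λ.injective (Finsupp.ext fun τ => ?_)
    rw [Module.End.mul_apply, hT, h, shiftTyp0_shiftTyp0 _ _ (by omega)]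
    rfl
  · have hT' : ∀ f (w : Typ c r), Λ (T f) (toTyp0 w) = Λ f (toTyp0 (shiftWord w (-fun _ => (α : ℤ)))) :=
      fun f w => by
        rw [hT, ← toTyp0_shiftWord]
        rfl
    refine ⟨monotone_const, ?_, fun f e _ _ w _ => hT' f w⟩
    intro f e hf w hw hne
    change Λ (T f) (toTyp0 w) ≠ 0 at hne
    rw [hT'] at hne
    have h1 := (hf _ (fun i j hij => add_le_add_left (hw hij) _) hne).add_right fun _ => (α : ℤ)
    have h2 : expo (shiftWord w (-fun _ => (α : ℤ))) + (fun _ => (α : ℤ)) = expo w := by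
      funext i
      simp [expo, shiftWord]
    rwa [h2, ← sub_neg_eq_add] at h1

end Operators


/-! ### Transport from spherical functions to functions on types. -/

/-! ### Spherical functions as functions of the type -/

section Spherical

variable {c : FormType} {F₀ F : Type*}
  [Field F₀] [ValuativeRel F₀] [TopologicalSpace F₀] [IsNonarchimedeanLocalField F₀]
  [Field F] [ValuativeRel F] [TopologicalSpace F] [IsNonarchimedeanLocalField F]
  [Algebra F₀ F] [ValuativeExtension F₀ F]
  {σ : F ≃ₐ[F₀] F} {ϖ : 𝒪[F₀]} {r : ℕ} {R : Type*} [CommRing R]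

theorem mem_sphericalFunctions_iff [DiscreteTopology (FormClass c σ r)] (f : FormClass c σ r → R) :
    f ∈ sphericalFunctions c σ r R ↔ (Function.support f).Finite := by
  change IsLocallyConstant f ∧ IsCompact (tsupport f) ↔ _
  rw [isCompact_iff_finite, tsupport, closure_discrete]
  exact and_iff_right (IsLocallyConstant.of_discrete f)

/-- Spherical functions are the finitely supported functions of the type. -/
def sphericalEquiv [DiscreteTopology (FormClass c σ r)]
    (htyp : Function.Bijective (typ σ ϖ : FormClass c σ r → Typ0 c r)) :
    sphericalFunctions c σ r R ≃ₗ[R] (Typ0 c r →₀ R) where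
  toFun f := Finsupp.ofSupportFinite
    (fun τ => (f : FormClass c σ r → R) ((Equiv.ofBijective _ htyp).symm τ))
    (((mem_sphericalFunctions_iff _).1 f.2).preimage (Equiv.injective _).injOn)
  map_add' f g := by ext; rfl
  map_smul' a f := by ext; rfl
  invFun v := ⟨fun o => v (typ σ ϖ o), (mem_sphericalFunctions_iff _).2
    (v.hasFiniteSupport.preimage htyp.injective.injOn)⟩
  left_inv f := by
    ext o
    exact congrArg (f : FormClass c σ r → R) ((Equiv.ofBijective _ htyp).symm_apply_apply o)
  right_inv v := by
    ext τ
    exact congrArg v ((Equiv.ofBijective _ htyp).apply_symm_apply τ)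

variable [DiscreteTopology (FormClass c σ r)]
  (htyp : Function.Bijective (typ σ ϖ : FormClass c σ r → Typ0 c r))

theorem sphericalEquiv_apply_typ (f : sphericalFunctions c σ r R) (o : FormClass c σ r) :
    sphericalEquiv htyp f (typ σ ϖ o) = (f : FormClass c σ r → R) o :=
  congrArg (f : FormClass c σ r → R) ((Equiv.ofBijective _ htyp).symm_apply_apply o)

theorem pairing_eq_sum (f : sphericalFunctions c σ r R) (v : Typ0 c r →₀ R) :
    pairing σ ϖ (f : FormClass c σ r → R) v = (sphericalEquiv htyp f).sum fun τ y => y * v τ := by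
  have h1 : pairing σ ϖ (f : FormClass c σ r → R) v = ∑ᶠ τ, sphericalEquiv htyp f τ * v τ :=
    finsum_eq_of_bijective _ htyp fun o => by rw [sphericalEquiv_apply_typ]
  rw [h1, finsum_eq_sum_of_support_subset]
  · rfl
  · intro τ hτ
    rw [Finset.mem_coe, Finsupp.mem_support_iff]
    exact left_ne_zero_of_mul hτ

theorem sphericalEquiv_symm_dvec (e : Fin r → ℤ) (s : (Fin r → c.Sign) →* ℤˣ) :
    ((sphericalEquiv htyp).symm (dvec R e s) : FormClass c σ r → R) = deltaFun σ ϖ R e s := by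
  classical
  funext o
  change dvec R e s (typ σ ϖ o) = _
  rw [dvec, Finsupp.finsetSum_apply, deltaFun]
  refine Finset.sum_congr rfl fun χ _ => ?_
  rw [Finsupp.single_apply, mul_ite, mul_one, mul_zero]
  by_cases h : toTyp0 (fun k => (e k, χ k)) = typ σ ϖ o
  · rw [if_pos h, if_pos h.symm]
  · rw [if_neg h, if_neg (Ne.symm h)]

variable (c R F₀ F) in
theorem exists_relGenerators_eq :
    ∃ (t : R) (ε : ℤˣ), relGenerators c R F₀ F = rels c R t ((ε : ℤ) : R) := by
  cases c
  · exact ⟨_, 1, rfl⟩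
  · exact ⟨_, _, rfl⟩
  · exact ⟨_, 1, rfl⟩

/-- The relation `IsStr` is single-valued: a linear map that kills Rel and is correct on weakly
decreasing words computes it. -/
theorem str_eq_of_isStr {t : R} {ε : ℤˣ} (hgen : relGenerators c R F₀ F = rels c R t ((ε : ℤ) : R))
    {str : (Typ c r →₀ R) →ₗ[R] (Typ0 c r →₀ R)}
    (hrel : ∀ v, inclTyp R r v ∈ relSub c t ((ε : ℤ) : R) → str v = 0)
    (hstr : ∀ w, Antitone (expo w) → str (Finsupp.single w 1) = Finsupp.single (toTyp0 w) 1)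
    {v : Typ c r →₀ R} {w : Typ0 c r →₀ R} (h : IsStr F₀ F v w) : str v = w := by
  obtain ⟨u, hu, hr, rfl⟩ := h
  have h1 : str (v - u) = 0 := hrel _ (by
    rw [InRel, hgen] at hr
    exact hr)
  rw [map_sub, sub_eq_zero] at h1
  rw [h1]
  conv_lhs => rw [← u.sum_single]
  rw [Finsupp.mapDomain, map_finsuppSum]
  refine Finsupp.sum_congr fun p hp => ?_
  rw [← mul_one (u p), ← smul_eq_mul, ← Finsupp.smul_single, map_smul, hstr p (hu p hp),
    Finsupp.smul_single]

end Spherical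


/-! ### Arithmetic of local fields: squares, norms and conjugation. -/

/-! ### Squares and quadratic equations in Henselian local rings -/

section Hensel

open IsLocalRing Polynomial

variable {O : Type*} [CommRing O] [HenselianLocalRing O]

/-- Modulo the maximal ideal 0 is a root, and it is simple because the derivative there is b. -/
theorem exists_root_quadratic {b c : O} (hb : IsUnit b) (hc : c ∈ maximalIdeal O) :
    ∃ y ∈ maximalIdeal O, y ^ 2 + b * y + c = 0 := by
  nontriviality O
  have hdeg : (C b * X + C c).degree < ((2 : ℕ) : WithBot ℕ) :=
    lt_of_le_of_lt degree_linear_le (by norm_num)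
  have hf : (X ^ 2 + (C b * X + C c) : O[X]).Monic := monic_X_pow_add hdeg
  obtain ⟨y, hy, hym⟩ := HenselianLocalRing.is_henselian _ hf 0 (by simpa using hc) (by simpa using hb)
  refine ⟨y, by simpa using hym, ?_⟩
  simp only [IsRoot, eval_add, eval_mul, eval_pow, eval_X, eval_C] at hy
  linear_combination hy

theorem exists_sq_eq_of_sub_one_mem (h2 : IsUnit (2 : O)) {u : O} (hu : u - 1 ∈ maximalIdeal O) :
    ∃ v, IsUnit v ∧ v * v = u := by
  -- The equation is (1 + y)² = u.
  obtain ⟨y, hy, h⟩ := exists_root_quadratic h2 (c := 1 - u)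
    (by rw [← neg_sub]; exact neg_mem hu)
  refine ⟨1 + y, ?_, by linear_combination h⟩
  by_contra hn
  exact (maximalIdeal.isMaximal O).ne_top ((Ideal.eq_top_iff_one _).2
    (by simpa using sub_mem ((mem_maximalIdeal _).2 hn) hy))

theorem exists_sq_eq_of_residue_eq (h2 : IsUnit (2 : O)) {u t : O} (ht : IsUnit t)
    (h : residue O u = residue O (t * t)) : ∃ v, IsUnit v ∧ v * v = u := by
  obtain ⟨t, rfl⟩ := ht
  have h1 : u * ↑t⁻¹ * ↑t⁻¹ - 1 ∈ maximalIdeal O := by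
    rw [← residue_eq_zero_iff, map_sub, map_mul, map_mul, h, ← map_mul, ← map_mul, ← map_sub]
    simp [mul_assoc]
  obtain ⟨v, hv, hvu⟩ := exists_sq_eq_of_sub_one_mem h2 h1
  refine ⟨v * t, hv.mul t.isUnit, ?_⟩
  have : v * t * (v * t) = v * v * (t * t) := by ring
  rw [this, hvu]
  have h3 : (↑t⁻¹ : O) * t = 1 := t.inv_mul
  linear_combination (u * (↑t⁻¹ : O) * t + u) * h3

theorem units_isSquare_iff_residue (h2 : IsUnit (2 : O)) (u : Oˣ) :
    IsSquare u ↔ IsSquare (residue O u) := by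
  constructor
  · rintro ⟨v, rfl⟩
    exact ⟨residue O v, by simp⟩
  · rintro ⟨t, ht⟩
    obtain ⟨t, rfl⟩ := residue_surjective t
    rw [← map_mul] at ht
    have htu : IsUnit t := by
      have h1 : IsUnit (residue O (t * t)) := by rw [← ht]; exact u.isUnit.map _
      exact isUnit_of_mul_isUnit_left (isUnit_of_map_unit (residue O) _ h1)
    obtain ⟨v, hv, hvu⟩ := exists_sq_eq_of_residue_eq h2 htu ht
    exact ⟨hv.unit, Units.ext hvu.symm⟩

variable [Finite (ResidueField O)]

theorem ringChar_residueField_ne_two (h2 : IsUnit (2 : O)) : ringChar (ResidueField O) ≠ 2 := by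
  intro h
  have h1 : ((2 : ℕ) : ResidueField O) = 0 := (ringChar.spec _ _).2 h.dvd
  have h3 := h2.map (residue O)
  rw [map_ofNat] at h3
  exact h3.ne_zero (by exact_mod_cast h1)

theorem isSquare_mul_of_not_isSquare (h2 : IsUnit (2 : O)) {u v : Oˣ} (hu : ¬ IsSquare u)
    (hv : ¬ IsSquare v) : IsSquare (u * v) := by
  classical
  let := Fintype.ofFinite (ResidueField O)
  rw [units_isSquare_iff_residue h2] at hu hv ⊢
  rw [← quadraticChar_neg_one_iff_not_isSquare] at hu hv
  by_contra h
  rw [← quadraticChar_neg_one_iff_not_isSquare, Units.val_mul, map_mul, map_mul, hu, hv] at h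
  norm_num at h

theorem exists_not_isSquare (h2 : IsUnit (2 : O)) : ∃ u : Oˣ, ¬ IsSquare u := by
  obtain ⟨a, ha⟩ := FiniteField.exists_nonsquare (ringChar_residueField_ne_two h2)
  obtain ⟨t, rfl⟩ := residue_surjective a
  have ht : IsUnit t := by
    by_contra hn
    exact ha (by rw [(residue_eq_zero_iff _).2 ((mem_maximalIdeal _).2 hn)]; exact IsSquare.zero)
  exact ⟨ht.unit, by rwa [units_isSquare_iff_residue h2]⟩

/-- Over the finite residue field a binary quadratic form represents ν by counting. One of the two
coordinates is then a unit, and that one is corrected by a square root of a unit. -/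
theorem exists_sq_add_mul_sq (h2 : IsUnit (2 : O)) {c ν : O} (hc : IsUnit c) (hν : IsUnit ν) :
    ∃ p q, p * p + c * (q * q) = ν := by
  let := Fintype.ofFinite (ResidueField O)
  have hc0 : residue O c ≠ 0 := (hc.map _).ne_zero
  obtain ⟨a, b, hab⟩ := FiniteField.exists_root_sum_quadratic
    (f := (X ^ 2 : (ResidueField O)[X])) (g := C (residue O c) * X ^ 2 - C (residue O ν))
    (degree_X_pow 2) (by
      rw [degree_sub_eq_left_of_degree_lt, degree_C_mul_X_pow 2 hc0]
      · rfl
      rw [degree_C_mul_X_pow 2 hc0]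
      exact lt_of_le_of_lt degree_C_le (by norm_num))
    (FiniteField.odd_card_of_char_ne_two (ringChar_residueField_ne_two h2))
  obtain ⟨p, rfl⟩ := residue_surjective a
  obtain ⟨q, rfl⟩ := residue_surjective b
  simp only [eval_pow, eval_X, eval_sub, eval_mul, eval_C] at hab
  by_cases hp : IsUnit p
  · obtain ⟨v, -, hv⟩ := exists_sq_eq_of_residue_eq h2 (u := ν - c * (q * q)) hp (by
      simp only [map_sub, map_mul]
      linear_combination -hab)
    exact ⟨v, q, by rw [hv]; ring⟩
  · have hp0 := (residue_eq_zero_iff _).2 ((mem_maximalIdeal _).2 hp)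
    have hq : IsUnit q := by
      by_contra hn
      rw [hp0, (residue_eq_zero_iff _).2 ((mem_maximalIdeal _).2 hn)] at hab
      exact (hν.map (residue O)).ne_zero (by linear_combination -hab)
    obtain ⟨c, rfl⟩ := hc
    obtain ⟨v, -, hv⟩ := exists_sq_eq_of_residue_eq h2 (u := (ν - p * p) * ↑c⁻¹) hq (by
      have h3 : residue O (↑c⁻¹ : O) * residue O c = 1 := by rw [← map_mul, c.inv_mul, map_one]
      simp only [map_sub, map_mul, hp0] at hab ⊢
      linear_combination (-residue O (↑c⁻¹ : O)) * hab + residue O q ^ 2 * h3)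
    refine ⟨p, v, ?_⟩
    have h3 : (c : O) * ↑c⁻¹ = 1 := c.mul_inv
    rw [hv]
    linear_combination (ν - p * p) * h3

end Hensel

theorem henselianLocalRing_integer (K : Type*) [Field K] [ValuativeRel K] [TopologicalSpace K]
    [IsNonarchimedeanLocalField K] : HenselianLocalRing 𝒪[K] := by
  let := IsTopologicalAddGroup.rightUniformSpace K
  have := isUniformAddGroup_of_addCommGroup (G := K)
  have : IsAdicComplete (IsLocalRing.maximalIdeal 𝒪[K]) 𝒪[K] := inferInstance
  refine ⟨fun f hf a ha hu => ?_⟩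
  exact HenselianRing.is_henselian (I := IsLocalRing.maximalIdeal 𝒪[K]) f hf a ha (hu.map _)


/-! ### Quadratic extensions with the same value group -/

section Quadratic

open IsLocalRing ValuativeRel

section Galois

variable {k E : Type*} [Field k] [Field E] [Algebra k E] {σ : E ≃ₐ[k] E}

/-- An extension of prime degree has no proper intermediate algebra, so the fixed algebra is the
base field or everything. -/
theorem exists_algebraMap_eq_of_fixed (h2 : Module.finrank k E = 2) (hσ : σ ≠ 1) {x : E}
    (hx : σ x = x) : ∃ a, algebraMap k E a = x := by
  have : IsSimpleOrder (Subalgebra k E) :=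
    Subalgebra.isSimpleOrder_of_finrank_prime k E (by rw [h2]; exact Nat.prime_two)
  rcases eq_bot_or_eq_top (AlgHom.equalizer (σ : E →ₐ[k] E) (AlgHom.id k E)) with h | h
  · have hm : x ∈ AlgHom.equalizer (σ : E →ₐ[k] E) (AlgHom.id k E) := hx
    rw [h] at hm
    exact Algebra.mem_bot.1 hm
  · refine absurd (AlgEquiv.ext fun y => ?_) hσ
    have hy : y ∈ AlgHom.equalizer (σ : E →ₐ[k] E) (AlgHom.id k E) := h ▸ Algebra.mem_top
    exact hy

/-- Otherwise 1, σ and σ² would be three automorphisms in degree two. -/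
theorem involutive_of_finrank_eq_two (h2 : Module.finrank k E = 2) (hσ : σ ≠ 1) (x : E) :
    σ (σ x) = x := by
  classical
  have : FiniteDimensional k E := Module.finite_of_finrank_pos (by omega)
  by_contra hx
  have h3 : σ * σ ≠ 1 := fun h => hx (DFunLike.congr_fun h x)
  have h4 : σ * σ ≠ σ := fun h => hσ (mul_eq_left.1 h)
  have h5 : ({1, σ, σ * σ} : Finset (E ≃ₐ[k] E)).card = 3 := by
    rw [Finset.card_insert_of_notMem, Finset.card_insert_of_notMem, Finset.card_singleton]
    · simpa using h4.symm
    · simp only [Finset.mem_insert, Finset.mem_singleton, not_or]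
      exact ⟨hσ.symm, h3.symm⟩
  have h6 := Finset.card_le_univ ({1, σ, σ * σ} : Finset (E ≃ₐ[k] E))
  have h7 := AlgEquiv.card_le (F := k) (K := E)
  omega

end Galois

variable {F₀ F : Type*}
  [Field F₀] [ValuativeRel F₀] [Field F] [ValuativeRel F] [Algebra F₀ F] [ValuativeExtension F₀ F]

theorem valuation_algebraMap_le_iff (a b : F₀) :
    valuation F (algebraMap F₀ F a) ≤ valuation F (algebraMap F₀ F b) ↔
      valuation F₀ a ≤ valuation F₀ b := by
  rw [← (valuation F).vle_iff_le, ← (valuation F₀).vle_iff_le, ValuativeExtension.vle_iff_vle]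

theorem valuation_algebraMap_le_one_iff (a : F₀) :
    valuation F (algebraMap F₀ F a) ≤ 1 ↔ valuation F₀ a ≤ 1 := by
  simpa using valuation_algebraMap_le_iff (F := F) a 1

theorem one_le_valuation_algebraMap_iff (a : F₀) :
    1 ≤ valuation F (algebraMap F₀ F a) ↔ 1 ≤ valuation F₀ a := by
  simpa using valuation_algebraMap_le_iff (F := F) 1 a

variable (F₀ F) in
/-- The inclusion of rings of integers. -/
def inclO : 𝒪[F₀] →+* 𝒪[F] :=
  (algebraMap F₀ F).restrict 𝒪[F₀] 𝒪[F] fun x hx => (valuation_algebraMap_le_one_iff x).2 hx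

theorem coe_inclO (a : 𝒪[F₀]) : (inclO F₀ F a : F) = algebraMap F₀ F a := rfl

theorem isUnit_iff_one_le_valuation {K : Type*} [Field K] [ValuativeRel K] (x : 𝒪[K]) :
    IsUnit x ↔ 1 ≤ valuation K (x : K) := by
  rw [← not_iff_not, Valuation.Integer.not_isUnit_iff_valuation_lt_one, not_le]

theorem isUnit_inclO_iff (a : 𝒪[F₀]) : IsUnit (inclO F₀ F a) ↔ IsUnit a := by
  rw [isUnit_iff_one_le_valuation, isUnit_iff_one_le_valuation, coe_inclO,
    one_le_valuation_algebraMap_iff]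

/-- If value groups agree, every integer is an integer of the base field times a unit. -/
theorem exists_inclO_mul_unit
    (hval : ∀ x : F, ∃ y : F₀, valuation F (algebraMap F₀ F y) = valuation F x) (x : 𝒪[F]) :
    ∃ (a : 𝒪[F₀]) (u : (𝒪[F])ˣ), x = inclO F₀ F a * u := by
  by_cases hx : (x : F) = 0
  · exact ⟨0, 1, Subtype.ext (by simp [hx])⟩
  · obtain ⟨y, hy⟩ := hval x
    have hy1 : valuation F₀ y ≤ 1 := by
      rw [← valuation_algebraMap_le_one_iff (F := F), hy]
      exact x.2
    have hv0 : valuation F (x : F) ≠ 0 := (valuation F).ne_zero_iff.2 hx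
    have hy0 : algebraMap F₀ F y ≠ 0 := (valuation F).ne_zero_iff.1 (hy ▸ hv0)
    have hu : valuation F ((x : F) / algebraMap F₀ F y) = 1 := by
      rw [map_div₀, hy, div_self hv0]
    have huu : IsUnit (⟨(x : F) / algebraMap F₀ F y, hu.le⟩ : 𝒪[F]) :=
      (isUnit_iff_one_le_valuation _).2 hu.ge
    exact ⟨⟨y, hy1⟩, huu.unit, Subtype.ext (mul_div_cancel₀ _ hy0).symm⟩

variable [TopologicalSpace F₀] [IsNonarchimedeanLocalField F₀]
  [TopologicalSpace F] [IsNonarchimedeanLocalField F]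

theorem irreducible_inclO
    (hval : ∀ x : F, ∃ y : F₀, valuation F (algebraMap F₀ F y) = valuation F x) {ϖ : 𝒪[F₀]}
    (hϖ : Irreducible ϖ) : Irreducible (inclO F₀ F ϖ) := by
  rw [IsDiscreteValuationRing.irreducible_iff_uniformizer]
  have h0 := (IsDiscreteValuationRing.irreducible_iff_uniformizer ϖ).1 hϖ
  apply le_antisymm
  · intro x hx
    obtain ⟨a, u, rfl⟩ := exists_inclO_mul_unit hval x
    have ha : a ∈ maximalIdeal 𝒪[F₀] := by
      rw [mem_maximalIdeal, mem_nonunits_iff] at hx ⊢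
      exact fun h => hx (((isUnit_inclO_iff a).2 h).mul u.isUnit)
    rw [h0, Ideal.mem_span_singleton] at ha
    exact Ideal.mem_span_singleton.2 ((map_dvd (inclO F₀ F) ha).mul_right _)
  · rw [Ideal.span_singleton_le_iff_mem, mem_maximalIdeal, mem_nonunits_iff, isUnit_inclO_iff]
    exact hϖ.not_isUnit

variable {σ : F ≃ₐ[F₀] F}

/-- If σ u were larger than the unit u, trace T and norm N would both have the size of σ u. Hensel
then gives a root y in F₀ of Ny² − Ty + 1 = (uy − 1)(σu·y − 1), so u or σ u lies in F₀, whence σ u =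
u. -/
theorem valuation_conj_le_one (h2 : Module.finrank F₀ F = 2) (hσ : σ ≠ 1) {u : F}
    (hu : valuation F u = 1) : valuation F (σ u) ≤ 1 := by
  by_contra! hlt
  have hinv := involutive_of_finrank_eq_two h2 hσ
  obtain ⟨T, hT⟩ := exists_algebraMap_eq_of_fixed h2 hσ (x := σ u + u)
    (by rw [map_add, hinv, add_comm])
  obtain ⟨N, hN⟩ := exists_algebraMap_eq_of_fixed h2 hσ (x := σ u * u)
    (by rw [map_mul, hinv, mul_comm])
  have hvT : valuation F (algebraMap F₀ F T) = valuation F (σ u) := by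
    rw [hT, (valuation F).map_add_eq_of_lt_left (by rw [hu]; exact hlt)]
  have hvN : valuation F (algebraMap F₀ F N) = valuation F (σ u) := by
    rw [hN, map_mul, hu, mul_one]
  have hv0 : valuation F (σ u) ≠ 0 := (zero_lt_one.trans hlt).ne'
  have hN0 : N ≠ 0 := by
    rintro rfl
    rw [map_zero, map_zero] at hvN
    exact hv0 hvN.symm
  have hb1 : valuation F (algebraMap F₀ F (-T / N)) = 1 := by
    rw [map_div₀, map_neg, map_div₀, Valuation.map_neg, hvT, hvN, div_self hv0]
  have hc1 : valuation F (algebraMap F₀ F (1 / N)) < 1 := by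
    rw [map_div₀, map_one, map_div₀, map_one, hvN, one_div]
    exact inv_lt_one_of_one_lt₀ hlt
  have := henselianLocalRing_integer F₀
  obtain ⟨y, -, hy⟩ := exists_root_quadratic
    (b := (⟨-T / N, (valuation_algebraMap_le_one_iff (F := F) _).1 hb1.le⟩ : 𝒪[F₀]))
    (c := ⟨1 / N, (valuation_algebraMap_le_one_iff (F := F) _).1 hc1.le⟩)
    ((isUnit_iff_one_le_valuation _).2 ((one_le_valuation_algebraMap_iff (F := F) _).1 hb1.ge))
    (by
      rw [mem_maximalIdeal, mem_nonunits_iff, isUnit_iff_one_le_valuation,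
        ← one_le_valuation_algebraMap_iff (F := F), not_le]
      exact hc1)
  have hy' : (y : F₀) ^ 2 + -T / N * y + 1 / N = 0 := congrArg Subtype.val hy
  have hy2 : N * (y : F₀) ^ 2 - T * y + 1 = 0 := by
    field_simp at hy'
    linear_combination hy'
  have hy3 : (u * algebraMap F₀ F y - 1) * (σ u * algebraMap F₀ F y - 1) = 0 := by
    have h := congrArg (algebraMap F₀ F) hy2
    simp only [map_add, map_sub, map_mul, map_pow, map_one, map_zero, hT, hN] at h
    linear_combination h
  have hfix : σ u = u := by
    have hy0 : algebraMap F₀ F y ≠ 0 := by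
      intro h
      rw [h] at hy3
      simp at hy3
    rcases mul_eq_zero.1 hy3 with h | h
    · have h1 : u = algebraMap F₀ F (y : F₀)⁻¹ := by
        rw [map_inv₀]
        exact eq_inv_of_mul_eq_one_left (sub_eq_zero.1 h)
      rw [h1, AlgEquiv.commutes]
    · have h1 : σ u = algebraMap F₀ F (y : F₀)⁻¹ := by
        rw [map_inv₀]
        exact eq_inv_of_mul_eq_one_left (sub_eq_zero.1 h)
      rw [← hinv u, h1, AlgEquiv.commutes, AlgEquiv.commutes]
  rw [hfix, hu] at hlt
  exact lt_irrefl _ hlt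

theorem conj_mem_integer (h2 : Module.finrank F₀ F = 2) (hσ : σ ≠ 1)
    (hval : ∀ x : F, ∃ y : F₀, valuation F (algebraMap F₀ F y) = valuation F x) (x : F)
    (hx : x ∈ 𝒪[F]) : σ x ∈ 𝒪[F] := by
  obtain ⟨a, u, h⟩ := exists_inclO_mul_unit hval ⟨x, hx⟩
  have h1 : x = algebraMap F₀ F a * (u : 𝒪[F]) := congrArg Subtype.val h
  have hu : valuation F ((u : 𝒪[F]) : F) = 1 :=
    le_antisymm (u : 𝒪[F]).2 ((isUnit_iff_one_le_valuation _).1 u.isUnit)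
  rw [h1, map_mul, AlgEquiv.commutes]
  exact Subring.mul_mem _ (inclO F₀ F a).2 (valuation_conj_le_one h2 hσ hu)

/-- The conjugation of the ring of integers. -/
def conjO (h2 : Module.finrank F₀ F = 2) (hσ : σ ≠ 1)
    (hval : ∀ x : F, ∃ y : F₀, valuation F (algebraMap F₀ F y) = valuation F x) : 𝒪[F] →+* 𝒪[F] :=
  (σ : F →+* F).restrict 𝒪[F] 𝒪[F] (conj_mem_integer h2 hσ hval)

section Conj

variable (h2 : Module.finrank F₀ F = 2) (hσ : σ ≠ 1)
  (hval : ∀ x : F, ∃ y : F₀, valuation F (algebraMap F₀ F y) = valuation F x)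

theorem conjO_conjO (x : 𝒪[F]) : conjO h2 hσ hval (conjO h2 hσ hval x) = x :=
  Subtype.ext (involutive_of_finrank_eq_two h2 hσ _)

theorem conjO_inclO (a : 𝒪[F₀]) : conjO h2 hσ hval (inclO F₀ F a) = inclO F₀ F a :=
  Subtype.ext (σ.commutes _)

include h2 hσ in
theorem exists_inclO_eq {x : 𝒪[F]} (hx : conjO h2 hσ hval x = x) : ∃ a, inclO F₀ F a = x := by
  obtain ⟨a, ha⟩ : ∃ a, algebraMap F₀ F a = (x : F) :=
    exists_algebraMap_eq_of_fixed h2 hσ (congrArg Subtype.val hx)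
  refine ⟨⟨a, ?_⟩, Subtype.ext ha⟩
  have := x.2
  rw [← ha] at this
  exact (valuation_algebraMap_le_one_iff a).1 this

include h2 hσ hval in
/-- The residue field extension is nontrivial. -/
theorem exists_sub_isUnit : ∃ δ : 𝒪[F], ∀ a : 𝒪[F₀], IsUnit (δ - inclO F₀ F a) := by
  by_contra! hcon
  obtain ⟨ϖ, hϖ⟩ := IsDiscreteValuationRing.exists_irreducible 𝒪[F₀]
  have hπ := irreducible_inclO hval hϖ
  have h0 := (IsDiscreteValuationRing.irreducible_iff_uniformizer _).1 hπ
  -- If every integer were congruent to one of F₀, writing δ = a + πδ' would give σδ − δ = π(σδ' −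
  -- δ'); iterating forces σ to be trivial.
  have hdvd : ∀ (n : ℕ) (δ : 𝒪[F]), inclO F₀ F ϖ ^ n ∣ conjO h2 hσ hval δ - δ := by
    intro n
    induction n with
    | zero => intro δ; simp
    | succ n ih =>
      intro δ
      obtain ⟨a, ha⟩ := hcon δ
      have hm : δ - inclO F₀ F a ∈ maximalIdeal 𝒪[F] := ha
      rw [h0, Ideal.mem_span_singleton] at hm
      obtain ⟨δ', hδ'⟩ := hm
      have h1 : conjO h2 hσ hval δ - δ = inclO F₀ F ϖ * (conjO h2 hσ hval δ' - δ') := by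
        rw [sub_eq_iff_eq_add] at hδ'
        rw [hδ', map_add, map_mul, conjO_inclO, conjO_inclO]
        ring
      rw [h1, pow_succ']
      exact mul_dvd_mul_left _ (ih δ')
  have hfix : ∀ δ, conjO h2 hσ hval δ = δ := by
    intro δ
    by_contra hne
    obtain ⟨n, u, hn⟩ := IsDiscreteValuationRing.eq_unit_mul_pow_irreducible (sub_ne_zero.2 hne) hπ
    have h1 := hdvd (n + 1) δ
    rw [hn, pow_succ, mul_comm (u : 𝒪[F])] at h1
    have h3 : inclO F₀ F ϖ ∣ (u : 𝒪[F]) := (mul_dvd_mul_iff_left (pow_ne_zero n hπ.ne_zero)).1 h1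
    exact hπ.not_isUnit (isUnit_of_dvd_unit h3 u.isUnit)
  refine hσ (AlgEquiv.ext fun x => ?_)
  obtain ⟨y, z, -, rfl⟩ := IsFractionRing.div_surjective (A := 𝒪[F]) x
  rw [map_div₀]
  exact congrArg₂ (· / ·) (congrArg Subtype.val (hfix y)) (congrArg Subtype.val (hfix z))

theorem isUnit_two_of_inclO : IsUnit (2 : 𝒪[F]) ↔ IsUnit (2 : 𝒪[F₀]) := by
  have h := isUnit_inclO_iff (F := F) (2 : 𝒪[F₀])
  rwa [map_ofNat] at h

theorem exists_sq_sub_mem (h : ¬ IsUnit (2 : 𝒪[F₀])) (u : 𝒪[F₀]) :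
    ∃ x, x ^ 2 - u ∈ maximalIdeal 𝒪[F₀] := by
  have hchar : ringChar 𝓀[F₀] = 2 := by
    have h1 : ((2 : ℕ) : 𝓀[F₀]) = 0 := by
      have := (residue_eq_zero_iff (2 : 𝒪[F₀])).2 h
      rw [map_ofNat] at this
      exact_mod_cast this
    have h3 := (ringChar.spec _ _).1 h1
    exact ((Nat.dvd_prime Nat.prime_two).1 h3).resolve_left CharP.ringChar_ne_one
  obtain ⟨t, ht⟩ := FiniteField.isSquare_of_char_two hchar (residue _ u)
  obtain ⟨x, rfl⟩ := residue_surjective t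
  refine ⟨x, ?_⟩
  rw [← residue_eq_zero_iff, map_sub, ht, map_pow]
  ring

theorem inclO_mem_maximalIdeal {a : 𝒪[F₀]} (ha : a ∈ maximalIdeal 𝒪[F₀]) :
    inclO F₀ F a ∈ maximalIdeal 𝒪[F] := by
  rw [mem_maximalIdeal, mem_nonunits_iff] at ha ⊢
  rwa [isUnit_inclO_iff]

/-- If 2 is a unit, δ − σδ is 2 times the unit δ − T/2, where T is the trace. In residue
characteristic 2, choose a with a² congruent to the norm of δ; then (δ − a)² is congruent to δ(δ −
σδ). -/
theorem isUnit_sub_conjO {δ : 𝒪[F]} (hδ : ∀ a : 𝒪[F₀], IsUnit (δ - inclO F₀ F a)) :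
    IsUnit (δ - conjO h2 hσ hval δ) := by
  by_contra hn
  have hm : δ - conjO h2 hσ hval δ ∈ maximalIdeal 𝒪[F] := hn
  by_cases h : IsUnit (2 : 𝒪[F₀])
  · obtain ⟨v, hv⟩ := h
    obtain ⟨T, hT⟩ := exists_inclO_eq h2 hσ hval (x := δ + conjO h2 hσ hval δ)
      (by rw [map_add, conjO_conjO, add_comm])
    have h1 := hδ (↑v⁻¹ * T)
    have h3 : inclO F₀ F ↑v⁻¹ * 2 = 1 := by
      rw [← map_ofNat (inclO F₀ F), ← hv, ← map_mul, v.inv_mul, map_one]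
    have h4 : δ - inclO F₀ F (↑v⁻¹ * T) = inclO F₀ F ↑v⁻¹ * (δ - conjO h2 hσ hval δ) := by
      rw [map_mul, hT]
      linear_combination (-δ) * h3
    rw [h4] at h1
    exact (mem_maximalIdeal _).1 (Ideal.mul_mem_left _ _ hm) h1
  · obtain ⟨N, hN⟩ := exists_inclO_eq h2 hσ hval (x := δ * conjO h2 hσ hval δ)
      (by rw [map_mul, conjO_conjO, mul_comm])
    obtain ⟨a, ha⟩ := exists_sq_sub_mem h N
    have ha' := inclO_mem_maximalIdeal (F := F) ha
    have h2' : (2 : 𝒪[F]) ∈ maximalIdeal 𝒪[F] := by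
      rw [← isUnit_two_of_inclO (F := F)] at h
      exact h
    rw [map_sub, map_pow, hN] at ha'
    have h4 : (δ - inclO F₀ F a) * (δ - inclO F₀ F a) ∈ maximalIdeal 𝒪[F] := by
      have : (δ - inclO F₀ F a) * (δ - inclO F₀ F a) = δ * (δ - conjO h2 hσ hval δ) -
          (inclO F₀ F a ^ 2 - δ * conjO h2 hσ hval δ) +
          2 * (inclO F₀ F a * (inclO F₀ F a - δ)) := by ring
      rw [this]
      exact add_mem (sub_mem (Ideal.mul_mem_left _ _ hm) ha') (Ideal.mul_mem_right _ _ h2')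
    exact (mem_maximalIdeal _).1 h4 ((hδ a).mul (hδ a))

-- The witness θ = δ/(δ − σδ) has trace 1, since the denominator changes sign under conjugation.
include h2 hσ in
theorem exists_add_conjO_isUnit : ∃ θ, IsUnit (θ + conjO h2 hσ hval θ) := by
  obtain ⟨δ, hδ⟩ := exists_sub_isUnit h2 hσ hval
  obtain ⟨v, hv⟩ := isUnit_sub_conjO h2 hσ hval hδ
  have h1 : conjO h2 hσ hval ↑v⁻¹ = -↑v⁻¹ := by
    have h3 : conjO h2 hσ hval ↑v⁻¹ * conjO h2 hσ hval (v : 𝒪[F]) = 1 := by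
      rw [← map_mul, v.inv_mul, map_one]
    have h4 : conjO h2 hσ hval (v : 𝒪[F]) = -v := by
      rw [hv, map_sub, conjO_conjO, neg_sub]
    rw [h4] at h3
    have h5 : (v : 𝒪[F]) * ↑v⁻¹ = 1 := v.mul_inv
    linear_combination (-(↑v⁻¹ : 𝒪[F])) * h3 - conjO h2 hσ hval ↑v⁻¹ * h5
  refine ⟨δ * ↑v⁻¹, ?_⟩
  have h6 : δ * ↑v⁻¹ + conjO h2 hσ hval (δ * ↑v⁻¹) = 1 := by
    rw [map_mul, h1, mul_neg, ← sub_eq_add_neg, ← sub_mul, ← hv, v.mul_inv]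
  rw [h6]
  exact isUnit_one

include h2 hσ in
/-- Every unit fixed by conjugation is a norm. -/
theorem exists_norm_eq {u : 𝒪[F]} (hu : IsUnit u) (hfix : conjO h2 hσ hval u = u) :
    ∃ c, IsUnit c ∧ conjO h2 hσ hval c * c = u := by
  suffices h : ∃ c, conjO h2 hσ hval c * c = u by
    obtain ⟨c, rfl⟩ := h
    exact ⟨c, isUnit_of_mul_isUnit_right hu, rfl⟩
  have := henselianLocalRing_integer F₀
  obtain ⟨u, rfl⟩ := exists_inclO_eq h2 hσ hval hfix
  rw [isUnit_inclO_iff] at hu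
  obtain ⟨δ, hδ⟩ := exists_sub_isUnit h2 hσ hval
  obtain ⟨T, hT⟩ := exists_inclO_eq h2 hσ hval (x := δ + conjO h2 hσ hval δ)
    (by rw [map_add, conjO_conjO, add_comm])
  -- If 2 is a unit, use ρ with σρ = −ρ: the norm of p + qρ is p² − ρ²q², which represents every
  -- unit.
  by_cases h : IsUnit (2 : 𝒪[F₀])
  · have h' := h
    obtain ⟨v, hv⟩ := h
    set ρ := δ - inclO F₀ F (↑v⁻¹ * T) with hρ
    have hρu : IsUnit ρ := hδ _
    have hρc : conjO h2 hσ hval ρ = -ρ := by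
      have h3 : inclO F₀ F ↑v⁻¹ * 2 = 1 := by
        rw [← map_ofNat (inclO F₀ F), ← hv, ← map_mul, v.inv_mul, map_one]
      rw [hρ, map_sub, conjO_inclO, map_mul, hT]
      linear_combination -(δ + conjO h2 hσ hval δ) * h3
    obtain ⟨N, hN⟩ := exists_inclO_eq h2 hσ hval (x := -(ρ * ρ))
      (by rw [map_neg, map_mul, hρc, neg_mul_neg])
    have hNu : IsUnit N := by
      rw [← isUnit_inclO_iff (F := F), hN]
      exact (hρu.mul hρu).neg
    obtain ⟨p, q, hpq⟩ := exists_sq_add_mul_sq h' hNu hu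
    refine ⟨inclO F₀ F p + inclO F₀ F q * ρ, ?_⟩
    rw [map_add, map_mul, conjO_inclO, conjO_inclO, hρc, ← hpq, map_add, map_mul, map_mul, map_mul, hN]
    ring
  · obtain ⟨N, hN⟩ := exists_inclO_eq h2 hσ hval (x := δ * conjO h2 hσ hval δ)
      (by rw [map_mul, conjO_conjO, mul_comm])
    have h2' : (2 : 𝒪[F]) ∈ maximalIdeal 𝒪[F] := by
      rw [← isUnit_two_of_inclO (F := F)] at h
      exact h
    have hδu : IsUnit δ := by simpa using hδ 0
    have hNu : IsUnit N := by
      rw [← isUnit_inclO_iff (F := F), hN]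
      exact hδu.mul (hδu.map _)
    have hTu : IsUnit T := by
      rw [← isUnit_inclO_iff (F := F), hT]
      by_contra hn
      have h5 : δ - conjO h2 hσ hval δ ∈ maximalIdeal 𝒪[F] := by
        have : δ - conjO h2 hσ hval δ = (δ + conjO h2 hσ hval δ) - 2 * conjO h2 hσ hval δ := by ring
        rw [this]
        exact sub_mem ((mem_maximalIdeal _).2 hn) (Ideal.mul_mem_right _ _ h2')
      exact (mem_maximalIdeal _).1 h5 (isUnit_sub_conjO h2 hσ hval hδ)
    obtain ⟨x, hx⟩ := exists_sq_sub_mem h u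
    have hxu : IsUnit x := by
      by_contra hn
      have : u = x * x - (x ^ 2 - u) := by ring
      have h5 : u ∈ maximalIdeal 𝒪[F₀] := by
        rw [this]
        exact sub_mem (Ideal.mul_mem_left _ _ ((mem_maximalIdeal _).2 hn)) hx
      exact (mem_maximalIdeal _).1 h5 hu
    obtain ⟨N, rfl⟩ := hNu
    -- In residue characteristic 2, x² ≡ u is solvable, and Hensel solves x² + Txy + Ny² = u in y,
    -- the trace T being a unit; the left side is the norm of x + yδ.
    obtain ⟨y, -, hy⟩ := exists_root_quadratic (b := T * x * ↑N⁻¹) (c := (x ^ 2 - u) * ↑N⁻¹)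
      ((hTu.mul hxu).mul N⁻¹.isUnit) (Ideal.mul_mem_right _ _ hx)
    have hy' : x ^ 2 + T * x * y + N * y ^ 2 = u := by
      have h5 : (N : 𝒪[F₀]) * ↑N⁻¹ = 1 := N.mul_inv
      linear_combination (N : 𝒪[F₀]) * hy - (T * x * y + (x ^ 2 - u)) * h5
    refine ⟨inclO F₀ F x + inclO F₀ F y * δ, ?_⟩
    rw [map_add, map_mul, conjO_inclO, conjO_inclO, ← hy']
    simp only [map_add, map_mul, map_pow, hN, hT]
    ring

end Conj

end Quadratic


/-! ### Classification of forms: Jordan splitting and its uniqueness. -/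

/-! ### Change of basis for sesquilinear forms -/

section Congruence

open Matrix

variable {K A m n o ι κ : Type*} [CommRing K] [CommRing A]

/-- Conjugate transpose with respect to a ring endomorphism. -/
def conjT (s : K →+* K) (M : Matrix m n K) : Matrix n m K := (M.map s)ᵀ

theorem conjT_mul [Fintype n] (s : K →+* K) (M : Matrix m n K) (N : Matrix n o K) :
    conjT s (M * N) = conjT s N * conjT s M := by
  simp [conjT, Matrix.map_mul, transpose_mul]

theorem conjT_one [DecidableEq n] (s : K →+* K) : conjT s (1 : Matrix n n K) = 1 := by
  simp [conjT, Matrix.map_one]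

theorem conjT_zero (s : K →+* K) : conjT s (0 : Matrix m n K) = 0 := by
  ext; simp [conjT]

theorem conjT_neg (s : K →+* K) (M : Matrix m n K) : conjT s (-M) = -conjT s M := by
  ext; simp [conjT]

theorem conjT_conjT {s : K →+* K} (hs : ∀ x, s (s x) = x) (M : Matrix m n K) :
    conjT s (conjT s M) = M := by
  ext; simp [conjT, hs]

theorem conjT_smul {s : K →+* K} {t : K} (ht : s t = t) (M : Matrix m n K) :
    conjT s (t • M) = t • conjT s M := by
  ext; simp [conjT, ht]

theorem conjT_map {s : K →+* K} {s' : A →+* A} {f : A →+* K} (h : ∀ a, f (s' a) = s (f a))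
    (M : Matrix m n A) : conjT s (M.map f) = (conjT s' M).map f := by
  ext; simp [conjT, h]

theorem conjT_fromBlocks {l : Type*} (s : K →+* K) (P : Matrix m n K) (B : Matrix m o K)
    (C : Matrix l n K) (D : Matrix l o K) :
    conjT s (fromBlocks P B C D) =
      fromBlocks (conjT s P) (conjT s C) (conjT s B) (conjT s D) := by
  simp [conjT, fromBlocks_map, fromBlocks_transpose]

theorem det_conjT [Fintype n] [DecidableEq n] (s : K →+* K) (M : Matrix n n K) :
    (conjT s M).det = s M.det := by
  rw [conjT, det_transpose, RingHom.map_det]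
  rfl

variable [Fintype ι] [DecidableEq ι] [Fintype κ] [DecidableEq κ]

/-- The Gram matrices `X` and `Y` are related by a change of basis over `A`. -/
def Cong (f : A →+* K) (s : K →+* K) (X Y : Matrix ι ι K) : Prop :=
  ∃ k : Matrix ι ι A, IsUnit k.det ∧ Y = conjT s (k.map f) * X * k.map f

variable {f : A →+* K} {s : K →+* K} {X Y Z : Matrix ι ι K} {X' Y' : Matrix κ κ K}

theorem Cong.refl (X : Matrix ι ι K) : Cong f s X X :=
  ⟨1, by simp, by simp [Matrix.map_one, conjT_one]⟩

theorem Cong.trans (h : Cong f s X Y) (h' : Cong f s Y Z) : Cong f s X Z := by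
  obtain ⟨k, hk, rfl⟩ := h
  obtain ⟨l, hl, rfl⟩ := h'
  refine ⟨k * l, by rw [det_mul]; exact hk.mul hl, ?_⟩
  simp only [Matrix.map_mul, conjT_mul, Matrix.mul_assoc]

theorem Cong.submatrix (h : Cong f s X Y) (e : κ ≃ ι) :
    Cong f s (X.submatrix e e) (Y.submatrix e e) := by
  obtain ⟨k, hk, rfl⟩ := h
  refine ⟨k.submatrix e e, by rwa [det_submatrix_equiv_self], ?_⟩
  have h1 : conjT s ((k.submatrix e e).map f) = (conjT s (k.map f)).submatrix e e := rfl
  have h2 : (k.submatrix e e).map f = (k.map f).submatrix e e := rfl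
  rw [h1, h2, submatrix_mul_equiv, submatrix_mul_equiv]

theorem cong_submatrix_perm (X : Matrix ι ι K) (p : Equiv.Perm ι) :
    Cong f s X (X.submatrix p p) := by
  refine ⟨(1 : Matrix ι ι A).submatrix id p, ?_, ?_⟩
  · rw [det_permute', det_one, mul_one]
    exact (Units.isUnit (Equiv.Perm.sign p)).map (Int.castRingHom A)
  · have h1 : ((1 : Matrix ι ι A).submatrix id p).map f = (1 : Matrix ι ι K).submatrix id p := by
      rw [← submatrix_map, Matrix.map_one _ f.map_zero f.map_one]
    have h2 : conjT s ((1 : Matrix ι ι K).submatrix id p) = (1 : Matrix ι ι K).submatrix p id := by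
      have h3 : conjT s ((1 : Matrix ι ι K).submatrix id p) =
          (conjT s (1 : Matrix ι ι K)).submatrix p id := rfl
      rw [h3, conjT_one]
    rw [h1, h2]
    ext a b
    simp [Matrix.mul_apply, one_apply]

theorem Cong.fromBlocks (h : Cong f s X Y) (h' : Cong f s X' Y') :
    Cong f s (Matrix.fromBlocks X 0 0 X') (Matrix.fromBlocks Y 0 0 Y') := by
  obtain ⟨k, hk, rfl⟩ := h
  obtain ⟨l, hl, rfl⟩ := h'
  refine ⟨Matrix.fromBlocks k 0 0 l, by rw [det_fromBlocks_zero₂₁]; exact hk.mul hl, ?_⟩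
  rw [fromBlocks_map, conjT_fromBlocks, Matrix.map_zero _ f.map_zero, Matrix.map_zero _ f.map_zero,
    conjT_zero, conjT_zero]
  simp [fromBlocks_multiply]

theorem Cong.smul (h : Cong f s X Y) (t : K) : Cong f s (t • X) (t • Y) := by
  obtain ⟨k, hk, rfl⟩ := h
  exact ⟨k, hk, by simp⟩

theorem Cong.map {s' : A →+* A} (hf : ∀ a, f (s' a) = s (f a)) {X Y : Matrix ι ι A}
    (h : Cong (RingHom.id A) s' X Y) : Cong f s (X.map f) (Y.map f) := by
  obtain ⟨k, hk, rfl⟩ := h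
  refine ⟨k, hk, ?_⟩
  simp only [RingHom.coe_id, Matrix.map_id, Matrix.map_mul]
  rw [conjT_map hf]

theorem Cong.conjT_eq (hs : ∀ x, s (s x) = x) {ε : ℤ} (h : Cong f s X Y)
    (hX : conjT s X = ε • X) : conjT s Y = ε • Y := by
  obtain ⟨k, hk, rfl⟩ := h
  rw [conjT_mul, conjT_mul, conjT_conjT hs, hX]
  simp only [Matrix.mul_assoc, Matrix.mul_smul, Matrix.smul_mul]

theorem Cong.isUnit_det (h : Cong f s X Y) (hX : IsUnit X.det) : IsUnit Y.det := by
  obtain ⟨k, hk, rfl⟩ := h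
  have h1 : IsUnit (k.map f).det := by
    have := hk.map f
    rwa [RingHom.map_det] at this
  rw [det_mul, det_mul, det_conjT]
  exact ((h1.map s).mul hX).mul h1

/-- A unimodular block splits off. -/
theorem cong_fromBlocks {s : A →+* A} {ε : ℤ} {P : Matrix ι ι A} {B : Matrix ι κ A}
    {C : Matrix κ ι A} {D : Matrix κ κ A} (hP : IsUnit P.det)
    (hX : conjT s (fromBlocks P B C D) = ε • fromBlocks P B C D) :
    ∃ Y, Cong (RingHom.id A) s (fromBlocks P B C D) (fromBlocks P 0 0 Y) := by
  rw [conjT_fromBlocks, fromBlocks_smul, fromBlocks_inj] at hX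
  obtain ⟨hPP, hCB, hBC, -⟩ := hX
  have h1 : P * P⁻¹ = 1 := mul_nonsing_inv P hP
  have h2 : ε • (conjT s P⁻¹ * P) = 1 := by
    have h3 := congrArg (conjT s) h1
    rw [conjT_mul, conjT_one, hPP] at h3
    rw [← h3, mul_smul_comm]
  -- This is the Schur complement, cleared by one block transvection; the symmetry of P makes ε
  -- times the conjugate transpose of P⁻¹ an inverse of P.
  refine ⟨-(ε • C * conjT s P⁻¹) * B + D, fromBlocks 1 (-(P⁻¹ * B)) 0 1, by simp, ?_⟩
  rw [RingHom.coe_id, Matrix.map_id, conjT_fromBlocks, conjT_one, conjT_one, conjT_zero, conjT_neg,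
    conjT_mul, hBC]
  have h4 : -(ε • C * conjT s P⁻¹) * P + C = 0 := by
    have : ε • C * conjT s P⁻¹ * P = C * (ε • (conjT s P⁻¹ * P)) := by
      simp only [Matrix.mul_assoc, Matrix.mul_smul, Matrix.smul_mul]
    rw [Matrix.neg_mul, this, h2, Matrix.mul_one, neg_add_cancel]
  have h5 : P * -(P⁻¹ * B) + B = 0 := by
    rw [Matrix.mul_neg, ← Matrix.mul_assoc, h1, Matrix.one_mul, neg_add_cancel]
  simp only [fromBlocks_multiply, Matrix.one_mul, Matrix.mul_one, Matrix.zero_mul, Matrix.mul_zero,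
    add_zero]
  rw [h4, h5, Matrix.zero_mul, zero_add]

end Congruence

/-! ### Splitting off unimodular blocks -/

section Splitting

open Matrix

variable {A Sg : Type*} [CommRing A] {γ : ℕ}

/-- Every form with a unit entry has one of the blocks `M χ` as an orthogonal summand. -/
def Splits (s : A →+* A) (ε : ℤ) (M : Sg → Matrix (Fin γ) (Fin γ) A) : Prop :=
  ∀ (ι : Type) [Fintype ι] [DecidableEq ι] (X : Matrix ι ι A), conjT s X = ε • X →
    (∃ i j, IsUnit (X i j)) →
    ∃ (κ : Type) (_ : Fintype κ) (_ : DecidableEq κ) (e : Fin γ ⊕ κ ≃ ι) (χ : Sg) (Y : Matrix κ κ A),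
      Cong (RingHom.id A) s (X.submatrix e e) (fromBlocks (M χ) 0 0 Y)

variable {s : A →+* A} {ε : ℤ} {M : Sg → Matrix (Fin γ) (Fin γ) A}

theorem splits_of_frame {ι : Type} [Fintype ι] [DecidableEq ι] {X : Matrix ι ι A}
    (hX : conjT s X = ε • X) {v : Fin γ → ι} (hv : Function.Injective v)
    (hP : IsUnit (X.submatrix v v).det) {χ : Sg}
    (hM : Cong (RingHom.id A) s (X.submatrix v v) (M χ)) :
    ∃ (κ : Type) (_ : Fintype κ) (_ : DecidableEq κ) (e : Fin γ ⊕ κ ≃ ι) (χ : Sg) (Y : Matrix κ κ A),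
      Cong (RingHom.id A) s (X.submatrix e e) (fromBlocks (M χ) 0 0 Y) := by
  classical
  let e : Fin γ ⊕ ↥(Set.range v)ᶜ ≃ ι :=
    (Equiv.sumCongr (Equiv.ofInjective v hv) (Equiv.refl _)).trans (Equiv.Set.sumCompl _)
  have he : ∀ a, e (Sum.inl a) = v a := fun a => rfl
  have h11 : (X.submatrix e e).toBlocks₁₁ = X.submatrix v v := rfl
  have hXe : conjT s (X.submatrix e e) = ε • X.submatrix e e :=
    congrArg (fun Y : Matrix ι ι A => Y.submatrix e e) hX
  rw [← fromBlocks_toBlocks (X.submatrix e e), h11] at hXe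
  obtain ⟨Y, hY⟩ := cong_fromBlocks hP hXe
  refine ⟨_, inferInstance, inferInstance, e, χ, Y, ?_⟩
  rw [← fromBlocks_toBlocks (X.submatrix e e), h11]
  exact hY.trans (hM.fromBlocks (Cong.refl Y))

theorem conjT_transvection {ι : Type*} [Fintype ι] [DecidableEq ι] (i j : ι) (c : A) :
    conjT s (transvection i j c) = transvection j i (s c) := by
  ext a b
  simp only [conjT, transvection, transpose_apply, Matrix.map_apply, Matrix.add_apply, map_add, one_apply,
    single_apply, apply_ite s, map_one, map_zero]
  congr 1
  · simp only [eq_comm]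
  · simp only [and_comm]

/-- Rank one splitting, for Hermitian and symmetric forms. -/
theorem splits_one [IsLocalRing A] (hs : ∀ x, s (s x) = x) {ν : Sg → A}
    (hθ : ∃ θ, IsUnit (θ + s θ))
    (hν : ∀ u, IsUnit u → s u = u → ∃ c χ, IsUnit c ∧ s c * u * c = ν χ) :
    Splits s 1 (fun χ => (Matrix.of fun _ _ : Fin 1 => ν χ)) := by
  intro ι _ _ X hX hij
  obtain ⟨i, X', hXX', hii⟩ : ∃ i X', Cong (RingHom.id A) s X X' ∧ IsUnit (X' i i) := by
    by_cases h : ∃ i, IsUnit (X i i)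
    · obtain ⟨i, hi⟩ := h
      exact ⟨i, X, Cong.refl X, hi⟩
    · push Not at h
      obtain ⟨i, j, hij⟩ := hij
      have hne : i ≠ j := by
        rintro rfl
        exact h i hij
      obtain ⟨θ, hθ⟩ := hθ
      obtain ⟨u, hu⟩ := hij
      -- When all diagonal entries are nonunits, adding θu⁻¹ times the j-th basis vector to the i-th
      -- changes the diagonal entry by the unit θ + sθ plus a nonunit.
      refine ⟨i, _, ⟨transvection j i (θ * ↑u⁻¹), by rw [det_transvection_of_ne j i hne.symm]; simp,
        rfl⟩, ?_⟩
      have hji : X j i = s u := by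
        rw [hu]
        simpa [conjT] using (congrFun (congrFun hX j) i).symm
      rw [RingHom.coe_id, Matrix.map_id, conjT_transvection, mul_transvection_apply_same,
        transvection_mul_apply_same, transvection_mul_apply_same, hji, ← hu]
      have h1 : s ↑u⁻¹ * s u = 1 := by rw [← map_mul, u.inv_mul, map_one]
      have h2 : (↑u⁻¹ : A) * u = 1 := u.inv_mul
      have h3 : X i i + s (θ * ↑u⁻¹) * s u + θ * ↑u⁻¹ * (u + s (θ * ↑u⁻¹) * X j j) =
          (θ + s θ) + (X i i + θ * ↑u⁻¹ * s (θ * ↑u⁻¹) * X j j) := by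
        rw [map_mul]
        linear_combination s θ * h1 + θ * h2
      rw [h3]
      by_contra hn
      have h4 : X i i + θ * ↑u⁻¹ * s (θ * ↑u⁻¹) * X j j ∈ IsLocalRing.maximalIdeal A :=
        add_mem ((IsLocalRing.mem_maximalIdeal _).2 (h i))
          (Ideal.mul_mem_left _ _ ((IsLocalRing.mem_maximalIdeal _).2 (h j)))
      have h5 := sub_mem ((IsLocalRing.mem_maximalIdeal _).2 hn) h4
      rw [add_sub_cancel_right] at h5
      exact (IsLocalRing.mem_maximalIdeal _).1 h5 hθ
  have hX' := hXX'.conjT_eq hs hX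
  have hfix : s (X' i i) = X' i i := by
    simpa [conjT] using congrFun (congrFun hX' i) i
  obtain ⟨c, χ, hc, hcχ⟩ := hν _ hii hfix
  obtain ⟨κ, h1, h2, e, χ', Y, h⟩ := splits_of_frame (M := fun χ => (Matrix.of fun _ _ : Fin 1 => ν χ))
    hX' (v := fun _ : Fin 1 => i) (Function.injective_of_subsingleton _)
    (by simpa using hii) (χ := χ)
    ⟨Matrix.of fun _ _ : Fin 1 => c, by simpa using hc, by
      ext a b
      simp [conjT, Matrix.mul_apply, hcχ]⟩
  exact ⟨κ, h1, h2, e, χ', Y, (hXX'.submatrix e).trans h⟩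

/-- Splitting off hyperbolic planes, for alternating forms. -/
theorem splits_two [Nontrivial A] (hA : ∀ a : A, a = -a → a = 0) (χ₀ : Sg) :
    Splits (RingHom.id A) (-1) (fun _ : Sg => !![(0 : A), 1; -1, 0]) := by
  intro ι _ _ X hX hij
  obtain ⟨i, j, u, hu⟩ := hij
  have hXe : ∀ a b, X b a = -X a b := fun a b => by
    simpa [conjT] using congrFun (congrFun hX a) b
  -- Diagonal entries equal their own negatives, so they vanish and the unit entry is off the
  -- diagonal.
  have hne : i ≠ j := by
    rintro rfl
    rw [hA _ (hXe i i)] at hu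
    exact u.ne_zero hu
  have hd : X.submatrix ![i, j] ![i, j] = !![0, (u : A); -u, 0] := by
    rw [hu]
    ext a b
    fin_cases a <;> fin_cases b
    · exact hA _ (hXe i i)
    · rfl
    · exact hXe i j
    · exact hA _ (hXe j j)
  have hinj : Function.Injective ![i, j] := by
    intro a b hab
    fin_cases a <;> fin_cases b
    · rfl
    · exact absurd hab hne
    · exact absurd hab.symm hne
    · rfl
  refine splits_of_frame (M := fun _ : Sg => !![(0 : A), 1; -1, 0]) hX hinj ?_ (χ := χ₀) ?_
  · rw [hd, det_fin_two_of]
    simp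
  · rw [hd]
    refine ⟨!![1, 0; 0, ↑u⁻¹], by rw [det_fin_two_of]; simp, ?_⟩
    ext a b
    fin_cases a <;> fin_cases b <;> simp [conjT, Matrix.mul_apply, Fin.sum_univ_two]

end Splitting


/-! ### Model blocks -/

section Model

open IsLocalRing Matrix

variable (c : FormType) {F₀ F : Type*}
  [Field F₀] [ValuativeRel F₀] [TopologicalSpace F₀] [IsNonarchimedeanLocalField F₀]
  [Field F] [ValuativeRel F] [TopologicalSpace F] [IsNonarchimedeanLocalField F]
  [Algebra F₀ F] [ValuativeExtension F₀ F]

/-- The involution, the uniformizer and the unimodular blocks used to describe forms. -/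
structure FormModel (σ : F ≃ₐ[F₀] F) (ϖ : 𝒪[F₀]) where
  s : F →+* F
  sO : 𝒪[F] →+* 𝒪[F]
  ε : ℤ
  M : c.Sign → Matrix (Fin c.gamma) (Fin c.gamma) 𝒪[F]
  π : 𝒪[F]
  adj_eq : ∀ {m n : Type} (A : Matrix m n F), adj c σ A = conjT s A
  isForm_iff : ∀ {n : Type} (A : Matrix n n F), IsForm c σ A ↔ conjT s A = ε • A
  coe_sO : ∀ a : 𝒪[F], (sO a : F) = s a
  s_s : ∀ x, s (s x) = x
  coe_π : (π : F) = algebraMap F₀ F ϖ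
  s_π : s π = π
  irreducible_π : Irreducible π
  splits : Splits sO ε M
  conjT_M : ∀ χ, conjT sO (M χ) = ε • M χ
  isUnit_det_M : ∀ χ, IsUnit (M χ).det
  sign_det_M : ∀ χ (u : (𝒪[F])ˣ), (u : 𝒪[F]) = (M χ).det → sign c u = χ
  cong_M_mul : ∀ χ₁ χ₂ η, Cong (RingHom.id 𝒪[F]) sO (fromBlocks (M χ₁) 0 0 (M χ₂))
    (fromBlocks (M (χ₁ * η)) 0 0 (M (χ₂ * η)))
  sign_mul : ∀ u v : (𝒪[F])ˣ, sign c (u * v) = sign c u * sign c v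
  sign_eq_of_sub_mem : ∀ (u v : (𝒪[F])ˣ) (t : 𝒪[F]), (u : 𝒪[F]) - sO t * v * t ∈ maximalIdeal 𝒪[F] →
    sign c u = sign c v

variable {c}

/-- The form ax² + by² represents a', say at (p, q). The vector (−bqt, apt) is orthogonal to (p, q),
and t is chosen to give it the value b', possible because the determinants agree up to a square. -/
theorem cong_diag_two {O : Type*} [CommRing O] [HenselianLocalRing O]
    [Finite (ResidueField O)] (h2 : IsUnit (2 : O)) {a b a' b' : Oˣ}
    (h : IsSquare (a * b * (a' * b'))) :
    Cong (RingHom.id O) (RingHom.id O)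
      (fromBlocks (Matrix.of fun _ _ : Fin 1 => (a : O)) 0 0 (Matrix.of fun _ _ : Fin 1 => (b : O)))
      (fromBlocks (Matrix.of fun _ _ : Fin 1 => (a' : O)) 0 0
        (Matrix.of fun _ _ : Fin 1 => (b' : O))) := by
  obtain ⟨l, hl⟩ := h
  obtain ⟨p, q, hpq⟩ := exists_sq_add_mul_sq h2 (b * a⁻¹).isUnit (a' * a⁻¹).isUnit
  have hl' : (a : O) * b * (a' * b') = l * l := by exact_mod_cast congrArg Units.val hl
  have ha : (a : O) * ↑a⁻¹ = 1 := a.mul_inv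
  have hb : (b : O) * ↑b⁻¹ = 1 := b.mul_inv
  have ha' : (a' : O) * ↑a'⁻¹ = 1 := a'.mul_inv
  have hpq' : (a : O) * (p * p) + b * (q * q) = a' := by
    rw [Units.val_mul, Units.val_mul] at hpq
    linear_combination (a : O) * hpq + (a' - b * (q * q)) * ha
  obtain ⟨t, ht⟩ : ∃ t : Oˣ, t = l * (a * b * a')⁻¹ := ⟨_, rfl⟩
  have ht' : (a : O) * b * a' * (t * t) = b' := by
    have h1 : a * b * a' * (t * t) = b' := by
      have h3 : t * (a * b * a') = l := by rw [ht, inv_mul_cancel_right]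
      refine mul_left_cancel (a := a * b * a') ?_
      calc a * b * a' * (a * b * a' * (t * t)) = t * (a * b * a') * (t * (a * b * a')) := by ac_rfl
        _ = a * b * a' * b' := by rw [h3, ← hl]; ac_rfl
    exact_mod_cast congrArg Units.val h1
  refine ⟨fromBlocks (Matrix.of fun _ _ => p) (Matrix.of fun _ _ => -(b * q * t))
    (Matrix.of fun _ _ => q) (Matrix.of fun _ _ => a * p * t), ?_, ?_⟩
  · have hdet : (fromBlocks (Matrix.of fun _ _ : Fin 1 => p) (Matrix.of fun _ _ : Fin 1 => -(b * q * t))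
        (Matrix.of fun _ _ : Fin 1 => q) (Matrix.of fun _ _ : Fin 1 => a * p * t)).det = t * a' := by
      rw [← det_submatrix_equiv_self (finSumFinEquiv (m := 1) (n := 1)).symm, det_fin_two]
      change p * (a * p * t) - -(b * q * t) * q = t * a'
      linear_combination (t : O) * hpq'
    rw [hdet]
    exact t.isUnit.mul a'.isUnit
  · simp only [RingHom.coe_id, Matrix.map_id, conjT_fromBlocks, fromBlocks_multiply, Matrix.mul_zero,
      add_zero, zero_add]
    congr 1 <;> ext i j
    · simp [conjT, Matrix.mul_apply]
      linear_combination -hpq'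
    · simp [conjT, Matrix.mul_apply]
      ring
    · simp [conjT, Matrix.mul_apply]
      ring
    · simp [conjT, Matrix.mul_apply]
      linear_combination -ht' - (a : O) * b * t * t * hpq'

theorem sign_symmetric_eq_one_iff (u : (𝒪[F])ˣ) :
    sign .symmetric u = 1 ↔ IsSquare u := by
  have h : (-1 : ℤˣ) ∈ FormType.symmetric.signGroup := Subgroup.mem_top _
  unfold sign
  split_ifs with h1
  · refine iff_of_false (fun h3 => ?_) h1.2
    have := congrArg Subtype.val h3
    simp at this
  · exact iff_of_true rfl (by by_contra h3; exact h1 ⟨h, h3⟩)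

theorem sign_ext_symmetric {χ χ' : FormType.symmetric.Sign} (h : χ = 1 ↔ χ' = 1) : χ = χ' := by
  by_cases h1 : χ = 1
  · rw [h1, h.1 h1]
  · have := sign_eq_of_ne_one h1 fun h3 => h1 (h.2 h3)
    rw [← sign_mul_self χ'] at this
    exact mul_right_cancel this

theorem sign_symmetric_mul (h2 : IsUnit (2 : 𝒪[F])) (u v : (𝒪[F])ˣ) :
    sign .symmetric (u * v) = sign .symmetric u * sign .symmetric v := by
  have := henselianLocalRing_integer F
  by_cases hu : IsSquare u
  · rw [(sign_symmetric_eq_one_iff u).2 hu, one_mul]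
    refine sign_ext_symmetric ?_
    rw [sign_symmetric_eq_one_iff, sign_symmetric_eq_one_iff]
    refine ⟨fun h => ?_, hu.mul⟩
    have := hu.inv.mul h
    rwa [inv_mul_cancel_left] at this
  · by_cases hv : IsSquare v
    · rw [(sign_symmetric_eq_one_iff v).2 hv, mul_one]
      refine sign_ext_symmetric ?_
      rw [sign_symmetric_eq_one_iff, sign_symmetric_eq_one_iff]
      refine ⟨fun h => ?_, fun h => h.mul hv⟩
      have := h.mul hv.inv
      rwa [mul_inv_cancel_right] at this
    · rw [sign_eq_of_ne_one (mt (sign_symmetric_eq_one_iff u).1 hu)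
        (mt (sign_symmetric_eq_one_iff v).1 hv), sign_symmetric_eq_one_iff]
      exact isSquare_mul_of_not_isSquare h2 hu hv

theorem sign_symmetric_eq_of_sub_mem (h2 : IsUnit (2 : 𝒪[F])) (u v : (𝒪[F])ˣ) (t : 𝒪[F])
    (h : (u : 𝒪[F]) - t * v * t ∈ maximalIdeal 𝒪[F]) :
    sign .symmetric u = sign .symmetric v := by
  have := henselianLocalRing_integer F
  refine sign_ext_symmetric ?_
  rw [sign_symmetric_eq_one_iff, sign_symmetric_eq_one_iff, units_isSquare_iff_residue h2,
    units_isSquare_iff_residue h2]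
  rw [← residue_eq_zero_iff, map_sub, map_mul, map_mul, sub_eq_zero] at h
  have ht : residue 𝒪[F] t ≠ 0 := by
    intro h0
    rw [h0, mul_zero] at h
    exact (u.isUnit.map (residue 𝒪[F])).ne_zero h
  have h3 : residue 𝒪[F] u = residue 𝒪[F] t * residue 𝒪[F] t * residue 𝒪[F] v := by
    rw [h]
    ring
  have hsq : IsSquare (residue 𝒪[F] t * residue 𝒪[F] t) := ⟨_, rfl⟩
  rw [h3]
  constructor
  · intro h4
    have h5 := h4.mul hsq.inv
    rwa [mul_comm, inv_mul_cancel_left₀ (mul_ne_zero ht ht)] at h5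
  · exact hsq.mul

theorem exists_model_units (h2 : IsUnit (2 : 𝒪[F])) :
    ∃ ν : FormType.symmetric.Sign → (𝒪[F])ˣ, ∀ χ, sign .symmetric (ν χ) = χ := by
  have := henselianLocalRing_integer F
  classical
  obtain ⟨u, hu⟩ := exists_not_isSquare h2
  refine ⟨fun χ => if χ = 1 then 1 else u, fun χ => ?_⟩
  change sign .symmetric (if χ = 1 then 1 else u) = χ
  split_ifs with h
  · rw [h, sign_symmetric_eq_one_iff]
    exact IsSquare.one
  · refine sign_ext_symmetric (iff_of_false ?_ h)
    rwa [sign_symmetric_eq_one_iff]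

omit [TopologicalSpace F₀] [IsNonarchimedeanLocalField F₀]
  [TopologicalSpace F] [IsNonarchimedeanLocalField F] [ValuativeExtension F₀ F] in
theorem exists_algebraMap_of_finrank_one (h : Module.finrank F₀ F = 1) (x : F) :
    ∃ y : F₀, ValuativeRel.valuation F (algebraMap F₀ F y) = ValuativeRel.valuation F x := by
  obtain ⟨y, hy⟩ := ((Algebra.bijective_algebraMap_iff (R := F₀) (A := F)).2
    (Subalgebra.bot_eq_top_of_finrank_eq_one h).symm).2 x
  exact ⟨y, by rw [hy]⟩

theorem exists_formModel [CharZero F₀] {σ : F ≃ₐ[F₀] F} (hF : FieldHyp c σ) {ϖ : 𝒪[F₀]}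
    (hϖ : Irreducible ϖ) : Nonempty (FormModel c σ ϖ) := by
  have := henselianLocalRing_integer F
  cases c with
  | unramHermitian =>
    obtain ⟨h2, hval, hσ⟩ := hF
    have hsub : Subsingleton FormType.unramHermitian.Sign := subsingleton_sign nofun
    exact ⟨{
      s := σ
      sO := conjO h2 hσ hval
      ε := 1
      M := fun _ => (Matrix.of fun _ _ : Fin 1 => (1 : 𝒪[F]))
      π := inclO F₀ F ϖ
      adj_eq := fun A => rfl
      isForm_iff := fun A => by rw [one_smul]; exact Iff.rfl
      coe_sO := fun a => rfl
      s_s := involutive_of_finrank_eq_two h2 hσ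
      coe_π := rfl
      s_π := σ.commutes _
      irreducible_π := irreducible_inclO hval hϖ
      splits := splits_one (Sg := FormType.unramHermitian.Sign) (ν := fun _ => 1)
        (conjO_conjO h2 hσ hval) (exists_add_conjO_isUnit h2 hσ hval) (by
          -- The inverse of a fixed unit is a norm, so rescaling a basis vector turns its value into
          -- 1.
          rintro _ ⟨u, rfl⟩ hfix
          have h1 : conjO h2 hσ hval ↑u⁻¹ = ↑u⁻¹ := by
            have h3 : conjO h2 hσ hval u * conjO h2 hσ hval ↑u⁻¹ = 1 := by
              rw [← map_mul, u.mul_inv, map_one]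
            rw [hfix] at h3
            exact Units.eq_inv_of_mul_eq_one_left h3
          obtain ⟨c, hc, hcu⟩ := exists_norm_eq h2 hσ hval u⁻¹.isUnit h1
          refine ⟨c, 1, hc, ?_⟩
          rw [mul_right_comm, hcu, u.inv_mul])
      conjT_M := fun χ => by
        rw [one_smul]
        exact Matrix.ext fun i j => map_one (conjO h2 hσ hval)
      isUnit_det_M := fun χ => (by simp : IsUnit (Matrix.of fun _ _ : Fin 1 => (1 : 𝒪[F])).det)
      sign_det_M := fun χ u _ => Subsingleton.elim _ _
      cong_M_mul := fun _ _ _ => Cong.refl _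
      sign_mul := fun u v => Subsingleton.elim _ _
      sign_eq_of_sub_mem := fun u v t _ => Subsingleton.elim _ _ }⟩
  | symmetric =>
    obtain ⟨h1, h2⟩ := hF
    obtain ⟨ν, hν⟩ := exists_model_units h2
    exact ⟨{
      s := RingHom.id F
      sO := RingHom.id 𝒪[F]
      ε := 1
      M := fun χ => (Matrix.of fun _ _ : Fin 1 => (ν χ : 𝒪[F]))
      π := inclO F₀ F ϖ
      adj_eq := fun A => rfl
      isForm_iff := fun A => by rw [one_smul]; exact Iff.rfl
      coe_sO := fun a => rfl
      s_s := fun x => rfl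
      coe_π := rfl
      s_π := rfl
      irreducible_π := irreducible_inclO (exists_algebraMap_of_finrank_one h1) hϖ
      splits := splits_one (Sg := FormType.symmetric.Sign) (ν := fun χ => (ν χ : 𝒪[F]))
        (fun x => rfl) ⟨1, by rw [map_one, one_add_one_eq_two]; exact h2⟩ (by
          rintro _ ⟨u, rfl⟩ -
          have h3 : IsSquare (ν (sign .symmetric u) * u) := by
            rw [← sign_symmetric_eq_one_iff, sign_symmetric_mul h2, hν, sign_mul_self]
          obtain ⟨v, hv⟩ := h3
          refine ⟨↑(v * u⁻¹), sign .symmetric u, Units.isUnit _, ?_⟩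
          rw [RingHom.id_apply, ← Units.val_mul, ← Units.val_mul]
          congr 1
          rw [inv_mul_cancel_right, ← mul_assoc, ← hv, mul_inv_cancel_right])
      conjT_M := fun χ => by rw [one_smul]; rfl
      isUnit_det_M := fun χ =>
        (by simp : IsUnit (Matrix.of fun _ _ : Fin 1 => (ν χ : 𝒪[F])).det)
      sign_det_M := fun χ u h => by
        have h3 : u = ν χ := Units.ext (h.trans (det_fin_one_of _))
        rw [h3, hν]
      cong_M_mul := fun χ₁ χ₂ η => cong_diag_two h2 (by
        rw [← sign_symmetric_eq_one_iff]
        simp only [sign_symmetric_mul h2, hν]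
        rw [mul_mul_mul_comm χ₁ η, sign_mul_self, mul_one, sign_mul_self])
      sign_mul := sign_symmetric_mul h2
      sign_eq_of_sub_mem := sign_symmetric_eq_of_sub_mem h2 }⟩
  | alternating =>
    have h1 : Module.finrank F₀ F = 1 := hF
    have hsub : Subsingleton FormType.alternating.Sign := subsingleton_sign nofun
    have hchar : CharZero F := charZero_of_injective_algebraMap (algebraMap F₀ F).injective
    -- `IsForm` only asks for skew-symmetry; characteristic zero makes the diagonal vanish, also in
    -- residue characteristic 2.
    have hA : ∀ a : 𝒪[F], a = -a → a = 0 := fun a ha =>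
      Subtype.ext (self_eq_neg.1 (congrArg Subtype.val ha))
    exact ⟨{
      s := RingHom.id F
      sO := RingHom.id 𝒪[F]
      ε := -1
      M := fun χ => !![(0 : 𝒪[F]), 1; -1, 0]
      π := inclO F₀ F ϖ
      adj_eq := fun A => rfl
      isForm_iff := fun A => by rw [neg_one_smul]; exact Iff.rfl
      coe_sO := fun a => rfl
      s_s := fun x => rfl
      coe_π := rfl
      s_π := rfl
      irreducible_π := irreducible_inclO (exists_algebraMap_of_finrank_one h1) hϖ
      splits := splits_two hA 1
      conjT_M := fun χ => by
        change conjT (RingHom.id 𝒪[F]) !![(0 : 𝒪[F]), 1; -1, 0] = (-1 : ℤ) • !![(0 : 𝒪[F]), 1; -1, 0]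
        rw [neg_one_smul]
        ext a b
        fin_cases a <;> fin_cases b <;> simp [conjT]
      isUnit_det_M := fun χ => by
        change IsUnit (!![(0 : 𝒪[F]), 1; -1, 0]).det
        rw [det_fin_two_of]
        simp
      sign_det_M := fun χ u _ => Subsingleton.elim _ _
      cong_M_mul := fun _ _ _ => Cong.refl _
      sign_mul := fun u v => Subsingleton.elim _ _
      sign_eq_of_sub_mem := fun u v t _ => Subsingleton.elim _ _ }⟩

end Model


/-! ### Orthogonal bases -/

section Jordan

open IsLocalRing Matrix

theorem cong_of_block {A K ι ρ : Type*} [CommRing A] [CommRing K] [Fintype ι] [DecidableEq ι]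
    [Fintype ρ] [DecidableEq ρ] {f : A →+* K} {s : K →+* K} {X Y : Matrix ι ι K} {v : ρ → ι}
    (hv : Function.Injective v)
    (hX : ∀ a, ∀ b ∉ Set.range v, X (v a) b = 0 ∧ X b (v a) = 0)
    (hY : ∀ a, ∀ b ∉ Set.range v, Y (v a) b = 0 ∧ Y b (v a) = 0)
    (hXY : ∀ a ∉ Set.range v, ∀ b ∉ Set.range v, X a b = Y a b)
    (h : Cong f s (X.submatrix v v) (Y.submatrix v v)) : Cong f s X Y := by
  classical
  let e : ρ ⊕ ↥(Set.range v)ᶜ ≃ ι :=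
    (Equiv.sumCongr (Equiv.ofInjective v hv) (Equiv.refl _)).trans (Equiv.Set.sumCompl _)
  have hblock : ∀ Z : Matrix ι ι K, (∀ a, ∀ b ∉ Set.range v, Z (v a) b = 0 ∧ Z b (v a) = 0) →
      Z.submatrix e e = fromBlocks (Z.submatrix v v) 0 0
        (Z.submatrix (Subtype.val : ↥(Set.range v)ᶜ → ι) (Subtype.val : ↥(Set.range v)ᶜ → ι)) := by
    intro Z hZ
    ext a b
    rcases a with a | a <;> rcases b with b | b
    · rfl
    · exact (hZ a b b.2).1
    · exact (hZ b a a.2).2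
    · rfl
  have h22 : X.submatrix (Subtype.val : ↥(Set.range v)ᶜ → ι) (Subtype.val : ↥(Set.range v)ᶜ → ι) =
      Y.submatrix (Subtype.val : ↥(Set.range v)ᶜ → ι) (Subtype.val : ↥(Set.range v)ᶜ → ι) := by
    ext a b
    exact hXY a a.2 b b.2
  have h1 : Cong f s (X.submatrix e e) (Y.submatrix e e) := by
    rw [hblock X hX, hblock Y hY, h22]
    exact h.fromBlocks (Cong.refl _)
  simpa using h1.submatrix e.symm

variable {c : FormType} {F₀ F : Type*}
  [Field F₀] [ValuativeRel F₀] [TopologicalSpace F₀] [IsNonarchimedeanLocalField F₀]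
  [Field F] [ValuativeRel F] [TopologicalSpace F] [IsNonarchimedeanLocalField F]
  [Algebra F₀ F] [ValuativeExtension F₀ F]
  {σ : F ≃ₐ[F₀] F} {ϖ : 𝒪[F₀]}

theorem gamma_pos : 0 < c.gamma := by
  cases c <;> simp [FormType.gamma]

theorem exists_zpow_mul_unit {π : 𝒪[F]} (hπ : Irreducible π) {z : F} (hz : z ≠ 0) :
    ∃ (m : ℤ) (u : (𝒪[F])ˣ), z = (π : F) ^ m * (u : 𝒪[F]) := by
  obtain ⟨a, b, hb, rfl⟩ := IsFractionRing.div_surjective (A := 𝒪[F]) z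
  have hb0 : b ≠ 0 := nonZeroDivisors.ne_zero hb
  have ha0 : a ≠ 0 := by
    rintro rfl
    simp at hz
  obtain ⟨k, u, rfl⟩ := IsDiscreteValuationRing.eq_unit_mul_pow_irreducible ha0 hπ
  obtain ⟨l, v, rfl⟩ := IsDiscreteValuationRing.eq_unit_mul_pow_irreducible hb0 hπ
  have hπ0 : (π : F) ≠ 0 := fun h => hπ.ne_zero (Subtype.ext h)
  refine ⟨k - l, u * v⁻¹, ?_⟩
  have hv : ((v : 𝒪[F]) : F) * ((↑v⁻¹ : 𝒪[F]) : F) = 1 := congrArg Subtype.val v.mul_inv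
  have hv0 : ((v : 𝒪[F]) : F) ≠ 0 := left_ne_zero_of_mul_eq_one hv
  change (((u : 𝒪[F]) : F) * (π : F) ^ k) / (((v : 𝒪[F]) : F) * (π : F) ^ l) =
    (π : F) ^ ((k : ℤ) - l) * (((u : 𝒪[F]) : F) * ((↑v⁻¹ : 𝒪[F]) : F))
  rw [zpow_sub₀ hπ0, zpow_natCast, zpow_natCast, eq_inv_of_mul_eq_one_right hv]
  field_simp

/-- Divide by the power of π that occurs in an entry of maximal valuation: this entry becomes a unit
and all others stay integral. -/
theorem exists_zpow_smul {π : 𝒪[F]} (hπ : Irreducible π) {ι : Type*} [Finite ι]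
    {x : Matrix ι ι F} (hx : x ≠ 0) :
    ∃ (m : ℤ) (X : Matrix ι ι 𝒪[F]), x = (π : F) ^ m • X.map 𝒪[F].subtype ∧
      ∃ i j, IsUnit (X i j) := by
  have hne : ∃ i j, x i j ≠ 0 := by
    by_contra! h
    exact hx (Matrix.ext h)
  obtain ⟨i₀, j₀, h0⟩ := hne
  have : Nonempty (ι × ι) := ⟨(i₀, j₀)⟩
  obtain ⟨⟨i, j⟩, hmax⟩ := Finite.exists_max fun p : ι × ι => ValuativeRel.valuation F (x p.1 p.2)
  have hij : x i j ≠ 0 := by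
    intro h
    have := hmax (i₀, j₀)
    simp only [h, map_zero, le_zero_iff, Valuation.zero_iff] at this
    exact h0 this
  obtain ⟨m, u, hu⟩ := exists_zpow_mul_unit hπ hij
  have hπ0 : (π : F) ^ m ≠ 0 := zpow_ne_zero _ fun h => hπ.ne_zero (Subtype.ext h)
  have hu' : ((π : F) ^ m)⁻¹ * x i j = ((u : 𝒪[F]) : F) := by
    rw [hu, inv_mul_cancel_left₀ hπ0]
  have hint : ∀ a b, ((π : F) ^ m)⁻¹ * x a b ∈ 𝒪[F] := by
    intro a b
    have h1 : ValuativeRel.valuation F (((π : F) ^ m)⁻¹ * x i j) ≤ 1 := by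
      rw [hu']
      exact (u : 𝒪[F]).2
    change ValuativeRel.valuation F _ ≤ 1
    refine le_trans ?_ h1
    rw [map_mul, map_mul]
    exact mul_le_mul_right (hmax (a, b)) _
  refine ⟨m, Matrix.of fun a b => ⟨_, hint a b⟩, ?_, i, j, ?_⟩
  · ext a b
    exact (mul_inv_cancel_left₀ hπ0 _).symm
  · have : (Matrix.of fun a b => (⟨_, hint a b⟩ : 𝒪[F])) i j = u := Subtype.ext hu'
    rw [this]
    exact u.isUnit

theorem zsmul_map {A K m n : Type*} [CommRing A] [CommRing K] (f : A →+* K) (ε : ℤ)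
    (X : Matrix m n A) : (ε • X).map f = ε • X.map f := by
  ext i j
  simp only [Matrix.smul_apply, Matrix.map_apply, map_zsmul]

namespace FormModel

variable (μ : FormModel c σ ϖ)

theorem π_ne_zero : (μ.π : F) ≠ 0 := fun h => μ.irreducible_π.ne_zero (Subtype.ext h)

/-- The orthogonal sum of the model blocks prescribed by `w`. -/
def diag {κ : Type} [DecidableEq κ] (w : κ → ℤ × c.Sign) :
    Matrix (Fin c.gamma × κ) (Fin c.gamma × κ) F :=
  blockDiagonal fun a => (μ.π : F) ^ (w a).1 • (μ.M (w a).2).map 𝒪[F].subtype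

theorem conjT_diag {κ : Type} [DecidableEq κ] (w : κ → ℤ × c.Sign) :
    conjT μ.s (μ.diag w) = μ.ε • μ.diag w := by
  have h1 : ∀ a, conjT μ.s ((μ.π : F) ^ (w a).1 • (μ.M (w a).2).map 𝒪[F].subtype) =
      μ.ε • ((μ.π : F) ^ (w a).1 • (μ.M (w a).2).map 𝒪[F].subtype) := fun a => by
    rw [conjT_smul (by rw [map_zpow₀, μ.s_π]), conjT_map (s' := μ.sO) μ.coe_sO, μ.conjT_M, zsmul_map,
      smul_comm]
  ext ⟨i, a⟩ ⟨j, b⟩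
  simp only [conjT, diag, transpose_apply, Matrix.map_apply, blockDiagonal_apply, Matrix.smul_apply]
  by_cases h : a = b
  · subst h
    rw [if_pos rfl, if_pos rfl]
    exact congrFun (congrFun (h1 a) i) j
  · rw [if_neg h, if_neg (Ne.symm h), map_zero, smul_zero]

theorem isUnit_det_diag {κ : Type} [DecidableEq κ] [Fintype κ] (w : κ → ℤ × c.Sign) :
    IsUnit (μ.diag w).det := by
  rw [diag, det_blockDiagonal, IsUnit.prod_univ_iff]
  intro a
  rw [det_smul]
  refine ((zpow_ne_zero _ μ.π_ne_zero).isUnit.pow _).mul ?_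
  have := (μ.isUnit_det_M (w a).2).map 𝒪[F].subtype
  rwa [RingHom.map_det] at this

/-- Jordan splitting by induction on the size: scale until there is a unit entry, split off a model
block, and continue with the complement, which is again a nondegenerate form. -/
theorem exists_cong_diag (n : ℕ) : ∀ (ι : Type) [Fintype ι] [DecidableEq ι], Fintype.card ι ≤ n →
    ∀ x : Matrix ι ι F, conjT μ.s x = μ.ε • x → IsUnit x.det →
    ∃ (κ : Type) (_ : Fintype κ) (_ : DecidableEq κ) (e : Fin c.gamma × κ ≃ ι) (w : κ → ℤ × c.Sign),
      Cong 𝒪[F].subtype μ.s (x.submatrix e e) (μ.diag w) := by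
  induction n with
  | zero =>
    intro ι _ _ hι x _ _
    have : IsEmpty ι := Fintype.card_eq_zero_iff.1 (Nat.le_zero.1 hι)
    refine ⟨Empty, inferInstance, inferInstance, Equiv.equivOfIsEmpty _ _, Empty.elim, ?_⟩
    rw [Subsingleton.elim (μ.diag _) (x.submatrix _ _)]
    exact Cong.refl _
  | succ n ih =>
    intro ι _ _ hι x hx hdet
    rcases isEmpty_or_nonempty ι with h | h
    · exact ih ι (by rw [Fintype.card_eq_zero]; exact Nat.zero_le _) x hx hdet
    have hx0 : x ≠ 0 := by
      rintro rfl
      rw [det_zero] at hdet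
      exact hdet.ne_zero rfl
    obtain ⟨m, X, rfl, hunit⟩ := exists_zpow_smul μ.irreducible_π hx0
    have hπm : (μ.π : F) ^ m ≠ 0 := zpow_ne_zero _ μ.π_ne_zero
    have hX : conjT μ.sO X = μ.ε • X := by
      rw [conjT_smul (by rw [map_zpow₀, μ.s_π]), conjT_map (s' := μ.sO) μ.coe_sO, smul_comm] at hx
      have h1 := smul_right_injective _ hπm hx
      ext i j
      have h2 := congrFun (congrFun h1 i) j
      simpa using h2
    obtain ⟨κ, _, _, e, χ, Y, hcong⟩ := μ.splits ι X hX hunit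
    have h1 : Cong 𝒪[F].subtype μ.s (((μ.π : F) ^ m • X.map 𝒪[F].subtype).submatrix e e)
        (fromBlocks ((μ.π : F) ^ m • (μ.M χ).map 𝒪[F].subtype) 0 0
          ((μ.π : F) ^ m • Y.map 𝒪[F].subtype)) := by
      have h2 := (hcong.map (f := 𝒪[F].subtype) (s := μ.s) μ.coe_sO).smul ((μ.π : F) ^ m)
      rw [fromBlocks_map, fromBlocks_smul, Matrix.map_zero _ (map_zero _),
        Matrix.map_zero _ (map_zero _), smul_zero, smul_zero] at h2
      exact h2
    have h2 := h1.conjT_eq μ.s_s (ε := μ.ε) (congrArg (fun Z : Matrix ι ι F => Z.submatrix e e) hx)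
    have h3 := h1.isUnit_det (by rwa [det_submatrix_equiv_self])
    rw [conjT_fromBlocks, fromBlocks_smul, fromBlocks_inj] at h2
    rw [det_fromBlocks_zero₂₁] at h3
    have hcard : Fintype.card κ ≤ n := by
      have h4 := Fintype.card_congr e
      rw [Fintype.card_sum, Fintype.card_fin] at h4
      have := gamma_pos (c := c)
      omega
    obtain ⟨κ', _, _, e', w', h'⟩ := ih κ hcard _ h2.2.2.2 (isUnit_of_mul_isUnit_right h3)
    let e₃ : Fin c.gamma × (Unit ⊕ κ') ≃ Fin c.gamma ⊕ Fin c.gamma × κ' :=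
      (Equiv.prodSumDistrib _ _ _).trans (Equiv.sumCongr (Equiv.prodPUnit _) (Equiv.refl _))
    refine ⟨Unit ⊕ κ', inferInstance, inferInstance,
      e₃.trans ((Equiv.sumCongr (Equiv.refl _) e').trans e), Sum.elim (fun _ => (m, χ)) w', ?_⟩
    have h4 := (h1.submatrix (Equiv.sumCongr (Equiv.refl (Fin c.gamma)) e')).trans
      (Z := fromBlocks ((μ.π : F) ^ m • (μ.M χ).map 𝒪[F].subtype) 0 0 (μ.diag w')) (by
        have h5 := (Cong.refl (f := 𝒪[F].subtype) (s := μ.s)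
          ((μ.π : F) ^ m • (μ.M χ).map 𝒪[F].subtype)).fromBlocks h'
        convert h5 using 1
        ext a b
        rcases a with a | a <;> rcases b with b | b <;> rfl)
    have h6 := h4.submatrix e₃
    convert h6 using 1
    · ext ⟨i, a⟩ ⟨j, b⟩
      rcases a with a | a <;> rcases b with b | b <;> rfl
    · ext ⟨i, a⟩ ⟨j, b⟩
      rcases a with a | a <;> rcases b with b | b <;>
        simp [diag, blockDiagonal_apply, e₃]

end FormModel

end Jordan


/-! ### Canonical forms -/

section CanonicalForms

open IsLocalRing Matrix

theorem toTyp0_comp_perm {c : FormType} {r : ℕ} (w : Typ c r) (p : Equiv.Perm (Fin r)) :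
    toTyp0 (w ∘ p) = toTyp0 w := by
  simp only [toTyp0, Typ0.mk.injEq]
  refine ⟨Equiv.sum_comp p fun k => Finsupp.single (w k).1 1, ?_⟩
  funext i
  rw [Finset.prod_filter, Finset.prod_filter]
  exact Equiv.prod_comp p fun k => if (w k).1 = i then (w k).2 else 1

theorem exists_perm_antitone {c : FormType} {r : ℕ} (w : Typ c r) :
    ∃ p : Equiv.Perm (Fin r), Antitone (expo (w ∘ p)) :=
  ⟨Tuple.sort fun k => OrderDual.toDual (expo w k),
    Tuple.monotone_sort fun k => OrderDual.toDual (expo w k)⟩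

theorem blockHom_mul_mulSingle {c : FormType} {r : ℕ} {e : Fin r → ℤ} {i j : Fin r}
    (hij : e i = e j) (χ : Fin r → c.Sign) (η : c.Sign) :
    blockHom c e (χ * (Pi.mulSingle i η * Pi.mulSingle j η)) = blockHom c e χ := by
  rw [map_mul]
  refine mul_eq_left.2 ?_
  funext m
  change ∏ k with e k = m, (Pi.mulSingle i η * Pi.mulSingle j η : Fin r → c.Sign) k = 1
  simp only [Pi.mul_apply, Finset.prod_mul_distrib, Finset.prod_pi_mulSingle',
    Finset.mem_filter, Finset.mem_univ, true_and]
  rw [hij]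
  split_ifs
  · exact sign_mul_self η
  · exact one_mul 1

variable {c : FormType} {F₀ F : Type*}
  [Field F₀] [ValuativeRel F₀] [TopologicalSpace F₀] [IsNonarchimedeanLocalField F₀]
  [Field F] [ValuativeRel F] [TopologicalSpace F] [IsNonarchimedeanLocalField F]
  [Algebra F₀ F] [ValuativeExtension F₀ F]
  {σ : F ≃ₐ[F₀] F} {ϖ : 𝒪[F₀]}

namespace FormModel

variable (μ : FormModel c σ ϖ)

theorem diag_comp {κ κ' : Type} [DecidableEq κ] [DecidableEq κ'] (w : κ → ℤ × c.Sign)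
    (p : κ' ≃ κ) :
    μ.diag (w ∘ p) = (μ.diag w).submatrix (Equiv.prodCongr (Equiv.refl _) p)
      (Equiv.prodCongr (Equiv.refl _) p) := by
  ext ⟨a, i⟩ ⟨b, j⟩
  simp [diag, blockDiagonal_apply]

/-- Two blocks of the same degree may be multiplied by the same sign; this changes the form only on
their sum, where it is the identity `cong_M_mul` of the model. -/
theorem cong_diag_mul_mulSingle {κ : Type} [DecidableEq κ] [Fintype κ] {e : κ → ℤ} {i j : κ}
    (hne : i ≠ j) (hij : e i = e j) (χ : κ → c.Sign) (η : c.Sign) :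
    Cong 𝒪[F].subtype μ.s (μ.diag fun k => (e k, χ k))
      (μ.diag fun k => (e k, (χ * (Pi.mulSingle i η * Pi.mulSingle j η) : κ → c.Sign) k)) := by
  let v : Fin c.gamma ⊕ Fin c.gamma → Fin c.gamma × κ := Sum.elim (fun a => (a, i)) fun a => (a, j)
  have hv : Function.Injective v := by
    rintro (a | a) (b | b) h
    · exact congrArg _ (Prod.ext_iff.1 h).1
    · exact absurd (Prod.ext_iff.1 h).2 hne
    · exact absurd (Prod.ext_iff.1 h).2 hne.symm
    · exact congrArg _ (Prod.ext_iff.1 h).1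
  have hrange : ∀ b ∉ Set.range v, b.2 ≠ i ∧ b.2 ≠ j := fun b hb =>
    ⟨fun h => hb ⟨Sum.inl b.1, Prod.ext rfl h.symm⟩, fun h => hb ⟨Sum.inr b.1, Prod.ext rfl h.symm⟩⟩
  have hzero : ∀ (w : κ → ℤ × c.Sign) a, ∀ b ∉ Set.range v,
      μ.diag w (v a) b = 0 ∧ μ.diag w b (v a) = 0 := by
    intro w a b hb
    obtain ⟨h1, h2⟩ := hrange b hb
    rcases a with a | a
    · exact ⟨blockDiagonal_apply_ne _ _ _ h1.symm, blockDiagonal_apply_ne _ _ _ h1⟩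
    · exact ⟨blockDiagonal_apply_ne _ _ _ h2.symm, blockDiagonal_apply_ne _ _ _ h2⟩
  have hsub : ∀ χ' : κ → c.Sign, (μ.diag fun k => (e k, χ' k)).submatrix v v =
      (μ.π : F) ^ e i •
        (fromBlocks (μ.M (χ' i)) 0 0 (μ.M (χ' j))).map 𝒪[F].subtype := by
    intro χ'
    rw [fromBlocks_map, fromBlocks_smul, Matrix.map_zero _ (map_zero _), smul_zero]
    ext a b
    rcases a with a | a <;> rcases b with b | b <;>
      simp [v, diag, blockDiagonal_apply, hne, hne.symm, hij]
  refine cong_of_block hv (hzero _) (hzero _) ?_ ?_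
  · intro a ha b hb
    obtain ⟨h1, h2⟩ := hrange a ha
    simp only [diag, blockDiagonal_apply, Pi.mul_apply, Pi.mulSingle_eq_of_ne h1,
      Pi.mulSingle_eq_of_ne h2, mul_one]
  · rw [hsub, hsub]
    have hi : (χ * (Pi.mulSingle i η * Pi.mulSingle j η) : κ → c.Sign) i = χ i * η := by
      rw [Pi.mul_apply, Pi.mul_apply, Pi.mulSingle_eq_same, Pi.mulSingle_eq_of_ne hne, mul_one]
    have hj : (χ * (Pi.mulSingle i η * Pi.mulSingle j η) : κ → c.Sign) j = χ j * η := by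
      rw [Pi.mul_apply, Pi.mul_apply, Pi.mulSingle_eq_same, Pi.mulSingle_eq_of_ne hne.symm, one_mul]
    rw [hi, hj]
    exact ((μ.cong_M_mul _ _ η).map μ.coe_sO).smul _

/-- If block products agree, a site where the signs differ has a partner of the same exponent where
they also differ. Multiplying both by χ i * χ' i repairs the first without creating a new
discrepancy. -/
theorem cong_diag_of_blockHom_eq {r : ℕ} {e : Fin r → ℤ} {χ' : Fin r → c.Sign} (n : ℕ) :
    ∀ χ : Fin r → c.Sign, (Finset.univ.filter fun k => χ k ≠ χ' k).card ≤ n →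
      blockHom c e χ = blockHom c e χ' →
      Cong 𝒪[F].subtype μ.s (μ.diag fun k => (e k, χ k)) (μ.diag fun k => (e k, χ' k)) := by
  induction n with
  | zero =>
    intro χ hn _
    have h1 := Finset.card_eq_zero.1 (Nat.le_zero.1 hn)
    have h2 : χ = χ' := by
      funext k
      by_contra hk
      have := (Finset.mem_filter (p := fun k => χ k ≠ χ' k)).2 ⟨Finset.mem_univ k, hk⟩
      rw [h1] at this
      exact absurd this (Finset.notMem_empty k)
    rw [h2]
    exact Cong.refl _
  | succ n ih =>
    intro χ hn hχ
    by_cases heq : χ = χ'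
    · rw [heq]
      exact Cong.refl _
    obtain ⟨i, hi⟩ := Function.ne_iff.1 heq
    obtain ⟨j, hne, hij, hj⟩ : ∃ j, j ≠ i ∧ e j = e i ∧ χ j ≠ χ' j := by
      by_contra! hcon
      have h1 : ∏ k with e k = e i, χ k = ∏ k with e k = e i, χ' k := congrFun hχ (e i)
      have hmem : i ∈ Finset.univ.filter fun k => e k = e i := by simp
      rw [← Finset.mul_prod_erase _ _ hmem, ← Finset.mul_prod_erase _ _ hmem,
        Finset.prod_congr rfl fun k hk => hcon k (Finset.ne_of_mem_erase hk)
          (Finset.mem_filter.1 (Finset.mem_of_mem_erase hk)).2] at h1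
      exact hi (mul_right_cancel h1)
    refine (μ.cong_diag_mul_mulSingle hne.symm hij.symm χ (χ i * χ' i)).trans
      (ih _ ?_ ((blockHom_mul_mulSingle hij.symm χ _).trans hχ))
    refine Nat.le_of_lt_succ (lt_of_lt_of_le (Finset.card_lt_card ?_) hn)
    refine (Finset.ssubset_iff_of_subset fun k hk => ?_).2 ⟨i, by simpa using hi, ?_⟩
    · rw [Finset.mem_filter] at hk ⊢
      refine ⟨hk.1, fun h => ?_⟩
      by_cases hki : k = i
      · exact hi (hki ▸ h)
      by_cases hkj : k = j
      · exact hj (hkj ▸ h)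
      rw [Pi.mul_apply, Pi.mul_apply, Pi.mulSingle_eq_of_ne hki, Pi.mulSingle_eq_of_ne hkj, mul_one,
        mul_one] at hk
      exact hk.2 h
    · simp only [Finset.mem_filter, Finset.mem_univ, true_and, ne_eq, not_not]
      rw [Pi.mul_apply, Pi.mul_apply, Pi.mulSingle_eq_same, Pi.mulSingle_eq_of_ne hne.symm, mul_one,
        ← mul_assoc, sign_mul_self, one_mul]

theorem cong_diag_comp_perm {κ : Type} [DecidableEq κ] [Fintype κ] (w : κ → ℤ × c.Sign)
    (p : Equiv.Perm κ) :
    Cong 𝒪[F].subtype μ.s (μ.diag w) (μ.diag (w ∘ p)) := by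
  rw [diag_comp]
  exact cong_submatrix_perm _ _

theorem cong_comp_perm_diag {κ : Type} [DecidableEq κ] [Fintype κ] (w : κ → ℤ × c.Sign)
    (p : Equiv.Perm κ) :
    Cong 𝒪[F].subtype μ.s (μ.diag (w ∘ p)) (μ.diag w) := by
  have h := μ.cong_diag_comp_perm (w ∘ p) p.symm
  rwa [Function.comp_assoc, Equiv.self_comp_symm, Function.comp_id] at h

/-- Words of the same type give equivalent forms. -/
theorem cong_diag_of_toTyp0_eq {r : ℕ} {w w' : Typ c r} (h : toTyp0 w = toTyp0 w') :
    Cong 𝒪[F].subtype μ.s (μ.diag w) (μ.diag w') := by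
  obtain ⟨p, hp⟩ := exists_perm_antitone w
  obtain ⟨p', hp'⟩ := exists_perm_antitone w'
  refine (μ.cong_diag_comp_perm w p).trans (Cong.trans ?_ (μ.cong_comp_perm_diag w' p'))
  have h1 : toTyp0 (w ∘ p) = toTyp0 (w' ∘ p') := by rw [toTyp0_comp_perm, toTyp0_comp_perm, h]
  have he := expo_eq_of_toTyp0_eq hp hp' h1
  have hw' : w' ∘ p' = fun k => (expo (w ∘ p) k, ((w' ∘ p') k).2) := by
    rw [he]
    rfl
  rw [hw'] at h1 ⊢
  exact μ.cong_diag_of_blockHom_eq _ (fun k => ((w ∘ p) k).2) le_rfl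
    ((toTyp0_eq_iff (expo (w ∘ p)) _ _).1 h1)

/-- The form in the standard coordinates with the orthogonal blocks prescribed by `w`. -/
def canon {r : ℕ} (w : Typ c r) : FormSpace c σ r :=
  ⟨(μ.diag w).submatrix finProdFinEquiv.symm finProdFinEquiv.symm, by
    rw [det_submatrix_equiv_self]
    exact μ.isUnit_det_diag w, (μ.isForm_iff _).2
      (congrArg (fun Z : Matrix _ _ F => Z.submatrix finProdFinEquiv.symm finProdFinEquiv.symm)
        (μ.conjT_diag w))⟩

theorem exists_cong_canon {r : ℕ} (x : FormSpace c σ r) :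
    ∃ w : Typ c r, Cong 𝒪[F].subtype μ.s x.1 (μ.canon w).1 := by
  obtain ⟨κ, _, _, e, w, h⟩ := μ.exists_cong_diag _ _ le_rfl x.1 ((μ.isForm_iff _).1 x.2.2) x.2.1
  have hcard : Fintype.card κ = r := by
    have h1 := Fintype.card_congr e
    rw [Fintype.card_prod, Fintype.card_fin, Fintype.card_fin] at h1
    exact Nat.eq_of_mul_eq_mul_left gamma_pos h1
  let q : Fin r ≃ κ := (Fintype.equivFinOfCardEq hcard).symm
  let e' : Fin (c.gamma * r) ≃ Fin c.gamma × κ :=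
    finProdFinEquiv.symm.trans (Equiv.prodCongr (Equiv.refl _) q)
  refine ⟨w ∘ q, ?_⟩
  have h1 := h.submatrix e'
  have h2 : (μ.diag w).submatrix e' e' = (μ.canon (w ∘ q)).1 := by
    simp only [canon, diag_comp, submatrix_submatrix]
    rfl
  rw [h2] at h1
  exact (cong_submatrix_perm x.1 (e'.trans e)).trans h1

theorem hasTyp_canon {r : ℕ} (w : Typ c r) : HasTyp σ ϖ (μ.canon w) (toTyp0 w) := by
  let e₀ : Fin (c.gamma * r) ≃ Fin c.gamma × Fin r := finProdFinEquiv.symm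
  let N : Matrix (Fin c.gamma × Fin r) (Fin c.gamma × Fin r) 𝒪[F] :=
    blockDiagonal fun k => μ.M (w k).2
  let v : Fin r → (𝒪[F])ˣ := fun k => (μ.isUnit_det_M (w k).2).unit
  let E : ∀ i : ℤ, Fin c.gamma × {k // (w k).1 = i} ≃ {a // (w (e₀ a).2).1 = i} := fun i =>
    { toFun := fun p => ⟨e₀.symm (p.1, p.2.1), by simpa using p.2.2⟩
      invFun := fun a => ((e₀ a.1).1, ⟨(e₀ a.1).2, a.2⟩)
      left_inv := fun p => by simp
      right_inv := fun a => by simp }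
  refine ⟨1, fun a => (w (e₀ a).2).1, N.submatrix e₀ e₀,
    fun i => ∏ k : {k // (w k).1 = i}, v k, ?_, fun i => ⟨?_, ?_, ?_⟩⟩
  · intro a b
    have h1 : toField ((1 : GeneralLinearGroup (Fin (c.gamma * r)) 𝒪[F]).val) = 1 :=
      Matrix.map_one _ rfl rfl
    rw [h1, μ.adj_eq, conjT_one, Matrix.one_mul, Matrix.mul_one]
    change μ.diag w (e₀ a) (e₀ b) = _
    change _ = if (w (e₀ a).2).1 = (w (e₀ b).2).1 then
      algebraMap F₀ F ϖ ^ (w (e₀ a).2).1 * ((N (e₀ a) (e₀ b) : 𝒪[F]) : F) else 0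
    generalize e₀ a = p
    generalize e₀ b = q
    obtain ⟨a', k⟩ := p
    obtain ⟨b', l⟩ := q
    simp only [diag, N, blockDiagonal_apply]
    by_cases h : k = l
    · subst h
      simp [μ.coe_π]
    · simp [h]
  · rw [← det_submatrix_equiv_self (E i)]
    have h1 : ((N.submatrix e₀ e₀).submatrix (Subtype.val : {a // (w (e₀ a).2).1 = i} → _)
        Subtype.val).submatrix (E i) (E i) =
        blockDiagonal fun k : {k // (w k).1 = i} => μ.M (w k).2 := by
      refine Matrix.ext fun ⟨a, k⟩ ⟨b, l⟩ => ?_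
      simp [N, E, blockDiagonal_apply, Subtype.ext_iff]
    rw [h1, det_blockDiagonal, Units.coe_prod]
    rfl
  · rw [← Fintype.card_congr (E i), Fintype.card_prod, Fintype.card_fin, Fintype.card_subtype]
    simp [toTyp0, Finsupp.finsetSum_apply, Finsupp.single_apply]
  · have h1 : ∀ s : Finset {k // (w k).1 = i}, sign c (∏ k ∈ s, v k) = ∏ k ∈ s, (w k).2 := by
      let f : (𝒪[F])ˣ →* c.Sign := MonoidHom.mk' (sign c) μ.sign_mul
      intro s
      change f _ = _
      rw [map_prod]
      exact Finset.prod_congr rfl fun k _ => μ.sign_det_M _ _ rfl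
    rw [h1]
    change ∏ k with (w k).1 = i, (w k).2 = _
    rw [Finset.prod_subtype (p := fun k => (w k).1 = i) _ (by simp)]

end FormModel

end CanonicalForms


/-! ### Approximate equivalence of orthogonal decompositions -/

section Uniqueness

open IsLocalRing Matrix

variable {c : FormType} {F₀ F : Type*}
  [Field F₀] [ValuativeRel F₀] [TopologicalSpace F₀] [IsNonarchimedeanLocalField F₀]
  [Field F] [ValuativeRel F] [TopologicalSpace F] [IsNonarchimedeanLocalField F]
  [Algebra F₀ F] [ValuativeExtension F₀ F]
  {σ : F ≃ₐ[F₀] F} {ϖ : 𝒪[F₀]}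

theorem det_sub_det_mem {A ι : Type*} [CommRing A] [Fintype ι] [DecidableEq ι] {I : Ideal A}
    {X Y : Matrix ι ι A} (h : ∀ i j, X i j - Y i j ∈ I) : X.det - Y.det ∈ I := by
  rw [← Ideal.Quotient.mk_eq_mk_iff_sub_mem, RingHom.map_det, RingHom.map_det]
  congr 1
  ext i j
  exact (Ideal.Quotient.mk_eq_mk_iff_sub_mem _ _).2 (h i j)

namespace FormModel

variable (μ : FormModel c σ ϖ)

/-- The fractional ideal generated by `π ^ m`. -/
def frac (m : ℤ) : Submodule 𝒪[F] F := Submodule.span 𝒪[F] {(μ.π : F) ^ m}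

theorem zpow_mul_mem_frac (m : ℤ) (t : 𝒪[F]) : (μ.π : F) ^ m * (t : F) ∈ μ.frac m :=
  Submodule.mem_span_singleton.2 ⟨t, mul_comm _ _⟩

theorem frac_anti {m n : ℤ} (h : m ≤ n) : μ.frac n ≤ μ.frac m := by
  refine (Submodule.span_singleton_le_iff_mem _ _).2 ?_
  obtain ⟨k, rfl⟩ := Int.le.dest h
  rw [zpow_add₀ μ.π_ne_zero, zpow_natCast]
  exact μ.zpow_mul_mem_frac m (μ.π ^ k)

theorem mul_mem_frac {m : ℤ} {z : F} (t : 𝒪[F]) (hz : z ∈ μ.frac m) : (t : F) * z ∈ μ.frac m :=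
  (μ.frac m).smul_mem t hz

theorem zpow_mul_mem_frac_succ_iff {m : ℤ} {t : 𝒪[F]} :
    (μ.π : F) ^ m * (t : F) ∈ μ.frac (m + 1) ↔ t ∈ maximalIdeal 𝒪[F] := by
  rw [(IsDiscreteValuationRing.irreducible_iff_uniformizer _).1 μ.irreducible_π,
    Ideal.mem_span_singleton']
  constructor
  · intro h
    obtain ⟨a, ha⟩ := Submodule.mem_span_singleton.1 h
    refine ⟨a, Subtype.ext (mul_left_cancel₀ (zpow_ne_zero m μ.π_ne_zero) ?_)⟩
    rw [← ha, zpow_add_one₀ μ.π_ne_zero]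
    change (μ.π : F) ^ m * ((a : F) * μ.π) = (a : F) * _
    ring
  · rintro ⟨a, rfl⟩
    refine Submodule.mem_span_singleton.2 ⟨a, ?_⟩
    rw [zpow_add_one₀ μ.π_ne_zero]
    change (a : F) * _ = (μ.π : F) ^ m * ((a : F) * μ.π)
    ring

variable {ι : Type} [Fintype ι] [DecidableEq ι]

/-- `B` is the orthogonal sum of the forms `π ^ i • y_i`, where `y_i`, the restriction of `y` to the
indices in degree `i`, is unimodular. -/
structure IsJordan (B : Matrix ι ι F) (d : ι → ℤ) (y : Matrix ι ι 𝒪[F]) : Prop where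
  apply_eq : ∀ a b, B a b = if d a = d b then (μ.π : F) ^ d a * (y a b : F) else 0
  isUnit_det : ∀ i, IsUnit (y.submatrix (Subtype.val : {a // d a = i} → ι) Subtype.val).det

variable {μ} {B B' : Matrix ι ι F} {d d' : ι → ℤ} {y y' : Matrix ι ι 𝒪[F]} {N : ℤ}
  {k : Matrix ι ι 𝒪[F]}

theorem IsJordan.mem_frac (hB : μ.IsJordan B d y) (a b : ι) : B a b ∈ μ.frac (d b) := by
  rw [hB.apply_eq]
  split_ifs with h
  · rw [h]
    exact μ.zpow_mul_mem_frac _ _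
  · exact zero_mem _

theorem isUnit_det_conjT {s : 𝒪[F] →+* 𝒪[F]} (hk : IsUnit k.det) : IsUnit (conjT s k).det := by
  rw [det_conjT]
  exact hk.map s

theorem map_mul_apply_mem_frac {m : ℤ} {Z : Matrix ι ι F} (L : Matrix ι ι 𝒪[F]) (b : ι)
    (hZ : ∀ a, Z a b ∈ μ.frac m) (a : ι) : (L.map 𝒪[F].subtype * Z) a b ∈ μ.frac m := by
  rw [Matrix.mul_apply]
  exact sum_mem fun e _ => μ.mul_mem_frac (L a e) (hZ e)

theorem mul_map_apply_mem_frac {m : ℤ} {Z : Matrix ι ι F} (L : Matrix ι ι 𝒪[F]) (a : ι)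
    (hZ : ∀ b, Z a b ∈ μ.frac m) (b : ι) : (Z * L.map 𝒪[F].subtype) a b ∈ μ.frac m := by
  rw [Matrix.mul_apply]
  refine sum_mem fun e _ => ?_
  rw [mul_comm]
  exact μ.mul_mem_frac (L e b) (hZ e)

theorem map_inv_mul_map {L : Matrix ι ι 𝒪[F]} (hL : IsUnit L.det) :
    L⁻¹.map 𝒪[F].subtype * L.map 𝒪[F].subtype = 1 := by
  rw [← Matrix.map_mul, nonsing_inv_mul _ hL, Matrix.map_one _ (map_zero _) (map_one _)]

theorem map_mul_map_inv {L : Matrix ι ι 𝒪[F]} (hL : IsUnit L.det) :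
    L.map 𝒪[F].subtype * L⁻¹.map 𝒪[F].subtype = 1 := by
  rw [← Matrix.map_mul, mul_nonsing_inv _ hL, Matrix.map_one _ (map_zero _) (map_one _)]

/-- Cancelling the integral invertible left factor of k* B k shows that Bk inherits the column
divisibility of B', up to the error of order N. -/
theorem mul_apply_mem_frac (hB' : μ.IsJordan B' d' y') (hk : IsUnit k.det)
    (hE : ∀ a b, (conjT μ.s (k.map 𝒪[F].subtype) * B * k.map 𝒪[F].subtype - B') a b ∈ μ.frac N)
    (a b : ι) : (B * k.map 𝒪[F].subtype) a b ∈ μ.frac (min (d' b) N) := by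
  have h1 : B * k.map 𝒪[F].subtype = (conjT μ.sO k)⁻¹.map 𝒪[F].subtype *
      (conjT μ.s (k.map 𝒪[F].subtype) * B * k.map 𝒪[F].subtype) := by
    rw [conjT_map (s' := μ.sO) μ.coe_sO, Matrix.mul_assoc, ← Matrix.mul_assoc,
      map_inv_mul_map (isUnit_det_conjT hk), Matrix.one_mul]
  rw [h1]
  refine map_mul_apply_mem_frac _ b (fun e => ?_) a
  rw [← sub_add_cancel ((conjT μ.s (k.map 𝒪[F].subtype) * B * k.map 𝒪[F].subtype) e b) (B' e b)]
  exact add_mem (μ.frac_anti (min_le_right _ _) (hE e b))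
    (μ.frac_anti (min_le_left _ _) (hB'.mem_frac e b))

theorem IsJordan.mul_apply (hB : μ.IsJordan B d y) (a b : ι) :
    (B * k.map 𝒪[F].subtype) a b =
      (μ.π : F) ^ d a * ((∑ e : {e // d e = d a}, y a e * k e b : 𝒪[F]) : F) := by
  rw [Matrix.mul_apply, ← Finset.sum_subtype (Finset.univ.filter fun e => d e = d a) (by simp)
    fun e => y a e * k e b, Finset.sum_filter]
  push_cast
  rw [Finset.mul_sum]
  refine Finset.sum_congr rfl fun e _ => ?_
  rw [hB.apply_eq]
  by_cases h : d a = d e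
  · rw [if_pos h, if_pos h.symm, mul_assoc]
    rfl
  · rw [if_neg h, if_neg (Ne.symm h), zero_mul]
    exact (mul_zero _).symm

/-- Within the block of degree d a, Bk is π^(d a) times a unimodular matrix applied to entries of k.
Column b is divisible by a higher power of π, so those entries vanish in the residue field. -/
theorem mem_maximalIdeal_of_lt (hB : μ.IsJordan B d y) (hB' : μ.IsJordan B' d' y')
    (hk : IsUnit k.det)
    (hE : ∀ a b, (conjT μ.s (k.map 𝒪[F].subtype) * B * k.map 𝒪[F].subtype - B') a b ∈ μ.frac N)
    (hN : ∀ a, d a < N) {a b : ι} (hab : d a < d' b) : k a b ∈ maximalIdeal 𝒪[F] := by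
  let Y := y.submatrix (Subtype.val : {e // d e = d a} → ι) (Subtype.val : {e // d e = d a} → ι)
  let v : {e // d e = d a} → 𝒪[F] := fun e => k e b
  have h1 : ∀ e, (Y *ᵥ v) e ∈ maximalIdeal 𝒪[F] := by
    rintro ⟨e, he⟩
    rw [← μ.zpow_mul_mem_frac_succ_iff (m := d e)]
    have h2 := hB.mul_apply (k := k) e b
    rw [he] at h2
    rw [he]
    change _ * ((∑ e' : {e // d e = d a}, y e e' * k e' b : 𝒪[F]) : F) ∈ _
    rw [← h2]
    exact μ.frac_anti (le_min hab (hN a)) (mul_apply_mem_frac hB' hk hE e b)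
  have h3 : v = Y⁻¹ *ᵥ (Y *ᵥ v) := by
    rw [mulVec_mulVec, nonsing_inv_mul _ (hB.isUnit_det _), one_mulVec]
  have h4 : v ⟨a, rfl⟩ ∈ maximalIdeal 𝒪[F] := by
    rw [h3]
    exact sum_mem fun e _ => Ideal.mul_mem_left _ _ (h1 e)
  exact h4

/-- The determinant of k is a unit, so some term of its Leibniz expansion has no factor in the
maximal ideal. -/
theorem exists_perm_le (hB : μ.IsJordan B d y) (hB' : μ.IsJordan B' d' y')
    (hk : IsUnit k.det)
    (hE : ∀ a b, (conjT μ.s (k.map 𝒪[F].subtype) * B * k.map 𝒪[F].subtype - B') a b ∈ μ.frac N)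
    (hN : ∀ a, d a < N) : ∃ p : Equiv.Perm ι, ∀ b, d' b ≤ d (p b) := by
  by_contra! hcon
  refine (mem_maximalIdeal _).1 ?_ hk
  rw [det_apply]
  refine sum_mem fun p _ => ?_
  obtain ⟨b, hb⟩ := hcon p
  rw [Units.smul_def, zsmul_eq_mul]
  refine Ideal.mul_mem_left _ _ (Ideal.mem_of_dvd _ (Finset.dvd_prod_of_mem _ (Finset.mem_univ b)) ?_)
  exact mem_maximalIdeal_of_lt hB hB' hk hE hN hb

theorem exists_perm_eq (hB : μ.IsJordan B d y) (hB' : μ.IsJordan B' d' y')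
    (hk : IsUnit k.det)
    (hE : ∀ a b, (conjT μ.s (k.map 𝒪[F].subtype) * B * k.map 𝒪[F].subtype - B') a b ∈ μ.frac N)
    (hN : ∀ a, d a < N) : ∃ p : Equiv.Perm ι, ∀ b, d (p b) = d' b := by
  obtain ⟨p, hp⟩ := exists_perm_le hB hB' hk hE hN
  have hk' : IsUnit k⁻¹.det := by
    rw [det_nonsing_inv]
    exact hk.ringInverse
  obtain ⟨p', hp'⟩ := exists_perm_le hB' hB hk' (N := N) (fun a b => by
    have h1 : conjT μ.s (k⁻¹.map 𝒪[F].subtype) * B' * k⁻¹.map 𝒪[F].subtype - B =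
        (-conjT μ.sO k⁻¹).map 𝒪[F].subtype *
          ((conjT μ.s (k.map 𝒪[F].subtype) * B * k.map 𝒪[F].subtype - B') *
            k⁻¹.map 𝒪[F].subtype) := by
      have h2 : conjT μ.s (k⁻¹.map 𝒪[F].subtype) * conjT μ.s (k.map 𝒪[F].subtype) = 1 := by
        rw [← conjT_mul, map_mul_map_inv hk, conjT_one]
      have h3 : (-conjT μ.sO k⁻¹).map 𝒪[F].subtype = -conjT μ.s (k⁻¹.map 𝒪[F].subtype) := by
        rw [conjT_map (s' := μ.sO) μ.coe_sO]
        rfl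
      rw [h3, Matrix.sub_mul, Matrix.mul_assoc _ (k.map _), map_mul_map_inv hk, Matrix.mul_one,
        Matrix.neg_mul, Matrix.mul_sub, ← Matrix.mul_assoc, h2, Matrix.one_mul, neg_sub,
        Matrix.mul_assoc]
    rw [h1]
    exact map_mul_apply_mem_frac _ _ (fun e => mul_map_apply_mem_frac _ _ (fun e' => hE e e') _) _)
    fun b => (hp b).trans_lt (hN _)
  -- The inequalities in both directions give equal sums of degrees, so every termwise inequality is
  -- an equality.
  refine ⟨p, fun b => le_antisymm ?_ (hp b)⟩
  have h1 : ∑ b, d' b ≤ ∑ b, d (p b) := Finset.sum_le_sum fun b _ => hp b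
  have h2 : ∑ b, d b ≤ ∑ b, d' (p' b) := Finset.sum_le_sum fun b _ => hp' b
  rw [Equiv.sum_comp p d] at h1
  rw [Equiv.sum_comp p' d'] at h2
  have h3 : ∑ b, d' b = ∑ b, d (p b) := by
    rw [Equiv.sum_comp p d]
    exact le_antisymm h1 h2
  exact ((Finset.sum_eq_sum_iff_of_le fun b _ => hp b).1 h3 b (Finset.mem_univ b)).ge

/-- In the entry of k* B k at two indices of degree i, blocks of lower degree contribute an extra
factor from the maximal ideal through k*, and blocks of higher degree an extra power of π. Only the
block of degree i survives modulo π^(i+1). -/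
theorem apply_sub_mem_maximalIdeal (hB : μ.IsJordan B d y) (hB' : μ.IsJordan B' d' y')
    (hk : IsUnit k.det)
    (hE : ∀ a b, (conjT μ.s (k.map 𝒪[F].subtype) * B * k.map 𝒪[F].subtype - B') a b ∈ μ.frac N)
    (hN : ∀ a, d a < N) (hN' : ∀ a, d' a < N) {i : ℤ} {a b : ι} (ha : d' a = i) (hb : d' b = i) :
    y' a b - ∑ e : {e // d e = i}, μ.sO (k e a) * ∑ e' : {e // d e = i}, y e e' * k e' b ∈
      maximalIdeal 𝒪[F] := by
  rw [← μ.zpow_mul_mem_frac_succ_iff (m := i)]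
  have h1 : ∀ e, (μ.s (k e a) : F) * (B * k.map 𝒪[F].subtype) e b -
      (if d e = i then (μ.π : F) ^ i *
        ((μ.sO (k e a) * ∑ e' : {e // d e = i}, y e e' * k e' b : 𝒪[F]) : F) else 0) ∈
      μ.frac (i + 1) := by
    intro e
    have hfrac : (B * k.map 𝒪[F].subtype) e b ∈ μ.frac i :=
      μ.frac_anti (le_min hb.ge ((hb ▸ hN' b).le)) (mul_apply_mem_frac hB' hk hE e b)
    rw [← μ.coe_sO]
    rcases lt_trichotomy (d e) i with h | h | h
    · rw [if_neg h.ne, sub_zero]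
      obtain ⟨t, ht⟩ := Submodule.mem_span_singleton.1 hfrac
      have hs : μ.sO (k e a) ∈ maximalIdeal 𝒪[F] := by
        have h2 := mem_maximalIdeal_of_lt hB hB' hk hE hN (h.trans_eq ha.symm)
        rw [mem_maximalIdeal, mem_nonunits_iff] at h2 ⊢
        intro h3
        refine h2 ?_
        have h4 := h3.map μ.sO
        have h5 : μ.sO (μ.sO (k e a)) = k e a := Subtype.ext (by rw [μ.coe_sO, μ.coe_sO, μ.s_s])
        rwa [h5] at h4
      rw [← ht]
      have h2 := (μ.zpow_mul_mem_frac_succ_iff (m := i)).2 (Ideal.mul_mem_right t _ hs)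
      convert h2 using 1
      change (_ : F) * ((t : F) * _) = _ * (((μ.sO (k e a) : 𝒪[F]) : F) * (t : F))
      ring
    · rw [if_pos h, hB.mul_apply]
      subst h
      convert zero_mem (μ.frac _) using 1
      change (_ : F) * (_ * _) - _ * (((μ.sO (k e a) : 𝒪[F]) : F) * _) = 0
      ring
    · rw [if_neg h.ne', sub_zero, hB.mul_apply]
      exact μ.mul_mem_frac _ (μ.frac_anti h (μ.zpow_mul_mem_frac _ _))
  have h2 := sub_mem (sum_mem fun e (_ : e ∈ Finset.univ) => h1 e)
    (μ.frac_anti (hb ▸ hN' b : i + 1 ≤ N) (hE a b))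
  convert h2 using 1
  rw [Finset.sum_sub_distrib, Matrix.sub_apply, hB'.apply_eq, if_pos (ha.trans hb.symm), ha,
    Matrix.mul_assoc, Matrix.mul_apply, ← Finset.sum_filter,
    Finset.sum_subtype (p := fun e => d e = i) (Finset.univ.filter fun e => d e = i) (by simp)]
  have h3 : ∀ e, conjT μ.s (k.map 𝒪[F].subtype) a e = μ.s (k e a) := fun e => rfl
  simp only [h3]
  push_cast
  rw [mul_sub, Finset.mul_sum]
  abel

/-- Hence corresponding unimodular blocks are congruent in the residue field, and their determinants
differ by a factor of the form sO(t)·t, which the sign does not see. -/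
theorem det_sub_mem_maximalIdeal (hB : μ.IsJordan B d y) (hB' : μ.IsJordan B' d' y')
    (hk : IsUnit k.det)
    (hE : ∀ a b, (conjT μ.s (k.map 𝒪[F].subtype) * B * k.map 𝒪[F].subtype - B') a b ∈ μ.frac N)
    (hN : ∀ a, d a < N) {p : Equiv.Perm ι} (hp : ∀ b, d (p b) = d' b) (i : ℤ) :
    ∃ t, (y'.submatrix (Subtype.val : {a // d' a = i} → ι) Subtype.val).det -
      μ.sO t * (y.submatrix (Subtype.val : {a // d a = i} → ι) Subtype.val).det * t ∈
        maximalIdeal 𝒪[F] := by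
  let E : {b // d' b = i} ≃ {e // d e = i} := p.subtypeEquiv fun b => by rw [hp]
  let H : Matrix {e // d e = i} {b // d' b = i} 𝒪[F] := k.submatrix Subtype.val Subtype.val
  let Y := y.submatrix (Subtype.val : {e // d e = i} → ι) (Subtype.val : {e // d e = i} → ι)
  refine ⟨(H.submatrix E id).det, ?_⟩
  change _ - _ * Y.det * _ ∈ _
  rw [← det_submatrix_equiv_self E Y, ← det_conjT, ← det_mul, ← det_mul]
  have h1 : conjT μ.sO (H.submatrix E id) = (conjT μ.sO H).submatrix id E := rfl
  rw [h1, submatrix_mul_equiv, submatrix_mul_equiv]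
  refine det_sub_det_mem fun a b => ?_
  have h2 := apply_sub_mem_maximalIdeal hB hB' hk hE hN (fun a => (hp a) ▸ hN (p a)) a.2 b.2
  convert h2 using 1
  refine congrArg (y' a b - ·) ?_
  rw [submatrix_id_id, Matrix.mul_assoc, Matrix.mul_apply]
  rfl

end FormModel

end Uniqueness


/-! ### Classification of forms -/

section Classification

open IsLocalRing Matrix

variable {c : FormType} {F₀ F : Type*}
  [Field F₀] [ValuativeRel F₀] [TopologicalSpace F₀] [IsNonarchimedeanLocalField F₀]
  [Field F] [ValuativeRel F] [TopologicalSpace F] [IsNonarchimedeanLocalField F]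
  [Algebra F₀ F] [ValuativeExtension F₀ F]
  {σ : F ≃ₐ[F₀] F} {ϖ : 𝒪[F₀]} {r : ℕ}

theorem isUnit_det_val (g : GeneralLinearGroup (Fin r) 𝒪[F]) : IsUnit g.val.det :=
  (isUnit_iff_isUnit_det _).1 g.isUnit

namespace FormModel

theorem isJordan_of_hasTyp (μ : FormModel c σ ϖ) {x : FormSpace c σ r} {τ : Typ0 c r} (h : HasTyp σ ϖ x τ) :
    ∃ (g : Matrix (Fin (c.gamma * r)) (Fin (c.gamma * r)) 𝒪[F]) (d : Fin (c.gamma * r) → ℤ)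
      (y : Matrix (Fin (c.gamma * r)) (Fin (c.gamma * r)) 𝒪[F]),
      IsUnit g.det ∧
      μ.IsJordan (conjT μ.s (g.map 𝒪[F].subtype) * x.1 * g.map 𝒪[F].subtype) d y ∧
      (∀ i, c.gamma * τ.e i = Fintype.card {a // d a = i}) ∧
      ∀ i (u : (𝒪[F])ˣ), (u : 𝒪[F]) =
        (y.submatrix (Subtype.val : {a // d a = i} → Fin (c.gamma * r)) Subtype.val).det →
        τ.χ i = sign c u := by
  obtain ⟨g, d, y, u, hB, hu⟩ := h
  refine ⟨g.val, d, y, isUnit_det_val g, ⟨fun a b => ?_, fun i => ?_⟩, fun i => (hu i).2.1,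
    fun i v hv => ?_⟩
  · have h1 := hB a b
    rw [μ.adj_eq, ← μ.coe_π] at h1
    exact h1
  · rw [← (hu i).1]
    exact (u i).isUnit
  · rw [(hu i).2.2, Units.ext (hv.trans (hu i).1.symm)]

/-- The type of a form is unique, and is shared by all forms which are close to it. -/
theorem exists_typ_eq (μ : FormModel c σ ϖ) {x : FormSpace c σ r} {τ : Typ0 c r} (h : HasTyp σ ϖ x τ) :
    ∃ N : ℤ, ∀ (x' : FormSpace c σ r) (τ' : Typ0 c r), (∀ a b, x'.1 a b - x.1 a b ∈ μ.frac N) →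
      HasTyp σ ϖ x' τ' → τ = τ' := by
  obtain ⟨g, d, y, hg, hB, hcard, hsign⟩ := μ.isJordan_of_hasTyp h
  -- Precision beyond all degrees of the first decomposition is enough; the degrees of the second
  -- are then a permutation of them.
  obtain ⟨N, hN⟩ : ∃ N, ∀ a, d a < N := by
    obtain ⟨N, hN⟩ := (Set.finite_range d).bddAbove
    exact ⟨N + 1, fun a => Int.lt_add_one_of_le (hN ⟨a, rfl⟩)⟩
  refine ⟨N, fun x' τ' hx h' => ?_⟩
  obtain ⟨g', d', y', hg', hB', hcard', hsign'⟩ := μ.isJordan_of_hasTyp h'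
  have hk : IsUnit (g⁻¹ * g').det := by
    rw [det_mul, det_nonsing_inv]
    exact hg.ringInverse.mul hg'
  have hE : ∀ a b, (conjT μ.s ((g⁻¹ * g').map 𝒪[F].subtype) *
      (conjT μ.s (g.map 𝒪[F].subtype) * x.1 * g.map 𝒪[F].subtype) *
      (g⁻¹ * g').map 𝒪[F].subtype -
      conjT μ.s (g'.map 𝒪[F].subtype) * x'.1 * g'.map 𝒪[F].subtype) a b ∈ μ.frac N := by
    intro a b
    have h1 : g.map 𝒪[F].subtype * (g⁻¹ * g').map 𝒪[F].subtype = g'.map 𝒪[F].subtype := by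
      rw [← Matrix.map_mul, ← Matrix.mul_assoc, mul_nonsing_inv _ hg, Matrix.one_mul]
    have h2 : conjT μ.s ((g⁻¹ * g').map 𝒪[F].subtype) *
        (conjT μ.s (g.map 𝒪[F].subtype) * x.1 * g.map 𝒪[F].subtype) *
        (g⁻¹ * g').map 𝒪[F].subtype =
        conjT μ.s (g'.map 𝒪[F].subtype) * x.1 * g'.map 𝒪[F].subtype := by
      rw [← h1, conjT_mul]
      simp only [Matrix.mul_assoc]
    rw [h2, ← Matrix.sub_mul, ← Matrix.mul_sub, conjT_map (s' := μ.sO) μ.coe_sO]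
    refine mul_map_apply_mem_frac _ _ (fun b' => map_mul_apply_mem_frac _ b' (fun e => ?_) _) _
    rw [Matrix.sub_apply, ← neg_sub]
    exact neg_mem (hx _ _)
  obtain ⟨p, hp⟩ := exists_perm_eq hB hB' hk hE hN
  have he : ∀ i, τ.e i = τ'.e i := fun i => by
    refine Nat.eq_of_mul_eq_mul_left gamma_pos ((hcard i).trans (Eq.trans ?_ (hcard' i).symm))
    exact (Fintype.card_congr (p.subtypeEquiv fun b => by rw [hp])).symm
  have hχ : ∀ i, τ.χ i = τ'.χ i := fun i => by
    obtain ⟨t, ht⟩ := det_sub_mem_maximalIdeal hB hB' hk hE hN hp i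
    rw [hsign i (hB.isUnit_det i).unit rfl, hsign' i (hB'.isUnit_det i).unit rfl]
    exact (μ.sign_eq_of_sub_mem _ _ t ht).symm
  cases τ
  cases τ'
  simp only [Typ0.mk.injEq]
  exact ⟨Finsupp.ext he, funext hχ⟩

theorem hasTyp_of_cong (μ : FormModel c σ ϖ) {x x' : FormSpace c σ r} {τ : Typ0 c r}
    (h : Cong 𝒪[F].subtype μ.s x.1 x'.1) (hx : HasTyp σ ϖ x' τ) : HasTyp σ ϖ x τ := by
  obtain ⟨k, hk, hkx⟩ := h
  obtain ⟨g, d, y, u, hB, hu⟩ := hx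
  refine ⟨nonsingInvUnit k hk * g, d, y, u, fun a b => ?_, hu⟩
  rw [← hB a b]
  have h1 : toField (nonsingInvUnit k hk * g).val = k.map 𝒪[F].subtype * toField g.val :=
    Matrix.map_mul (f := 𝒪[F].subtype)
  rw [h1, μ.adj_eq, μ.adj_eq, conjT_mul, hkx]
  simp only [Matrix.mul_assoc]

theorem mk_eq_of_cong (μ : FormModel c σ ϖ) {x x' : FormSpace c σ r} (h : Cong 𝒪[F].subtype μ.s x.1 x'.1) :
    (Quot.mk _ x : FormClass c σ r) = Quot.mk _ x' := by
  obtain ⟨k, hk, hkx⟩ := h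
  refine Quot.sound ⟨nonsingInvUnit k hk, ?_⟩
  rw [μ.adj_eq]
  exact hkx

theorem exists_hasTyp (μ : FormModel c σ ϖ) (x : FormSpace c σ r) : ∃ w : Typ c r, HasTyp σ ϖ x (toTyp0 w) ∧
    (Quot.mk _ x : FormClass c σ r) = Quot.mk _ (μ.canon w) := by
  obtain ⟨w, hw⟩ := μ.exists_cong_canon x
  exact ⟨w, μ.hasTyp_of_cong hw (μ.hasTyp_canon w), μ.mk_eq_of_cong hw⟩

theorem hasTyp_unique (μ : FormModel c σ ϖ) {x : FormSpace c σ r} {τ τ' : Typ0 c r} (h : HasTyp σ ϖ x τ)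
    (h' : HasTyp σ ϖ x τ') : τ = τ' := by
  obtain ⟨N, hN⟩ := μ.exists_typ_eq h
  exact hN x τ' (fun a b => by rw [sub_self]; exact zero_mem _) h'

/-- Forms of the same type are equivalent. -/
theorem mk_eq_of_hasTyp (μ : FormModel c σ ϖ) {x x' : FormSpace c σ r} {τ : Typ0 c r} (h : HasTyp σ ϖ x τ)
    (h' : HasTyp σ ϖ x' τ) : (Quot.mk _ x : FormClass c σ r) = Quot.mk _ x' := by
  obtain ⟨w, hw, hxw⟩ := μ.exists_hasTyp x
  obtain ⟨w', hw', hxw'⟩ := μ.exists_hasTyp x'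
  rw [hxw, hxw']
  have h1 : toTyp0 w = toTyp0 w' :=
    (μ.hasTyp_unique hw h).trans (μ.hasTyp_unique h' hw')
  refine μ.mk_eq_of_cong ?_
  exact (μ.cong_diag_of_toTyp0_eq h1).submatrix finProdFinEquiv.symm

theorem hasTyp_iff_of_mk_eq (μ : FormModel c σ ϖ) {x x' : FormSpace c σ r}
    (h : (Quot.mk _ x : FormClass c σ r) = Quot.mk _ x') (τ : Typ0 c r) :
    HasTyp σ ϖ x τ ↔ HasTyp σ ϖ x' τ := by
  let P : FormClass c σ r → Prop := Quot.lift (fun x => HasTyp σ ϖ x τ) fun x x' ⟨k, hk⟩ => by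
    have hcong : Cong 𝒪[F].subtype μ.s x.1 x'.1 := by
      rw [μ.adj_eq] at hk
      exact ⟨k.val, isUnit_det_val k, hk⟩
    refine propext ⟨fun hx => ?_, μ.hasTyp_of_cong hcong⟩
    obtain ⟨w, hw, -⟩ := μ.exists_hasTyp x'
    rwa [μ.hasTyp_unique hx (μ.hasTyp_of_cong hcong hw)]
  exact iff_of_eq (congrArg P h)

theorem hasTyp_typ (μ : FormModel c σ ϖ) (x : FormSpace c σ r) :
    HasTyp σ ϖ x (typ σ ϖ (Quot.mk _ x : FormClass c σ r)) := by
  obtain ⟨w, hw, -⟩ := μ.exists_hasTyp x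
  obtain ⟨x', hx', h⟩ := Classical.epsilon_spec (p := fun τ =>
    ∃ x' : FormSpace c σ r, (Quot.mk _ x' : FormClass c σ r) = Quot.mk _ x ∧ HasTyp σ ϖ x' τ)
    ⟨_, x, rfl, hw⟩
  exact (μ.hasTyp_iff_of_mk_eq hx' _).1 h

theorem typ_bijective (μ : FormModel c σ ϖ) : Function.Bijective (typ σ ϖ : FormClass c σ r → Typ0 c r) := by
  constructor
  · rintro ⟨x⟩ ⟨x'⟩ h
    refine μ.mk_eq_of_hasTyp (μ.hasTyp_typ x) ?_
    change typ σ ϖ (Quot.mk _ x) = typ σ ϖ (Quot.mk _ x') at h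
    rw [h]
    exact μ.hasTyp_typ x'
  · intro τ
    obtain ⟨w, -, rfl⟩ := exists_antitone_toTyp0_eq τ
    exact ⟨Quot.mk _ (μ.canon w), μ.hasTyp_unique (μ.hasTyp_typ _) (μ.hasTyp_canon w)⟩

theorem frac_mem_nhds (μ : FormModel c σ ϖ) (N : ℤ) : (μ.frac N : Set F) ∈ nhds 0 := by
  have h0 : ValuativeRel.valuation F ((μ.π : F) ^ N) ≠ 0 :=
    (Valuation.ne_zero_iff _).2 (zpow_ne_zero N μ.π_ne_zero)
  refine Filter.mem_of_superset
    ((IsValuativeTopology.hasBasis_nhds_zero' F).mem_of_mem (i := _) h0) fun z hz => ?_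
  have h1 : ((μ.π : F) ^ N)⁻¹ * z ∈ 𝒪[F] := by
    change ValuativeRel.valuation F _ ≤ 1
    rw [map_mul, map_inv₀]
    exact inv_mul_le_one_of_le₀ (le_of_lt hz) zero_le
  have h2 := μ.zpow_mul_mem_frac N ⟨_, h1⟩
  rwa [mul_inv_cancel_left₀ (zpow_ne_zero N μ.π_ne_zero)] at h2

/-- The type is locally constant and determines the class, so classes are open in the space of
forms. -/
theorem discreteTopology_formClass (μ : FormModel c σ ϖ) : DiscreteTopology (FormClass c σ r) := by
  refine discreteTopology_iff_isOpen_singleton.2 ?_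
  rintro ⟨x₀⟩
  refine isOpen_coinduced.2 (isOpen_iff_mem_nhds.2 fun x hx => ?_)
  obtain ⟨N, hN⟩ := μ.exists_typ_eq (μ.hasTyp_typ x)
  have h1 : ∀ᶠ x' : FormSpace c σ r in nhds x, ∀ a b, x'.1 a b - x.1 a b ∈ μ.frac N := by
    refine Filter.eventually_all.2 fun a => Filter.eventually_all.2 fun b => ?_
    have hc : Continuous fun x' : FormSpace c σ r => x'.1 a b - x.1 a b :=
      (continuous_subtype_val.matrix_elem a b).sub continuous_const
    refine hc.continuousAt.eventually (p := fun z => z ∈ μ.frac N) ?_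
    have h2 := μ.frac_mem_nhds N
    rwa [← sub_self (x.1 a b)] at h2
  filter_upwards [h1] with x' hx'
  change (Quot.mk _ x' : FormClass c σ r) = Quot.mk _ x₀
  rw [← (show (Quot.mk _ x : FormClass c σ r) = Quot.mk _ x₀ from hx)]
  refine (μ.mk_eq_of_hasTyp (μ.hasTyp_typ x) ?_).symm
  rw [hN x' _ hx' (μ.hasTyp_typ x')]
  exact μ.hasTyp_typ x'

end FormModel

/-- Forms are classified by their types, and the classes are open. -/
theorem typ_bijective_and_discreteTopology [CharZero F₀] (hF : FieldHyp c σ) (hϖ : Irreducible ϖ) :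
    Function.Bijective (typ σ ϖ : FormClass c σ r → Typ0 c r) ∧
      DiscreteTopology (FormClass c σ r) := by
  obtain ⟨μ⟩ := exists_formModel hF hϖ
  exact ⟨μ.typ_bijective, μ.discreteTopology_formClass⟩

end Classification

end SphForm

end


theorem mainTheorem4 (c : SphForm.FormType)
    {F₀ F : Type*} [Field F₀] [ValuativeRel F₀] [TopologicalSpace F₀]
    [IsNonarchimedeanLocalField F₀] [CharZero F₀]
    [Field F] [ValuativeRel F] [TopologicalSpace F] [IsNonarchimedeanLocalField F]
    [Algebra F₀ F] [ValuativeExtension F₀ F]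
    (σ : F ≃ₐ[F₀] F) (hF : SphForm.FieldHyp c σ)
    (ϖ : Valuation.integer (ValuativeRel.valuation F₀)) (hϖ : Irreducible ϖ)
    {R : Type*} [CommRing R] [Nontrivial R] (hR : IsUnit (Nat.card c.Sign : R))
    (r α : ℕ) (hr : 1 ≤ r) (hα : 1 ≤ α)
    (a : (Fin r → Fin 2) → R)
    (ha : ∀ k, k ≤ r → a (SphForm.lastOnes r k) = 1)
    (S : Fin (r + 1) → Module.End R (SphForm.sphericalFunctions c σ r R))
    (hcomm : ∀ i j, Commute (S i) (S j))
    (T : Fin (r + 1) → Module.End R (SphForm.Typ0 c r →₀ R))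
    (hdual : ∀ k, SphForm.IsDual σ ϖ (S k) (T k))
    (hT : ∀ (k : Fin (r + 1)) (v : SphForm.Typ c r →₀ R) (w : SphForm.Typ0 c r →₀ R),
      SphForm.IsStr F₀ F v w → SphForm.IsStr F₀ F (SphForm.shiftSum c a α k v) (T k w)) :
    LinearIndependent R
      (fun m : Fin r → ℕ => (List.ofFn fun i : Fin r => S i.succ ^ m i).prod) ∧
    ∃ U : (Module.End R (SphForm.sphericalFunctions c σ r R))ˣ,
      (U : Module.End R (SphForm.sphericalFunctions c σ r R)) = S (Fin.last r) ∧
      ∃ b : Module.Basis (SphForm.BasisIndex c r α)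
          (Algebra.adjoin R (Set.range (fun i : Fin r => S i.succ) ∪
            {((U⁻¹ : (Module.End R (SphForm.sphericalFunctions c σ r R))ˣ) :
              Module.End R (SphForm.sphericalFunctions c σ r R))}))
          (SphForm.sphericalFunctions c σ r R),
        ∀ p : SphForm.BasisIndex c r α,
          (b p : SphForm.FormClass c σ r → R) = SphForm.deltaFun σ ϖ R p.1.1 p.1.2 := by
  obtain ⟨htyp, hdisc⟩ := SphForm.typ_bijective_and_discreteTopology (r := r) hF hϖ
  obtain ⟨t, ε, hgen⟩ := SphForm.exists_relGenerators_eq c F₀ F R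
  obtain ⟨str, hrel, hstr, hdom⟩ := SphForm.exists_str (r := r) hR t ε
  -- Pairing with the indicator of a type evaluates a function there, so duality expresses S_k f at
  -- w through the straightened translates of w.
  have hS : ∀ (k : Fin (r + 1)) f (w : SphForm.Typ c r), Antitone (SphForm.expo w) →
      SphForm.sphericalEquiv htyp (S k f) (SphForm.toTyp0 w) =
        (SphForm.sphericalEquiv htyp f).sum fun τ y =>
          y * str (SphForm.shiftSum c a α k (Finsupp.single w 1)) τ := by
    intro k f w hw
    -- A weakly decreasing word is already straight, so the hypothesis on T computes it on every
    -- basis element of R[Typ⁰_r].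
    have h1 : SphForm.IsStr F₀ F (Finsupp.single w (1 : R))
        (Finsupp.single (SphForm.toTyp0 w) 1) := by
      refine ⟨Finsupp.single w 1, fun p hp => ?_, ?_, Finsupp.mapDomain_single⟩
      · rw [Finset.mem_singleton.1 (Finsupp.support_single_subset hp)]
        exact hw
      · rw [SphForm.InRel, sub_self, map_zero]
        exact TwoSidedIdeal.zero_mem _
    rw [SphForm.str_eq_of_isStr hgen hrel hstr (hT k _ _ h1), ← SphForm.pairing_eq_sum htyp,
      ← hdual k f, SphForm.pairing_eq_sum htyp, SphForm.sum_mul_single]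
  have hlast : a (SphForm.lastOnes r (Fin.last r : ℕ)) = 1 := ha _ le_rfl
  obtain ⟨U, hU, hU'⟩ := SphForm.exists_unit_of_shift (S := S (Fin.last r)) fun f τ =>
    SphForm.apply_toTyp0_of_eq hstr (hS (Fin.last r)) rfl hlast f τ
  obtain ⟨hli, b, hb⟩ := SphForm.exists_basis_of_hasShift hr hα hR hcomm hU
    (fun k => SphForm.hasShift_of_shiftSum (Nat.lt_succ_iff.1 k.isLt) hα hstr hdom (hS k)
      (ha k (Nat.lt_succ_iff.1 k.isLt))) hU'
  refine ⟨hli, U, hU, b, fun p => ?_⟩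
  rw [hb p, SphForm.sphericalEquiv_symm_dvec]
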